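/- Write $h_2(x)=-x\log_2 x-(1-x)\log_2(1-x)$. Complexity is measured by the logarithmic cost of a randomized random access machine. A stabilizer code $Q=[[n,k]]$ is given by $n-k$ generators of its additive self-orthogonal quaternary code $C\subset\mathbb F_4^n$, $|C|=2^{n-k}$; its distance is the minimum weight of a vector in $C^\perp\setminus C$, where $C^\perp$ is the dual with respect to the trace inner product. A linear code $[n,k]_q$ is given by an $(n-k)\times n$ parity-check matrix; its distance is the minimum weight of a nonzero codeword. A random code is drawn uniformly from all stabilizer codes $[[n,k]]$, respectively from all linear codes $[n,k]_q$. Let $k=k_n\ge 1$ for all large $n$, and $k_n/n\to R$ with $0\le R<1$; write $\delta n$ for the distance of the drawn code. We say that a program finds the distance of random codes with complexity $2^{nF(\delta)}$ if, for every $\varepsilon>0$, the following holds for all codes of length $n$ in the ensemble except a fraction that tends to $0$ as $n\to\infty$: for each admissible input matrix of the code, the program outputs the exact distance $\delta n$ at cost at most $2^{n(F(\delta)+\varepsilon)}$, with probability at least $1-\varepsilon$ over its coin tosses. **Proposition (covering set technique).** (a) There is a program that, for all such $R$ and $(k_n)$, finds the distance $\delta n$ of random stabilizer codes $[[n,k_n]]$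 with complexity $2^{nF_{\mathrm{CS}}}$, where $$F_{\mathrm{CS}}=h_2(\delta)-\frac{1-R}{2}\,h_2\!\left(\frac{2\delta}{1-R}\right).$$ (b) For every finite field $\mathbb F_q$ there is a program that, for all such $R$ and $(k_n)$, finds the distance $\delta n$ of random linear codes $[n,k_n]_q$ with complexity $2^{nF}$, where $$F=h_2(\delta)-(1-R)\,h_2\!\left(\frac{\delta}{1-R}\right).$$ For $q=2$ the same program finds the distance of random binary codes with complexity exponent $$F=(1-R)\left[1-h_2\!\left(\frac{\delta}{1-R}\right)\right].$$ -/

import Mathlib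

open Filter Topology

/-! ## A randomized random access machine with logarithmic cost

Programs work on finitely many named arrays of natural numbers (a scalar variable is entry `0` of an
array).  Every operation is charged at least the bit lengths of all numbers that it touches, addresses
included; products and quotients are charged the product of the bit lengths of the operands. -/

namespace RAM

/-- Arithmetic expressions. -/
inductive Expr : Type
  | lit (c : ℕ)
  | get (a : ℕ) (i : Expr)
  | add (x y : Expr)
  | sub (x y : Expr)
  | mul (x y : Expr)
  | div (x y : Expr)

/-- Structured programs.  `coin a i` writes a fresh fair random bit into entry `i` of array `a`;
the tests of `ite` and `loop` succeed when their value is nonzero. -/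
inductive Prog : Type
  | skip
  | set (a : ℕ) (i x : Expr)
  | coin (a : ℕ) (i : Expr)
  | seq (p p' : Prog)
  | ite (x : Expr) (p p' : Prog)
  | loop (x : Expr) (p : Prog)

/-- Contents of the memory: entry `i` of array `a` is `m a i`. -/
abbrev Mem : Type := ℕ → ℕ → ℕ

/-- Value of an expression. -/
def Expr.val (m : Mem) : Expr → ℕ
  | .lit c => c
  | .get a i => m a (i.val m)
  | .add x y => x.val m + y.val m
  | .sub x y => x.val m - y.val m
  | .mul x y => x.val m * y.val m
  | .div x y => x.val m / y.val m

/-- Cost of the evaluation of an expression; `Nat.size` is the bit length. -/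
def Expr.cost (m : Mem) : Expr → ℕ
  | .lit c => 1 + c.size
  | .get a i => i.cost m + (1 + (i.val m).size + (m a (i.val m)).size)
  | .add x y => x.cost m + y.cost m + (1 + (x.val m).size + (y.val m).size)
  | .sub x y => x.cost m + y.cost m + (1 + (x.val m).size + (y.val m).size)
  | .mul x y => x.cost m + y.cost m + (1 + (x.val m).size) * (1 + (y.val m).size)
  | .div x y => x.cost m + y.cost m + (1 + (x.val m).size) * (1 + (y.val m).size)

/-- Overwrite entry `i` of array `a` by `v`. -/
def Mem.write (m : Mem) (a i v : ℕ) : Mem :=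
  Function.update m a (Function.update (m a) i v)

/-- `Exec p m ω m' ω' t`: started in memory `m` with the coin tosses `ω` still to come, the program
`p` halts in memory `m'` with the coin tosses `ω'` left over, at total cost `t`. -/
inductive Exec : Prog → Mem → List Bool → Mem → List Bool → ℕ → Prop
  | skip (m : Mem) (ω : List Bool) : Exec .skip m ω m ω 1
  | set (a : ℕ) (i x : Expr) (m : Mem) (ω : List Bool) :
      Exec (.set a i x) m ω (m.write a (i.val m) (x.val m)) ω
        (1 + i.cost m + x.cost m + (i.val m).size + (x.val m).size)
  | coin (a : ℕ) (i : Expr) (m : Mem) (b : Bool) (ω : List Bool) :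
      Exec (.coin a i) m (b :: ω) (m.write a (i.val m) b.toNat) ω
        (1 + i.cost m + (i.val m).size)
  | seq {p p' : Prog} {m m' m'' : Mem} {ω ω' ω'' : List Bool} {t t' : ℕ}
      (h : Exec p m ω m' ω' t) (h' : Exec p' m' ω' m'' ω'' t') :
      Exec (.seq p p') m ω m'' ω'' (t + t')
  | ite_true {x : Expr} {p p' : Prog} {m m' : Mem} {ω ω' : List Bool} {t : ℕ}
      (hx : x.val m ≠ 0) (h : Exec p m ω m' ω' t) :
      Exec (.ite x p p') m ω m' ω' (1 + x.cost m + t)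
  | ite_false {x : Expr} {p p' : Prog} {m m' : Mem} {ω ω' : List Bool} {t : ℕ}
      (hx : x.val m = 0) (h : Exec p' m ω m' ω' t) :
      Exec (.ite x p p') m ω m' ω' (1 + x.cost m + t)
  | loop_true {x : Expr} {p : Prog} {m m' m'' : Mem} {ω ω' ω'' : List Bool} {t t' : ℕ}
      (hx : x.val m ≠ 0) (h : Exec p m ω m' ω' t) (h' : Exec (.loop x p) m' ω' m'' ω'' t') :
      Exec (.loop x p) m ω m'' ω'' (1 + x.cost m + t + t')
  | loop_false {x : Expr} {p : Prog} {m : Mem} {ω : List Bool} (hx : x.val m = 0) :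
      Exec (.loop x p) m ω m ω (1 + x.cost m)

/-- The input for a matrix with `r` rows and `n` columns over a finite alphabet whose letters are
labelled by natural numbers: array `0` holds `n` and `r`, array `1` holds the labels of the entries
row by row, and everything else is `0`. -/
def input {α : Type} (label : α → ℕ) {r n : ℕ} (M : Fin r → Fin n → α) : Mem := fun a i =>
  if a = 0 then (if i = 0 then n else if i = 1 then r else 0)
  else if h : a = 1 ∧ i / n < r ∧ 0 < n then
    label (M ⟨i / n, h.2.1⟩ ⟨i % n, Nat.mod_lt i h.2.2⟩)
  else 0

open Classical in
/-- The probability, over fair coin tosses, that `p` started in memory `m` halts at cost at most `t`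
with the value `d` in entry `0` of array `0`.  Since every toss costs at least `1`, a computation
of cost at most `t` uses at most `t` tosses, so `t` tosses are all that matters. -/
noncomputable def successProb (p : Prog) (m : Mem) (d t : ℕ) : ℝ :=
  ((Finset.univ.filter fun ω : Fin t → Bool =>
      ∃ (m' : Mem) (ω' : List Bool) (c : ℕ),
        Exec p m (List.ofFn ω) m' ω' c ∧ c ≤ t ∧ m' 0 0 = d).card : ℝ) / 2 ^ t

end RAM

/-! ## Codes -/

/-- The proportion of the elements of a (finite) set `S` that satisfy `P`. -/
noncomputable def proportion {α : Type} (S : Set α) (P : α → Prop) : ℝ :=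
  ({x | x ∈ S ∧ P x}.ncard : ℝ) / (S.ncard : ℝ)

/-- The set of all linear `[n, k]` codes over the field `K`. -/
def linearCodes (K : Type) [Field K] (n k : ℕ) : Set (Submodule K (Fin n → K)) :=
  {C | Module.finrank K C = k}

/-- The distance of a linear code: the least Hamming weight of a nonzero codeword. -/
noncomputable def codeDistance {K : Type} [Field K] [DecidableEq K] {n : ℕ}
    (C : Submodule K (Fin n → K)) : ℕ :=
  sInf {w | ∃ c ∈ C, c ≠ 0 ∧ hammingNorm c = w}

/-- `H` is a parity check matrix of `C`, that is, `C = {c | H c = 0}`. -/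
def IsParityCheck {K : Type} [Field K] {r n : ℕ} (H : Matrix (Fin r) (Fin n) K)
    (C : Submodule K (Fin n → K)) : Prop :=
  ∀ c : Fin n → K, c ∈ C ↔ H.mulVec c = 0

/-- Pauli operators on `n` qubits up to phase.  The operator `X ^ v Z ^ u` is represented by the
vector `e` with entries `e i = (u i, v i)`, which is the quaternary vector `u + ω v` written in the
basis `1, ω` of the field with four elements over the field with two elements.  The number of qubits
that the operator affects is the Hamming weight of `e`. -/
abbrev PauliVec (n : ℕ) : Type := Fin n → ZMod 2 × ZMod 2

/-- The trace inner product of quaternary vectors `u + ω v` and `u' + ω v'`, which is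
`u ⬝ v' + v ⬝ u'`; it vanishes exactly when the Pauli operators commute. -/
def tracePairing {n : ℕ} (e f : PauliVec n) : ZMod 2 :=
  ∑ i, ((e i).1 * (f i).2 + (e i).2 * (f i).1)

/-- The vectors orthogonal to an additive code: the Pauli operators that commute with the whole
stabilizer. -/
def traceDual {n : ℕ} (C : Submodule (ZMod 2) (PauliVec n)) : Set (PauliVec n) :=
  {e | ∀ f ∈ C, tracePairing e f = 0}

/-- The set of all stabilizer codes `[[n, k]]`, each given by its additive self-orthogonal
quaternary code `C` of size `2 ^ (n - k)` (the stabilizer group up to phases). -/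
def stabilizerCodes (n k : ℕ) : Set (Submodule (ZMod 2) (PauliVec n)) :=
  {C | Module.finrank (ZMod 2) C = n - k ∧ (C : Set (PauliVec n)) ⊆ traceDual C}

/-- The distance of the stabilizer code: the least weight of a Pauli operator that commutes with the
stabilizer and does not belong to it. -/
noncomputable def stabilizerDistance {n : ℕ} (C : Submodule (ZMod 2) (PauliVec n)) : ℕ :=
  sInf {w | ∃ e ∈ traceDual C, e ∉ C ∧ hammingNorm e = w}

/-- The label `u + 2 v` of the quaternary symbol `u + ω v`. -/
def pauliLabel (s : ZMod 2 × ZMod 2) : ℕ := s.1.val + 2 * s.2.val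

/-! ## Exponents -/

/-- The binary entropy function, with logarithms to the base two. -/
noncomputable def h₂ (x : ℝ) : ℝ := Real.binEntropy x / Real.log 2

/-- The covering set exponent of stabilizer codes of rate `R` and relative distance `δ`. -/
noncomputable def expCS (R δ : ℝ) : ℝ :=
  h₂ δ - (1 - R) / 2 * h₂ (2 * δ / (1 - R))

/-- The covering set exponent of linear codes of rate `R` and relative distance `δ`. -/
noncomputable def expLinear (R δ : ℝ) : ℝ :=
  h₂ δ - (1 - R) * h₂ (δ / (1 - R))

/-- The covering set exponent of random binary codes of rate `R` and relative distance `δ`. -/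
noncomputable def expBinary (R δ : ℝ) : ℝ :=
  (1 - R) * (1 - h₂ (δ / (1 - R)))

/-- The integer part of `2 ^ (n F)`. -/
noncomputable def budget (n : ℕ) (F : ℝ) : ℕ := ⌊(2 : ℝ) ^ ((n : ℝ) * F)⌋₊

/-- The program `p` finds the distance of random stabilizer codes `[[n, k n]]` with complexity
exponent `F δ`, where `δ n` is the distance: for every `ε > 0`, the proportion of codes such that,
from any `n - k n` generators of the stabilizer, `p` computes the distance `δ n` with probability at
least `1 - ε` and at cost at most `2 ^ (n (F δ + ε))`, tends to `1`. -/
def FindsStabilizerDistance (p : RAM.Prog) (k : ℕ → ℕ) (F : ℝ → ℝ) : Prop :=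
  ∀ ε : ℝ, 0 < ε →
    Tendsto (fun n : ℕ => proportion (stabilizerCodes n (k n)) fun C =>
      ∀ g : Fin (n - k n) → PauliVec n, Submodule.span (ZMod 2) (Set.range g) = C →
        1 - ε ≤ RAM.successProb p (RAM.input pauliLabel g) (stabilizerDistance C)
          (budget n (F ((stabilizerDistance C : ℝ) / n) + ε)))
      atTop (𝓝 1)

/-- The program `p` finds the distance of random linear `[n, k n]` codes over `K` with complexity
exponent `F δ`, where `δ n` is the distance: for every `ε > 0`, the proportion of codes such that,
from any parity check matrix with `n - k n` rows, `p` computes the distance `δ n` with probability at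
least `1 - ε` and at cost at most `2 ^ (n (F δ + ε))`, tends to `1`. -/
def FindsLinearDistance {K : Type} [Field K] [DecidableEq K] (label : K → ℕ) (p : RAM.Prog)
    (k : ℕ → ℕ) (F : ℝ → ℝ) : Prop :=
  ∀ ε : ℝ, 0 < ε →
    Tendsto (fun n : ℕ => proportion (linearCodes K n (k n)) fun C =>
      ∀ H : Matrix (Fin (n - k n)) (Fin n) K, IsParityCheck H C →
        1 - ε ≤ RAM.successProb p (RAM.input label H) (codeDistance C)
          (budget n (F ((codeDistance C : ℝ) / n) + ε)))
      atTop (𝓝 1)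

/-- The sequence of dimensions `k n` has rate `R`, and the codes are eventually nontrivial. -/
def HasRate (k : ℕ → ℕ) (R : ℝ) : Prop :=
  (∀ᶠ n in atTop, 0 < k n) ∧ Tendsto (fun n : ℕ => (k n : ℝ) / n) atTop (𝓝 R)

/-! Let d be the distance and m the Singleton bound, `n - k + 1` for a linear code and `(n - k) / 2
+ 1` for a stabilizer code, so that d ≤ m. A trial selects each coordinate independently with
probability about m / n, computes by elimination the words that solve the parity equations and
vanish outside the selected set J (words of the code itself, or of the trace dual in the quantum
case), and forms a random combination of them. Words of the excluded set, `{0}` or the stabilizer,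
are rejected by a linear test. A fixed admissible word x of weight d is produced as soon as |J| = m,
J contains the support of x, and the coefficients are the right ones. Since m is the mode of the
binomial distribution, the first two events together have probability `choose m d / choose n d` up
to a polynomial factor. The third has probability at least 2^(-4q√n), roughly, provided that the
words supported on J form a space of dimension at most 4 * `rootCount n`, where `rootCount n` is √n
rounded up. Hence `choose n d / choose m d` trials, up to a subexponential factor, miss with
probability at most exp(-n) (`card_hits_ge`, `successProb_mainProg`). Entropy bounds for binomial
coefficients turn the ratio into 2^(n(h₂ δ - ρ h₂(δ/ρ) + o(1))) with ρ = lim m / n, which is 1 - R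
or (1 - R) / 2 (`eventually_le_budget`).

The program does not know d. It keeps the best weight w found so far, starting from m, and stops
once the number of trials reaches the number prescribed for w. This number increases with w, and w
never drops below d; so the program cannot stop before it has made the trials prescribed for d, and
after finding d it stops exactly then (`exec_mainLoop`).

The dimension condition holds for almost all codes by a high moment (`card_bad_supports_le`). If a
code meets the space of words supported on J in dimension above 4t, where t = `rootCount n`, then
the intersection contains at least q^(4t²) independent t-tuples. A given t-tuple lies in a random
code with probability about q^(-rt), r being the number of checks. The resulting bound q^(-2t² +
O(t)) for one J survives the union over at most 2^n ≤ q^(t²) sets J. For linear codes the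
probability comes from transitivity of the linear group on independent tuples. For stabilizer codes
one needs the number of isotropic spaces orthogonal to a given space W; isotropic bases are built
one vector at a time, and a potential depending on the dimension of the intersection with W controls
the count (`potential_step`, `card_isoTuples_mul_le`).

For binary codes the two exponents differ by h₂ δ - (1 - R). Chebyshev's inequality shows that
almost every random binary code contains words of any weight slightly above the Gilbert-Varshamov
distance, so that this difference is at most ε for almost all codes (`ncard_entropy_gt_le`). -/

namespace RAM

/-! ## Bounded loop commands -/

/-- Deterministic commands whose loops count down from a bound that is computed beforehand. -/
inductive Cmd : Type
  | skip
  | set (a : ℕ) (i x : Expr)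
  | seq (c c' : Cmd)
  | ite (x : Expr) (c c' : Cmd)
  | for_ (v : ℕ) (b : Expr) (c : Cmd)

/-- Apply `f` for the values `k - 1, …, 0` of the variable `v`. -/
def iterDown (f : Mem → Mem) (v : ℕ) : ℕ → Mem → Mem
  | 0, m => m
  | k + 1, m => iterDown f v k (f (m.write v 0 k))

/-- `good` holds at the start of every pass of `iterDown`. -/
def iterGood (f : Mem → Mem) (good : Mem → Prop) (v : ℕ) : ℕ → Mem → Prop
  | 0, _ => True
  | k + 1, m => good (m.write v 0 k) ∧ iterGood f good v k (f (m.write v 0 k))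

/-- A scalar variable. -/
abbrev Expr.var (v : ℕ) : Expr := .get v (.lit 0)

namespace Cmd

/-- The effect of a command. -/
def run : Cmd → Mem → Mem
  | skip, m => m
  | set a i x, m => m.write a (i.val m) (x.val m)
  | seq c c', m => c'.run (c.run m)
  | ite x c c', m => if x.val m ≠ 0 then c.run m else c'.run m
  | for_ v b c, m => iterDown c.run v (b.val m) (m.write v 0 (b.val m))

/-- The program that implements a command. -/
def prog : Cmd → Prog
  | skip => .skip
  | set a i x => .set a i x
  | seq c c' => .seq c.prog c'.prog
  | ite x c c' => .ite x c.prog c'.prog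
  | for_ v b c => .seq (.set v (.lit 0) b)
      (.loop (.var v) (.seq (.set v (.lit 0) (.sub (.var v) (.lit 1))) c.prog))

/-- The arrays to which a command writes. -/
def writes : Cmd → List ℕ
  | skip => []
  | set a _ _ => [a]
  | seq c c' => c.writes ++ c'.writes
  | ite _ c c' => c.writes ++ c'.writes
  | for_ v _ c => v :: c.writes

/-- No loop variable is overwritten in the body of its loop. -/
def wf : Cmd → Prop
  | skip => True
  | set _ _ _ => True
  | seq c c' => c.wf ∧ c'.wf
  | ite _ c c' => c.wf ∧ c'.wf
  | for_ v _ c => v ∉ c.writes ∧ c.wf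

/-- All values that are written have at most `S` bits and all loop bounds are at most `B`. -/
def ok (S B : ℕ) : Cmd → Mem → Prop
  | skip, _ => True
  | set _ _ x, m => x.val m < 2 ^ S
  | seq c c', m => c.ok S B m ∧ c'.ok S B (c.run m)
  | ite x c c', m => if x.val m ≠ 0 then c.ok S B m else c'.ok S B m
  | for_ v b c, m => b.val m < 2 ^ S ∧ b.val m ≤ B ∧
      iterGood c.run (c.ok S B) v (b.val m) (m.write v 0 (b.val m))

end Cmd

theorem Mem.write_apply (m : Mem) (a i v b j : ℕ) :
    m.write a i v b j = if b = a ∧ j = i then v else m b j := by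
  by_cases hb : b = a
  · subst hb
    by_cases hj : j = i
    · subst hj; simp [Mem.write]
    · simp [Mem.write, hj]
  · simp [Mem.write, hb]

theorem Mem.write_same (m : Mem) (a i v : ℕ) : m.write a i v a i = v := by
  simp [Mem.write_apply]

theorem Mem.write_of_ne (m : Mem) {a b : ℕ} (i v : ℕ) (h : b ≠ a) : m.write a i v b = m b := by
  simp [Mem.write, h]

theorem iterDown_of_unchanged {f : Mem → Mem} {v a : ℕ} (hv : a ≠ v)
    (hf : ∀ m, f m a = m a) : ∀ k m, iterDown f v k m a = m a
  | 0, _ => rfl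
  | k + 1, m => by
    rw [iterDown, iterDown_of_unchanged hv hf k, hf, Mem.write_of_ne _ _ _ hv]

theorem Cmd.run_of_notMem_writes {a : ℕ} :
    ∀ (c : Cmd), a ∉ c.writes → ∀ m, c.run m a = m a
  | .skip, _, m => rfl
  | .set b i x, h, m => by
    simp only [Cmd.writes, List.mem_singleton] at h
    exact Mem.write_of_ne _ _ _ h
  | .seq c c', h, m => by
    simp only [Cmd.writes, List.mem_append, not_or] at h
    rw [Cmd.run, Cmd.run_of_notMem_writes c' h.2, Cmd.run_of_notMem_writes c h.1]
  | .ite x c c', h, m => by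
    simp only [Cmd.writes, List.mem_append, not_or] at h
    rw [Cmd.run]
    split_ifs
    · rw [Cmd.run_of_notMem_writes c h.1]
    · rw [Cmd.run_of_notMem_writes c' h.2]
  | .for_ v b c, h, m => by
    simp only [Cmd.writes, List.mem_cons, not_or] at h
    rw [Cmd.run, iterDown_of_unchanged h.1 (Cmd.run_of_notMem_writes c h.2),
      Mem.write_of_ne _ _ _ h.1]

/-! ## Cost of commands -/

/-- All entries of the memory have at most `S` bits. -/
def Mem.Bdd (S : ℕ) (m : Mem) : Prop := ∀ a i, m a i < 2 ^ S

theorem Mem.Bdd.write {S : ℕ} {m : Mem} (h : m.Bdd S) (a i : ℕ) {v : ℕ} (hv : v < 2 ^ S) :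
    (m.write a i v).Bdd S := fun b j => by
  rw [Mem.write_apply]
  split_ifs
  exacts [hv, h b j]

/-- The number of bits of the value of an expression is at most `wt` times that of the memory. -/
def Expr.wt : Expr → ℕ
  | .lit c => c.size
  | .get _ _ => 1
  | .add x y => x.wt + y.wt + 1
  | .sub x _ => x.wt
  | .mul x y => x.wt + y.wt
  | .div x _ => x.wt

/-- The cost of an expression is at most `kap` times the squared number of bits of the memory. -/
def Expr.kap : Expr → ℕ
  | .lit c => 1 + c.size
  | .get _ i => i.kap + 2 + i.wt
  | .add x y => x.kap + y.kap + (1 + x.wt + y.wt)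
  | .sub x y => x.kap + y.kap + (1 + x.wt + y.wt)
  | .mul x y => x.kap + y.kap + (1 + x.wt) * (1 + y.wt)
  | .div x y => x.kap + y.kap + (1 + x.wt) * (1 + y.wt)

/-- A sum has at most one bit more than its longer operand, a product at most as many bits as both
factors together, and truncated subtraction and division never lengthen a number. A fixed expression
therefore has values of O(S) bits. -/
theorem Expr.size_val_le {S : ℕ} {m : Mem} (h : m.Bdd S) :
    ∀ e : Expr, (e.val m).size ≤ e.wt * (S + 1)
  | .lit c => by
    simp only [Expr.val, Expr.wt]
    nlinarith [Nat.zero_le (c.size * S)]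
  | .get a i => by
    simp only [Expr.val, Expr.wt, one_mul]
    exact (Nat.size_le.2 (h _ _)).trans (Nat.le_succ S)
  | .add x y => by
    have hx := Nat.size_le.1 (x.size_val_le h)
    have hy := Nat.size_le.1 (y.size_val_le h)
    simp only [Expr.val, Expr.wt]
    rw [Nat.size_le]
    have h1 : 2 ^ (x.wt * (S + 1)) ≤ 2 ^ ((x.wt + y.wt) * (S + 1)) :=
      Nat.pow_le_pow_right two_pos (by nlinarith)
    have h2 : 2 ^ (y.wt * (S + 1)) ≤ 2 ^ ((x.wt + y.wt) * (S + 1)) :=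
      Nat.pow_le_pow_right two_pos (by nlinarith)
    have h3 : 2 ^ ((x.wt + y.wt) * (S + 1) + 1) ≤ 2 ^ ((x.wt + y.wt + 1) * (S + 1)) :=
      Nat.pow_le_pow_right two_pos (by nlinarith)
    rw [pow_succ] at h3
    omega
  | .sub x y => by
    have hx := x.size_val_le h
    simp only [Expr.val, Expr.wt]
    exact (Nat.size_le_size (Nat.sub_le _ _)).trans hx
  | .mul x y => by
    have hx := Nat.size_le.1 (x.size_val_le h)
    have hy := Nat.size_le.1 (y.size_val_le h)
    simp only [Expr.val, Expr.wt]
    rw [Nat.size_le, add_mul, pow_add]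
    exact Nat.mul_lt_mul'' hx hy
  | .div x y => by
    have hx := x.size_val_le h
    simp only [Expr.val, Expr.wt]
    exact (Nat.size_le_size (Nat.div_le_self _ _)).trans hx

theorem Expr.cost_le {S : ℕ} {m : Mem} (h : m.Bdd S) :
    ∀ e : Expr, e.cost m ≤ e.kap * (S + 1) ^ 2
  | .lit c => by
    simp only [Expr.cost, Expr.kap]
    exact Nat.le_mul_of_pos_right _ (by positivity)
  | .get a i => by
    have hi := i.cost_le h
    have hs := i.size_val_le h
    have hg := Nat.size_le.2 (h a (i.val m))
    simp only [Expr.cost, Expr.kap]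
    nlinarith [Nat.zero_le (i.wt * S * S), Nat.zero_le (i.wt * S), Nat.zero_le (S * S)]
  | .add x y => by
    have h1 := x.cost_le h
    have h2 := y.cost_le h
    have h3 := x.size_val_le h
    have h4 := y.size_val_le h
    simp only [Expr.cost, Expr.kap]
    nlinarith [Nat.zero_le (x.wt * S * S), Nat.zero_le (x.wt * S), Nat.zero_le (S * S),
      Nat.zero_le (y.wt * S * S), Nat.zero_le (y.wt * S)]
  | .sub x y => by
    have h1 := x.cost_le h
    have h2 := y.cost_le h
    have h3 := x.size_val_le h
    have h4 := y.size_val_le h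
    simp only [Expr.cost, Expr.kap]
    nlinarith [Nat.zero_le (x.wt * S * S), Nat.zero_le (x.wt * S), Nat.zero_le (S * S),
      Nat.zero_le (y.wt * S * S), Nat.zero_le (y.wt * S)]
  | .mul x y => by
    have h1 := x.cost_le h
    have h2 := y.cost_le h
    have h3 : 1 + (x.val m).size ≤ (1 + x.wt) * (S + 1) := by
      nlinarith [x.size_val_le h, Nat.zero_le (x.wt * S)]
    have h4 : 1 + (y.val m).size ≤ (1 + y.wt) * (S + 1) := by
      nlinarith [y.size_val_le h, Nat.zero_le (y.wt * S)]
    have h5 := Nat.mul_le_mul h3 h4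
    simp only [Expr.cost, Expr.kap]
    linarith
  | .div x y => by
    have h1 := x.cost_le h
    have h2 := y.cost_le h
    have h3 : 1 + (x.val m).size ≤ (1 + x.wt) * (S + 1) := by
      nlinarith [x.size_val_le h, Nat.zero_le (x.wt * S)]
    have h4 : 1 + (y.val m).size ≤ (1 + y.wt) * (S + 1) := by
      nlinarith [y.size_val_le h, Nat.zero_le (y.wt * S)]
    have h5 := Nat.mul_le_mul h3 h4
    simp only [Expr.cost, Expr.kap]
    linarith

/-- Cost factor of an assignment. -/
def setCost (i x : Expr) : ℕ := 1 + i.kap + x.kap + i.wt + x.wt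

theorem setCost_le {S : ℕ} {m : Mem} (h : m.Bdd S) (i x : Expr) :
    1 + i.cost m + x.cost m + (i.val m).size + (x.val m).size ≤ setCost i x * (S + 1) ^ 2 := by
  have h1 := i.cost_le h
  have h2 := x.cost_le h
  have h3 := i.size_val_le h
  have h4 := x.size_val_le h
  unfold setCost
  nlinarith [Nat.zero_le (x.wt * S * S), Nat.zero_le (x.wt * S), Nat.zero_le (S * S),
      Nat.zero_le (i.wt * S * S), Nat.zero_le (i.wt * S)]

/-- Cost factor of a command whose loops make at most `B` passes. -/
def Cmd.cst (B : ℕ) : Cmd → ℕ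
  | skip => 1
  | set _ i x => setCost i x
  | seq c c' => c.cst B + c'.cst B
  | ite x c c' => 1 + x.kap + (c.cst B + c'.cst B)
  | for_ v b c => setCost (.lit 0) b + (1 + (Expr.var v).kap) +
      B * (1 + (Expr.var v).kap + setCost (.lit 0) (.sub (.var v) (.lit 1)) + c.cst B)

/-- The degree grows by one with every loop, so a fixed program costs a polynomial in the bound for
its loops. -/
theorem Cmd.cst_poly : ∀ c : Cmd, ∃ C D : ℕ, ∀ B, c.cst B ≤ C * (B + 1) ^ D
  | .skip => ⟨1, 0, fun B => by simp [Cmd.cst]⟩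
  | .set a i x => ⟨setCost i x, 0, fun B => by simp [Cmd.cst]⟩
  | .seq c c' => by
    obtain ⟨C, D, h⟩ := c.cst_poly
    obtain ⟨C', D', h'⟩ := c'.cst_poly
    refine ⟨C + C', D + D', fun B => ?_⟩
    have h1 : (B + 1) ^ D ≤ (B + 1) ^ (D + D') := Nat.pow_le_pow_right (by omega) (by omega)
    have h2 : (B + 1) ^ D' ≤ (B + 1) ^ (D + D') := Nat.pow_le_pow_right (by omega) (by omega)
    have := h B
    have := h' B
    simp only [Cmd.cst]
    nlinarith
  | .ite x c c' => by
    obtain ⟨C, D, h⟩ := c.cst_poly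
    obtain ⟨C', D', h'⟩ := c'.cst_poly
    refine ⟨1 + x.kap + C + C', D + D', fun B => ?_⟩
    have h1 : (B + 1) ^ D ≤ (B + 1) ^ (D + D') := Nat.pow_le_pow_right (by omega) (by omega)
    have h2 : (B + 1) ^ D' ≤ (B + 1) ^ (D + D') := Nat.pow_le_pow_right (by omega) (by omega)
    have h3 : 1 ≤ (B + 1) ^ (D + D') := Nat.one_le_pow _ _ (by omega)
    have := h B
    have := h' B
    simp only [Cmd.cst]
    nlinarith
  | .for_ v b c => by
    obtain ⟨C, D, h⟩ := c.cst_poly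
    generalize hX : setCost (.lit 0) b + (1 + (Expr.var v).kap) = X
    generalize hY : 1 + (Expr.var v).kap + setCost (.lit 0) (.sub (.var v) (.lit 1)) = Y
    refine ⟨X + Y + C, D + 1, fun B => ?_⟩
    have h1 : 1 ≤ (B + 1) ^ D := Nat.one_le_pow _ _ (by omega)
    have h2 := h B
    simp only [Cmd.cst, hX, hY]
    rw [pow_succ]
    generalize (B + 1) ^ D = Z at *
    nlinarith [Nat.zero_le (X * Z * B), Nat.zero_le (Y * B * (Z - 1)), Nat.zero_le (Y * Z),
      Nat.mul_le_mul_left X h1, Nat.mul_le_mul_left (Y * B) h1, Nat.mul_le_mul_left B h2,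
      Nat.zero_le (C * Z)]

/-- The passage from the functional meaning of a command to the machine. The cost `t` is chosen
before `ω`, because a command tosses no coins; this makes the cost of a whole run a sum that does
not depend on later coins. -/
theorem Cmd.exec (S B : ℕ) : ∀ (c : Cmd), c.wf → ∀ m : Mem, m.Bdd S → c.ok S B m →
    (c.run m).Bdd S ∧ ∃ t ≤ c.cst B * (S + 1) ^ 2, ∀ ω, Exec c.prog m ω (c.run m) ω t
  | .skip, _, m, hm, _ => ⟨hm, 1, by simpa [Cmd.cst] using Nat.one_le_pow 2 (S + 1) (by omega), fun ω => .skip m ω⟩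
  | .set a i x, _, m, hm, hok =>
    ⟨hm.write _ _ hok, _, setCost_le hm i x, fun ω => .set a i x m ω⟩
  | .seq c c', hw, m, hm, hok => by
    obtain ⟨hb, t, ht, he⟩ := Cmd.exec S B c hw.1 m hm hok.1
    obtain ⟨hb', t', ht', he'⟩ := Cmd.exec S B c' hw.2 _ hb hok.2
    exact ⟨hb', t + t', by simp only [Cmd.cst]; linarith, fun ω => .seq (he ω) (he' ω)⟩
  | .ite x c c', hw, m, hm, hok => by
    have hx := x.cost_le hm
    have hZ : 1 ≤ (S + 1) ^ 2 := Nat.one_le_pow _ _ (by omega)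
    by_cases h : x.val m = 0
    · simp only [Cmd.ok, h, ne_eq, not_true, if_false] at hok
      obtain ⟨hb, t, ht, he⟩ := Cmd.exec S B c' hw.2 m hm hok
      have hr : (Cmd.ite x c c').run m = c'.run m := by simp [Cmd.run, h]
      rw [hr]
      refine ⟨hb, _, ?_, fun ω => .ite_false h (he ω)⟩
      simp only [Cmd.cst]
      nlinarith [Nat.zero_le (c.cst B * (S + 1) ^ 2)]
    · simp only [Cmd.ok, ne_eq, h, not_false_eq_true, if_true] at hok
      obtain ⟨hb, t, ht, he⟩ := Cmd.exec S B c hw.1 m hm hok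
      have hr : (Cmd.ite x c c').run m = c.run m := by simp [Cmd.run, h]
      rw [hr]
      refine ⟨hb, _, ?_, fun ω => .ite_true h (he ω)⟩
      simp only [Cmd.cst]
      nlinarith [Nat.zero_le (c'.cst B * (S + 1) ^ 2)]
  | .for_ v b c, hw, m, hm, hok => by
    obtain ⟨hb, hbB, hit⟩ := hok
    -- The machine stores the number of remaining passes in the loop variable, and well-formedness
    -- keeps the body from changing it. Hence the loop test agrees with the recursion of `iterDown`.
    have key : ∀ k (m : Mem), m.Bdd S → m v 0 = k → iterGood c.run (c.ok S B) v k m →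
        (iterDown c.run v k m).Bdd S ∧
        ∃ t ≤ ((1 + (Expr.var v).kap) + k * (1 + (Expr.var v).kap +
            setCost (.lit 0) (.sub (.var v) (.lit 1)) + c.cst B)) * (S + 1) ^ 2,
          ∀ ω, Exec (.loop (.var v) (.seq (.set v (.lit 0) (.sub (.var v) (.lit 1))) c.prog))
            m ω (iterDown c.run v k m) ω t := by
      intro k
      induction k with
      | zero =>
        intro m hm hv _
        refine ⟨hm, 1 + (Expr.var v).cost m, ?_, fun ω => .loop_false (by simpa [Expr.val] using hv)⟩
        have := (Expr.var v).cost_le hm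
        have hZ : 1 ≤ (S + 1) ^ 2 := Nat.one_le_pow _ _ (by omega)
        nlinarith
      | succ k ih =>
        intro m hm hv hg
        obtain ⟨hg1, hg2⟩ := hg
        have hk : k < 2 ^ S := by have := hm v 0; omega
        have hm1 := hm.write v 0 hk
        obtain ⟨hb2, t2, ht2, he2⟩ := Cmd.exec S B c hw.2 _ hm1 hg1
        have hv2 : c.run (m.write v 0 k) v 0 = k := by
          rw [Cmd.run_of_notMem_writes c hw.1, Mem.write_same]
        obtain ⟨hb3, t3, ht3, he3⟩ := ih _ hb2 hv2 hg2
        have he1 : ∀ ω, Exec (.set v (.lit 0) (.sub (.var v) (.lit 1))) m ω (m.write v 0 k) ω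
            (1 + (Expr.lit 0).cost m + (Expr.sub (.var v) (.lit 1)).cost m
            + ((Expr.lit 0).val m).size + ((Expr.sub (.var v) (.lit 1)).val m).size) := by
          intro ω
          have := Exec.set v (.lit 0) (.sub (.var v) (.lit 1)) m ω
          simpa [Expr.val, hv] using this
        refine ⟨hb3, _, ?_, fun ω =>
          .loop_true (by simp [Expr.val, hv]) (.seq (he1 ω) (he2 ω)) (he3 ω)⟩
        · have h1 := (Expr.var v).cost_le hm
          have h2 := setCost_le hm (.lit 0) (.sub (.var v) (.lit 1))
          generalize (Expr.var v).cost m = A1 at *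
          generalize 1 + (Expr.lit 0).cost m + (Expr.sub (.var v) (.lit 1)).cost m
            + ((Expr.lit 0).val m).size + ((Expr.sub (.var v) (.lit 1)).val m).size = A2 at *
          have h5 : 1 ≤ (S + 1) ^ 2 := Nat.one_le_pow _ _ (by omega)
          generalize (S + 1) ^ 2 = Z at *
          rw [Nat.succ_mul]
          nlinarith
    have hv1 : (m.write v 0 (b.val m)) v 0 = b.val m := Mem.write_same ..
    obtain ⟨hb3, t, ht, he⟩ := key (b.val m) _ (hm.write v 0 hb) hv1 hit
    refine ⟨hb3, _, ?_, fun ω => .seq (.set v (.lit 0) b m ω) (he ω)⟩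
    have h2 := setCost_le hm (.lit 0) b
    simp only [Cmd.cst]
    have h3 : b.val m * (1 + (Expr.var v).kap +
            setCost (.lit 0) (.sub (.var v) (.lit 1)) + c.cst B) ≤
            B * (1 + (Expr.var v).kap +
            setCost (.lit 0) (.sub (.var v) (.lit 1)) + c.cst B) := Nat.mul_le_mul_right _ hbB
    have h4 := Nat.mul_le_mul_right ((S + 1) ^ 2) h3
    rw [add_mul] at ht
    rw [add_mul, add_mul]
    linarith

end RAM

namespace RAM

/-! ## Weakest preconditions -/

/-- The command runs within the bounds `S`, `B` and establishes `Q`. -/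
def Cmd.wp (S B : ℕ) (c : Cmd) (Q : Mem → Prop) (m : Mem) : Prop :=
  c.ok S B m ∧ Q (c.run m)

namespace Cmd

variable {S B : ℕ} {c c' : Cmd} {m : Mem} {P Q : Mem → Prop}

theorem wp.mono (h : c.wp S B P m) (hPQ : ∀ m', P m' → Q m') : c.wp S B Q m :=
  ⟨h.1, hPQ _ h.2⟩

theorem wp_skip (h : Q m) : wp S B .skip Q m := ⟨trivial, h⟩

theorem wp_set {a : ℕ} {i x : Expr} (hx : x.val m < 2 ^ S)
    (h : Q (m.write a (i.val m) (x.val m))) : wp S B (.set a i x) Q m := ⟨hx, h⟩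

/-- The frame condition is supplied automatically: arrays that `c` does not write reach `c'`
unchanged, so that `P` only has to describe what `c` computes. -/
theorem wp_seq (h : c.wp S B P m)
    (h' : ∀ m', (∀ a, a ∉ c.writes → m' a = m a) → P m' → c'.wp S B Q m') :
    wp S B (.seq c c') Q m :=
  have h2 := h' _ (fun _ ha => c.run_of_notMem_writes ha m) h.2
  ⟨⟨h.1, h2.1⟩, h2.2⟩

theorem wp_ite {x : Expr} (h : x.val m ≠ 0 → c.wp S B Q m) (h' : x.val m = 0 → c'.wp S B Q m) :
    wp S B (.ite x c c') Q m := by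
  by_cases hx : x.val m = 0
  · have := h' hx
    exact ⟨by simpa [ok, hx] using this.1, by simpa [run, hx] using this.2⟩
  · have := h hx
    exact ⟨by simpa [ok, hx] using this.1, by simpa [run, hx] using this.2⟩

/-- The index of the invariant is the number of passes still to come. By `hI` the invariant ignores
the loop variable, which is overwritten before each pass. -/
theorem wp_for {v : ℕ} {b : Expr} {L : ℕ} (I : ℕ → Mem → Prop) (hL : b.val m = L)
    (hS : L < 2 ^ S) (hB : L ≤ B)
    (hI : ∀ k m' x, I k m' → I k (m'.write v 0 x)) (h0 : I L m)
    (hstep : ∀ k, k < L → ∀ m', (∀ a, a ∉ v :: c.writes → m' a = m a) → m' v 0 = k →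
      I (k + 1) m' → c.wp S B (I k) m') :
    wp S B (.for_ v b c) (fun m' => (∀ a, a ∉ v :: c.writes → m' a = m a) ∧ I 0 m') m := by
  have key : ∀ k, k ≤ L → ∀ m', (∀ a, a ∉ v :: c.writes → m' a = m a) → I k m' →
      iterGood c.run (c.ok S B) v k m' ∧ I 0 (iterDown c.run v k m') := by
    intro k
    induction k with
    | zero => exact fun _ m' _ h => ⟨trivial, h⟩
    | succ k ih =>
      intro hk m' hf hIk
      have hf1 : ∀ a, a ∉ v :: c.writes → (m'.write v 0 k) a = m a := fun a ha => by
        rw [Mem.write_of_ne _ _ _ (by simp at ha; exact ha.1), hf a ha]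
      have h1 := hstep k hk _ hf1 (Mem.write_same ..) (hI _ _ _ hIk)
      have h2 := ih (by omega) (c.run (m'.write v 0 k)) (fun a ha => by
        rw [c.run_of_notMem_writes (by simp at ha; simp [ha]), hf1 a ha]) h1.2
      exact ⟨⟨h1.1, h2.1⟩, h2.2⟩
  subst hL
  have hk := key _ le_rfl (m.write v 0 (b.val m)) (fun a ha => by
    rw [Mem.write_of_ne _ _ _ (by simp at ha; exact ha.1)]) (hI _ _ _ h0)
  exact ⟨⟨hS, hB, hk.1⟩, fun a ha => run_of_notMem_writes (.for_ v b c) ha m, hk.2⟩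

/-- A loop that computes the entries of the array `a` one by one. -/
theorem wp_map {v a : ℕ} {b : Expr} {L : ℕ} (F : ℕ → ℕ) (hav : a ≠ v) (hL : b.val m = L)
    (hS : L < 2 ^ S) (hB : L ≤ B)
    (hstep : ∀ k, k < L → ∀ m', (∀ x, x ∉ v :: c.writes → m' x = m x) → m' v 0 = k →
      (∀ j, j ≤ k → m' a j = m a j) →
      c.wp S B (fun m'' => m'' a k = F k ∧ ∀ j, j ≠ k → m'' a j = m' a j) m') :
    wp S B (.for_ v b c) (fun m' => (∀ x, x ∉ v :: c.writes → m' x = m x) ∧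
      ∀ j, m' a j = if j < L then F j else m a j) m := by
  refine (wp_for (fun k m' => ∀ j, m' a j = if k ≤ j ∧ j < L then F j else m a j) hL hS hB
    ?_ ?_ ?_).mono ?_
  · intro k m' x h j
    rw [Mem.write_of_ne _ _ _ hav, h]
  · intro j
    rw [if_neg (by omega)]
  · intro k hk m' hf hv hI
    refine (hstep k hk m' hf hv fun j hj => by rw [hI, if_neg (by omega)]).mono ?_
    rintro m'' ⟨h1, h2⟩ j
    by_cases hj : j = k
    · subst hj
      rw [h1, if_pos ⟨le_rfl, hk⟩]
    · rw [h2 j hj, hI]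
      by_cases hc : k ≤ j ∧ j < L
      · rw [if_pos hc, if_pos (by omega)]
      · rw [if_neg hc, if_neg (by omega)]
  · rintro m' ⟨hf, h⟩
    exact ⟨hf, fun j => by simpa using h j⟩

end Cmd

/-- Fill the first `N` entries of an array with fixed numbers. -/
def tabulate (a : ℕ) (f : ℕ → ℕ) : ℕ → Cmd
  | 0 => .skip
  | N + 1 => .seq (tabulate a f N) (.set a (.lit N) (.lit (f N)))

theorem wp_tabulate {S B a : ℕ} {m : Mem} (f : ℕ → ℕ) (N : ℕ) (hf : ∀ i < N, f i < 2 ^ S) :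
    (tabulate a f N).wp S B (fun m' => (∀ b, b ≠ a → m' b = m b) ∧
      ∀ i, m' a i = if i < N then f i else m a i) m := by
  induction N with
  | zero => exact Cmd.wp_skip ⟨fun _ _ => rfl, fun i => by simp⟩
  | succ N ih =>
    refine Cmd.wp_seq (ih fun i hi => hf i (by omega)) fun m' _ ⟨h1, h2⟩ => ?_
    refine Cmd.wp_set (hf N (by omega)) ⟨fun b hb => ?_, fun i => ?_⟩
    · rw [Mem.write_of_ne _ _ _ hb, h1 b hb]
    · simp only [Mem.write_apply, Expr.val, true_and, h2]
      by_cases h : i = N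
      · simp [h]
      · by_cases h' : i < N
        · simp [h, h', Nat.lt_succ_of_lt h']
        · simp [h, h', show ¬ i < N + 1 by omega]

theorem tabulate_wf (a : ℕ) (f : ℕ → ℕ) : ∀ N, (tabulate a f N).wf
  | 0 => trivial
  | N + 1 => ⟨tabulate_wf a f N, trivial⟩

/-! ## Arithmetic in a finite field by tables -/

section Field

variable {K : Type} [Field K] [Fintype K]

/-- A numbering of the elements of `K` in which `0` has the number `0`. -/
noncomputable def fieldEquivFin (K : Type) [Field K] [Fintype K] : K ≃ Fin (Fintype.card K) :=
  (Fintype.equivFin K).trans (Equiv.swap (Fintype.equivFin K 0) ⟨0, Fintype.card_pos⟩)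

/-- The number of a field element. -/
noncomputable def enc (x : K) : ℕ := fieldEquivFin K x

/-- The field element with a given number. -/
noncomputable def dec (K : Type) [Field K] [Fintype K] (u : ℕ) : K :=
  if h : u < Fintype.card K then (fieldEquivFin K).symm ⟨u, h⟩ else 0

theorem enc_lt (x : K) : enc x < Fintype.card K := (fieldEquivFin K x).2

theorem enc_zero : enc (0 : K) = 0 := by simp [enc, fieldEquivFin]

theorem dec_enc (x : K) : dec K (enc x) = x := by
  rw [dec, dif_pos (enc_lt x)]
  simp [enc]

theorem enc_injective : Function.Injective (enc : K → ℕ) :=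
  Function.LeftInverse.injective dec_enc

/-- This is the purpose of giving `0` the number `0`: the tests of the machine then decide whether a
field element vanishes. -/
theorem enc_eq_zero {x : K} : enc x = 0 ↔ x = 0 := by
  rw [← enc_zero (K := K)]
  exact enc_injective.eq_iff

end Field

end RAM

/-! ## Fraction-free elimination -/

section Elimination

variable {K W : Type} [Field K] [AddCommGroup W] [Module K W]

open Classical in
/-- One elimination step: the pivot is the first vector on which `φ` does not vanish. -/
noncomputable def elimStep (N : ℕ) (φ : W →ₗ[K] K) (V : ℕ → W) : ℕ → W :=
  if h : ∃ i, i < N ∧ φ (V i) ≠ 0 then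
    fun i => φ (V (Nat.find h)) • V i - φ (V i) • V (Nat.find h)
  else V

theorem elimStep_of_pivot {N p : ℕ} {φ : W →ₗ[K] K} {V : ℕ → W} (hp : p < N) (h0 : φ (V p) ≠ 0)
    (hmin : ∀ i < p, φ (V i) = 0) :
    elimStep N φ V = fun i => φ (V p) • V i - φ (V i) • V p := by
  classical
  have h : ∃ i, i < N ∧ φ (V i) ≠ 0 := ⟨p, hp, h0⟩
  have hf : Nat.find h = p := by
    rw [Nat.find_eq_iff]
    exact ⟨⟨hp, h0⟩, fun i hi hc => hc.2 (hmin i hi)⟩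
  rw [elimStep, dif_pos h, hf]

theorem elimStep_of_forall {N : ℕ} {φ : W →ₗ[K] K} {V : ℕ → W} (h0 : ∀ i < N, φ (V i) = 0) :
    elimStep N φ V = V := by
  rw [elimStep, dif_neg]
  rintro ⟨i, hi, h⟩
  exact h (h0 i hi)

/-- Elimination with respect to `φ (r - 1), …, φ (r - k)`. -/
noncomputable def elimFam (N r : ℕ) (φ : ℕ → W →ₗ[K] K) (V : ℕ → W) : ℕ → ℕ → W
  | 0 => V
  | k + 1 => elimStep N (φ (r - (k + 1))) (elimFam N r φ V k)

/-- The nonzero members of `V` are independent, have indices below `N` and span `U`. -/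
def IsBasisFamily (N : ℕ) (V : ℕ → W) (U : Submodule K W) : Prop :=
  ∃ Z : Finset ℕ, Z ⊆ Finset.range N ∧ (∀ i, i ∉ Z → V i = 0) ∧
    LinearIndepOn K V (Z : Set ℕ) ∧ Submodule.span K (V '' Z) = U

/-- Each vector is scaled by the nonzero `φ (V p)` and corrected by a multiple of the pivot vector,
which makes `φ` vanish and keeps the other vectors independent; the pivot vector itself becomes
zero. No inverse in the field is computed, so the two tables for `a + x * y` and `a - x * y` suffice
for the program. -/
theorem IsBasisFamily.elimStep {N : ℕ} {V : ℕ → W} {U : Submodule K W} (h : IsBasisFamily N V U)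
    (φ : W →ₗ[K] K) : IsBasisFamily N (elimStep N φ V) (U ⊓ LinearMap.ker φ) := by
  classical
  obtain ⟨Z, hZN, hZ0, hli, hsp⟩ := h
  by_cases hex : ∃ i, i < N ∧ φ (V i) ≠ 0
  swap
  · push Not at hex
    rw [elimStep_of_forall hex]
    refine ⟨Z, hZN, hZ0, hli, ?_⟩
    rw [hsp, eq_comm, inf_eq_left, ← hsp, Submodule.span_le]
    rintro _ ⟨i, hi, rfl⟩
    exact hex i (Finset.mem_range.1 (hZN hi))
  set p := Nat.find hex with hpdef
  obtain ⟨hpN, hp0⟩ : p < N ∧ φ (V p) ≠ 0 := Nat.find_spec hex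
  have hst : _root_.elimStep N φ V = fun i => φ (V p) • V i - φ (V i) • V p := by
    rw [_root_.elimStep, dif_pos hex]
  have hpZ : p ∈ Z := by
    by_contra hc
    exact hp0 (by rw [hZ0 p hc, map_zero])
  rw [hst]
  refine ⟨Z.erase p, (Finset.erase_subset _ _).trans hZN, fun i hi => ?_, ?_, ?_⟩
  · by_cases hip : i = p
    · subst hip; simp
    · simp [hZ0 i fun hc => hi (Finset.mem_erase.2 ⟨hip, hc⟩)]
  · rw [linearIndepOn_finset_iff] at hli ⊢
    intro g hg i hi
    -- A relation among the new vectors, rewritten in the old ones. All contributions of the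
    -- corrections are collected in the coefficient of the pivot vector.
    have hsum : ∑ j ∈ Z, (if j = p then -∑ l ∈ Z.erase p, g l * φ (V l) else g j * φ (V p)) • V j
        = 0 := by
      rw [← Finset.add_sum_erase _ _ hpZ, if_pos rfl]
      rw [Finset.sum_congr rfl (g := fun j => (g j * φ (V p)) • V j) fun j hj => by
        rw [if_neg (Finset.ne_of_mem_erase hj)]]
      rw [← hg, neg_smul, Finset.sum_smul, neg_add_eq_sub, ← Finset.sum_sub_distrib]
      refine Finset.sum_congr rfl fun j _ => ?_
      rw [smul_sub, smul_smul, smul_smul]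
    have := hli _ hsum i (Finset.mem_of_mem_erase hi)
    rw [if_neg (Finset.ne_of_mem_erase hi)] at this
    exact (mul_eq_zero.1 this).resolve_right hp0
  · apply le_antisymm
    · rw [Submodule.span_le]
      rintro _ ⟨i, hi, rfl⟩
      have hi' : i ∈ Z := Finset.mem_of_mem_erase hi
      refine ⟨?_, ?_⟩
      · rw [← hsp]
        exact Submodule.sub_mem _ (Submodule.smul_mem _ _ (Submodule.subset_span ⟨i, hi', rfl⟩))
          (Submodule.smul_mem _ _ (Submodule.subset_span ⟨p, hpZ, rfl⟩))
      · simp [mul_comm]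
    · rintro x ⟨hxU, hx0⟩
      rw [← hsp] at hxU
      obtain ⟨c, rfl⟩ := (Submodule.mem_span_image_finset_iff_exists_fun' K).1 hxU
      replace hx0 : φ (∑ i ∈ Z, c i • V i) = 0 := hx0
      rw [map_sum] at hx0
      -- Dividing the coefficients by `φ (V p)` gives the right multiples of the vectors other than
      -- the pivot; the multiple of `V p` is then right because `φ` vanishes on the sum.
      have hx : ∑ i ∈ Z, c i • V i =
          ∑ i ∈ Z.erase p, ((φ (V p))⁻¹ * c i) • (φ (V p) • V i - φ (V i) • V p) := by
        have h1 : ∀ i, ((φ (V p))⁻¹ * c i) • (φ (V p) • V i - φ (V i) • V p) =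
            c i • V i - ((φ (V p))⁻¹ * (c i * φ (V i))) • V p := by
          intro i
          rw [smul_sub, smul_smul, smul_smul]
          congr 2
          · field_simp
          · ring
        rw [Finset.sum_congr rfl fun i _ => h1 i, Finset.sum_sub_distrib, ← Finset.sum_smul,
          ← Finset.mul_sum, ← Finset.add_sum_erase _ _ hpZ]
        rw [← Finset.add_sum_erase _ _ hpZ] at hx0
        simp only [map_smul, smul_eq_mul] at hx0
        have h2 : ∑ i ∈ Z.erase p, c i * φ (V i) = -(c p * φ (V p)) :=
          eq_neg_of_add_eq_zero_right hx0
        rw [h2]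
        have h3 : (φ (V p))⁻¹ * -(c p * φ (V p)) = - c p := by field_simp
        rw [h3, neg_smul, sub_neg_eq_add, add_comm]
      rw [hx]
      exact Submodule.sum_mem _ fun i hi => Submodule.smul_mem _ _
        (Submodule.subset_span ⟨i, hi, rfl⟩)

/-- The functionals are used in descending order because the loops of the program count down. -/
theorem IsBasisFamily.elimFam {N r : ℕ} {V : ℕ → W} {U : Submodule K W} (h : IsBasisFamily N V U)
    (φ : ℕ → W →ₗ[K] K) (k : ℕ) (hk : k ≤ r) :
    IsBasisFamily N (elimFam N r φ V k) (U ⊓ ⨅ i ∈ Set.Ico (r - k) r, LinearMap.ker (φ i)) := by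
  induction k with
  | zero => simpa [_root_.elimFam] using h
  | succ k ih =>
    have := (ih (by omega)).elimStep (φ (r - (k + 1)))
    rw [_root_.elimFam]
    convert this using 1
    ext x
    simp only [Submodule.mem_inf, Submodule.mem_iInf, Set.mem_Ico, LinearMap.mem_ker]
    constructor
    · rintro ⟨hx, h⟩
      exact ⟨⟨hx, fun i hi => h i ⟨by omega, hi.2⟩⟩, h _ ⟨le_rfl, by omega⟩⟩
    · rintro ⟨⟨hx, h⟩, h0⟩
      refine ⟨hx, fun i hi => ?_⟩
      by_cases hc : i = r - (k + 1)
      · rw [hc]; exact h0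
      · exact h i ⟨by omega, hi.2⟩

/-- In a basis family, a vector of the span has coefficients, and only few of them matter. -/
theorem IsBasisFamily.exists_coeff {N : ℕ} {V : ℕ → W} {U : Submodule K W}
    (h : IsBasisFamily N V U) {x : W} (hx : x ∈ U) :
    ∃ Z : Finset ℕ, Z ⊆ Finset.range N ∧ Z.card = Module.finrank K U ∧ ∃ c : ℕ → K,
      ∀ g : ℕ → K, (∀ i ∈ Z, g i = c i) → ∑ i ∈ Finset.range N, g i • V i = x := by
  obtain ⟨Z, hZN, hZ0, hli, hsp⟩ := h
  rw [← hsp] at hx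
  obtain ⟨c, hc⟩ := (Submodule.mem_span_image_finset_iff_exists_fun' K).1 hx
  refine ⟨Z, hZN, ?_, c, fun g hg => ?_⟩
  · have h1 := finrank_span_eq_card hli.linearIndependent
    have h2 : Set.range (fun i : (Z : Set ℕ) => V i) = V '' Z := by
      ext; simp
    rw [h2, hsp] at h1
    rw [h1]
    simp
  · rw [← hc, ← Finset.sum_subset hZN (f := fun i => g i • V i)]
    · exact Finset.sum_congr rfl fun i hi => by rw [hg i hi]
    · intro i _ hi
      rw [hZ0 i hi, smul_zero]

theorem IsBasisFamily.sum_mem {N : ℕ} {V : ℕ → W} {U : Submodule K W}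
    (h : IsBasisFamily N V U) (g : ℕ → K) : ∑ i ∈ Finset.range N, g i • V i ∈ U := by
  obtain ⟨Z, hZN, hZ0, hli, hsp⟩ := h
  refine Submodule.sum_mem _ fun i _ => Submodule.smul_mem _ _ ?_
  by_cases hi : i ∈ Z
  · rw [← hsp]
    exact Submodule.subset_span ⟨i, hi, rfl⟩
  · rw [hZ0 i hi]
    exact Submodule.zero_mem _

theorem IsBasisFamily.mem_iff {N : ℕ} {V : ℕ → W} {U : Submodule K W}
    (h : IsBasisFamily N V U) {ψ : W →ₗ[K] K} :
    (∀ i < N, ψ (V i) = 0) ↔ ∀ x ∈ U, ψ x = 0 := by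
  obtain ⟨Z, hZN, hZ0, hli, hsp⟩ := h
  constructor
  · intro h x hx
    have : U ≤ LinearMap.ker ψ := by
      rw [← hsp, Submodule.span_le]
      rintro _ ⟨i, hi, rfl⟩
      exact h i (Finset.mem_range.1 (hZN hi))
    exact this hx
  · intro h i _
    by_cases hi : i ∈ Z
    · exact h _ (by rw [← hsp]; exact Submodule.subset_span ⟨i, hi, rfl⟩)
    · rw [hZ0 i hi, map_zero]

/-- The functional `x ↦ ∑ t < N, h t * x t`. -/
noncomputable def dotFun (N : ℕ) (h : ℕ → K) : (ℕ → K) →ₗ[K] K :=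
  ∑ t ∈ Finset.range N, h t • LinearMap.proj t

theorem dotFun_apply (N : ℕ) (h x : ℕ → K) : dotFun N h x = ∑ t ∈ Finset.range N, h t * x t := by
  simp [dotFun, LinearMap.sum_apply]

open Classical in
/-- The unit vectors with indices in `Z`. -/
noncomputable def unitFam (K : Type) [Field K] (Z : Set ℕ) : ℕ → ℕ → K :=
  fun i => if i ∈ Z then Pi.single i 1 else 0

theorem isBasisFamily_unitFam (N : ℕ) (Z : Set ℕ) (hZ : ∀ i ∈ Z, i < N) :
    IsBasisFamily N (unitFam K Z)
      (⨅ i ∈ Zᶜ, LinearMap.ker (LinearMap.proj i : (ℕ → K) →ₗ[K] K)) := by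
  classical
  have hmem : ∀ i, i ∈ (Finset.range N).filter (· ∈ Z) ↔ i ∈ Z := fun i => by
    simp only [Finset.mem_filter, Finset.mem_range, and_iff_right_iff_imp]
    exact hZ i
  refine ⟨(Finset.range N).filter (· ∈ Z), Finset.filter_subset _ _, fun i hi => ?_, ?_, ?_⟩
  · rw [hmem] at hi
    simp [unitFam, hi]
  · rw [linearIndepOn_finset_iff]
    intro g hg i hi
    have := congrFun hg i
    rw [Finset.sum_apply, Finset.sum_eq_single i] at this
    · simpa [unitFam, (hmem i).1 hi] using this
    · intro j hj hji
      simp [unitFam, (hmem j).1 hj, hji.symm]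
    · exact fun h => absurd hi h
  · apply le_antisymm
    · rw [Submodule.span_le]
      rintro _ ⟨i, hi, rfl⟩
      have hi' := (hmem i).1 hi
      simp only [SetLike.mem_coe, Submodule.mem_iInf, LinearMap.mem_ker, LinearMap.proj_apply]
      intro j hj
      have : j ≠ i := fun h => hj (h ▸ hi')
      simp [unitFam, hi', this]
    · intro x hx
      simp only [Submodule.mem_iInf, LinearMap.mem_ker, LinearMap.proj_apply] at hx
      have : x = ∑ i ∈ (Finset.range N).filter (· ∈ Z), x i • unitFam K Z i := by
        funext j
        rw [Finset.sum_apply]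
        by_cases hj : j ∈ Z
        · rw [Finset.sum_eq_single j]
          · simp [unitFam, hj]
          · intro i hi hij
            simp [unitFam, (hmem i).1 hi, hij.symm]
          · exact fun h => absurd ((hmem j).2 hj) h
        · rw [hx j hj, Finset.sum_eq_zero]
          intro i hi
          have hij : j ≠ i := fun h => hj (h ▸ (hmem i).1 hi)
          simp [unitFam, (hmem i).1 hi, hij]
      rw [this]
      exact Submodule.sum_mem _ fun i hi => Submodule.smul_mem _ _
        (Submodule.subset_span ⟨i, hi, rfl⟩)

end Elimination

namespace RAM

/-! ## The program

Memory map: `2`, `3` tables of `a + x * y` and `a - x * y`; `4` translation of letters; `6` table of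
coefficients; `7` matrix; `9` generators for the test; `10` vectors; `11` coordinate set; `12` coins;
`13` coefficients; `14` candidate; `15` syndromes; `16` pivot vector; `17` numbers of trials.
Scalars: `20` length, `21` rows, `22` columns, `23` size of the coordinate set, `24` power of two,
`25`-`28` counting, `29` best weight, `30` trials made, `31` accumulator, `32` pivot, `33` weight,
`34` indicator, `35` result of the test, `36` pivot syndrome; `40`-`43` loop variables. -/

open RAM.Cmd RAM.Expr

/-- Look up `a + x * y`. -/
def eAM (q : ℕ) (a x y : Expr) : Expr := .get 2 (.add (.mul (.add (.mul a (.lit q)) x) (.lit q)) y)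

/-- Look up `a - x * y`. -/
def eSM (q : ℕ) (a x y : Expr) : Expr := .get 3 (.add (.mul (.add (.mul a (.lit q)) x) (.lit q)) y)

/-- Inner product of two vectors. -/
def dotC (q v : ℕ) (e₁ e₂ : Expr) : Cmd :=
  .seq (.set 31 (.lit 0) (.lit 0)) (.for_ v (.var 22) (.set 31 (.lit 0) (eAM q (.var 31) e₁ e₂)))

/-- Unit vectors for the coordinates in the set. -/
def initC (s one : ℕ) : Cmd :=
  .for_ 42 (.mul (.var 22) (.var 22))
    (.ite (.add (.sub (.div (.var 42) (.var 22)) (.sub (.var 42) (.mul (.div (.var 42) (.var 22)) (.var 22))))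
        (.sub (.sub (.var 42) (.mul (.div (.var 42) (.var 22)) (.var 22))) (.div (.var 42) (.var 22))))
      (.set 10 (.var 42) (.lit 0))
      (.ite (.get 11 (.div (.div (.var 42) (.var 22)) (.lit s)))
        (.set 10 (.var 42) (.lit one)) (.set 10 (.var 42) (.lit 0))))

/-- Syndromes of all vectors with respect to one row, and the first pivot. -/
def syndC (q : ℕ) : Cmd :=
  .seq (.set 32 (.lit 0) (.lit 0))
    (.for_ 40 (.var 22)
      (.seq (dotC q 41 (.get 7 (.add (.mul (.var 43) (.var 22)) (.var 41)))
          (.get 10 (.add (.mul (.var 40) (.var 22)) (.var 41))))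
        (.seq (.set 15 (.var 40) (.var 31))
          (.ite (.var 31) (.set 32 (.lit 0) (.add (.var 40) (.lit 1))) .skip))))

/-- Replace all vectors by combinations with the pivot vector. -/
def reduceC (q : ℕ) : Cmd :=
  .seq (.for_ 41 (.var 22)
      (.set 16 (.var 41) (.get 10 (.add (.mul (.sub (.var 32) (.lit 1)) (.var 22)) (.var 41)))))
    (.seq (.set 36 (.lit 0) (.get 15 (.sub (.var 32) (.lit 1))))
      (.for_ 42 (.mul (.var 22) (.var 22))
        (.set 10 (.var 42) (eSM q (eAM q (.lit 0) (.var 36) (.get 10 (.var 42)))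
          (.get 15 (.div (.var 42) (.var 22)))
          (.get 16 (.sub (.var 42) (.mul (.div (.var 42) (.var 22)) (.var 22))))))))

/-- Elimination. -/
def elimC (q s one : ℕ) : Cmd :=
  .seq (initC s one)
    (.for_ 43 (.var 21) (.seq (syndC q) (.ite (.var 32) (reduceC q) .skip)))

/-! ### Correctness of the elimination commands -/

section Specs

variable (K : Type)

/-- The arithmetic tables are in place. -/
def Tab [Field K] [Fintype K] (m : Mem) : Prop :=
  (∀ a x y : K, m 2 ((enc a * Fintype.card K + enc x) * Fintype.card K + enc y) = enc (a + x * y)) ∧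
  (∀ a x y : K, m 3 ((enc a * Fintype.card K + enc x) * Fintype.card K + enc y) = enc (a - x * y))

/-- The bounds suffice for all values and loops. -/
structure Enough [Fintype K] (S B n r s m : ℕ) : Prop where
  B_lt : B < 2 ^ S
  sq_le : n * s * (n * s) ≤ B
  rows_le : r * (n * s) ≤ B
  N_le : n * s ≤ B
  r_le : r ≤ B
  n_le : n ≤ B
  m_le : m ≤ B
  s_le : s ≤ B
  q_le_B : Fintype.card K ≤ B
  n_lt : n < S
  q_lt : Fintype.card K < S
  pow_lt : m * 2 ^ n < 2 ^ S

/-- The scalars and tables that stay fixed. -/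
structure Base [Field K] [Fintype K] (m : Mem) (n r s : ℕ) : Prop where
  len : m 20 0 = n
  rows : m 21 0 = r
  cols : m 22 0 = n * s
  tab : Tab K m

end Specs

variable {K : Type} [Field K] [Fintype K] {S B n r s mm : ℕ} {m : Mem}

theorem Enough.lt {K : Type} [Fintype K] {S B n r s mm x : ℕ} (hE : Enough K S B n r s mm) (hx : x ≤ B) : x < 2 ^ S := hx.trans_lt hE.B_lt

theorem Enough.enc_lt (hE : Enough K S B n r s mm) (x : K) : enc x < 2 ^ S :=
  ((RAM.enc_lt x).le.trans hE.q_le_B).trans_lt hE.B_lt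

theorem Base.of_eq {m' : Mem} (h : Base K m n r s) (h20 : m' 20 = m 20) (h21 : m' 21 = m 21)
    (h22 : m' 22 = m 22) (h2 : m' 2 = m 2) (h3 : m' 3 = m 3) : Base K m' n r s :=
  ⟨by rw [h20, h.len], by rw [h21, h.rows], by rw [h22, h.cols],
    ⟨by rw [h2]; exact h.tab.1, by rw [h3]; exact h.tab.2⟩⟩

theorem eAM_val (hT : Tab K m) {e₁ e₂ e₃ : Expr} {a x y : K} (h₁ : e₁.val m = enc a)
    (h₂ : e₂.val m = enc x) (h₃ : e₃.val m = enc y) :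
    (eAM (Fintype.card K) e₁ e₂ e₃).val m = enc (a + x * y) := by
  simp only [eAM, Expr.val, h₁, h₂, h₃, hT.1]

theorem eSM_val (hT : Tab K m) {e₁ e₂ e₃ : Expr} {a x y : K} (h₁ : e₁.val m = enc a)
    (h₂ : e₂.val m = enc x) (h₃ : e₃.val m = enc y) :
    (eSM (Fintype.card K) e₁ e₂ e₃).val m = enc (a - x * y) := by
  simp only [eSM, Expr.val, h₁, h₂, h₃, hT.2]

/-- The operands may depend on the loop variable `v`, so their values are prescribed in every memory
that differs from `m` only in `v` and in the accumulator `31`. The bound `37 ≤ v` separates `v` from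
the tables and scalars. -/
theorem wp_dotC (hE : Enough K S B n r s mm) (hb : Base K m n r s) {v : ℕ} (hv : 37 ≤ v)
    {e₁ e₂ : Expr} (f g : ℕ → K)
    (h₁ : ∀ m' : Mem, (∀ a, a ≠ v → a ≠ 31 → m' a = m a) → ∀ k < n * s, m' v 0 = k →
      e₁.val m' = enc (f k))
    (h₂ : ∀ m' : Mem, (∀ a, a ≠ v → a ≠ 31 → m' a = m a) → ∀ k < n * s, m' v 0 = k →
      e₂.val m' = enc (g k)) :
    (dotC (Fintype.card K) v e₁ e₂).wp S B (fun m' => (∀ a, a ≠ v → a ≠ 31 → m' a = m a) ∧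
      m' 31 0 = enc (dotFun (n * s) f g)) m := by
  refine wp_seq (P := fun m' => m' 31 0 = 0 ∧ ∀ a, a ≠ 31 → m' a = m a)
    (wp_set (by simp [Expr.val]) ⟨by simp [Mem.write_apply, Expr.val], fun a ha =>
      Mem.write_of_ne _ _ _ ha⟩) ?_
  rintro m1 - ⟨h0, hf1⟩
  refine (wp_for (fun k m' => m' 31 0 = enc (∑ t ∈ Finset.Ico k (n * s), f t * g t))
    (L := n * s) ?_ (hE.lt hE.N_le) hE.N_le ?_ ?_ ?_).mono ?_
  · simp only [Expr.val]
    rw [hf1 22 (of_decide_eq_true rfl), hb.cols]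
  · intro k m' x h
    rwa [Mem.write_of_ne _ _ _ (by omega)]
  · simp [h0, enc_zero]
  · intro k hk m' hf hvk hI
    have hf' : ∀ a, a ≠ v → a ≠ 31 → m' a = m a := fun a ha ha' => by
      rw [hf a (by simp [writes, ha, ha']), hf1 a ha']
    have hT : Tab K m' := (hb.of_eq (hf' 20 (by omega) (by decide)) (hf' 21 (by omega) (by decide))
      (hf' 22 (by omega) (by decide)) (hf' 2 (by omega) (by decide))
      (hf' 3 (by omega) (by decide))).tab
    have hval := eAM_val hT (e₁ := .var 31) (e₂ := e₁) (e₃ := e₂) (m := m') (by simpa [Expr.val] using hI)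
      (h₁ m' hf' k hk hvk) (h₂ m' hf' k hk hvk)
    refine wp_set (by rw [hval]; exact hE.enc_lt _) ?_
    simp only [Expr.val, Mem.write_same]
    rw [hval, Finset.sum_eq_sum_Ico_succ_bot hk, add_comm]
  · rintro m' ⟨hf, hI⟩
    refine ⟨fun a ha ha' => ?_, ?_⟩
    · rw [hf a (by simp [writes, ha, ha']), hf1 a ha']
    · rw [hI, dotFun_apply, Finset.range_eq_Ico]

/-- The matrix in array `7` has the rows `H`, and the vectors in array `10` are `V`. -/
def HasVecs (m : Mem) (a N L : ℕ) (V : ℕ → ℕ → K) : Prop :=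
  ∀ i < L, ∀ t < N, m a (i * N + t) = enc (V i t)

/-- Expressions have no remainder operation; the program computes remainders in this way. -/
theorem sub_div_mul_eq_mod (a b : ℕ) : a - a / b * b = a % b := by
  rw [Nat.mod_eq_sub, mul_comm]

theorem wp_initC (hE : Enough K S B n r s mm) (hb : Base K m n r s) (J : Set ℕ)
    (hJ : ∀ j < n, m 11 j ≠ 0 ↔ j ∈ J) :
    (initC s (enc (1 : K))).wp S B (fun m' => (∀ a, a ≠ 42 → a ≠ 10 → m' a = m a) ∧
      HasVecs m' 10 (n * s) (n * s) (unitFam K {i | i < n * s ∧ i / s ∈ J})) m := by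
  classical
  refine (wp_map (a := 10) (L := n * s * (n * s))
    (fun u => enc (unitFam K {i | i < n * s ∧ i / s ∈ J} (u / (n * s)) (u % (n * s)))) (by decide)
    (by simp [Expr.val, hb.cols]) (hE.lt hE.sq_le) hE.sq_le ?_).mono ?_
  · intro k hk m' hf hk' hm'
    have e20 : m' 22 0 = n * s := by rw [hf 22 (of_decide_eq_true rfl), hb.cols]
    have hk1 : k / (n * s) < n * s := Nat.div_lt_of_lt_mul hk
    have hk2 : k / (n * s) / s < n := Nat.div_lt_of_lt_mul (by rwa [mul_comm s n])
    have hset : ∀ c : ℕ, c < 2 ^ S →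
        c = enc (unitFam K {i | i < n * s ∧ i / s ∈ J} (k / (n * s)) (k % (n * s))) →
        (Cmd.set 10 (.var 42) (.lit c)).wp S B (fun m'' => m'' 10 k =
          enc (unitFam K {i | i < n * s ∧ i / s ∈ J} (k / (n * s)) (k % (n * s))) ∧
          ∀ j, j ≠ k → m'' 10 j = m' 10 j) m' := fun c hc hc' => by
      refine wp_set (by simpa [Expr.val] using hc) ⟨?_, fun j hj => ?_⟩
      · simp [Mem.write_apply, Expr.val, hk', hc']
      · simp [Mem.write_apply, Expr.val, hk', hj]
    refine wp_ite (fun h => ?_) (fun h => ?_)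
    · refine hset _ (by positivity) ?_
      simp only [Expr.val, hk', e20, sub_div_mul_eq_mod] at h
      -- The test adds the two truncated differences of row and column, which are both zero only on
      -- the diagonal.
      have hne : k % (n * s) ≠ k / (n * s) := by omega
      rw [eq_comm, enc_eq_zero, unitFam]
      split_ifs
      · simp [hne]
      · rfl
    · simp only [Expr.val, hk', e20, sub_div_mul_eq_mod] at h
      have heq : k % (n * s) = k / (n * s) := by omega
      have h11 : m' 11 = m 11 := hf 11 (of_decide_eq_true rfl)
      refine wp_ite (fun h => ?_) (fun h => ?_)
      · refine hset _ (hE.enc_lt _) ?_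
        simp only [Expr.val, hk', e20, h11] at h
        have hmem : k / (n * s) ∈ {i | i < n * s ∧ i / s ∈ J} := ⟨hk1, (hJ _ hk2).1 h⟩
        rw [heq, unitFam, if_pos hmem, Pi.single_eq_same]
      · refine hset _ (by positivity) ?_
        simp only [Expr.val, hk', e20, h11] at h
        rw [eq_comm, enc_eq_zero, unitFam, if_neg]
        · rfl
        · exact fun hc => (hJ _ hk2).2 hc.2 h
  · rintro m' ⟨hf, h⟩
    refine ⟨fun a h1 h2 => hf a (by simp [writes, h1, h2]), fun i hi t ht => ?_⟩
    have hpos : 0 < n * s := by omega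
    have h1 : (i * (n * s) + t) / (n * s) = i := by
      rw [mul_comm, Nat.mul_add_div hpos, Nat.div_eq_of_lt ht, add_zero]
    have h2 : (i * (n * s) + t) % (n * s) = t := by
      rw [mul_comm, Nat.mul_add_mod, Nat.mod_eq_of_lt ht]
    have h3 : i * (n * s) + t < n * s * (n * s) := by nlinarith
    rw [h, if_pos h3, h1, h2]

/-- Entry `32` holds the pivot index plus one, so that `0` can mean that all syndromes vanish. The
loop runs downwards and overwrites this entry, so what remains is the smallest index, as `elimStep`
demands. -/
theorem wp_syndC (hE : Enough K S B n r s mm) (hb : Base K m n r s) {V : ℕ → ℕ → K} {h : ℕ → K}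
    {ρ : ℕ} (hρ : m 43 0 = ρ) (hV : HasVecs m 10 (n * s) (n * s) V)
    (hH : ∀ t < n * s, m 7 (ρ * (n * s) + t) = enc (h t)) :
    (syndC (Fintype.card K)).wp S B (fun m' =>
      (∀ i < n * s, m' 15 i = enc (dotFun (n * s) h (V i))) ∧
      ((m' 32 0 = 0 ∧ ∀ i < n * s, dotFun (n * s) h (V i) = 0) ∨
        ∃ p < n * s, m' 32 0 = p + 1 ∧ dotFun (n * s) h (V p) ≠ 0 ∧
          ∀ i < p, dotFun (n * s) h (V i) = 0)) m := by
  refine wp_seq (P := fun m' => m' 32 0 = 0)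
    (wp_set (by simp [Expr.val]) (by simp [Mem.write_apply, Expr.val])) ?_
  intro m1 hf1 h0
  refine (wp_for (L := n * s) (fun k m' =>
      (∀ i < n * s, k ≤ i → m' 15 i = enc (dotFun (n * s) h (V i))) ∧
      ((m' 32 0 = 0 ∧ ∀ i < n * s, k ≤ i → dotFun (n * s) h (V i) = 0) ∨
        ∃ p < n * s, k ≤ p ∧ m' 32 0 = p + 1 ∧ dotFun (n * s) h (V p) ≠ 0 ∧
          ∀ i < p, k ≤ i → dotFun (n * s) h (V i) = 0)) ?_ (hE.lt hE.N_le) hE.N_le ?_ ?_ ?_).mono ?_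
  · simp only [Expr.val]
    rw [hf1 22 (of_decide_eq_true rfl), hb.cols]
  · intro k m' x hI
    rwa [Mem.write_of_ne _ _ _ (by decide), Mem.write_of_ne _ _ _ (by decide)]
  · exact ⟨fun i h1 h2 => by omega, .inl ⟨h0, fun i h1 h2 => by omega⟩⟩
  · intro k hk m' hf hk' hI
    have hf' : ∀ a, a ∉ (syndC (Fintype.card K)).writes → m' a = m a := fun a ha => by
      have ha' : a ∉ [32, 40, 31, 41, 31, 15, 32] := by
        simpa [syndC, dotC, Cmd.writes, eAM] using ha
      simp only [List.mem_cons, not_or, List.not_mem_nil, not_false_eq_true, and_true] at ha'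
      rw [hf a (by simp [dotC, Cmd.writes, ha']), hf1 a (by simp [Cmd.writes, ha'])]
    have hb' : Base K m' n r s := hb.of_eq (hf' 20 (of_decide_eq_true rfl)) (hf' 21 (of_decide_eq_true rfl))
      (hf' 22 (of_decide_eq_true rfl)) (hf' 2 (of_decide_eq_true rfl)) (hf' 3 (of_decide_eq_true rfl))
    have g7 := hf' 7 (of_decide_eq_true rfl)
    have g10 := hf' 10 (of_decide_eq_true rfl)
    have g43 := hf' 43 (of_decide_eq_true rfl)
    refine wp_seq (wp_dotC hE hb' (by decide) h (V k) ?_ ?_) ?_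
    · intro m2 hf2 t ht hvt
      simp only [Expr.val, hvt]
      rw [hf2 7 (by decide) (by decide), hf2 43 (by decide) (by decide),
        hf2 22 (by decide) (by decide), hb'.cols, g7, g43, hρ, hH t ht]
    · intro m2 hf2 t ht hvt
      simp only [Expr.val, hvt]
      rw [hf2 10 (by decide) (by decide), hf2 40 (by decide) (by decide),
        hf2 22 (by decide) (by decide), hb'.cols, g10, hk', hV k hk t ht]
    · rintro m2 - ⟨hf2, hd⟩
      have g40 : m2 40 0 = k := by rw [hf2 40 (by decide) (by decide), hk']
      have g15 : m2 15 = m' 15 := hf2 15 (by decide) (by decide)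
      have g32 : m2 32 = m' 32 := hf2 32 (by decide) (by decide)
      refine wp_seq (P := fun m3 => m3 = m2.write 15 k (enc (dotFun (n * s) h (V k))))
        (wp_set ?_ ?_) ?_
      · simp only [Expr.val, hd]
        exact hE.enc_lt _
      · simp only [Expr.val, hd, g40]
      · rintro m3 - rfl
        have w15 : ∀ i < n * s, k ≤ i →
            (m2.write 15 k (enc (dotFun (n * s) h (V k)))) 15 i = enc (dotFun (n * s) h (V i)) := by
          intro i hi hki
          rw [Mem.write_apply]
          by_cases hik : i = k
          · simp [hik]
          · rw [if_neg (by tauto), g15, hI.1 i hi (by omega)]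
        refine wp_ite (fun hx => ?_) (fun hx => ?_)
        · simp only [Expr.val, Mem.write_of_ne _ _ _ (show 31 ≠ 15 by decide), hd, ne_eq,
            enc_eq_zero] at hx
          refine wp_set ?_ ⟨?_, .inr ⟨k, hk, le_rfl, ?_, hx, fun i h1 h2 => by omega⟩⟩
          · simp only [Expr.val, Mem.write_of_ne _ _ _ (show 40 ≠ 15 by decide), g40]
            exact (show k + 1 ≤ n * s from hk).trans_lt (hE.lt hE.N_le)
          · intro i hi hki
            rw [Mem.write_of_ne _ _ _ (by decide), w15 i hi hki]
          · simp only [Expr.val, Mem.write_of_ne _ _ _ (show 40 ≠ 15 by decide), g40,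
              Mem.write_same]
        · simp only [Expr.val, Mem.write_of_ne _ _ _ (show 31 ≠ 15 by decide), hd,
            enc_eq_zero] at hx
          refine wp_skip ⟨w15, ?_⟩
          rw [Mem.write_of_ne _ _ _ (show 32 ≠ 15 by decide), g32]
          have ext : ∀ i, k ≤ i → (k + 1 ≤ i ∨ i = k) := fun i hi => by omega
          rcases hI.2 with ⟨h1, h2⟩ | ⟨p, hp, hkp, h1, h2, h3⟩
          · refine .inl ⟨h1, fun i hi hki => ?_⟩
            rcases ext i hki with h | rfl
            exacts [h2 i hi h, hx]
          · refine .inr ⟨p, hp, by omega, h1, h2, fun i hi hki => ?_⟩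
            rcases ext i hki with h | rfl
            exacts [h3 i hi h, hx]
  · rintro m' ⟨-, h1, h2⟩
    refine ⟨fun i hi => h1 i hi (Nat.zero_le _), ?_⟩
    simpa using h2

/-- The vectors in array `10` are replaced in place, including the pivot vector, which is therefore
copied to array `16` beforehand. -/
theorem wp_reduceC (hE : Enough K S B n r s mm) (hb : Base K m n r s) {V : ℕ → ℕ → K} {σ : ℕ → K}
    {p : ℕ} (hp : m 32 0 = p + 1) (hpN : p < n * s) (hV : HasVecs m 10 (n * s) (n * s) V)
    (hσ : ∀ i < n * s, m 15 i = enc (σ i)) :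
    (reduceC (Fintype.card K)).wp S B (fun m' =>
      HasVecs m' 10 (n * s) (n * s) (fun i => σ p • V i - σ i • V p)) m := by
  refine wp_seq (wp_map (a := 16) (L := n * s) (fun t => enc (V p t)) (by decide)
    (by simp [Expr.val, hb.cols]) (hE.lt hE.N_le) hE.N_le ?_) ?_
  · intro k hk m' hf hk' _
    have hval : (Expr.get 10 (.add (.mul (.sub (.var 32) (.lit 1)) (.var 22)) (.var 41))).val m' =
        enc (V p k) := by
      simp only [Expr.val, hk']
      rw [hf 10 (of_decide_eq_true rfl), hf 32 (of_decide_eq_true rfl), hf 22 (of_decide_eq_true rfl), hp, hb.cols,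
        Nat.add_sub_cancel, hV p hpN k hk]
    refine wp_set (by rw [hval]; exact hE.enc_lt _) ?_
    rw [hval]
    simp only [Expr.val, hk']
    exact ⟨Mem.write_same .., fun j hj => by simp [Mem.write_apply, hj]⟩
  · rintro m1 - ⟨hf1, h16⟩
    have g15 := hf1 15 (of_decide_eq_true rfl)
    have g32 := hf1 32 (of_decide_eq_true rfl)
    refine wp_seq (P := fun m' => m' 36 0 = enc (σ p) ∧ ∀ a, a ≠ 36 → m' a = m1 a) (wp_set ?_ ?_) ?_
    · simp only [Expr.val, g15, g32, hp, Nat.add_sub_cancel, hσ p hpN]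
      exact hE.enc_lt _
    · simp only [Expr.val, g15, g32, hp, Nat.add_sub_cancel, hσ p hpN]
      exact ⟨Mem.write_same .., fun a ha => Mem.write_of_ne _ _ _ ha⟩
    · rintro m2 - ⟨h36, hf2⟩
      have hb2 : Base K m2 n r s := hb.of_eq (by rw [hf2 20 (of_decide_eq_true rfl), hf1 20 (of_decide_eq_true rfl)])
        (by rw [hf2 21 (of_decide_eq_true rfl), hf1 21 (of_decide_eq_true rfl)])
        (by rw [hf2 22 (of_decide_eq_true rfl), hf1 22 (of_decide_eq_true rfl)])
        (by rw [hf2 2 (of_decide_eq_true rfl), hf1 2 (of_decide_eq_true rfl)])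
        (by rw [hf2 3 (of_decide_eq_true rfl), hf1 3 (of_decide_eq_true rfl)])
      refine (wp_map (a := 10) (L := n * s * (n * s)) (fun u => enc
        (σ p * V (u / (n * s)) (u % (n * s)) - σ (u / (n * s)) * V p (u % (n * s)))) (by decide)
        (by simp [Expr.val, hb2.cols]) (hE.lt hE.sq_le) hE.sq_le ?_).mono ?_
      · intro k hk m' hf hk' hm'
        have hpos : 0 < n * s := by omega
        have hk1 : k / (n * s) < n * s := Nat.div_lt_of_lt_mul hk
        have hk2 : k % (n * s) < n * s := Nat.mod_lt _ hpos
        have hb' : Base K m' n r s := hb2.of_eq (hf 20 (of_decide_eq_true rfl)) (hf 21 (of_decide_eq_true rfl))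
          (hf 22 (of_decide_eq_true rfl)) (hf 2 (of_decide_eq_true rfl)) (hf 3 (of_decide_eq_true rfl))
        have v1 : (Expr.var 36).val m' = enc (σ p) := by
          simp only [Expr.val]; rw [hf 36 (of_decide_eq_true rfl), h36]
        have v2 : (Expr.get 10 (.var 42)).val m' = enc (V (k / (n * s)) (k % (n * s))) := by
          simp only [Expr.val, hk']
          rw [hm' k le_rfl, hf2 10 (of_decide_eq_true rfl), hf1 10 (of_decide_eq_true rfl), ← hV _ hk1 _ hk2,
            Nat.div_add_mod']
        have v3 : (Expr.get 15 (.div (.var 42) (.var 22))).val m' = enc (σ (k / (n * s))) := by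
          simp only [Expr.val, hk', hb'.cols]
          rw [hf 15 (of_decide_eq_true rfl), hf2 15 (of_decide_eq_true rfl), g15, hσ _ hk1]
        have v4 : (Expr.get 16 (.sub (.var 42) (.mul (.div (.var 42) (.var 22)) (.var 22)))).val m' =
            enc (V p (k % (n * s))) := by
          simp only [Expr.val, hk', hb'.cols, sub_div_mul_eq_mod]
          rw [hf 16 (of_decide_eq_true rfl), hf2 16 (of_decide_eq_true rfl), h16, if_pos hk2]
        -- A product is looked up as `0 + x * y`, so no separate table for products is needed.
        have v5 := eAM_val hb'.tab (e₁ := .lit 0) (a := 0) enc_zero.symm v1 v2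
        have v6 := eSM_val hb'.tab v5 v3 v4
        refine wp_set (by rw [v6]; exact hE.enc_lt _) ?_
        rw [v6]
        simp only [Expr.val, hk', zero_add]
        exact ⟨Mem.write_same .., fun j hj => by simp [Mem.write_apply, hj]⟩
      · rintro m' ⟨-, h⟩ i hi t ht
        have hpos : 0 < n * s := by omega
        have h1 : (i * (n * s) + t) / (n * s) = i := by
          rw [mul_comm, Nat.mul_add_div hpos, Nat.div_eq_of_lt ht, add_zero]
        have h2 : (i * (n * s) + t) % (n * s) = t := by
          rw [mul_comm, Nat.mul_add_mod, Nat.mod_eq_of_lt ht]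
        have h3 : i * (n * s) + t < n * s * (n * s) := by nlinarith
        rw [h, if_pos h3, h1, h2]
        simp

theorem wp_elimC (hE : Enough K S B n r s mm) (hb : Base K m n r s) (J : Set ℕ)
    (hJ : ∀ j < n, m 11 j ≠ 0 ↔ j ∈ J) {H : ℕ → ℕ → K} (hH : HasVecs m 7 (n * s) r H) :
    (elimC (Fintype.card K) s (enc (1 : K))).wp S B (fun m' =>
      HasVecs m' 10 (n * s) (n * s) (elimFam (n * s) r (fun ρ => dotFun (n * s) (H ρ))
        (unitFam K {i | i < n * s ∧ i / s ∈ J}) r)) m := by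
  refine wp_seq (wp_initC hE hb J hJ) ?_
  rintro m1 - ⟨hf1, hV1⟩
  refine (wp_for (L := r) (fun k m' => HasVecs m' 10 (n * s) (n * s)
    (elimFam (n * s) r (fun ρ => dotFun (n * s) (H ρ))
        (unitFam K {i | i < n * s ∧ i / s ∈ J}) (r - k))) ?_ (hE.lt hE.r_le) hE.r_le ?_ ?_ ?_).mono ?_
  · simp only [Expr.val]
    rw [hf1 21 (by decide) (by decide), hb.rows]
  · intro k m' x h
    simp only [HasVecs]
    rwa [Mem.write_of_ne _ _ _ (by decide)]
  · simpa [elimFam] using hV1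
  · intro k hk m' hf hk' hI
    have hf' : ∀ a, a ∉ (elimC (Fintype.card K) s (enc (1 : K))).writes → m' a = m a :=
      fun a ha => by
        have ha' : a ∉ [42, 10, 10, 10, 43, 32, 40, 31, 41, 31, 15, 32, 41, 16, 36, 42, 10] := by
          simpa [elimC, initC, reduceC, syndC, dotC, Cmd.writes, eAM] using ha
        simp only [List.mem_cons, not_or, List.not_mem_nil, not_false_eq_true, and_true] at ha'
        rw [hf a (by simp [reduceC, syndC, dotC, Cmd.writes, ha']), hf1 a (by tauto) (by tauto)]
    have hb' : Base K m' n r s := hb.of_eq (hf' 20 (of_decide_eq_true rfl)) (hf' 21 (of_decide_eq_true rfl))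
      (hf' 22 (of_decide_eq_true rfl)) (hf' 2 (of_decide_eq_true rfl)) (hf' 3 (of_decide_eq_true rfl))
    have g7 := hf' 7 (of_decide_eq_true rfl)
    have hrk : r - k = (r - (k + 1)) + 1 := by omega
    have hrk' : r - (r - (k + 1) + 1) = k := by omega
    rw [show r - k = (r - (k + 1)) + 1 by omega, elimFam, hrk']
    generalize elimFam (n * s) r (fun ρ => dotFun (n * s) (H ρ))
        (unitFam K {i | i < n * s ∧ i / s ∈ J}) (r - (k + 1)) = V at hI ⊢
    refine wp_seq (wp_syndC hE hb' hk' hI (h := H k) fun t ht => by rw [g7, hH k hk t ht]) ?_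
    rintro m2 hf2 ⟨h15, h32⟩
    have hb2 : Base K m2 n r s := hb'.of_eq (hf2 20 (of_decide_eq_true rfl)) (hf2 21 (of_decide_eq_true rfl))
      (hf2 22 (of_decide_eq_true rfl)) (hf2 2 (of_decide_eq_true rfl)) (hf2 3 (of_decide_eq_true rfl))
    have g10 := hf2 10 (of_decide_eq_true rfl)
    have hI2 : HasVecs m2 10 (n * s) (n * s) V := by
      simp only [HasVecs, g10]; exact hI
    refine wp_ite (fun hx => ?_) (fun hx => ?_)
    · simp only [Expr.val] at hx
      rcases h32 with ⟨h, -⟩ | ⟨p, hp, h, hp0, hmin⟩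
      · exact absurd h hx
      · rw [elimStep_of_pivot hp hp0 hmin]
        exact wp_reduceC hE hb2 h hp hI2 h15
    · simp only [Expr.val] at hx
      rcases h32 with ⟨-, h⟩ | ⟨p, hp, h, hp0, hmin⟩
      · rw [elimStep_of_forall h]
        exact wp_skip hI2
      · omega
  · rintro m' ⟨-, h⟩
    simpa using h

end RAM

namespace RAM

open RAM.Cmd RAM.Expr

/-! ## One trial -/

/-- Read the bits given by `e` as a binary number. -/
def numC (b e : Expr) : Cmd :=
  .seq (.set 31 (.lit 0) (.lit 0))
    (.for_ 41 b (.set 31 (.lit 0) (.add (.mul (.var 31) (.lit 2)) e)))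

/-- The random coordinate set. -/
def coordC : Cmd :=
  .for_ 44 (.var 20)
    (.seq (numC (.var 20) (.get 12 (.add (.mul (.var 44) (.var 20)) (.var 41))))
      (.set 11 (.var 44) (.sub (.mul (.var 23) (.var 24)) (.mul (.var 31) (.var 20)))))

/-- The random coefficients. -/
def coefC (q : ℕ) : Cmd :=
  .for_ 40 (.var 22)
    (.seq (numC (.lit q)
        (.get 12 (.add (.add (.mul (.var 20) (.var 20)) (.mul (.var 40) (.lit q))) (.var 41))))
      (.set 13 (.var 40) (.get 6 (.var 31))))

/-- The random combination. -/
def combC (q : ℕ) : Cmd :=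
  .for_ 40 (.var 22)
    (.seq (dotC q 41 (.get 13 (.var 41)) (.get 10 (.add (.mul (.var 41) (.var 22)) (.var 40))))
      (.set 14 (.var 40) (.var 31)))

/-- The weight of the candidate. -/
def weightC (s : ℕ) : Cmd :=
  .seq (.set 33 (.lit 0) (.lit 0))
    (.for_ 44 (.var 20)
      (.seq (.set 34 (.lit 0) (.lit 0))
        (.seq (.for_ 41 (.lit s)
            (.ite (.get 14 (.add (.mul (.var 44) (.lit s)) (.var 41)))
              (.set 34 (.lit 0) (.lit 1)) .skip))
          (.set 33 (.lit 0) (.add (.var 33) (.var 34))))))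

/-- Is the candidate outside of the excluded space? -/
def testC (q : ℕ) : Cmd :=
  .seq (.set 35 (.lit 0) (.lit 0))
    (.for_ 40 (.var 22)
      (.seq (dotC q 41 (.get 9 (.add (.mul (.var 40) (.var 22)) (.var 41))) (.get 14 (.var 41)))
        (.ite (.var 31) (.set 35 (.lit 0) (.lit 1)) .skip)))

/-- Record the weight of the candidate if it is an improvement. -/
def updateC : Cmd :=
  .ite (.var 35) (.ite (.sub (.var 29) (.var 33)) (.set 29 (.lit 0) (.var 33)) .skip) .skip

/-- One trial. -/
def trialC (q s one : ℕ) : Cmd :=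
  .seq coordC (.seq (elimC q s one) (.seq (coefC q) (.seq (combC q)
    (.seq (weightC s) (.seq (testC q) updateC)))))

/-- The number with binary digits `f 0, …, f (L - 1)`. -/
def numOf (f : ℕ → ℕ) (L : ℕ) : ℕ := ∑ u ∈ Finset.range L, f u * 2 ^ u

theorem numOf_succ (f : ℕ → ℕ) (L : ℕ) :
    numOf f (L + 1) = f 0 + 2 * numOf (fun u => f (u + 1)) L := by
  rw [numOf, Finset.sum_range_succ', add_comm, numOf, Finset.mul_sum]
  congr 1
  · simp
  · exact Finset.sum_congr rfl fun u _ => by ring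

theorem numOf_lt {f : ℕ → ℕ} {L : ℕ} (hf : ∀ u < L, f u ≤ 1) : numOf f L < 2 ^ L := by
  induction L generalizing f with
  | zero => simp [numOf]
  | succ L ih =>
    have h1 := ih (f := fun u => f (u + 1)) fun u hu => hf (u + 1) (by omega)
    have h2 := hf 0 (by omega)
    rw [numOf_succ, pow_succ]
    omega

/-- The coordinates selected by the coins `ρ`. -/
def trialSet (n mm : ℕ) (ρ : ℕ → ℕ) : Set ℕ :=
  {j | numOf (fun u => ρ (j * n + u)) n * n < mm * 2 ^ n}

/-- The coefficients selected by the coins `ρ`. -/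
noncomputable def trialCoef (K : Type) [Field K] [Fintype K] (n : ℕ) (ρ : ℕ → ℕ) (i : ℕ) : K :=
  dec K (numOf (fun u => ρ (n * n + i * Fintype.card K + u)) (Fintype.card K))

/-- The vectors after elimination with coordinate set `J`. -/
noncomputable def kerFam {K : Type} [Field K] (n s r : ℕ) (H : ℕ → ℕ → K) (J : Set ℕ) :
    ℕ → ℕ → K :=
  elimFam (n * s) r (fun ρ => dotFun (n * s) (H ρ)) (unitFam K {i | i < n * s ∧ i / s ∈ J}) r

/-- The candidate of a trial with coins `ρ`. -/
noncomputable def trialVec {K : Type} [Field K] [Fintype K] (n s r mm : ℕ) (H : ℕ → ℕ → K)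
    (ρ : ℕ → ℕ) : ℕ → K :=
  ∑ i ∈ Finset.range (n * s), trialCoef K n ρ i • kerFam n s r H (trialSet n mm ρ) i

open Classical in
/-- The number of nonzero blocks of length `s`. -/
noncomputable def blockWeight {K : Type} [Field K] (n s : ℕ) (x : ℕ → K) : ℕ :=
  ((Finset.range n).filter fun j => ∃ c < s, x (j * s + c) ≠ 0).card

open Classical in
/-- The best weight after a trial with coins `ρ`. -/
noncomputable def trialBest {K : Type} [Field K] [Fintype K] (n s r mm : ℕ) (H G : ℕ → ℕ → K)
    (ρ : ℕ → ℕ) (best : ℕ) : ℕ :=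
  if (∃ i < n * s, dotFun (n * s) (G i) (trialVec n s r mm H ρ) ≠ 0) ∧
      blockWeight n s (trialVec n s r mm H ρ) < best then
    blockWeight n s (trialVec n s r mm H ρ) else best

variable {K : Type} [Field K] [Fintype K] {S B n r s mm : ℕ} {m : Mem}

/-- Horner's rule: the loop meets the most significant digit first, so after the pass with index `k`
the accumulator holds the number with the digits `f k, f (k + 1), …`. -/
theorem wp_numC {b e : Expr} {L : ℕ} {f : ℕ → ℕ} (hb : ∀ m' : Mem, (∀ a, a ≠ 31 → m' a = m a) →
      b.val m' = L)
    (hLB : L ≤ B) (hBS : B < 2 ^ S) (hLS : L < S) (hf : ∀ u < L, f u ≤ 1)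
    (he : ∀ m' : Mem, (∀ a, a ≠ 31 → a ≠ 41 → m' a = m a) → ∀ u < L, m' 41 0 = u → e.val m' = f u) :
    (numC b e).wp S B (fun m' => m' 31 0 = numOf f L) m := by
  refine wp_seq (P := fun m' => m' 31 0 = 0 ∧ ∀ a, a ≠ 31 → m' a = m a)
    (wp_set (by simp [Expr.val]) ⟨by simp [Mem.write_apply, Expr.val], fun a ha =>
      Mem.write_of_ne _ _ _ ha⟩) ?_
  rintro m1 - ⟨h0, hf1⟩
  refine (wp_for (fun k m' => m' 31 0 = numOf (fun u => f (k + u)) (L - k)) (hb m1 hf1)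
    (hLB.trans_lt hBS) hLB ?_ ?_ ?_).mono ?_
  · intro k m' x h
    rwa [Mem.write_of_ne _ _ _ (by decide)]
  · simp [h0, numOf]
  · intro k hk m' hf' hk' hI
    have hv : (Expr.add (.mul (.var 31) (.lit 2)) e).val m' = numOf (fun u => f (k + u)) (L - k) := by
      rw [show L - k = (L - (k + 1)) + 1 by omega, numOf_succ]
      simp only [Expr.val, hI]
      rw [he m' (fun a h1 h2 => by rw [hf' a (by simp [Cmd.writes, h1, h2]), hf1 a h1]) k hk hk']
      simp only [add_zero, add_assoc, add_comm 1]
      ring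
    have hlt := numOf_lt (f := fun u => f (k + u)) (L := L - k) fun u hu => hf _ (by omega)
    have hle : 2 ^ (L - k) ≤ 2 ^ S := Nat.pow_le_pow_right two_pos (by omega)
    refine wp_set (by rw [hv]; exact hlt.trans_le hle) ?_
    rw [hv]
    simp only [Expr.val, Mem.write_same]
  · rintro m' ⟨-, h⟩
    simpa using h

/-- A truncated difference is nonzero exactly when the inequality in `trialSet` holds, so array `11`
serves as an indicator. When `mm ≤ n`, a coordinate is selected with probability `mm / n`, rounded
up to a multiple of `2 ^ (-n)`, since `n` fair coins cannot give `mm / n` exactly. -/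
theorem wp_coordC (hE : Enough K S B n r s mm) (hb : Base K m n r s) (h23 : m 23 0 = mm)
    (h24 : m 24 0 = 2 ^ n) (hρ : ∀ i < n * n, m 12 i ≤ 1) :
    coordC.wp S B (fun m' => ∀ j < n, m' 11 j ≠ 0 ↔ j ∈ trialSet n mm (m 12)) m := by
  refine (wp_map (a := 11) (L := n)
    (fun j => mm * 2 ^ n - numOf (fun u => m 12 (j * n + u)) n * n) (by decide)
    (by simp [Expr.val, hb.len]) (hE.lt hE.n_le) hE.n_le ?_).mono ?_
  · intro k hk m' hf hk' hm'
    have g20 : m' 20 0 = n := by rw [hf 20 (of_decide_eq_true rfl), hb.len]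
    have g12 := hf 12 (of_decide_eq_true rfl)
    refine wp_seq (wp_numC (L := n) (f := fun u => m 12 (k * n + u)) ?_ hE.n_le hE.B_lt hE.n_lt
      ?_ ?_) ?_
    · intro m2 hf2
      simp only [Expr.val]
      rw [hf2 20 (by decide), g20]
    · exact fun u hu => hρ _ (by nlinarith)
    · intro m2 hf2 u hu hu'
      simp only [Expr.val, hu']
      rw [hf2 12 (by decide) (by decide), hf2 20 (by decide) (by decide), hf2 44 (by decide)
        (by decide), hk', g20, g12]
    · intro m2 hf2 h31
      have hv : (Expr.sub (.mul (.var 23) (.var 24)) (.mul (.var 31) (.var 20))).val m2 =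
          mm * 2 ^ n - numOf (fun u => m 12 (k * n + u)) n * n := by
        simp only [Expr.val, h31]
        rw [hf2 20 (of_decide_eq_true rfl), hf2 23 (of_decide_eq_true rfl),
          hf2 24 (of_decide_eq_true rfl), g20, hf 23 (of_decide_eq_true rfl),
          hf 24 (of_decide_eq_true rfl), h23, h24]
      refine wp_set (by rw [hv]; exact (Nat.sub_le _ _).trans_lt hE.pow_lt) ?_
      have g44 : m2 44 0 = k := by rw [hf2 44 (of_decide_eq_true rfl), hk']
      rw [hv]
      simp only [Expr.val, g44]
      refine ⟨Mem.write_same .., fun j hj => ?_⟩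
      rw [Mem.write_apply, if_neg (by tauto), hf2 11 (of_decide_eq_true rfl)]
  · rintro m' ⟨-, h⟩ j hj
    rw [h, if_pos hj, trialSet, Set.mem_ofPred_eq]
    omega

theorem wp_coefC (hE : Enough K S B n r s mm) (hb : Base K m n r s)
    (h6 : ∀ u < 2 ^ Fintype.card K, m 6 u = enc (dec K u))
    (hρ : ∀ i < n * n + n * s * Fintype.card K, m 12 i ≤ 1) :
    (coefC (Fintype.card K)).wp S B
      (fun m' => ∀ i < n * s, m' 13 i = enc (trialCoef K n (m 12) i)) m := by
  refine (wp_map (a := 13) (L := n * s)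
    (fun i => enc (trialCoef K n (m 12) i)) (by decide)
    (by simp [Expr.val, hb.cols]) (hE.lt hE.N_le) hE.N_le ?_).mono ?_
  · intro k hk m' hf hk' hm'
    have g20 : m' 20 0 = n := by rw [hf 20 (of_decide_eq_true rfl), hb.len]
    have g12 := hf 12 (of_decide_eq_true rfl)
    have hbit : ∀ u < Fintype.card K, m 12 (n * n + k * Fintype.card K + u) ≤ 1 :=
      fun u hu => hρ _ (by nlinarith)
    refine wp_seq (wp_numC (L := Fintype.card K)
      (f := fun u => m 12 (n * n + k * Fintype.card K + u)) ?_ hE.q_le_B hE.B_lt hE.q_lt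
      hbit ?_) ?_
    · intro m2 hf2
      simp only [Expr.val]
    · intro m2 hf2 u hu hu'
      simp only [Expr.val, hu']
      rw [hf2 12 (by decide) (by decide), hf2 20 (by decide) (by decide), hf2 40 (by decide)
        (by decide), hk', g20, g12]
    · intro m2 hf2 h31
      have hv : (Expr.get 6 (.var 31)).val m2 = enc (trialCoef K n (m 12) k) := by
        simp only [Expr.val, h31]
        rw [hf2 6 (of_decide_eq_true rfl), hf 6 (of_decide_eq_true rfl), h6 _ (numOf_lt hbit),
          trialCoef]
      refine wp_set (by rw [hv]; exact hE.enc_lt _) ?_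
      have g40 : m2 40 0 = k := by rw [hf2 40 (of_decide_eq_true rfl), hk']
      rw [hv]
      simp only [Expr.val, g40]
      refine ⟨Mem.write_same .., fun j hj => ?_⟩
      rw [Mem.write_apply, if_neg (by tauto), hf2 13 (of_decide_eq_true rfl)]
  · rintro m' ⟨-, h⟩ j hj
    rw [h, if_pos hj]

theorem wp_combC (hE : Enough K S B n r s mm) (hb : Base K m n r s) {V : ℕ → ℕ → K} {c : ℕ → K}
    (hV : HasVecs m 10 (n * s) (n * s) V) (hc : ∀ i < n * s, m 13 i = enc (c i)) :
    (combC (Fintype.card K)).wp S B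
      (fun m' => ∀ t < n * s, m' 14 t = enc ((∑ i ∈ Finset.range (n * s), c i • V i) t)) m := by
  refine (wp_map (a := 14) (L := n * s)
    (fun t => enc ((∑ i ∈ Finset.range (n * s), c i • V i) t)) (by decide)
    (by simp [Expr.val, hb.cols]) (hE.lt hE.N_le) hE.N_le ?_).mono ?_
  · intro k hk m' hf hk' hm'
    have hb' : Base K m' n r s := hb.of_eq (hf 20 (of_decide_eq_true rfl))
      (hf 21 (of_decide_eq_true rfl)) (hf 22 (of_decide_eq_true rfl)) (hf 2 (of_decide_eq_true rfl))
      (hf 3 (of_decide_eq_true rfl))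
    refine wp_seq (wp_dotC hE hb' (by decide) c (fun i => V i k) ?_ ?_) ?_
    · intro m2 hf2 t ht hvt
      simp only [Expr.val, hvt]
      rw [hf2 13 (by decide) (by decide), hf 13 (of_decide_eq_true rfl), hc t ht]
    · intro m2 hf2 t ht hvt
      simp only [Expr.val, hvt]
      rw [hf2 10 (by decide) (by decide), hf2 40 (by decide) (by decide),
        hf2 22 (by decide) (by decide), hb'.cols, hf 10 (of_decide_eq_true rfl), hk', hV t ht k hk]
    · rintro m2 - ⟨hf2, hd⟩
      have hv : (Expr.var 31).val m2 = enc ((∑ i ∈ Finset.range (n * s), c i • V i) k) := by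
        simp only [Expr.val, hd, dotFun_apply, Finset.sum_apply, Pi.smul_apply, smul_eq_mul]
      refine wp_set (by rw [hv]; exact hE.enc_lt _) ?_
      have g40 : m2 40 0 = k := by rw [hf2 40 (by decide) (by decide), hk']
      rw [hv]
      simp only [Expr.val, g40]
      refine ⟨Mem.write_same .., fun j hj => ?_⟩
      rw [Mem.write_apply, if_neg (by tauto), hf2 14 (by decide) (by decide)]
  · rintro m' ⟨-, h⟩ j hj
    rw [h, if_pos hj]

theorem wp_weightC (hE : Enough K S B n r s mm) (hb : Base K m n r s) {x : ℕ → K}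
    (hx : ∀ t < n * s, m 14 t = enc (x t)) :
    (weightC s).wp S B (fun m' => m' 33 0 = blockWeight n s x) m := by
  classical
  refine wp_seq (P := fun m' => m' 33 0 = 0)
    (wp_set (by simp [Expr.val]) (by simp [Mem.write_apply, Expr.val])) ?_
  intro m1 hf1 h0
  refine (wp_for (L := n) (fun k m' => m' 33 0 =
    ((Finset.Ico k n).filter fun j => ∃ c < s, x (j * s + c) ≠ 0).card) ?_ (hE.lt hE.n_le) hE.n_le
    ?_ ?_ ?_).mono ?_
  · simp only [Expr.val]
    rw [hf1 20 (of_decide_eq_true rfl), hb.len]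
  · intro k m' y h
    rwa [Mem.write_of_ne _ _ _ (by decide)]
  · simpa using h0
  · intro k hk m' hf hk' hI
    refine wp_seq (P := fun m' => m' 34 0 = 0)
      (wp_set (by simp [Expr.val]) (by simp [Mem.write_apply, Expr.val])) ?_
    intro m2 hf2 h34
    have g14 : m2 14 = m 14 := by
      rw [hf2 14 (of_decide_eq_true rfl), hf 14 (of_decide_eq_true rfl),
        hf1 14 (of_decide_eq_true rfl)]
    have g44 : m2 44 0 = k := by rw [hf2 44 (of_decide_eq_true rfl), hk']
    have g33 : m2 33 0 = m' 33 0 := by rw [hf2 33 (of_decide_eq_true rfl)]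
    refine wp_seq (wp_for (L := s) (fun c m' => m' 34 0 =
      if ∃ c' < s, c ≤ c' ∧ x (k * s + c') ≠ 0 then 1 else 0) ?_ (hE.lt hE.s_le) hE.s_le ?_ ?_ ?_) ?_
    · simp [Expr.val]
    · intro k m' y h
      rwa [Mem.write_of_ne _ _ _ (by decide)]
    · rw [h34, if_neg]
      rintro ⟨c', h1, h2, -⟩
      omega
    · intro c hc m3 hf3 hc3 hI3
      have hv : (Expr.get 14 (.add (.mul (.var 44) (.lit s)) (.var 41))).val m3 =
          enc (x (k * s + c)) := by
        simp only [Expr.val, hc3]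
        rw [hf3 14 (of_decide_eq_true rfl), hf3 44 (of_decide_eq_true rfl), g14, g44,
          hx _ (by nlinarith)]
      refine wp_ite (fun h => ?_) (fun h => ?_)
      · rw [hv, ne_eq, enc_eq_zero] at h
        refine wp_set (by simpa [Expr.val] using hE.lt (x := 1) (by have := hE.s_le; omega)) ?_
        rw [if_pos ⟨c, hc, le_rfl, h⟩]
        simp [Expr.val, Mem.write_apply]
      · rw [hv, enc_eq_zero] at h
        refine wp_skip ?_
        rw [hI3]
        congr 1
        simp only [eq_iff_iff]
        constructor
        · rintro ⟨c', h1, h2, h3⟩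
          exact ⟨c', h1, by omega, h3⟩
        · rintro ⟨c', h1, h2, h3⟩
          refine ⟨c', h1, ?_, h3⟩
          by_contra hcon
          have : c' = c := by omega
          exact h3 (this ▸ h)
    · rintro m3 - ⟨hf3, h3⟩
      have g33' : m3 33 0 = m' 33 0 := by rw [hf3 33 (of_decide_eq_true rfl), g33]
      have hv : (Expr.add (.var 33) (.var 34)).val m3 =
          ((Finset.Ico k n).filter fun j => ∃ c < s, x (j * s + c) ≠ 0).card := by
        have h0le : (∃ c' < s, 0 ≤ c' ∧ x (k * s + c') ≠ 0) ↔ ∃ c' < s, x (k * s + c') ≠ 0 := by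
          simp
        simp only [Expr.val]
        rw [h3, g33', hI, ← Finset.insert_Ico_add_one_left_eq_Ico hk, Finset.filter_insert]
        simp only [h0le]
        split_ifs
        · rw [Finset.card_insert_of_notMem (by simp)]
        · rfl
      refine wp_set ?_ ?_
      · rw [hv]
        refine hE.lt ((Finset.card_filter_le _ _).trans ?_)
        rw [Nat.card_Ico]
        exact (Nat.sub_le _ _).trans hE.n_le
      · rw [hv]
        exact Mem.write_same ..
  · rintro m' ⟨-, h⟩
    rw [h, blockWeight, Finset.range_eq_Ico]

theorem wp_testC (hE : Enough K S B n r s mm) (hb : Base K m n r s) {x : ℕ → K} {G : ℕ → ℕ → K}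
    (hG : HasVecs m 9 (n * s) (n * s) G) (hx : ∀ t < n * s, m 14 t = enc (x t)) :
    (testC (Fintype.card K)).wp S B
      (fun m' => m' 35 0 ≠ 0 ↔ ∃ i < n * s, dotFun (n * s) (G i) x ≠ 0) m := by
  refine wp_seq (P := fun m' => m' 35 0 = 0)
    (wp_set (by simp [Expr.val]) (by simp [Mem.write_apply, Expr.val])) ?_
  intro m1 hf1 h0
  refine (wp_for (L := n * s) (fun k m' => m' 35 0 ≠ 0 ↔
    ∃ i < n * s, k ≤ i ∧ dotFun (n * s) (G i) x ≠ 0) ?_ (hE.lt hE.N_le) hE.N_le ?_ ?_ ?_).mono ?_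
  · simp only [Expr.val]
    rw [hf1 22 (of_decide_eq_true rfl), hb.cols]
  · intro k m' y h
    rwa [Mem.write_of_ne _ _ _ (by decide)]
  · simp only [h0, ne_eq, not_true, false_iff]
    rintro ⟨i, h1, h2, -⟩
    omega
  · intro k hk m' hf hk' hI
    have hf' : ∀ a, a ∉ (testC (Fintype.card K)).writes → m' a = m a := fun a ha => by
      have ha' : a ∉ [35, 40, 31, 41, 31, 35] := by
        simpa [testC, dotC, Cmd.writes, eAM] using ha
      simp only [List.mem_cons, not_or, List.not_mem_nil, not_false_eq_true, and_true] at ha'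
      rw [hf a (by simp [dotC, Cmd.writes, ha']), hf1 a (by simp [Cmd.writes, ha'])]
    have hb' : Base K m' n r s := hb.of_eq (hf' 20 (of_decide_eq_true rfl))
      (hf' 21 (of_decide_eq_true rfl)) (hf' 22 (of_decide_eq_true rfl))
      (hf' 2 (of_decide_eq_true rfl)) (hf' 3 (of_decide_eq_true rfl))
    refine wp_seq (wp_dotC hE hb' (by decide) (G k) x ?_ ?_) ?_
    · intro m2 hf2 t ht hvt
      simp only [Expr.val, hvt]
      rw [hf2 9 (by decide) (by decide), hf2 40 (by decide) (by decide),
        hf2 22 (by decide) (by decide), hb'.cols, hf' 9 (of_decide_eq_true rfl), hk', hG k hk t ht]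
    · intro m2 hf2 t ht hvt
      simp only [Expr.val, hvt]
      rw [hf2 14 (by decide) (by decide), hf' 14 (of_decide_eq_true rfl), hx t ht]
    · rintro m2 - ⟨hf2, hd⟩
      have g35 : m2 35 = m' 35 := hf2 35 (by decide) (by decide)
      refine wp_ite (fun h => ?_) (fun h => ?_)
      · simp only [Expr.val, hd, ne_eq, enc_eq_zero] at h
        refine wp_set (by simpa [Expr.val] using hE.lt (x := 1) (by have := hE.N_le; omega)) ?_
        simp only [Expr.val, Mem.write_same, ne_eq, one_ne_zero, not_false_eq_true, true_iff]
        exact ⟨k, hk, le_rfl, h⟩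
      · simp only [Expr.val, hd, enc_eq_zero] at h
        refine wp_skip ?_
        rw [g35, hI]
        constructor
        · rintro ⟨i, h1, h2, h3⟩
          exact ⟨i, h1, by omega, h3⟩
        · rintro ⟨i, h1, h2, h3⟩
          refine ⟨i, h1, ?_, h3⟩
          by_contra hcon
          have : i = k := by omega
          exact h3 (this ▸ h)
  · rintro m' ⟨-, h⟩
    simpa using h

theorem blockWeight_le {K : Type} [Field K] (n s : ℕ) (x : ℕ → K) : blockWeight n s x ≤ n := by
  classical
  exact (Finset.card_filter_le _ _).trans (Finset.card_range n).le

theorem wp_trialC (hE : Enough K S B n r s mm) (hb : Base K m n r s) (h23 : m 23 0 = mm)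
    (h24 : m 24 0 = 2 ^ n) (h6 : ∀ u < 2 ^ Fintype.card K, m 6 u = enc (dec K u))
    {H G : ℕ → ℕ → K} (hH : HasVecs m 7 (n * s) r H) (hG : HasVecs m 9 (n * s) (n * s) G)
    (hρ : ∀ i < n * n + n * s * Fintype.card K, m 12 i ≤ 1) :
    (trialC (Fintype.card K) s (enc (1 : K))).wp S B (fun m' =>
      m' 29 0 = trialBest n s r mm H G (m 12) (m 29 0)) m := by
  refine wp_seq (wp_coordC hE hb h23 h24 fun i hi => hρ i (by omega)) ?_
  intro m1 hf1 h11
  have hb1 : Base K m1 n r s := hb.of_eq (hf1 20 (of_decide_eq_true rfl))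
    (hf1 21 (of_decide_eq_true rfl)) (hf1 22 (of_decide_eq_true rfl))
    (hf1 2 (of_decide_eq_true rfl)) (hf1 3 (of_decide_eq_true rfl))
  have hH1 : HasVecs m1 7 (n * s) r H := by
    simp only [HasVecs, hf1 7 (of_decide_eq_true rfl)]; exact hH
  refine wp_seq (wp_elimC hE hb1 _ h11 hH1) ?_
  intro m2 hf2 hV2
  have hb2 : Base K m2 n r s := hb1.of_eq (hf2 20 (of_decide_eq_true rfl))
    (hf2 21 (of_decide_eq_true rfl)) (hf2 22 (of_decide_eq_true rfl))
    (hf2 2 (of_decide_eq_true rfl)) (hf2 3 (of_decide_eq_true rfl))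
  have g6 : m2 6 = m 6 := by
    rw [hf2 6 (of_decide_eq_true rfl), hf1 6 (of_decide_eq_true rfl)]
  have g12 : m2 12 = m 12 := by
    rw [hf2 12 (of_decide_eq_true rfl), hf1 12 (of_decide_eq_true rfl)]
  refine wp_seq (wp_coefC hE hb2 (by rw [g6]; exact h6) (by rw [g12]; exact hρ)) ?_
  intro m3 hf3 h13
  have hb3 : Base K m3 n r s := hb2.of_eq (hf3 20 (of_decide_eq_true rfl))
    (hf3 21 (of_decide_eq_true rfl)) (hf3 22 (of_decide_eq_true rfl))
    (hf3 2 (of_decide_eq_true rfl)) (hf3 3 (of_decide_eq_true rfl))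
  rw [g12] at h13
  have hV3 := hV2
  simp only [HasVecs, ← hf3 10 (of_decide_eq_true rfl)] at hV3
  refine wp_seq (wp_combC hE hb3 hV3 h13) ?_
  intro m4 hf4 h14
  change ∀ t < n * s, m4 14 t = enc (trialVec n s r mm H (m 12) t) at h14
  have hb4 : Base K m4 n r s := hb3.of_eq (hf4 20 (of_decide_eq_true rfl))
    (hf4 21 (of_decide_eq_true rfl)) (hf4 22 (of_decide_eq_true rfl))
    (hf4 2 (of_decide_eq_true rfl)) (hf4 3 (of_decide_eq_true rfl))
  refine wp_seq (wp_weightC hE hb4 h14) ?_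
  intro m5 hf5 h33
  have hb5 : Base K m5 n r s := hb4.of_eq (hf5 20 (of_decide_eq_true rfl))
    (hf5 21 (of_decide_eq_true rfl)) (hf5 22 (of_decide_eq_true rfl))
    (hf5 2 (of_decide_eq_true rfl)) (hf5 3 (of_decide_eq_true rfl))
  have hG5 : HasVecs m5 9 (n * s) (n * s) G := by
    simp only [HasVecs]
    rw [hf5 9 (of_decide_eq_true rfl), hf4 9 (of_decide_eq_true rfl), hf3 9 (of_decide_eq_true rfl),
      hf2 9 (of_decide_eq_true rfl), hf1 9 (of_decide_eq_true rfl)]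
    exact hG
  refine wp_seq (wp_testC hE hb5 hG5 (x := trialVec n s r mm H (m 12))
    (by rw [hf5 14 (of_decide_eq_true rfl)]; exact h14)) ?_
  intro m6 hf6 h35
  have g33 : m6 33 0 = blockWeight n s (trialVec n s r mm H (m 12)) := by
    rw [hf6 33 (of_decide_eq_true rfl), h33]
  have g29 : m6 29 0 = m 29 0 := by
    rw [hf6 29 (of_decide_eq_true rfl), hf5 29 (of_decide_eq_true rfl),
      hf4 29 (of_decide_eq_true rfl), hf3 29 (of_decide_eq_true rfl),
      hf2 29 (of_decide_eq_true rfl), hf1 29 (of_decide_eq_true rfl)]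
  refine wp_ite (fun h => ?_) (fun h => ?_)
  · simp only [Expr.val] at h
    refine wp_ite (fun h' => ?_) (fun h' => ?_)
    · simp only [Expr.val, g29, g33] at h'
      refine wp_set ?_ ?_
      · simp only [Expr.val, g33]
        exact hE.lt ((blockWeight_le _ _ _).trans hE.n_le)
      · simp only [Expr.val, g33, Mem.write_same]
        rw [trialBest, if_pos ⟨h35.1 h, by omega⟩]
    · simp only [Expr.val, g29, g33] at h'
      refine wp_skip ?_
      rw [g29, trialBest, if_neg]
      exact fun hc => by omega
  · simp only [Expr.val] at h
    refine wp_skip ?_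
    rw [g29, trialBest, if_neg]
    exact fun hc => h35.2 hc.1 h

end RAM

namespace RAM

open RAM.Cmd RAM.Expr

/-! ## Initialization -/

/-- The arithmetic tables. -/
noncomputable def tablesC (K : Type) [Field K] [Fintype K] : Cmd :=
  let q := Fintype.card K
  .seq (tabulate 2 (fun u => enc (dec K (u / q / q) + dec K (u / q % q) * dec K (u % q))) (q * q * q))
    (.seq (tabulate 3 (fun u => enc (dec K (u / q / q) - dec K (u / q % q) * dec K (u % q)))
      (q * q * q))
    (tabulate 6 (fun u => enc (dec K u)) (2 ^ q)))

/-- The scalars. -/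
def scalarsC (s : ℕ) : Cmd :=
  .seq (.set 20 (.lit 0) (.get 0 (.lit 0)))
    (.seq (.set 21 (.lit 0) (.get 0 (.lit 1)))
    (.seq (.set 22 (.lit 0) (.mul (.var 20) (.lit s)))
    (.seq (.set 23 (.lit 0) (.add (.div (.var 21) (.lit s)) (.lit 1)))
    (.seq (.set 24 (.lit 0) (.lit 1))
      (.for_ 44 (.var 20) (.set 24 (.lit 0) (.mul (.var 24) (.lit 2))))))))

/-- Translate the letters of the input into rows over `K`. -/
def loadC (f : ℕ → ℕ) (L s : ℕ) : Cmd :=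
  .seq (tabulate 4 f (L * s))
    (.for_ 42 (.mul (.var 21) (.var 22))
      (.set 7 (.var 42) (.get 4 (.add (.mul (.get 1 (.div (.var 42) (.lit s))) (.lit s))
        (.sub (.var 42) (.mul (.div (.var 42) (.lit s)) (.lit s)))))))

/-- Generators for the test. -/
def generatorsC (q s one : ℕ) : Cmd :=
  .seq (.for_ 44 (.var 20) (.set 11 (.var 44) (.lit 1)))
    (.seq (elimC q s one)
      (.for_ 42 (.mul (.var 22) (.var 22)) (.set 9 (.var 42) (.get 10 (.var 42)))))

/-- The numbers of trials. -/
def trialsC (q : ℕ) : Cmd :=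
  .seq (.seq (.set 25 (.lit 0) (.lit 1))
      (.for_ 44 (.var 20) (.ite (.sub (.var 20) (.mul (.var 44) (.var 44)))
        (.set 25 (.lit 0) (.mul (.var 25) (.lit (2 ^ (4 * q))))) .skip)))
    (.seq (.set 26 (.lit 0) (.lit 1)) (.seq (.set 27 (.lit 0) (.lit 1)) (.seq (.set 28 (.lit 0) (.lit 0))
      (.for_ 44 (.var 23)
        (.seq (.set 26 (.lit 0) (.mul (.var 26) (.sub (.var 20) (.var 28))))
        (.seq (.set 27 (.lit 0) (.mul (.var 27) (.sub (.var 23) (.var 28))))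
        (.seq (.set 28 (.lit 0) (.add (.var 28) (.lit 1)))
          (.set 17 (.var 28) (.mul (.mul (.mul (.mul (.lit 4) (.var 20)) (.add (.var 20) (.lit 1)))
            (.var 25)) (.add (.div (.var 26) (.var 27)) (.lit 1)))))))))))

/-- The whole initialization. -/
noncomputable def startC (K : Type) [Field K] [Fintype K] (F₁ F₂ : ℕ → K) (L s : ℕ) : Cmd :=
  .seq (tablesC K) (.seq (scalarsC s) (.seq (loadC (fun u => enc (F₂ u)) L s)
    (.seq (generatorsC (Fintype.card K) s (enc (1 : K))) (.seq (loadC (fun u => enc (F₁ u)) L s)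
    (.seq (trialsC (Fintype.card K))
    (.seq (.set 29 (.lit 0) (.var 23)) (.set 30 (.lit 0) (.lit 0))))))))

/-- A natural number of size about the square root of `n`. -/
def rootCount (n : ℕ) : ℕ := ((Finset.range n).filter fun i => i * i < n).card

/-- The number of trials that are made for weight `w`. -/
def numTrials (q n mm w : ℕ) : ℕ :=
  4 * n * (n + 1) * 2 ^ (4 * q * rootCount n) * (n.descFactorial w / mm.descFactorial w + 1)

variable {K : Type} [Field K] [Fintype K] {S B n r s mm : ℕ} {m : Mem}

theorem wp_tablesC (hq : Fintype.card K < 2 ^ S) :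
    (tablesC K).wp S B (fun m' => Tab K m' ∧ (∀ u < 2 ^ Fintype.card K, m' 6 u = enc (dec K u)) ∧
      ∀ a, a ≠ 2 → a ≠ 3 → a ≠ 6 → m' a = m a) m := by
  have hlt : ∀ x : K, enc x < 2 ^ S := fun x => (enc_lt x).trans hq
  have hpos : 0 < Fintype.card K := Fintype.card_pos
  have hidx : ∀ a x y : K, (enc a * Fintype.card K + enc x) * Fintype.card K + enc y <
      Fintype.card K * Fintype.card K * Fintype.card K := fun a x y => by
    have h1 := enc_lt a
    have h2 := enc_lt x
    have h3 := enc_lt y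
    have h4 : enc a * Fintype.card K + enc x < Fintype.card K * Fintype.card K := by nlinarith
    nlinarith
  have hdiv : ∀ a b : ℕ, b < Fintype.card K → (a * Fintype.card K + b) / Fintype.card K = a :=
    fun a b hb => by
      rw [mul_comm, Nat.mul_add_div hpos, Nat.div_eq_of_lt hb, add_zero]
  have hmod : ∀ a b : ℕ, b < Fintype.card K → (a * Fintype.card K + b) % Fintype.card K = b :=
    fun a b hb => by
      rw [mul_comm, Nat.mul_add_mod, Nat.mod_eq_of_lt hb]
  refine wp_seq (wp_tabulate _ _ fun i _ => hlt _) ?_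
  rintro m1 - ⟨hf1, h2⟩
  refine wp_seq (wp_tabulate _ _ fun i _ => hlt _) ?_
  rintro m2 - ⟨hf2, h3⟩
  refine (wp_tabulate _ _ fun i _ => hlt _).mono ?_
  rintro m3 ⟨hf3, h6⟩
  refine ⟨⟨fun a x y => ?_, fun a x y => ?_⟩, fun u hu => ?_, fun a ha2 ha3 ha6 => ?_⟩
  · rw [hf3 2 (by decide), hf2 2 (by decide), h2, if_pos (hidx a x y), hmod _ _ (enc_lt y),
      hdiv _ _ (enc_lt y), hdiv _ _ (enc_lt x), hmod _ _ (enc_lt x), dec_enc, dec_enc, dec_enc]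
  · rw [hf3 3 (by decide), h3, if_pos (hidx a x y), hmod _ _ (enc_lt y),
      hdiv _ _ (enc_lt y), hdiv _ _ (enc_lt x), hmod _ _ (enc_lt x), dec_enc, dec_enc, dec_enc]
  · rw [h6, if_pos hu]
  · rw [hf3 a ha6, hf2 a ha3, hf1 a ha2]

theorem wp_scalarsC {K : Type} [Fintype K] {S B n r s mm : ℕ} {m : Mem} (hE : Enough K S B n r s mm) (hn : m 0 0 = n) (hr : m 0 1 = r)
    (hmm : mm = r / s + 1) :
    (scalarsC s).wp S B (fun m' => m' 20 0 = n ∧ m' 21 0 = r ∧ m' 22 0 = n * s ∧ m' 23 0 = mm ∧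
      m' 24 0 = 2 ^ n) m := by
  refine wp_seq (P := fun m' => m' = m.write 20 0 n) (wp_set ?_ ?_) ?_
  · simpa [Expr.val, hn] using hE.lt hE.n_le
  · simp [Expr.val, hn]
  rintro m1 - rfl
  refine wp_seq (P := fun m' => m' = (m.write 20 0 n).write 21 0 r) (wp_set ?_ ?_) ?_
  · simpa [Expr.val, hr, Mem.write_apply] using hE.lt hE.r_le
  · simp [Expr.val, hr, Mem.write_apply]
  rintro m2 - rfl
  refine wp_seq (P := fun m' => m' 20 0 = n ∧ m' 21 0 = r ∧ m' 22 0 = n * s) (wp_set ?_ ?_) ?_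
  · simpa [Expr.val, Mem.write_apply] using hE.lt hE.N_le
  · simp [Expr.val, Mem.write_apply]
  rintro m3 - ⟨h20, h21, h22⟩
  refine wp_seq (P := fun m' => m' 20 0 = n ∧ m' 21 0 = r ∧ m' 22 0 = n * s ∧ m' 23 0 = mm)
    (wp_set ?_ ?_) ?_
  · simpa [Expr.val, h21, ← hmm] using hE.lt hE.m_le
  · simp [Expr.val, Mem.write_apply, h20, h21, h22, hmm]
  rintro m4 - ⟨h20, h21, h22, h23⟩
  have h1S : 1 < 2 ^ S := hE.lt ((Nat.le_add_left 1 (r / s)).trans (hmm ▸ hE.m_le))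
  refine wp_seq (P := fun m' => m' 20 0 = n ∧ m' 21 0 = r ∧ m' 22 0 = n * s ∧ m' 23 0 = mm ∧
    m' 24 0 = 1) (wp_set (by simpa [Expr.val] using h1S) ?_) ?_
  · simp [Expr.val, Mem.write_apply, h20, h21, h22, h23]
  rintro m5 - ⟨h20, h21, h22, h23, h24⟩
  refine (wp_for (L := n) (fun k m' => m' 24 0 = 2 ^ (n - k)) (by simpa [Expr.val] using h20) (hE.lt hE.n_le) hE.n_le
    ?_ ?_ ?_).mono ?_
  · intro k m' x h
    rwa [Mem.write_of_ne _ _ _ (by decide)]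
  · simp [h24]
  · intro k hk m' hf hk' hI
    have hv : (Expr.mul (.var 24) (.lit 2)).val m' = 2 ^ (n - k) := by
      rw [show n - k = n - (k + 1) + 1 by omega, pow_succ]
      simp only [Expr.val, hI]
    refine wp_set ?_ ?_
    · rw [hv]
      exact Nat.pow_lt_pow_right (by decide) (by have := hE.n_lt; omega)
    · rw [hv]
      exact Mem.write_same ..
  · rintro m' ⟨hf, h⟩
    rw [hf 20 (of_decide_eq_true rfl), hf 21 (of_decide_eq_true rfl),
      hf 22 (of_decide_eq_true rfl), hf 23 (of_decide_eq_true rfl)]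
    exact ⟨h20, h21, h22, h23, by simpa using h⟩

/-- A letter stands for `s` consecutive field elements: the letter labelled `l` has its coefficients
in the entries from `l * s` to `l * s + s - 1` of array `4`. Thus a matrix with `n` columns of
letters becomes one with `n * s` columns over the field. -/
theorem wp_loadC (hE : Enough K S B n r s mm) (hb : Base K m n r s) (F : ℕ → K) {L : ℕ}
    (hL : ∀ i, m 1 i < L) :
    (loadC (fun u => enc (F u)) L s).wp S B (fun m' =>
      (∀ a, a ≠ 4 → a ≠ 7 → a ≠ 42 → m' a = m a) ∧
      HasVecs m' 7 (n * s) r (fun ρ t => F (m 1 (ρ * n + t / s) * s + t % s))) m := by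
  refine wp_seq (wp_tabulate _ _ fun i _ => hE.enc_lt _) ?_
  rintro m1 - ⟨hf1, h4⟩
  refine (wp_map (a := 7) (L := r * (n * s)) (fun u => enc (F (m 1 (u / s) * s + u % s)))
    (by decide) ?_ (hE.lt hE.rows_le) hE.rows_le ?_).mono ?_
  · simp only [Expr.val, hf1 21 (by decide), hf1 22 (by decide), hb.rows, hb.cols]
  · intro k hk m' hf hk' hm'
    have hs : 0 < s := Nat.pos_of_ne_zero fun h => by simp [h] at hk
    have hv : (Expr.get 4 (.add (.mul (.get 1 (.div (.var 42) (.lit s))) (.lit s))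
        (.sub (.var 42) (.mul (.div (.var 42) (.lit s)) (.lit s))))).val m' =
        enc (F (m 1 (k / s) * s + k % s)) := by
      simp only [Expr.val, hk', sub_div_mul_eq_mod]
      rw [hf 1 (of_decide_eq_true rfl), hf1 1 (by decide), hf 4 (of_decide_eq_true rfl), h4,
        if_pos]
      have h1 := hL (k / s)
      have h2 := Nat.mod_lt k hs
      nlinarith
    refine wp_set (by rw [hv]; exact hE.enc_lt _) ?_
    rw [hv]
    simp only [Expr.val, hk']
    exact ⟨Mem.write_same .., fun j hj => by rw [Mem.write_apply, if_neg (by tauto)]⟩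
  · rintro m' ⟨hf, h⟩
    refine ⟨fun a ha4 ha7 ha42 => ?_, fun ρ hρ t ht => ?_⟩
    · rw [hf a (by simp [Cmd.writes, ha7, ha42]), hf1 a ha4]
    · have hs : 0 < s := Nat.pos_of_ne_zero fun h => by simp [h] at ht
      have h1 : ρ * (n * s) + t < r * (n * s) := by nlinarith
      have h2 : (ρ * (n * s) + t) / s = ρ * n + t / s := by
        rw [show ρ * (n * s) + t = s * (ρ * n) + t by ring, Nat.mul_add_div hs]
      have h3 : (ρ * (n * s) + t) % s = t % s := by
        rw [show ρ * (n * s) + t = s * (ρ * n) + t by ring, Nat.mul_add_mod]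
      rw [h, if_pos h1, h2, h3]

/-- With all coordinates selected, elimination produces generators of the full solution space. A
candidate is later accepted when it fails to be orthogonal to at least one of them. -/
theorem wp_generatorsC (hE : Enough K S B n r s mm) (hb : Base K m n r s) {H : ℕ → ℕ → K}
    (hH : HasVecs m 7 (n * s) r H) :
    (generatorsC (Fintype.card K) s (enc (1 : K))).wp S B (fun m' =>
      HasVecs m' 9 (n * s) (n * s) (kerFam n s r H Set.univ)) m := by
  refine wp_seq (wp_map (a := 11) (L := n) (fun _ => 1) (by decide) (by simp [Expr.val, hb.len])
    (hE.lt hE.n_le) hE.n_le ?_) ?_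
  · intro k hk m' hf hk' hm'
    refine wp_set (by simpa [Expr.val] using hE.lt (x := 1) (by have := hE.n_le; omega)) ?_
    simp only [Expr.val, hk']
    exact ⟨Mem.write_same .., fun j hj => by rw [Mem.write_apply, if_neg (by tauto)]⟩
  · rintro m1 - ⟨hf1, h11⟩
    have hb1 : Base K m1 n r s := hb.of_eq (hf1 20 (of_decide_eq_true rfl))
      (hf1 21 (of_decide_eq_true rfl)) (hf1 22 (of_decide_eq_true rfl))
      (hf1 2 (of_decide_eq_true rfl)) (hf1 3 (of_decide_eq_true rfl))
    have hH1 : HasVecs m1 7 (n * s) r H := by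
      simp only [HasVecs, hf1 7 (of_decide_eq_true rfl)]; exact hH
    refine wp_seq (wp_elimC hE hb1 Set.univ (fun j hj => by simp [h11, hj]) hH1) ?_
    intro m2 hf2 hV
    have hb2 : Base K m2 n r s := hb1.of_eq (hf2 20 (of_decide_eq_true rfl))
      (hf2 21 (of_decide_eq_true rfl)) (hf2 22 (of_decide_eq_true rfl))
      (hf2 2 (of_decide_eq_true rfl)) (hf2 3 (of_decide_eq_true rfl))
    refine (wp_map (a := 9) (L := n * s * (n * s)) (fun u => m2 10 u) (by decide)
      (by simp [Expr.val, hb2.cols]) (hE.lt hE.sq_le) hE.sq_le ?_).mono ?_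
    · intro k hk m' hf hk' hm'
      have hpos : 0 < n * s := Nat.pos_of_ne_zero fun h => by simp [h] at hk
      have hk1 : k / (n * s) < n * s := Nat.div_lt_of_lt_mul hk
      have hk2 : k % (n * s) < n * s := Nat.mod_lt _ hpos
      have hv : (Expr.get 10 (.var 42)).val m' = m2 10 k := by
        simp only [Expr.val, hk', hf 10 (of_decide_eq_true rfl)]
      have hval := hV _ hk1 _ hk2
      rw [Nat.div_add_mod'] at hval
      refine wp_set (by rw [hv, hval]; exact hE.enc_lt _) ?_
      rw [hv]
      simp only [Expr.val, hk']
      exact ⟨Mem.write_same .., fun j hj => by rw [Mem.write_apply, if_neg (by tauto)]⟩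
    · rintro m' ⟨-, h⟩ i hi t ht
      have h3 : i * (n * s) + t < n * s * (n * s) := by nlinarith
      rw [h, if_pos h3, hV i hi t ht]
      rfl

theorem rootCount_le (n : ℕ) : rootCount n ≤ n :=
  (Finset.card_filter_le _ _).trans (Finset.card_range n).le

/-- No square root is computed: one factor `2 ^ (4 * q)` is multiplied in for each `i < n` with `i *
i < n`, which gives the exponent `rootCount n`. The two falling factorials are updated from one
weight to the next, and the count for each weight up to `mm` is stored in array `17`. -/
theorem wp_trialsC (hE : Enough K S B n r s mm) (hb : Base K m n r s) (h23 : m 23 0 = mm)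
    (hmn : mm ≤ n)
    (hS : 4 * n * (n + 1) * 2 ^ (4 * Fintype.card K * n) * (n ^ n + 1) < 2 ^ S) :
    (trialsC (Fintype.card K)).wp S B (fun m' =>
      ∀ w, 1 ≤ w → w ≤ mm → m' 17 w = numTrials (Fintype.card K) n mm w) m := by
  classical
  set q := Fintype.card K
  have h1S : 1 < 2 ^ S := hE.lt (by have := hE.q_le_B; have : 0 < q := Fintype.card_pos; omega)
  have hc : ∀ k, k ≤ n → ((Finset.Ico k n).filter fun i => i * i < n).card ≤ n := fun k _ =>
    (Finset.card_filter_le _ _).trans (by simp)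
  have hpow : ∀ j, j ≤ n → 2 ^ (4 * q * j) ≤ 2 ^ (4 * q * n) := fun j hj =>
    Nat.pow_le_pow_right two_pos (Nat.mul_le_mul_left _ hj)
  refine wp_seq (P := fun m' => m' 25 0 = 2 ^ (4 * q * rootCount n)) ?_ ?_
  · refine wp_seq (P := fun m' => m' 25 0 = 1) (wp_set (by simpa [Expr.val] using h1S)
      (by simp [Expr.val, Mem.write_apply])) ?_
    intro m1 hf1 h25
    refine (wp_for (L := n) (fun k m' => m' 25 0 =
      2 ^ (4 * q * ((Finset.Ico k n).filter fun i => i * i < n).card)) ?_ (hE.lt hE.n_le) hE.n_le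
      ?_ ?_ ?_).mono ?_
    · simp only [Expr.val, hf1 20 (of_decide_eq_true rfl), hb.len]
    · intro k m' x h
      rwa [Mem.write_of_ne _ _ _ (by decide)]
    · simp [h25]
    · intro k hk m' hf hk' hI
      have g20 : m' 20 0 = n := by
        rw [hf 20 (of_decide_eq_true rfl), hf1 20 (of_decide_eq_true rfl), hb.len]
      refine wp_ite (fun h => ?_) (fun h => ?_)
      · simp only [Expr.val, g20, hk'] at h
        have hv : (Expr.mul (.var 25) (.lit (2 ^ (4 * q)))).val m' =
            2 ^ (4 * q * ((Finset.Ico k n).filter fun i => i * i < n).card) := by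
          simp only [Expr.val, hI]
          rw [← Finset.insert_Ico_add_one_left_eq_Ico hk, Finset.filter_insert,
            if_pos (by omega), Finset.card_insert_of_notMem (by simp), mul_add, pow_add, mul_one]
        refine wp_set ?_ ?_
        · rw [hv]
          refine (hpow _ (hc k hk.le)).trans_lt (lt_of_le_of_lt ?_ hS)
          calc 2 ^ (4 * q * n) = 1 * 2 ^ (4 * q * n) * 1 := by ring
            _ ≤ 4 * n * (n + 1) * 2 ^ (4 * q * n) * (n ^ n + 1) := by
              gcongr
              · nlinarith
              · omega
        · rw [hv]
          exact Mem.write_same ..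
      · simp only [Expr.val, g20, hk'] at h
        refine wp_skip ?_
        rw [hI, ← Finset.insert_Ico_add_one_left_eq_Ico hk, Finset.filter_insert,
          if_neg (by omega)]
    · rintro m' ⟨-, h⟩
      rw [h, rootCount, Finset.range_eq_Ico]
  intro m1 hf1 h25
  refine wp_seq (P := fun m' => m' 26 0 = 1) (wp_set (by simpa [Expr.val] using h1S)
    (by simp [Expr.val, Mem.write_apply])) ?_
  intro m2 hf2 h26
  refine wp_seq (P := fun m' => m' 27 0 = 1) (wp_set (by simpa [Expr.val] using h1S)
    (by simp [Expr.val, Mem.write_apply])) ?_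
  intro m3 hf3 h27
  refine wp_seq (P := fun m' => m' 28 0 = 0) (wp_set (by simp [Expr.val])
    (by simp [Expr.val, Mem.write_apply])) ?_
  intro m4 hf4 h28
  have g : ∀ a, a ∉ [25, 44, 26, 27, 28] → m4 a = m a := fun a ha => by
    simp only [List.mem_cons, List.not_mem_nil, or_false, not_or] at ha
    rw [hf4 a (by simp [Cmd.writes, ha]), hf3 a (by simp [Cmd.writes, ha]),
      hf2 a (by simp [Cmd.writes, ha]), hf1 a (by simp [Cmd.writes, ha])]
  have g25 : m4 25 0 = 2 ^ (4 * q * rootCount n) := by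
    rw [hf4 25 (of_decide_eq_true rfl), hf3 25 (of_decide_eq_true rfl),
      hf2 25 (of_decide_eq_true rfl), h25]
  have hdf : ∀ N w, N ≤ n → w ≤ n → N.descFactorial w ≤ n ^ n := fun N w hN hw => by
    rcases Nat.eq_zero_or_pos n with h0 | h0
    · subst h0
      simp [Nat.le_zero.1 hN, Nat.le_zero.1 hw]
    · exact (Nat.descFactorial_le_pow _ _).trans
        ((Nat.pow_le_pow_left hN _).trans (Nat.pow_le_pow_right h0 hw))
  have hnS : 1 ≤ n → n ^ n < 2 ^ S := fun h0 => by
    refine lt_of_le_of_lt ?_ hS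
    calc n ^ n ≤ 1 * 1 * (n ^ n + 1) := by omega
      _ ≤ 4 * n * (n + 1) * 2 ^ (4 * q * n) * (n ^ n + 1) := by
        gcongr
        · nlinarith
        · exact Nat.one_le_two_pow
  refine (wp_for (L := mm) (fun k m' => m' 26 0 = n.descFactorial (mm - k) ∧
    m' 27 0 = mm.descFactorial (mm - k) ∧ m' 28 0 = mm - k ∧
    ∀ w, 1 ≤ w → w ≤ mm - k → m' 17 w = numTrials q n mm w) ?_ (hE.lt hE.m_le) hE.m_le
    ?_ ?_ ?_).mono ?_
  · simp only [Expr.val, g 23 (by decide), h23]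
  · intro k m' x h
    simpa [Mem.write_apply] using h
  · refine ⟨?_, ?_, ?_, fun w h1 h2 => by omega⟩
    · rw [hf4 26 (of_decide_eq_true rfl), hf3 26 (of_decide_eq_true rfl), h26]; simp
    · rw [hf4 27 (of_decide_eq_true rfl), h27]; simp
    · simp [h28]
  · rintro k hk m' hf hk' ⟨i26, i27, i28, i17⟩
    have hn0 : 1 ≤ n := by omega
    have hw : mm - k = mm - (k + 1) + 1 := by omega
    have g20 : m' 20 0 = n := by
      rw [hf 20 (of_decide_eq_true rfl), g 20 (by decide), hb.len]
    have g23 : m' 23 0 = mm := by rw [hf 23 (of_decide_eq_true rfl), g 23 (by decide), h23]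
    have g25' : m' 25 0 = 2 ^ (4 * q * rootCount n) := by
      rw [hf 25 (of_decide_eq_true rfl), g25]
    have v26 : (Expr.mul (.var 26) (.sub (.var 20) (.var 28))).val m' =
        n.descFactorial (mm - k) := by
      simp only [Expr.val, i26, i28, g20]
      rw [hw, Nat.descFactorial_succ, mul_comm]
    refine wp_seq (P := fun m2 => m2 = m'.write 26 0 (n.descFactorial (mm - k)))
      (wp_set ?_ (by rw [v26]; rfl)) ?_
    · rw [v26]
      exact (hdf n _ le_rfl (by omega)).trans_lt (hnS hn0)
    rintro m5 - rfl
    have v27 : (Expr.mul (.var 27) (.sub (.var 23) (.var 28))).val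
        (m'.write 26 0 (n.descFactorial (mm - k))) = mm.descFactorial (mm - k) := by
      simp only [Expr.val, Mem.write_of_ne _ _ _ (show 27 ≠ 26 by decide),
        Mem.write_of_ne _ _ _ (show 23 ≠ 26 by decide),
        Mem.write_of_ne _ _ _ (show 28 ≠ 26 by decide), i27, i28, g23]
      rw [hw, Nat.descFactorial_succ, mul_comm]
    refine wp_seq (P := fun m2 => m2 = (m'.write 26 0 (n.descFactorial (mm - k))).write 27 0
      (mm.descFactorial (mm - k))) (wp_set ?_ (by rw [v27]; rfl)) ?_
    · rw [v27]
      exact (hdf mm _ hmn (by omega)).trans_lt (hnS hn0)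
    rintro m6 - rfl
    refine wp_seq (P := fun m2 => m2 28 0 = mm - k ∧ m2 26 0 = n.descFactorial (mm - k) ∧
      m2 27 0 = mm.descFactorial (mm - k) ∧ m2 20 0 = n ∧
      m2 25 0 = 2 ^ (4 * q * rootCount n) ∧ m2 17 = m' 17) (wp_set ?_ ?_) ?_
    · simp only [Expr.val, Mem.write_of_ne _ _ _ (show 28 ≠ 27 by decide),
        Mem.write_of_ne _ _ _ (show 28 ≠ 26 by decide), i28]
      exact hE.lt (by have := hE.m_le; omega)
    · simp [Expr.val, Mem.write_apply, i28, g20, g25', hw, Mem.write_of_ne]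
    rintro m7 - ⟨e28, e26, e27, e20, e25, e17⟩
    have v17 : (Expr.mul (.mul (.mul (.mul (.lit 4) (.var 20)) (.add (.var 20) (.lit 1)))
            (.var 25)) (.add (.div (.var 26) (.var 27)) (.lit 1))).val m7 =
            numTrials q n mm (mm - k) := by
      simp only [Expr.val, e20, e25, e26, e27]
      rfl
    refine wp_set ?_ ?_
    · rw [v17, numTrials]
      refine lt_of_le_of_lt ?_ hS
      gcongr
      · decide
      · exact rootCount_le n
      · exact (Nat.div_le_self _ _).trans (hdf n _ le_rfl (by omega))
    · rw [v17]
      simp only [Expr.val, e28]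
      refine ⟨?_, ?_, ?_, fun w h1 h2 => ?_⟩
      · rw [Mem.write_of_ne _ _ _ (by decide), e26]
      · rw [Mem.write_of_ne _ _ _ (by decide), e27]
      · rw [Mem.write_of_ne _ _ _ (by decide), e28]
      · rw [Mem.write_apply]
        split_ifs with hc
        · rw [hc.2]
        · rw [e17, i17 w h1 (by
            have : w ≠ mm - k := fun h => hc ⟨rfl, h⟩
            omega)]
  · rintro m' ⟨-, -, -, -, h⟩
    simpa using h

/-- The memory between two trials. -/
structure Ready (S n r s mm : ℕ) (H G : ℕ → ℕ → K) (m : Mem) : Prop where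
  bdd : m.Bdd S
  base : Base K m n r s
  size : m 23 0 = mm
  pow : m 24 0 = 2 ^ n
  coef : ∀ u < 2 ^ Fintype.card K, m 6 u = enc (dec K u)
  mat : HasVecs m 7 (n * s) r H
  gens : HasVecs m 9 (n * s) (n * s) G
  coins : ∀ i, n * n + n * s * Fintype.card K ≤ i → m 12 i = 0
  trials : ∀ w, 1 ≤ w → w ≤ mm → m 17 w = numTrials (Fintype.card K) n mm w

theorem startC_wf (F₁ F₂ : ℕ → K) (L s : ℕ) : (startC K F₁ F₂ L s).wf := by
  simp [startC, tablesC, scalarsC, loadC, generatorsC, elimC, initC, syndC, dotC, reduceC, trialsC,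
    Cmd.wf, Cmd.writes, tabulate_wf]

theorem trialC_wf (q s one : ℕ) : (trialC q s one).wf := by
  simp [trialC, coordC, numC, coefC, combC, weightC, testC, updateC, elimC, initC, syndC, dotC,
    reduceC, Cmd.wf, Cmd.writes]

/-- Array `7` is used twice. It first receives the system with the coefficients `F₂`, from which the
generators for the test are computed, and afterwards the system with the coefficients `F₁` that the
trials solve. The best weight starts at `mm`, an upper bound for the distance by the Singleton
bound. -/
theorem wp_startC (hE : Enough K S B n r s mm) (hmm : mm = r / s + 1) (hmn : mm ≤ n)
    (hS : 4 * n * (n + 1) * 2 ^ (4 * Fintype.card K * n) * (n ^ n + 1) < 2 ^ S)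
    (F₁ F₂ : ℕ → K) {L : ℕ} (hbdd : m.Bdd S) (hn : m 0 0 = n) (hr : m 0 1 = r)
    (hL : ∀ i, m 1 i < L) (h12 : ∀ i, m 12 i = 0) :
    (startC K F₁ F₂ L s).wp S B (fun m' =>
      Ready S n r s mm (fun ρ t => F₁ (m 1 (ρ * n + t / s) * s + t % s))
        (kerFam n s r (fun ρ t => F₂ (m 1 (ρ * n + t / s) * s + t % s)) Set.univ) m' ∧
      m' 29 0 = mm ∧ m' 30 0 = 0) m := by
  -- The bound for the bit lengths in `Ready` is delivered by `Cmd.exec`, so only the remaining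
  -- fields have to be followed through the commands.
  suffices h : (startC K F₁ F₂ L s).wp S B (fun m' =>
      (Base K m' n r s ∧ m' 23 0 = mm ∧ m' 24 0 = 2 ^ n ∧
      (∀ u < 2 ^ Fintype.card K, m' 6 u = enc (dec K u)) ∧
      HasVecs m' 7 (n * s) r (fun ρ t => F₁ (m 1 (ρ * n + t / s) * s + t % s)) ∧
      HasVecs m' 9 (n * s) (n * s)
        (kerFam n s r (fun ρ t => F₂ (m 1 (ρ * n + t / s) * s + t % s)) Set.univ) ∧
      (∀ i, m' 12 i = 0) ∧
      ∀ w, 1 ≤ w → w ≤ mm → m' 17 w = numTrials (Fintype.card K) n mm w) ∧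
      m' 29 0 = mm ∧ m' 30 0 = 0) m by
    have hb' := (Cmd.exec S B _ (startC_wf F₁ F₂ L s) m hbdd h.1).1
    refine ⟨h.1, ?_⟩
    obtain ⟨⟨h1, h2, h3, h4, h5, h6, h7, h8⟩, h9⟩ := h.2
    exact ⟨⟨hb', h1, h2, h3, h4, h5, h6, fun i _ => h7 i, h8⟩, h9⟩
  refine wp_seq (wp_tablesC (hE.lt hE.q_le_B)) ?_
  rintro m1 - ⟨hT1, h6, hf1⟩
  refine wp_seq (wp_scalarsC hE (by rw [hf1 0 (by decide) (by decide) (by decide), hn])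
    (by rw [hf1 0 (by decide) (by decide) (by decide), hr]) hmm) ?_
  rintro m2 hf2 ⟨h20, h21, h22, h23, h24⟩
  have hb2 : Base K m2 n r s := ⟨h20, h21, h22, by
    rw [Tab, hf2 2 (of_decide_eq_true rfl), hf2 3 (of_decide_eq_true rfl)]; exact hT1⟩
  have e1 : m2 1 = m 1 := by
    rw [hf2 1 (of_decide_eq_true rfl), hf1 1 (by decide) (by decide) (by decide)]
  refine wp_seq (wp_loadC hE hb2 F₂ (by rw [e1]; exact hL)) ?_
  rintro m3 - ⟨hf3, h7⟩
  have hb3 : Base K m3 n r s := hb2.of_eq (hf3 _ (by decide) (by decide) (by decide))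
    (hf3 _ (by decide) (by decide) (by decide)) (hf3 _ (by decide) (by decide) (by decide))
    (hf3 _ (by decide) (by decide) (by decide)) (hf3 _ (by decide) (by decide) (by decide))
  refine wp_seq (wp_generatorsC hE hb3 h7) ?_
  intro m4 hf4 h9
  have hb4 : Base K m4 n r s := hb3.of_eq (hf4 20 (of_decide_eq_true rfl))
    (hf4 21 (of_decide_eq_true rfl)) (hf4 22 (of_decide_eq_true rfl)) (hf4 2 (of_decide_eq_true rfl))
    (hf4 3 (of_decide_eq_true rfl))
  have e1' : m4 1 = m 1 := by
    rw [hf4 1 (of_decide_eq_true rfl), hf3 1 (by decide) (by decide) (by decide), e1]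
  refine wp_seq (wp_loadC hE hb4 F₁ (by rw [e1']; exact hL)) ?_
  rintro m5 - ⟨hf5, h7'⟩
  have hb5 : Base K m5 n r s := hb4.of_eq (hf5 _ (by decide) (by decide) (by decide))
    (hf5 _ (by decide) (by decide) (by decide)) (hf5 _ (by decide) (by decide) (by decide))
    (hf5 _ (by decide) (by decide) (by decide)) (hf5 _ (by decide) (by decide) (by decide))
  have e23 : m5 23 0 = mm := by
    rw [hf5 _ (by decide) (by decide) (by decide), hf4 23 (of_decide_eq_true rfl),
      hf3 _ (by decide) (by decide) (by decide), h23]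
  refine wp_seq (wp_trialsC hE hb5 e23 hmn hS) ?_
  intro m6 hf6 h17
  have hb6 : Base K m6 n r s := hb5.of_eq (hf6 20 (of_decide_eq_true rfl))
    (hf6 21 (of_decide_eq_true rfl)) (hf6 22 (of_decide_eq_true rfl)) (hf6 2 (of_decide_eq_true rfl))
    (hf6 3 (of_decide_eq_true rfl))
  have e23' : m6 23 0 = mm := by rw [hf6 23 (of_decide_eq_true rfl), e23]
  have hfin : ∀ m7 : Mem, (∀ a, a ≠ 29 → a ≠ 30 → m7 a = m6 a) → Base K m7 n r s ∧ m7 23 0 = mm ∧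
      m7 24 0 = 2 ^ n ∧ (∀ u < 2 ^ Fintype.card K, m7 6 u = enc (dec K u)) ∧
      HasVecs m7 7 (n * s) r (fun ρ t => F₁ (m 1 (ρ * n + t / s) * s + t % s)) ∧
      HasVecs m7 9 (n * s) (n * s)
        (kerFam n s r (fun ρ t => F₂ (m 1 (ρ * n + t / s) * s + t % s)) Set.univ) ∧
      (∀ i, m7 12 i = 0) ∧
      ∀ w, 1 ≤ w → w ≤ mm → m7 17 w = numTrials (Fintype.card K) n mm w := by
    intro m7 hf7
    refine ⟨hb6.of_eq (hf7 _ (by decide) (by decide)) (hf7 _ (by decide) (by decide))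
      (hf7 _ (by decide) (by decide)) (hf7 _ (by decide) (by decide))
      (hf7 _ (by decide) (by decide)), ?_, ?_, ?_, ?_, ?_, ?_, ?_⟩
    · rw [hf7 _ (by decide) (by decide), e23']
    · rw [hf7 _ (by decide) (by decide), hf6 24 (of_decide_eq_true rfl),
        hf5 _ (by decide) (by decide) (by decide), hf4 24 (of_decide_eq_true rfl),
        hf3 _ (by decide) (by decide) (by decide), h24]
    · rw [hf7 _ (by decide) (by decide), hf6 6 (of_decide_eq_true rfl),
        hf5 _ (by decide) (by decide) (by decide), hf4 6 (of_decide_eq_true rfl),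
        hf3 _ (by decide) (by decide) (by decide), hf2 6 (of_decide_eq_true rfl)]
      exact h6
    · rw [e1'] at h7'
      rw [HasVecs, hf7 _ (by decide) (by decide), hf6 7 (of_decide_eq_true rfl)]
      exact h7'
    · rw [e1] at h9
      rw [HasVecs, hf7 _ (by decide) (by decide), hf6 9 (of_decide_eq_true rfl),
        hf5 _ (by decide) (by decide) (by decide)]
      exact h9
    · rw [hf7 _ (by decide) (by decide), hf6 12 (of_decide_eq_true rfl),
        hf5 _ (by decide) (by decide) (by decide), hf4 12 (of_decide_eq_true rfl),
        hf3 _ (by decide) (by decide) (by decide), hf2 12 (of_decide_eq_true rfl),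
        hf1 _ (by decide) (by decide) (by decide)]
      exact h12
    · rw [hf7 _ (by decide) (by decide)]
      exact h17
  refine wp_seq (P := fun m' => m' = m6.write 29 0 mm) (wp_set ?_ ?_) ?_
  · simp only [Expr.val, e23']
    exact hE.lt hE.m_le
  · simp only [Expr.val, e23']
  rintro m7 - rfl
  refine wp_set (by simp [Expr.val]) ⟨hfin _ fun a h1 h2 => ?_, ?_, ?_⟩
  · rw [Mem.write_of_ne _ _ _ h2, Mem.write_of_ne _ _ _ h1]
  · simp [Expr.val, Mem.write_apply]
  · simp [Expr.val, Mem.write_apply]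

end RAM

namespace RAM

open RAM.Cmd RAM.Expr

/-! ## The main loop -/

/-- The number of coins of a trial. -/
def coinsE (q : ℕ) : Expr := .add (.mul (.var 20) (.var 20)) (.mul (.var 22) (.lit q))

/-- The loop that tosses the coins of a trial. -/
def coinLoop (q : ℕ) : Prog :=
  .loop (.sub (coinsE q) (.var 45))
    (.seq (.coin 12 (.var 45)) (.set 45 (.lit 0) (.add (.var 45) (.lit 1))))

/-- Toss the coins of a trial. -/
def coinsP (q : ℕ) : Prog := .seq (.set 45 (.lit 0) (.lit 0)) (coinLoop q)

/-- Trials until their number suffices for the best weight found so far. -/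
noncomputable def mainLoop (K : Type) [Field K] [Fintype K] (s : ℕ) : Prog :=
  .loop (.sub (.get 17 (.var 29)) (.var 30))
    (.seq (.set 30 (.lit 0) (.add (.var 30) (.lit 1)))
      (.seq (coinsP (Fintype.card K)) (trialC (Fintype.card K) s (enc (1 : K))).prog))

/-- The program. -/
noncomputable def mainProg (K : Type) [Field K] [Fintype K] (F₁ F₂ : ℕ → K) (L s : ℕ) : Prog :=
  .seq (startC K F₁ F₂ L s).prog (.seq (mainLoop K s) (.set 0 (.lit 0) (.var 29)))

/-- The numbers `0` and `1` given by a list of coins. -/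
def bits (l : List Bool) (i : ℕ) : ℕ := (l.getD i false).toNat

theorem bits_le (l : List Bool) (i : ℕ) : bits l i ≤ 1 := Bool.toNat_le _

/-- Cost factor of one toss. -/
def coinCost (q : ℕ) : ℕ :=
  1 + (Expr.sub (coinsE q) (.var 45)).kap + (1 + (Expr.var 45).kap + (Expr.var 45).wt) +
    setCost (.lit 0) (.add (.var 45) (.lit 1)) + setCost (.lit 0) (.lit 0)

/-- Tossing coins is not a `Cmd`, so this loop is executed directly, by induction on the coins that
it consumes. The remaining coins `ω` are arbitrary and the cost does not depend on them. -/
theorem exec_coinLoop {S n N q : ℕ} (hC : n * n + N * q < 2 ^ S) (l : List Bool) :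
    ∀ (m : Mem), m.Bdd S → m 20 0 = n → m 22 0 = N → m 45 0 + l.length = n * n + N * q →
    ∃ m' : Mem, m'.Bdd S ∧ (∀ a, a ≠ 12 → a ≠ 45 → m' a = m a) ∧
      (∀ i, m' 12 i = if m 45 0 ≤ i ∧ i < n * n + N * q then bits l (i - m 45 0) else m 12 i) ∧
      ∃ t ≤ (l.length + 1) * coinCost q * (S + 1) ^ 2,
        ∀ ω, Exec (coinLoop q) m (l ++ ω) m' ω t := by
  induction l with
  | nil =>
    intro m hm h20 h22 hl
    simp only [List.length_nil, add_zero] at hl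
    refine ⟨m, hm, fun _ _ _ => rfl, fun i => by rw [if_neg (by omega)],
      1 + (Expr.sub (coinsE q) (.var 45)).cost m, ?_, fun ω => .loop_false ?_⟩
    · have h1 := (Expr.sub (coinsE q) (.var 45)).cost_le hm
      have hZ : 1 ≤ (S + 1) ^ 2 := Nat.one_le_pow _ _ (by omega)
      simp only [List.length_nil, zero_add, one_mul, coinCost]
      generalize (S + 1) ^ 2 = Z at *
      nlinarith [Nat.zero_le ((1 + (Expr.var 45).kap + (Expr.var 45).wt) * Z),
        Nat.zero_le (setCost (.lit 0) (.add (.var 45) (.lit 1)) * Z),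
        Nat.zero_le (setCost (.lit 0) (.lit 0) * Z)]
    · simp [coinsE, Expr.val, h20, h22, hl]
  | cons b l ih =>
    intro m hm h20 h22 hl
    simp only [List.length_cons] at hl
    have h1S : 1 < 2 ^ S := by omega
    set m1 := m.write 12 (m 45 0) b.toNat with hm1
    have hb1 : m1.Bdd S := hm.write _ _ ((Bool.toNat_le b).trans_lt h1S)
    have g45 : m1 45 = m 45 := Mem.write_of_ne _ _ _ (by decide)
    set m2 := m1.write 45 0 (m 45 0 + 1) with hm2
    have hb2 : m2.Bdd S := hb1.write _ _ (by omega)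
    have g45' : m2 45 0 = m 45 0 + 1 := Mem.write_same ..
    have g2 : ∀ a, a ≠ 12 → a ≠ 45 → m2 a = m a := fun a h1 h2 => by
      rw [hm2, Mem.write_of_ne _ _ _ h2, hm1, Mem.write_of_ne _ _ _ h1]
    obtain ⟨m', hb', hf', h12, t, ht, he⟩ := ih m2 hb2 (by rw [g2 20 (by decide) (by decide), h20])
      (by rw [g2 22 (by decide) (by decide), h22]) (by omega)
    have e1 : ∀ ω, Exec (.coin 12 (.var 45)) m (b :: ω) m1 ω
        (1 + (Expr.var 45).cost m + ((Expr.var 45).val m).size) := fun ω =>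
      Exec.coin 12 (.var 45) m b ω
    have e2 : ∀ ω, Exec (.set 45 (.lit 0) (.add (.var 45) (.lit 1))) m1 ω m2 ω
        (1 + (Expr.lit 0).cost m1 + (Expr.add (.var 45) (.lit 1)).cost m1 +
          ((Expr.lit 0).val m1).size + ((Expr.add (.var 45) (.lit 1)).val m1).size) := fun ω => by
      have := Exec.set 45 (.lit 0) (.add (.var 45) (.lit 1)) m1 ω
      simpa [Expr.val, g45] using this
    refine ⟨m', hb', fun a h1 h2 => by rw [hf' a h1 h2, g2 a h1 h2], fun i => ?_, _, ?_, fun ω =>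
      .loop_true ?_ (.seq (e1 _) (e2 _)) (he ω)⟩
    · rw [h12, g45']
      have hm2i : m2 12 i = if i = m 45 0 then b.toNat else m 12 i := by
        rw [hm2, Mem.write_of_ne _ _ _ (by decide), hm1, Mem.write_apply]
        simp
      by_cases hi : i = m 45 0
      · rw [if_neg (by omega), hm2i, if_pos hi, if_pos (by omega), hi]
        simp [bits]
      · rw [hm2i, if_neg hi]
        by_cases hc : m 45 0 + 1 ≤ i ∧ i < n * n + N * q
        · rw [if_pos hc, if_pos (by omega), bits, bits,
            show i - m 45 0 = (i - (m 45 0 + 1)) + 1 by omega]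
          simp
        · rw [if_neg hc, if_neg (by omega)]
    · have h1 := (Expr.sub (coinsE q) (.var 45)).cost_le hm
      have h2 := (Expr.var 45).cost_le hm
      have h3 := (Expr.var 45).size_val_le hm
      have h4 := setCost_le hb1 (.lit 0) (.add (.var 45) (.lit 1))
      have hZ : S + 1 ≤ (S + 1) ^ 2 := Nat.le_self_pow (by decide) _
      have h5 : (Expr.var 45).wt * (S + 1) ≤ (Expr.var 45).wt * (S + 1) ^ 2 :=
        Nat.mul_le_mul_left _ hZ
      have hZ1 : 1 ≤ (S + 1) ^ 2 := by omega
      rw [List.length_cons, show (l.length + 1 + 1) * coinCost q * (S + 1) ^ 2 =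
        (l.length + 1) * coinCost q * (S + 1) ^ 2 + coinCost q * (S + 1) ^ 2 by ring]
      have h6 : coinCost q * (S + 1) ^ 2 = (S + 1) ^ 2 +
          (Expr.sub (coinsE q) (.var 45)).kap * (S + 1) ^ 2 + ((S + 1) ^ 2 +
          (Expr.var 45).kap * (S + 1) ^ 2 + (Expr.var 45).wt * (S + 1) ^ 2) +
          setCost (.lit 0) (.add (.var 45) (.lit 1)) * (S + 1) ^ 2 +
          setCost (.lit 0) (.lit 0) * (S + 1) ^ 2 := by
        simp only [coinCost]; ring
      have h7 : 0 ≤ setCost (.lit 0) (.lit 0) * (S + 1) ^ 2 := Nat.zero_le _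
      omega
    · simp only [coinsE, Expr.val, h20, h22]
      omega

theorem exec_coinsP {S n N q : ℕ} (hC : n * n + N * q < 2 ^ S) {l : List Bool} {m : Mem}
    (hm : m.Bdd S) (h20 : m 20 0 = n) (h22 : m 22 0 = N) (hl : l.length = n * n + N * q)
    (h12 : ∀ i, n * n + N * q ≤ i → m 12 i = 0) :
    ∃ m' : Mem, m'.Bdd S ∧ (∀ a, a ≠ 12 → a ≠ 45 → m' a = m a) ∧ m' 12 = bits l ∧
      ∃ t ≤ (l.length + 2) * coinCost q * (S + 1) ^ 2,
        ∀ ω, Exec (coinsP q) m (l ++ ω) m' ω t := by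
  have h2S : 0 < 2 ^ S := by positivity
  obtain ⟨m', hb, hf, hbit, t, ht, he⟩ := exec_coinLoop hC l (m.write 45 0 0) (hm.write _ _ h2S)
    (by rw [Mem.write_of_ne _ _ _ (by decide), h20])
    (by rw [Mem.write_of_ne _ _ _ (by decide), h22]) (by rw [Mem.write_same, hl, zero_add])
  refine ⟨m', hb, fun a h1 h2 => by rw [hf a h1 h2, Mem.write_of_ne _ _ _ h2], ?_, _, ?_,
    fun ω => .seq (.set 45 (.lit 0) (.lit 0) m _) (he ω)⟩
  · funext i
    rw [hbit, Mem.write_same, Mem.write_of_ne _ _ _ (by decide)]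
    split_ifs with h
    · rw [Nat.sub_zero]
    · rw [h12 i (by omega), bits, List.getD_eq_default _ _ (by omega)]
      rfl
  · have h1 := setCost_le hm (.lit 0) (.lit 0)
    have h2 : setCost (.lit 0) (.lit 0) * (S + 1) ^ 2 ≤ coinCost q * (S + 1) ^ 2 :=
      Nat.mul_le_mul_right _ (by unfold coinCost; omega)
    rw [show (l.length + 2) * coinCost q * (S + 1) ^ 2 =
      (l.length + 1) * coinCost q * (S + 1) ^ 2 + coinCost q * (S + 1) ^ 2 by ring]
    omega

variable {K : Type} [Field K] [Fintype K] {S B n r s mm : ℕ} {m : Mem}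

/-- Cost factor of one pass of the main loop. -/
noncomputable def passCost (K : Type) [Field K] [Fintype K] (B s : ℕ) : ℕ :=
  1 + (Expr.sub (.get 17 (.var 29)) (.var 30)).kap + setCost (.lit 0) (.add (.var 30) (.lit 1)) +
    (B + 2) * coinCost (Fintype.card K) + (trialC (Fintype.card K) s (enc (1 : K))).cst B

theorem trialBest_le (H G : ℕ → ℕ → K) (ρ : ℕ → ℕ) (b : ℕ) : trialBest n s r mm H G ρ b ≤ b := by
  rw [trialBest]
  split_ifs with h
  exacts [h.2.le, le_rfl]

theorem exec_pass (hE : Enough K S B n r s mm) (hC : n * n + n * s * Fintype.card K ≤ B)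
    {H G : ℕ → ℕ → K} (hR : Ready S n r s mm H G m) (h30 : m 30 0 + 1 < 2 ^ S) {l : List Bool}
    (hl : l.length = n * n + n * s * Fintype.card K) :
    ∃ m' : Mem, Ready S n r s mm H G m' ∧ m' 30 0 = m 30 0 + 1 ∧
      m' 29 0 = trialBest n s r mm H G (bits l) (m 29 0) ∧
      ∃ t, 1 + (Expr.sub (.get 17 (.var 29)) (.var 30)).cost m + t ≤ passCost K B s * (S + 1) ^ 2 ∧
      ∀ ω, Exec (.seq (.set 30 (.lit 0) (.add (.var 30) (.lit 1)))
        (.seq (coinsP (Fintype.card K)) (trialC (Fintype.card K) s (enc (1 : K))).prog))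
        m (l ++ ω) m' ω t := by
  set m1 := m.write 30 0 (m 30 0 + 1) with hm1
  have hb1 : m1.Bdd S := hR.bdd.write _ _ h30
  have g1 : ∀ a, a ≠ 30 → m1 a = m a := fun a h => Mem.write_of_ne _ _ _ h
  obtain ⟨m2, hb2, hf2, h12, t2, ht2, he2⟩ := exec_coinsP (q := Fintype.card K) (N := n * s)
    (hE.lt hC) hb1 (by rw [g1 _ (by decide), hR.base.len]) (by rw [g1 _ (by decide), hR.base.cols])
    hl (by rw [g1 _ (by decide)]; exact hR.coins)
  have g2 : ∀ a, a ≠ 12 → a ≠ 45 → a ≠ 30 → m2 a = m a := fun a h1 h2 h3 => by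
    rw [hf2 a h1 h2, g1 a h3]
  have hbase2 : Base K m2 n r s := hR.base.of_eq (g2 _ (by decide) (by decide) (by decide))
    (g2 _ (by decide) (by decide) (by decide)) (g2 _ (by decide) (by decide) (by decide))
    (g2 _ (by decide) (by decide) (by decide)) (g2 _ (by decide) (by decide) (by decide))
  have hwp := wp_trialC hE hbase2 (by rw [g2 _ (by decide) (by decide) (by decide), hR.size])
    (by rw [g2 _ (by decide) (by decide) (by decide), hR.pow])
    (by rw [g2 _ (by decide) (by decide) (by decide)]; exact hR.coef) (H := H) (G := G)
    (by rw [HasVecs, g2 _ (by decide) (by decide) (by decide)]; exact hR.mat)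
    (by rw [HasVecs, g2 _ (by decide) (by decide) (by decide)]; exact hR.gens)
    (fun i _ => by rw [h12]; exact bits_le l i)
  obtain ⟨hb3, t3, ht3, he3⟩ := Cmd.exec S B _ (trialC_wf _ _ _) m2 hb2 hwp.1
  have h29 := hwp.2
  have g3 : ∀ a, a ∉ (trialC (Fintype.card K) s (enc (1 : K))).writes →
      (trialC (Fintype.card K) s (enc (1 : K))).run m2 a = m2 a := fun a ha =>
    Cmd.run_of_notMem_writes _ ha m2
  generalize (trialC (Fintype.card K) s (enc (1 : K))).run m2 = m3 at hb3 he3 h29 g3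
  have gg : ∀ a, a ∉ (trialC (Fintype.card K) s (enc (1 : K))).writes → a ≠ 12 → a ≠ 45 → a ≠ 30 →
      m3 a = m a := fun a h0 h1 h2 h3 => by rw [g3 a h0, g2 a h1 h2 h3]
  refine ⟨m3, ⟨hb3, ?_, ?_, ?_, ?_, ?_, ?_, ?_, ?_⟩, ?_, ?_, _, ?_, fun ω =>
    .seq (.set 30 (.lit 0) (.add (.var 30) (.lit 1)) m _) (.seq (he2 ω) (he3 ω))⟩
  · exact hbase2.of_eq (g3 20 (of_decide_eq_true rfl)) (g3 21 (of_decide_eq_true rfl))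
      (g3 22 (of_decide_eq_true rfl)) (g3 2 (of_decide_eq_true rfl)) (g3 3 (of_decide_eq_true rfl))
  · rw [gg 23 (of_decide_eq_true rfl) (by decide) (by decide) (by decide), hR.size]
  · rw [gg 24 (of_decide_eq_true rfl) (by decide) (by decide) (by decide), hR.pow]
  · rw [gg 6 (of_decide_eq_true rfl) (by decide) (by decide) (by decide)]; exact hR.coef
  · rw [HasVecs, gg 7 (of_decide_eq_true rfl) (by decide) (by decide) (by decide)]; exact hR.mat
  · rw [HasVecs, gg 9 (of_decide_eq_true rfl) (by decide) (by decide) (by decide)]; exact hR.gens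
  · intro i hi
    rw [g3 12 (of_decide_eq_true rfl), h12, bits, List.getD_eq_default _ _ (by omega)]
    rfl
  · rw [gg 17 (of_decide_eq_true rfl) (by decide) (by decide) (by decide)]; exact hR.trials
  · rw [g3 30 (of_decide_eq_true rfl), hf2 30 (by decide) (by decide), hm1, Mem.write_same]
  · rw [h29, h12, g2 29 (by decide) (by decide) (by decide)]
  · have h1 := (Expr.sub (.get 17 (.var 29)) (.var 30)).cost_le hR.bdd
    have h2 := setCost_le hR.bdd (.lit 0) (.add (.var 30) (.lit 1))
    have hZ : 1 ≤ (S + 1) ^ 2 := Nat.one_le_pow _ _ (by omega)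
    have h3 : (l.length + 2) * coinCost (Fintype.card K) * (S + 1) ^ 2 ≤
        (B + 2) * coinCost (Fintype.card K) * (S + 1) ^ 2 := by
      gcongr
      rw [hl]; exact hC
    have h4 : passCost K B s * (S + 1) ^ 2 = (S + 1) ^ 2 +
        (Expr.sub (.get 17 (.var 29)) (.var 30)).kap * (S + 1) ^ 2 +
        setCost (.lit 0) (.add (.var 30) (.lit 1)) * (S + 1) ^ 2 +
        (B + 2) * coinCost (Fintype.card K) * (S + 1) ^ 2 +
        (trialC (Fintype.card K) s (enc (1 : K))).cst B * (S + 1) ^ 2 := by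
      simp only [passCost]; ring
    omega

/-- If one of the first `numTrials d` blocks of coins is a hit, the loop makes exactly that many
passes. While the best weight `w` exceeds `d`, the loop goes on because `numTrials w` is at least
`numTrials d`; a hit sets the best weight to `d`, and soundness keeps it there until the count is
exhausted. So the number of coins used is known in advance, although the program does not know `d`.
-/
theorem exec_mainLoop (hE : Enough K S B n r s mm) (hC : n * n + n * s * Fintype.card K ≤ B)
    {H G : ℕ → ℕ → K} {d : ℕ} (hd : 1 ≤ d)
    (hmono : ∀ w, d ≤ w → w ≤ mm →
      numTrials (Fintype.card K) n mm d ≤ numTrials (Fintype.card K) n mm w)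
    (hT : numTrials (Fintype.card K) n mm d < 2 ^ S)
    (hsound : ∀ ρ b, d ≤ b → d ≤ trialBest n s r mm H G ρ b) (Ls : List (List Bool)) :
    (∀ l ∈ Ls, l.length = n * n + n * s * Fintype.card K) →
    ∀ m : Mem, Ready S n r s mm H G m → d ≤ m 29 0 → m 29 0 ≤ mm →
    m 30 0 + Ls.length = numTrials (Fintype.card K) n mm d →
    (m 29 0 = d ∨ ∃ l ∈ Ls, ∀ b, d ≤ b → trialBest n s r mm H G (bits l) b = d) →
    ∃ m' : Mem, m'.Bdd S ∧ m' 29 0 = d ∧ ∃ t ≤ (Ls.length + 1) * passCost K B s * (S + 1) ^ 2,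
      ∀ ω, Exec (mainLoop K s) m (Ls.flatten ++ ω) m' ω t := by
  induction Ls with
  | nil =>
    intro _ m hR hd1 hd2 hcnt hhit
    have h29 : m 29 0 = d := by simpa using hhit
    refine ⟨m, hR.bdd, h29, 1 + (Expr.sub (.get 17 (.var 29)) (.var 30)).cost m, ?_, fun ω =>
      .loop_false ?_⟩
    · have h1 := (Expr.sub (.get 17 (.var 29)) (.var 30)).cost_le hR.bdd
      have hZ : 1 ≤ (S + 1) ^ 2 := Nat.one_le_pow _ _ (by omega)
      have h2 : (1 + (Expr.sub (.get 17 (.var 29)) (.var 30)).kap) * (S + 1) ^ 2 ≤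
          passCost K B s * (S + 1) ^ 2 := Nat.mul_le_mul_right _ (by unfold passCost; omega)
      simp only [List.length_nil, zero_add, one_mul]
      rw [add_mul] at h2
      omega
    · simp only [Expr.val, h29, hR.trials d hd (h29 ▸ hd2)]
      simp only [List.length_nil] at hcnt
      omega
  | cons l Ls ih =>
    intro hlen m hR hd1 hd2 hcnt hhit
    simp only [List.length_cons] at hcnt
    have hl := hlen l (List.mem_cons_self ..)
    obtain ⟨m1, hR1, h30, h29, t, ht, he⟩ := exec_pass hE hC hR (by omega) hl
    obtain ⟨m', hb', h29', t', ht', he'⟩ := ih (fun l' h => hlen l' (List.mem_cons_of_mem _ h)) m1 hR1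
      (by rw [h29]; exact hsound _ _ hd1) (by rw [h29]; exact (trialBest_le _ _ _ _).trans hd2)
      (by omega) (by
        rcases hhit with h | ⟨l', hl', h⟩
        · left
          have h1 := hsound (bits l) (m 29 0) hd1
          have h2 := trialBest_le (n := n) (s := s) (r := r) (mm := mm) H G (bits l) (m 29 0)
          omega
        · rcases List.mem_cons.1 hl' with rfl | hl''
          · left
            rw [h29, h _ hd1]
          · exact .inr ⟨l', hl'', h⟩)
    have hx : (Expr.sub (.get 17 (.var 29)) (.var 30)).val m ≠ 0 := by
      simp only [Expr.val, hR.trials _ (hd.trans hd1) hd2]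
      have := hmono _ hd1 hd2
      omega
    have he1 : ∀ ω, Exec (.seq (.set 30 (.lit 0) (.add (.var 30) (.lit 1)))
        (.seq (coinsP (Fintype.card K)) (trialC (Fintype.card K) s (enc (1 : K))).prog))
        m ((l :: Ls).flatten ++ ω) m1 (Ls.flatten ++ ω) t := fun ω => by
      rw [List.flatten_cons, List.append_assoc]
      exact he _
    refine ⟨m', hb', h29', _, ?_, fun ω => .loop_true hx (he1 ω) (he' ω)⟩
    · rw [List.length_cons, show (Ls.length + 1 + 1) * passCost K B s * (S + 1) ^ 2 =
        (Ls.length + 1) * passCost K B s * (S + 1) ^ 2 + passCost K B s * (S + 1) ^ 2 by ring]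
      omega

/-- Cost factor of the program when `T` trials are made. -/
noncomputable def totalCost (K : Type) [Field K] [Fintype K] (F₁ F₂ : ℕ → K) (L s B T : ℕ) : ℕ :=
  (startC K F₁ F₂ L s).cst B + (T + 1) * passCost K B s + setCost (.lit 0) (.var 29)

theorem exec_mainProg (hE : Enough K S B n r s mm) (hC : n * n + n * s * Fintype.card K ≤ B)
    (hmm : mm = r / s + 1) (hmn : mm ≤ n)
    (hS : 4 * n * (n + 1) * 2 ^ (4 * Fintype.card K * n) * (n ^ n + 1) < 2 ^ S)
    (F₁ F₂ : ℕ → K) {L d : ℕ} (hbdd : m.Bdd S) (hn : m 0 0 = n) (hr : m 0 1 = r)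
    (hL : ∀ i, m 1 i < L) (h12 : ∀ i, m 12 i = 0) {H G : ℕ → ℕ → K}
    (hH : H = fun ρ t => F₁ (m 1 (ρ * n + t / s) * s + t % s))
    (hG : G = kerFam n s r (fun ρ t => F₂ (m 1 (ρ * n + t / s) * s + t % s)) Set.univ)
    (hd : 1 ≤ d) (hdm : d ≤ mm)
    (hmono : ∀ w, d ≤ w → w ≤ mm →
      numTrials (Fintype.card K) n mm d ≤ numTrials (Fintype.card K) n mm w)
    (hT : numTrials (Fintype.card K) n mm d < 2 ^ S)
    (hsound : ∀ ρ b, d ≤ b → d ≤ trialBest n s r mm H G ρ b) (Ls : List (List Bool))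
    (hLs : ∀ l ∈ Ls, l.length = n * n + n * s * Fintype.card K)
    (hlen : Ls.length = numTrials (Fintype.card K) n mm d)
    (hhit : ∃ l ∈ Ls, ∀ b, d ≤ b → trialBest n s r mm H G (bits l) b = d) (ω : List Bool) :
    ∃ m' t, Exec (mainProg K F₁ F₂ L s) m (Ls.flatten ++ ω) m' ω t ∧ m' 0 0 = d ∧
      t ≤ totalCost K F₁ F₂ L s B (numTrials (Fintype.card K) n mm d) * (S + 1) ^ 2 := by
  have hwp := wp_startC hE hmm hmn hS F₁ F₂ hbdd hn hr hL h12
  obtain ⟨-, t1, ht1, he1⟩ := Cmd.exec S B _ (startC_wf F₁ F₂ L s) m hbdd hwp.1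
  obtain ⟨hR, h29, h30⟩ := hwp.2
  rw [← hH, ← hG] at hR
  obtain ⟨m', hb', h29', t2, ht2, he2⟩ := exec_mainLoop hE hC hd hmono hT hsound Ls hLs _ hR
    (by rw [h29]; exact hdm) (by rw [h29]) (by rw [h30, hlen, zero_add]) (.inr hhit)
  refine ⟨_, _, .seq (he1 _) (.seq (he2 ω) (.set 0 (.lit 0) (.var 29) m' ω)), ?_, ?_⟩
  · simp [Expr.val, Mem.write_apply, h29']
  · have h3 := setCost_le hb' (.lit 0) (.var 29)
    rw [hlen] at ht2
    rw [totalCost, add_mul, add_mul]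
    omega

end RAM

/-! ## The largest term of a binomial sum -/

theorem choose_mul_pow_step {n m : ℕ} (j : ℕ) (hj : j < n) :
    (n.choose (j + 1) * m ^ (j + 1) * (n - m) ^ (n - (j + 1))) * ((j + 1) * (n - m)) =
    (n.choose j * m ^ j * (n - m) ^ (n - j)) * ((n - j) * m) := by
  have h1 := Nat.choose_succ_right_eq n j
  obtain ⟨e, he⟩ : ∃ e, n - j = e + 1 := ⟨n - j - 1, by omega⟩
  have h2 : n - (j + 1) = e := by omega
  rw [h2, he, pow_succ, pow_succ]
  rw [he] at h1
  calc _ = (n.choose (j + 1) * (j + 1)) * (m ^ j * m * (n - m) ^ e * (n - m)) := by ring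
    _ = (n.choose j * (e + 1)) * (m ^ j * m * (n - m) ^ e * (n - m)) := by rw [h1]
    _ = _ := by ring

/-- When `m < n`, consecutive terms have the ratio `(n - j) * m / ((j + 1) * (n - m))`, which is at
least one for `j < m` and at most one for `j ≥ m`. So the binomial distribution with parameter `m /
n` has its mode at `m`. -/
theorem choose_mul_pow_le {n m : ℕ} (hm : m ≤ n) (j : ℕ) (hj : j ≤ n) :
    n.choose j * m ^ j * (n - m) ^ (n - j) ≤ n.choose m * m ^ m * (n - m) ^ (n - m) := by
  rcases hm.eq_or_lt with rfl | hlt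
  · rcases hj.eq_or_lt with rfl | hj'
    · rfl
    · simp [Nat.sub_ne_zero_of_lt hj']
  set a : ℕ → ℕ := fun j => n.choose j * m ^ j * (n - m) ^ (n - j) with ha
  have hstep : ∀ j < n, a (j + 1) * ((j + 1) * (n - m)) = a j * ((n - j) * m) := fun j hj =>
    choose_mul_pow_step j hj
  have hpos : 0 < n - m := by omega
  have hup : ∀ j, j < m → a j ≤ a (j + 1) := fun j hj => by
    have h := hstep j (by omega)
    refine Nat.le_of_mul_le_mul_right (c := (j + 1) * (n - m)) ?_ (by positivity)
    rw [h]
    refine Nat.mul_le_mul_left _ ?_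
    zify [show m ≤ n by omega, show j ≤ n by omega]
    have : (j : ℤ) + 1 ≤ m := by exact_mod_cast hj
    have : (m : ℤ) ≤ n := by exact_mod_cast hm
    nlinarith
  have hdown : ∀ j, m ≤ j → j < n → a (j + 1) ≤ a j := fun j hj hjn => by
    have h := hstep j hjn
    refine Nat.le_of_mul_le_mul_right (c := (j + 1) * (n - m)) ?_ (by positivity)
    rw [h]
    refine Nat.mul_le_mul_left _ ?_
    zify [show m ≤ n by omega, show j ≤ n by omega]
    have : (m : ℤ) ≤ j := by exact_mod_cast hj
    have : (m : ℤ) ≤ n := by exact_mod_cast hm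
    nlinarith
  change a j ≤ a m
  rcases le_total j m with h | h
  · induction h using Nat.decreasingInduction with
    | self => rfl
    | of_succ k hk ih => exact (hup k hk).trans (ih (by omega))
  · induction j, h using Nat.le_induction with
    | base => rfl
    | succ k hk ih => exact (hdown k hk (by omega)).trans (ih (by omega))

/-- By the binomial theorem for `m + (n - m)`, the left side is a sum of `n + 1` terms, and none
exceeds the one at `m`. In terms of probability: a random set of expected size `m` has size exactly
`m` with probability at least `1 / (n + 1)`. -/
theorem pow_le_choose_mul {n m : ℕ} (hm : m ≤ n) :
    n ^ n ≤ (n + 1) * (n.choose m * m ^ m * (n - m) ^ (n - m)) := by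
  have h := add_pow m (n - m) n
  rw [Nat.add_sub_cancel' hm] at h
  rw [h]
  calc _ ≤ ∑ _j ∈ Finset.range (n + 1), n.choose m * m ^ m * (n - m) ^ (n - m) := by
        refine Finset.sum_le_sum fun j hj => ?_
        refine le_trans (le_of_eq ?_) (choose_mul_pow_le hm j (Finset.mem_range_succ_iff.1 hj))
        simp only [Nat.cast_id]
        ring
    _ = _ := by simp

theorem choose_mul_pow_le_pow {n m : ℕ} (hm : m ≤ n) :
    n.choose m * m ^ m * (n - m) ^ (n - m) ≤ n ^ n := by
  have h := add_pow m (n - m) n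
  rw [Nat.add_sub_cancel' hm] at h
  rw [h]
  refine le_trans (le_of_eq ?_) (Finset.single_le_sum (f := fun j => m ^ j * (n - m) ^ (n - j) *
    n.choose j) (fun _ _ => Nat.zero_le _) (Finset.mem_range_succ_iff.2 hm))
  ring

/-- Rounding `m / n` to a binary fraction hardly changes the largest term. -/
theorem threshold_bound {n m : ℕ} (hm : m ≤ n) (hn : 2 * n * n ≤ 2 ^ n) (hn0 : 0 < n) :
    (2 ^ n : ℝ) ^ n ≤ 2 * (n + 1) * n.choose m *
      (((Finset.range (2 ^ n)).filter fun u => u * n < m * 2 ^ n).card : ℝ) ^ m *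
      (((Finset.range (2 ^ n)).filter fun u => ¬ u * n < m * 2 ^ n).card : ℝ) ^ (n - m) := by
  set X := 2 ^ n with hX
  have hXpos : 0 < X := by positivity
  set θ := ((Finset.range X).filter fun u => u * n < m * X).card with hθ
  set η := ((Finset.range X).filter fun u => ¬ u * n < m * X).card with hη
  have hsum : θ + η = X := by
    rw [hθ, hη, Finset.card_filter_add_card_filter_not, Finset.card_range]
  -- The number of admissible values `u` is `m * X / n`, rounded up.
  have hθeq : θ = (m * X + (n - 1)) / n := by
    have : (Finset.range X).filter (fun u => u * n < m * X) =
        Finset.range ((m * X + (n - 1)) / n) := by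
      ext u
      simp only [Finset.mem_filter, Finset.mem_range]
      rw [Nat.lt_iff_add_one_le (m := u) (n := (m * X + (n - 1)) / n), Nat.le_div_iff_mul_le hn0]
      constructor
      · rintro ⟨-, h⟩
        rw [add_mul]; omega
      · intro h
        rw [add_mul] at h
        have h1 : u * n < m * X := by omega
        refine ⟨?_, h1⟩
        have h2 : m * X ≤ X * n := by nlinarith
        exact Nat.lt_of_mul_lt_mul_right (h1.trans_le h2)
    rw [hθ, this, Finset.card_range]
  have hθ1 : m * X ≤ θ * n := by
    have := Nat.div_add_mod (m * X + (n - 1)) n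
    have h2 := Nat.mod_lt (m * X + (n - 1)) hn0
    rw [← hθeq, mul_comm] at this
    omega
  have hθ2 : θ * n < m * X + n := by
    have := Nat.div_mul_le_self (m * X + (n - 1)) n
    rw [← hθeq] at this
    omega
  have hnR : (0 : ℝ) < n := by exact_mod_cast hn0
  have hXR : (0 : ℝ) < X := by exact_mod_cast hXpos
  have hmain : (n : ℝ) ^ n ≤ (n + 1) * (n.choose m * (m : ℝ) ^ m * (n - m : ℝ) ^ (n - m)) := by
    have := pow_le_choose_mul hm
    rify [hm] at this
    exact this
  have h1 : (m : ℝ) * X / n ≤ θ := by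
    rw [div_le_iff₀ hnR]; exact_mod_cast hθ1
  have h2 : ((n - m : ℝ) * X / n) ^ (n - m) ≤ 2 * (η : ℝ) ^ (n - m) := by
    rcases hm.eq_or_lt with rfl | hlt
    · simp
    have hnm : (1 : ℝ) ≤ n - m := by
      have : (m : ℝ) + 1 ≤ n := by exact_mod_cast hlt
      linarith
    -- Rounding removes less than one value from the complement, and one is at most the part `n / X`
    -- of `(n - m) * X / n`, because `n - m ≥ 1`.
    have hη1 : ((n - m : ℝ) * X / n) * (1 - n / X) ≤ η := by
      have e1 : (η : ℝ) = X - θ := by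
        rw [eq_sub_iff_add_eq, add_comm]; exact_mod_cast hsum
      have e2 : (θ : ℝ) * n < m * X + n := by exact_mod_cast hθ2
      rw [e1]
      have e3 : ((n - m : ℝ) * X / n) * (1 - n / X) = ((n - m) * X - (n - m) * n) / n := by
        field_simp
      rw [e3, div_le_iff₀ hnR]
      nlinarith
    -- Bernoulli's inequality; `2 * n * n ≤ 2 ^ n` bounds the total loss over the `n - m` unselected
    -- coordinates by one half.
    have hb : (1 : ℝ) / 2 ≤ (1 - n / X) ^ (n - m) := by
      have hnX : (n : ℝ) / X ≤ 1 := by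
        rw [div_le_one hXR]
        have : n ≤ X := by nlinarith
        exact_mod_cast this
      have hbern := one_add_mul_le_pow (a := -((n : ℝ) / X)) (by linarith) (n - m)
      have h3 : (((n - m : ℕ) : ℝ)) * (n / X) ≤ 1 / 2 := by
        rw [← mul_div_assoc, div_le_iff₀ hXR]
        have : (((n - m : ℕ) : ℝ)) ≤ n := by exact_mod_cast Nat.sub_le _ _
        have h4 : (2 * n * n : ℝ) ≤ X := by exact_mod_cast hn
        nlinarith
      calc (1 : ℝ) / 2 ≤ 1 + ((n - m : ℕ) : ℝ) * (-(n / X)) := by linarith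
        _ ≤ _ := by rw [← sub_eq_add_neg] at hbern; exact hbern
    have hnn : 0 ≤ (n - m : ℝ) * X / n := by positivity
    have hnn2 : (0 : ℝ) ≤ 1 - n / X := by
      rw [sub_nonneg, div_le_one hXR]
      have : n ≤ X := by nlinarith
      exact_mod_cast this
    calc ((n - m : ℝ) * X / n) ^ (n - m)
        = 2 * (((n - m : ℝ) * X / n) ^ (n - m) * (1 / 2)) := by ring
      _ ≤ 2 * (((n - m : ℝ) * X / n) ^ (n - m) * (1 - n / X) ^ (n - m)) := by gcongr
      _ = 2 * (((n - m : ℝ) * X / n) * (1 - n / X)) ^ (n - m) := by rw [mul_pow]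
      _ ≤ _ := by gcongr
  have hXn : ((2 : ℝ) ^ n) = X := by rw [hX]; norm_cast
  rw [hXn]
  have hsplit : (X : ℝ) ^ n = (X / n) ^ m * (X / n) ^ (n - m) * n ^ n := by
    rw [← pow_add, Nat.add_sub_cancel' hm, div_pow]
    field_simp
  have hnm0 : (0 : ℝ) ≤ n - m := by
    have : (m : ℝ) ≤ n := by exact_mod_cast hm
    linarith
  calc (X : ℝ) ^ n = (X / n) ^ m * (X / n) ^ (n - m) * n ^ n := hsplit
    _ ≤ (X / n) ^ m * (X / n) ^ (n - m) *
        ((n + 1) * (n.choose m * (m : ℝ) ^ m * (n - m : ℝ) ^ (n - m))) := by gcongr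
    _ = (n + 1) * n.choose m * (m * X / n) ^ m * ((n - m : ℝ) * X / n) ^ (n - m) := by
        rw [mul_div_assoc, mul_div_assoc, mul_pow, mul_pow]; ring
    _ ≤ (n + 1) * n.choose m * (θ : ℝ) ^ m * (2 * (η : ℝ) ^ (n - m)) := by gcongr
    _ = _ := by ring

namespace RAM

/-! ## Soundness and completeness of a trial -/

/-- The vectors in the kernel of the rows `H ρ`, `ρ < r`, supported on the blocks in `J`. -/
noncomputable def kerSpace {K : Type} [Field K] (n s r : ℕ) (H : ℕ → ℕ → K) (J : Set ℕ) :
    Submodule K (ℕ → K) :=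
  (⨅ i ∈ {i | i < n * s ∧ i / s ∈ J}ᶜ, LinearMap.ker (LinearMap.proj i : (ℕ → K) →ₗ[K] K)) ⊓
    ⨅ i ∈ Set.Ico 0 r, LinearMap.ker (dotFun (n * s) (H i))

section

variable {K : Type} [Field K] {n s r : ℕ}

theorem mem_kerSpace {H : ℕ → ℕ → K} {J : Set ℕ} {x : ℕ → K} :
    x ∈ kerSpace n s r H J ↔ (∀ i, x i ≠ 0 → i < n * s ∧ i / s ∈ J) ∧
      ∀ ρ < r, dotFun (n * s) (H ρ) x = 0 := by
  simp only [kerSpace, Submodule.mem_inf, Submodule.mem_iInf, LinearMap.mem_ker,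
    LinearMap.proj_apply, Set.mem_Ico, Nat.zero_le, true_and]
  refine and_congr_left fun _ => forall_congr' fun i => ?_
  exact not_imp_comm

theorem isBasisFamily_kerFam (H : ℕ → ℕ → K) (J : Set ℕ) :
    IsBasisFamily (n * s) (kerFam n s r H J) (kerSpace n s r H J) := by
  have := (isBasisFamily_unitFam (K := K) (n * s) {i | i < n * s ∧ i / s ∈ J}
    fun i hi => hi.1).elimFam (r := r) (fun ρ => dotFun (n * s) (H ρ)) r le_rfl
  rw [Nat.sub_self] at this
  exact this

theorem kerFam_congr (H : ℕ → ℕ → K) {J J' : Set ℕ} (h : ∀ j < n, j ∈ J ↔ j ∈ J') :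
    kerFam n s r H J = kerFam n s r H J' := by
  have : {i | i < n * s ∧ i / s ∈ J} = {i | i < n * s ∧ i / s ∈ J'} := by
    ext i
    simp only [Set.mem_ofPred_eq]
    exact and_congr_right fun hi => h _ (Nat.div_lt_of_lt_mul (by rwa [mul_comm s n]))
  simp only [kerFam, this]

variable [Fintype K] {mm : ℕ}

theorem trialVec_mem (H : ℕ → ℕ → K) (ρ : ℕ → ℕ) :
    trialVec n s r mm H ρ ∈ kerSpace n s r H (trialSet n mm ρ) :=
  (isBasisFamily_kerFam H _).sum_mem _

/-- Every candidate solves the system, so a recorded weight is the weight of an admissible word. The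
error is one-sided: the program can miss the minimum but cannot go below it. -/
theorem le_trialBest {H G : ℕ → ℕ → K} {d : ℕ}
    (hmin : ∀ x ∈ kerSpace n s r H Set.univ, (∃ i < n * s, dotFun (n * s) (G i) x ≠ 0) →
      d ≤ blockWeight n s x) (ρ : ℕ → ℕ) (b : ℕ) (hb : d ≤ b) :
    d ≤ trialBest n s r mm H G ρ b := by
  rw [trialBest]
  split_ifs with h
  · refine hmin _ ?_ h.1
    have := mem_kerSpace.1 (trialVec_mem (n := n) (s := s) (r := r) (mm := mm) H ρ)
    exact mem_kerSpace.2 ⟨fun i hi => ⟨(this.1 i hi).1, trivial⟩, this.2⟩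
  · exact hb

theorem trialBest_eq {H G : ℕ → ℕ → K} {d : ℕ} {ρ : ℕ → ℕ} {x : ℕ → K}
    (hx : trialVec n s r mm H ρ = x) (hw : blockWeight n s x = d)
    (ht : ∃ i < n * s, dotFun (n * s) (G i) x ≠ 0) (b : ℕ) (hb : d ≤ b) :
    trialBest n s r mm H G ρ b = d := by
  rw [trialBest, hx, hw]
  split_ifs with h
  · rfl
  · rw [not_and] at h
    have := h ht
    omega

end

/-! ## Counting successful coins -/

theorem numOf_testBit (L : ℕ) : ∀ x, numOf (fun u => (x.testBit u).toNat) L = x % 2 ^ L := by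
  induction L with
  | zero => intro x; simp [numOf, Nat.mod_one]
  | succ L ih =>
    intro x
    rw [numOf_succ]
    simp only [Nat.testBit_succ]
    rw [ih (x / 2), pow_succ', Nat.mod_mul]
    congr 1
    rw [Nat.testBit_zero]
    rcases Nat.mod_two_eq_zero_or_one x with h | h <;> simp [h]

/-- The coins that encode `n` numbers of `n` bits and `N` numbers of `q` bits. -/
def packCoins (n N q : ℕ) (g h : ℕ → ℕ) : Fin (n * n + N * q) → Bool := fun i =>
  if (i : ℕ) < n * n then (g (i / n)).testBit (i % n)
  else (h ((i - n * n) / q)).testBit ((i - n * n) % q)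

theorem bits_ofFn {C : ℕ} (f : Fin C → Bool) {i : ℕ} (hi : i < C) :
    bits (List.ofFn f) i = (f ⟨i, hi⟩).toNat := by
  rw [bits, List.getD_eq_getElem _ _ (by simpa using hi)]
  simp

theorem numOf_congr {f g : ℕ → ℕ} {L : ℕ} (h : ∀ u < L, f u = g u) : numOf f L = numOf g L :=
  Finset.sum_congr rfl fun u hu => by rw [h u (Finset.mem_range.1 hu)]

theorem numOf_packCoins_fst {n N q : ℕ} (g h : ℕ → ℕ) {j : ℕ} (hj : j < n) (hg : g j < 2 ^ n) :
    numOf (fun u => bits (List.ofFn (packCoins n N q g h)) (j * n + u)) n = g j := by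
  have : numOf (fun u => ((g j).testBit u).toNat) n = g j := by
    rw [numOf_testBit, Nat.mod_eq_of_lt hg]
  conv_rhs => rw [← this]
  refine numOf_congr fun u hu => ?_
  have h1 : j * n + u < n * n := by nlinarith
  rw [bits_ofFn _ (by omega), packCoins, if_pos h1]
  have hpos : 0 < n := by omega
  simp only
  rw [mul_comm, Nat.mul_add_div hpos, Nat.div_eq_of_lt hu, add_zero, Nat.mul_add_mod,
    Nat.mod_eq_of_lt hu]

theorem numOf_packCoins_snd {n N q : ℕ} (g h : ℕ → ℕ) {i : ℕ} (hi : i < N) (hh : h i < 2 ^ q) :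
    numOf (fun u => bits (List.ofFn (packCoins n N q g h)) (n * n + i * q + u)) q = h i := by
  have : numOf (fun u => ((h i).testBit u).toNat) q = h i := by
    rw [numOf_testBit, Nat.mod_eq_of_lt hh]
  conv_rhs => rw [← this]
  refine numOf_congr fun u hu => ?_
  have h1 : i * q + u < N * q := by nlinarith
  rw [bits_ofFn _ (by omega), packCoins, if_neg (by simp; omega)]
  have hpos : 0 < q := by omega
  simp only
  rw [show n * n + i * q + u - n * n = q * i + u by rw [mul_comm q]; omega,
    Nat.mul_add_div hpos, Nat.div_eq_of_lt hu, add_zero, Nat.mul_add_mod, Nat.mod_eq_of_lt hu]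

end RAM

/-! ### Lower bound for the probability that one trial succeeds -/

namespace RAM

/-- Extend a function on `Fin n` by `0`. -/
def extendFin {n : ℕ} (g : Fin n → ℕ) (j : ℕ) : ℕ := if h : j < n then g ⟨j, h⟩ else 0

theorem extendFin_apply {n : ℕ} (g : Fin n → ℕ) (j : Fin n) : extendFin g j = g j := by
  simp [extendFin]

theorem card_fin_filter_mem {n : ℕ} (T : Finset ℕ) (hT : T ⊆ Finset.range n) :
    (Finset.univ.filter fun j : Fin n => (j : ℕ) ∈ T).card = T.card := by
  rw [← Finset.card_map Fin.valEmbedding]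
  congr 1
  ext x
  simp only [Finset.mem_map, Finset.mem_filter, Finset.mem_univ, true_and, Fin.valEmbedding_apply]
  constructor
  · rintro ⟨j, hj, rfl⟩; exact hj
  · intro hx
    exact ⟨⟨x, Finset.mem_range.1 (hT hx)⟩, hx, rfl⟩

theorem card_piFinset_ite {n : ℕ} (T : Finset ℕ) (hT : T ⊆ Finset.range n) (A B : ℕ → Finset ℕ)
    (a b : ℕ) (hA : ∀ j, (A j).card = a) (hB : ∀ j, (B j).card = b) :
    (Fintype.piFinset fun j : Fin n => if (j : ℕ) ∈ T then A j else B j).card =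
      a ^ T.card * b ^ (n - T.card) := by
  rw [Fintype.card_piFinset]
  have : ∀ j : Fin n, (if (j : ℕ) ∈ T then A j else B j).card =
      if (j : ℕ) ∈ T then a else b := fun j => by split_ifs; exacts [hA _, hB _]
  rw [Finset.prod_congr rfl fun j _ => this j, Finset.prod_ite, Finset.prod_const,
    Finset.prod_const, card_fin_filter_mem T hT]
  congr 2
  have h := Finset.card_filter_add_card_filter_not (s := Finset.univ)
    (fun j : Fin n => (j : ℕ) ∈ T)
  rw [card_fin_filter_mem T hT, Finset.card_univ, Fintype.card_fin] at h
  omega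

variable {K : Type} [Field K] [Fintype K] {n s r mm : ℕ}

open Classical in
/-- The coins with which a trial finds the weight `d`. -/
noncomputable def hits (n s r mm : ℕ) (H G : ℕ → ℕ → K) (d : ℕ) :
    Finset (Fin (n * n + n * s * Fintype.card K) → Bool) :=
  Finset.univ.filter fun f => ∀ b, d ≤ b → trialBest n s r mm H G (bits (List.ofFn f)) b = d

/-- Let S be the support of `x`. For each set U of `mm - d` coordinates outside S, the coins that
select exactly S ∪ U and give the right coefficients on the relevant basis vectors produce `x`.
Distinct U give disjoint sets of coins. At most `b` coefficients matter, each read from as many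
coins as the field has elements, which costs the factor `2 ^ (q * b)`. The selections are counted by
`threshold_bound`, and `choose n mm * choose mm d = choose n d * choose (n - d) (mm - d)` leaves the
ratio `choose mm d / choose n d`. -/
theorem card_hits_ge (hmn : mm ≤ n) (hn : 2 * n * n ≤ 2 ^ n) (hn0 : 0 < n) {H G : ℕ → ℕ → K}
    {d b : ℕ} (hdm : d ≤ mm) {x : ℕ → K} (hx : x ∈ kerSpace n s r H Set.univ)
    (hw : blockWeight n s x = d) (ht : ∃ i < n * s, dotFun (n * s) (G i) x ≠ 0)
    (hker : ∀ T : Finset ℕ, T ⊆ Finset.range n → T.card = mm →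
      Module.finrank K (kerSpace n s r H (T : Set ℕ)) ≤ b) :
    (2 : ℝ) ^ (n * n + n * s * Fintype.card K) * mm.choose d ≤
      2 * (n + 1) * 2 ^ (Fintype.card K * b) * n.choose d * (hits n s r mm H G d).card := by
  classical
  set q := Fintype.card K with hq
  set N := n * s with hN
  set lo := (Finset.range (2 ^ n)).filter fun u => u * n < mm * 2 ^ n with hlo
  set hi := (Finset.range (2 ^ n)).filter fun u => ¬ u * n < mm * 2 ^ n with hhi
  set S := (Finset.range n).filter fun j => ∃ c < s, x (j * s + c) ≠ 0 with hS
  have hSd : S.card = d := by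
    rw [← hw, blockWeight, hS]
  have hSn : S ⊆ Finset.range n := Finset.filter_subset _ _
  set 𝒰 := (Finset.range n \ S).powersetCard (mm - d) with h𝒰
  have h𝒰c : 𝒰.card = (n - d).choose (mm - d) := by
    rw [h𝒰, Finset.card_powersetCard, Finset.card_sdiff_of_subset hSn, Finset.card_range, hSd]
  have hTn : ∀ U ∈ 𝒰, S ∪ U ⊆ Finset.range n := fun U hU =>
    Finset.union_subset hSn ((Finset.mem_powersetCard.1 hU).1.trans Finset.sdiff_subset)
  have hdisj : ∀ U ∈ 𝒰, Disjoint S U := fun U hU =>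
    Finset.disjoint_of_subset_right (Finset.mem_powersetCard.1 hU).1 Finset.disjoint_sdiff
  have hTc : ∀ U ∈ 𝒰, (S ∪ U).card = mm := fun U hU => by
    rw [Finset.card_union_of_disjoint (hdisj U hU), hSd, (Finset.mem_powersetCard.1 hU).2]
    omega
  have hxT : ∀ U, x ∈ kerSpace n s r H ((S ∪ U : Finset ℕ) : Set ℕ) := fun U => by
    have h := mem_kerSpace.1 hx
    refine mem_kerSpace.2 ⟨fun i hi => ⟨(h.1 i hi).1, ?_⟩, h.2⟩
    have hiN := (h.1 i hi).1
    have hs : 0 < s := Nat.pos_of_ne_zero fun h0 => by simp [h0] at hiN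
    refine Finset.mem_coe.2 (Finset.mem_union_left _ (Finset.mem_filter.2
      ⟨Finset.mem_range.2 (Nat.div_lt_of_lt_mul (by rwa [mul_comm s n])), i % s, Nat.mod_lt _ hs,
        ?_⟩))
    rwa [Nat.div_add_mod']
  choose Z hZN hZc c hc using fun U : Finset ℕ =>
    (isBasisFamily_kerFam (n := n) (s := s) (r := r) H ((S ∪ U : Finset ℕ) : Set ℕ)).exists_coeff
      (hxT U)
  set A : Finset ℕ → Finset (Fin n → ℕ) := fun U =>
    Fintype.piFinset fun j : Fin n => if (j : ℕ) ∈ S ∪ U then lo else hi with hA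
  set D : Finset ℕ → Finset (Fin N → ℕ) := fun U =>
    Fintype.piFinset fun i : Fin N => if (i : ℕ) ∈ Z U then {enc (c U i)} else
      Finset.range (2 ^ q) with hD
  have hAc : ∀ U ∈ 𝒰, (A U).card = lo.card ^ mm * hi.card ^ (n - mm) := fun U hU => by
    rw [hA]
    simp only
    rw [card_piFinset_ite _ (hTn U hU) (fun _ => lo) (fun _ => hi) _ _ (fun _ => rfl)
      (fun _ => rfl), hTc U hU]
  -- Only the coefficients with index in `Z U` are prescribed, because the other vectors of the
  -- family are zero; their coins remain free.
  have hDc : ∀ U ∈ 𝒰, 2 ^ (N * q) ≤ 2 ^ (q * b) * (D U).card := fun U hU => by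
    rw [hD]
    simp only
    rw [card_piFinset_ite (Z U) (hZN U) (fun i => {enc (c U i)}) (fun _ => Finset.range (2 ^ q)) 1
      (2 ^ q) (fun _ => Finset.card_singleton _) (fun _ => Finset.card_range _), one_pow, one_mul,
      ← pow_mul, ← pow_add]
    refine Nat.pow_le_pow_right two_pos ?_
    have h1 := hker (S ∪ U) (hTn U hU) (hTc U hU)
    rw [← hZc U] at h1
    have h2 : (Z U).card ≤ N := by
      simpa using Finset.card_le_card (hZN U)
    calc N * q = q * ((Z U).card + (N - (Z U).card)) := by
          rw [Nat.add_sub_cancel' h2, mul_comm]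
      _ ≤ q * (b + (N - (Z U).card)) := by gcongr
      _ = _ := by ring
  -- the coins that lead to the coordinate set and to the right coefficients
  set Φ : (Σ _ : Finset ℕ, (Fin n → ℕ) × (Fin N → ℕ)) → (Fin (n * n + N * q) → Bool) := fun p =>
    packCoins n N q (extendFin p.2.1) (extendFin p.2.2) with hΦ
  have hlolt : ∀ u ∈ lo, u < 2 ^ n := fun u hu => Finset.mem_range.1 (Finset.mem_filter.1 hu).1
  have hhilt : ∀ u ∈ hi, u < 2 ^ n := fun u hu => Finset.mem_range.1 (Finset.mem_filter.1 hu).1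
  have hqlt : q < 2 ^ q := Nat.lt_two_pow_self
  have hgA : ∀ U, ∀ g ∈ A U, ∀ j : Fin n, g j < 2 ^ n ∧ (g j * n < mm * 2 ^ n ↔ (j : ℕ) ∈ S ∪ U) :=
    fun U g hg j => by
      have := Fintype.mem_piFinset.1 hg j
      split_ifs at this with h
      · exact ⟨hlolt _ this, by simp only [h, iff_true]; exact (Finset.mem_filter.1 this).2⟩
      · exact ⟨hhilt _ this, by simp only [h, iff_false]; exact (Finset.mem_filter.1 this).2⟩
  have hhD : ∀ U, ∀ h ∈ D U, ∀ i : Fin N, h i < 2 ^ q ∧ ((i : ℕ) ∈ Z U → h i = enc (c U i)) :=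
    fun U h hh i => by
      have := Fintype.mem_piFinset.1 hh i
      split_ifs at this with h'
      · rw [Finset.mem_singleton] at this
        exact ⟨by rw [this]; exact (enc_lt _).trans hqlt, fun _ => this⟩
      · exact ⟨Finset.mem_range.1 this, fun hc => absurd hc h'⟩
  have hrec1 : ∀ U, ∀ g ∈ A U, ∀ (h : Fin N → ℕ) (j : ℕ) (hj : j < n),
      numOf (fun u => bits (List.ofFn (packCoins n N q (extendFin g) (extendFin h))) (j * n + u)) n =
        g ⟨j, hj⟩ := fun U g hg h j hj => by
    have h1 := extendFin_apply g ⟨j, hj⟩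
    simp only at h1
    rw [numOf_packCoins_fst _ _ hj (by rw [h1]; exact (hgA U g hg _).1), h1]
  have hrec2 : ∀ U, ∀ h ∈ D U, ∀ (g : Fin n → ℕ) (i : ℕ) (hi : i < N),
      numOf (fun u => bits (List.ofFn (packCoins n N q (extendFin g) (extendFin h)))
        (n * n + i * q + u)) q = h ⟨i, hi⟩ := fun U h hh g i hi => by
    have h1 := extendFin_apply h ⟨i, hi⟩
    simp only at h1
    rw [numOf_packCoins_snd _ _ hi (by rw [h1]; exact (hhD U h hh _).1), h1]
  -- The coins determine the numbers `g` and `h`. The numbers `g` determine S ∪ U, and hence U,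
  -- since U is disjoint from S.
  have hcard : (𝒰.sigma fun U => A U ×ˢ D U).card ≤ (hits n s r mm H G d).card := by
    refine Finset.card_le_card_of_injOn Φ ?_ ?_
    · rintro ⟨U, g, h⟩ hp
      simp only [Finset.coe_sigma, Set.mem_sigma_iff, Finset.mem_coe, Finset.mem_product] at hp
      obtain ⟨hU, hg, hh⟩ := hp
      refine Finset.mem_coe.2 (Finset.mem_filter.2 ⟨Finset.mem_univ _, ?_⟩)
      refine trialBest_eq (x := x) ?_ hw ht
      have hset : ∀ j < n, j ∈ trialSet n mm (bits (List.ofFn (Φ ⟨U, g, h⟩))) ↔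
          j ∈ ((S ∪ U : Finset ℕ) : Set ℕ) := fun j hj => by
        rw [trialSet, Set.mem_ofPred_eq, hΦ]
        simp only
        rw [hrec1 U g hg h j hj]
        exact (hgA U g hg ⟨j, hj⟩).2
      rw [trialVec, kerFam_congr H hset]
      refine hc U _ fun i hi => ?_
      have hiN : i < N := Finset.mem_range.1 (hZN U hi)
      rw [trialCoef, hΦ]
      simp only
      rw [hrec2 U h hh g i hiN, (hhD U h hh ⟨i, hiN⟩).2 hi, dec_enc]
    · rintro ⟨U, g, h⟩ hp ⟨U', g', h'⟩ hp' heq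
      simp only [Finset.coe_sigma, Set.mem_sigma_iff, Finset.mem_coe, Finset.mem_product] at hp hp'
      obtain ⟨hU, hg, hh⟩ := hp
      obtain ⟨hU', hg', hh'⟩ := hp'
      simp only [hΦ] at heq
      have e1 : g = g' := by
        funext j
        rw [← hrec1 U g hg h j j.2, ← hrec1 U' g' hg' h' j j.2, heq]
      have e2 : h = h' := by
        funext i
        rw [← hrec2 U h hh g i i.2, ← hrec2 U' h' hh' g' i i.2, heq]
      subst e1 e2
      have e3 : U = U' := by
        have hTT : S ∪ U = S ∪ U' := by
          ext j
          by_cases hj : j < n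
          · exact ((hgA U g hg ⟨j, hj⟩).2.symm).trans (hgA U' g hg' ⟨j, hj⟩).2
          · exact iff_of_false (fun hc => hj (Finset.mem_range.1 (hTn U hU hc)))
              (fun hc => hj (Finset.mem_range.1 (hTn U' hU' hc)))
        rw [← Finset.union_sdiff_cancel_left (hdisj U hU), hTT,
          Finset.union_sdiff_cancel_left (hdisj U' hU')]
      subst e3
      rfl
  have hcard2 : (n - d).choose (mm - d) * (lo.card ^ mm * hi.card ^ (n - mm)) * 2 ^ (N * q) ≤
      2 ^ (q * b) * (hits n s r mm H G d).card := by
    rw [Finset.card_sigma] at hcard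
    calc (n - d).choose (mm - d) * (lo.card ^ mm * hi.card ^ (n - mm)) * 2 ^ (N * q)
        = ∑ _U ∈ 𝒰, (lo.card ^ mm * hi.card ^ (n - mm)) * 2 ^ (N * q) := by
          rw [Finset.sum_const, h𝒰c, smul_eq_mul, mul_assoc]
      _ ≤ ∑ U ∈ 𝒰, 2 ^ (q * b) * (A U ×ˢ D U).card := by
          refine Finset.sum_le_sum fun U hU => ?_
          rw [Finset.card_product, hAc U hU]
          calc _ ≤ (lo.card ^ mm * hi.card ^ (n - mm)) * (2 ^ (q * b) * (D U).card) :=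
                Nat.mul_le_mul_left _ (hDc U hU)
            _ = _ := by ring
      _ = 2 ^ (q * b) * ∑ U ∈ 𝒰, (A U ×ˢ D U).card := by rw [Finset.mul_sum]
      _ ≤ _ := Nat.mul_le_mul_left _ hcard
  have hthr := threshold_bound hmn hn hn0
  rw [← hlo, ← hhi] at hthr
  have hchoose : (n.choose mm : ℝ) * mm.choose d = n.choose d * (n - d).choose (mm - d) := by
    exact_mod_cast Nat.choose_mul hdm
  have hcard3 : ((n - d).choose (mm - d) : ℝ) * ((lo.card : ℝ) ^ mm * (hi.card : ℝ) ^ (n - mm)) *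
      2 ^ (N * q) ≤ 2 ^ (q * b) * (hits n s r mm H G d).card := by exact_mod_cast hcard2
  rw [pow_add, pow_mul]
  calc ((2 : ℝ) ^ n) ^ n * 2 ^ (N * q) * mm.choose d
      ≤ (2 * (n + 1) * n.choose mm * (lo.card : ℝ) ^ mm * (hi.card : ℝ) ^ (n - mm)) *
        2 ^ (N * q) * mm.choose d := by gcongr
    _ = 2 * (n + 1) * (n.choose mm * mm.choose d) * ((lo.card : ℝ) ^ mm * (hi.card : ℝ) ^ (n - mm)) *
        2 ^ (N * q) := by ring
    _ = 2 * (n + 1) * n.choose d * ((n - d).choose (mm - d) *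
        ((lo.card : ℝ) ^ mm * (hi.card : ℝ) ^ (n - mm)) * 2 ^ (N * q)) := by rw [hchoose]; ring
    _ ≤ 2 * (n + 1) * n.choose d * (2 ^ (q * b) * (hits n s r mm H G d).card) := by gcongr
    _ = _ := by ring

end RAM

namespace RAM

/-! ## Probability of success -/

/-- The first `T * C` coins are `T` independent blocks, and a run can fail only if every block
misses `A`. The budget `t` may exceed `T * C`; the `e` surplus coins are arbitrary and cancel in the
quotient. -/
theorem successProb_ge {p : Prog} {m : Mem} {d C T cost t : ℕ} (A : Finset (Fin C → Bool))
    (hexec : ∀ Ls : List (List Bool), (∀ l ∈ Ls, l.length = C) → Ls.length = T →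
      (∃ f ∈ A, List.ofFn f ∈ Ls) → ∀ ω, ∃ m' c, Exec p m (Ls.flatten ++ ω) m' ω c ∧ m' 0 0 = d ∧
        c ≤ cost) (hC : T * C ≤ cost) (ht : cost ≤ t) :
    1 - (1 - (A.card : ℝ) / 2 ^ C) ^ T ≤ successProb p m d t := by
  classical
  obtain ⟨e, rfl⟩ := Nat.exists_eq_add_of_le (hC.trans ht)
  have hlt : ∀ (i : Fin T) (c : Fin C), (i : ℕ) * C + c < T * C := fun i c => by
    calc (i : ℕ) * C + c < i * C + C := by have := c.2; omega
      _ = (i + 1) * C := by ring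
      _ ≤ T * C := Nat.mul_le_mul_right _ i.2
  let blk : (Fin (T * C + e) → Bool) → Fin T → Fin C → Bool := fun ω i c =>
    ω (Fin.castLE (Nat.le_add_right _ _) ⟨i * C + c, hlt i c⟩)
  let rest : (Fin (T * C + e) → Bool) → Fin e → Bool := fun ω c => ω (Fin.natAdd (T * C) c)
  have hflat : ∀ ω, List.ofFn ω =
      (List.ofFn fun i => List.ofFn (blk ω i)).flatten ++ List.ofFn (rest ω) := fun ω => by
    rw [List.ofFn_add, List.ofFn_mul]
  set good := Finset.univ.filter fun ω : Fin (T * C + e) → Bool =>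
      ∃ (m' : Mem) (ω' : List Bool) (c : ℕ),
        Exec p m (List.ofFn ω) m' ω' c ∧ c ≤ T * C + e ∧ m' 0 0 = d with hgood
  have hbad : goodᶜ.card ≤ (Aᶜ.card) ^ T * 2 ^ e := by
    have h1 : goodᶜ.card ≤ (Fintype.piFinset (fun _ : Fin T => Aᶜ) ×ˢ
        (Finset.univ : Finset (Fin e → Bool))).card := by
      refine Finset.card_le_card_of_injOn (fun ω => (blk ω, rest ω)) ?_ ?_
      · intro ω hω
        simp only [Finset.coe_product, Finset.coe_univ, Set.mem_prod, Set.mem_univ, and_true,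
          Finset.mem_coe, Fintype.mem_piFinset]
        intro i
        rw [Finset.mem_compl]
        intro hA
        refine (Finset.mem_compl.1 hω) (Finset.mem_filter.2 ⟨Finset.mem_univ _, ?_⟩)
        obtain ⟨m', c, he, hd, hc⟩ := hexec (List.ofFn fun i => List.ofFn (blk ω i))
          (by
            intro l hl
            obtain ⟨j, rfl⟩ := (List.mem_ofFn' _ _).1 hl
            exact List.length_ofFn) List.length_ofFn
          ⟨_, hA, (List.mem_ofFn' _ _).2 ⟨i, rfl⟩⟩ (List.ofFn (rest ω))
        exact ⟨m', _, c, by rw [hflat]; exact he, hc.trans ht, hd⟩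
      · intro ω _ ω' _ h
        simp only [Prod.mk.injEq] at h
        funext i
        by_cases hi : (i : ℕ) < T * C
        · have hC0 : 0 < C := Nat.pos_of_ne_zero fun h0 => by simp [h0] at hi
          have := congrFun (congrFun h.1 ⟨i / C, Nat.div_lt_of_lt_mul (hi.trans_eq (mul_comm _ _))⟩)
            ⟨i % C, Nat.mod_lt _ hC0⟩
          have hi' : i = Fin.castLE (Nat.le_add_right (T * C) e) ⟨i / C * C + i % C, by
              rw [Nat.div_add_mod']; exact hi⟩ := Fin.ext (by simp [Nat.div_add_mod'])
          rw [hi']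
          exact this
        · have := congrFun h.2 ⟨i - T * C, by have := i.2; omega⟩
          have hi' : i = Fin.natAdd (T * C) ⟨i - T * C, by have := i.2; omega⟩ :=
            Fin.ext (by simp; omega)
          rw [hi']
          exact this
    rwa [Finset.card_product, Fintype.card_piFinset_const, Finset.card_univ, Fintype.card_fun,
      Fintype.card_bool, Fintype.card_fin] at h1
  have htot : (good.card : ℝ) + goodᶜ.card = 2 ^ (T * C + e) := by
    rw [← Nat.cast_add, Finset.card_add_card_compl]
    simp
  have hAc : (Aᶜ.card : ℝ) = 2 ^ C - A.card := by
    rw [Finset.card_compl, Nat.cast_sub (Finset.card_le_univ _)]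
    simp
  have hbad' : (goodᶜ.card : ℝ) ≤ (2 ^ C - A.card) ^ T * 2 ^ e := by
    rw [← hAc]
    exact_mod_cast hbad
  have h2 : (1 - (A.card : ℝ) / 2 ^ C) ^ T = (2 ^ C - A.card) ^ T * 2 ^ e / 2 ^ (T * C + e) := by
    rw [one_sub_div (by positivity), div_pow, pow_add, ← pow_mul, mul_comm C T,
      mul_div_mul_right _ _ (by positivity)]
  rw [successProb, h2, ← hgood]
  have h3 : (0 : ℝ) < 2 ^ (T * C + e) := by positivity
  rw [le_div_iff₀ h3, sub_mul, div_mul_cancel₀ _ h3.ne', one_mul]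
  linarith

/-- Passing from `w` to `w + 1` multiplies the quotient by `(n - w) / (m - w)`, which is at least
one, and rounding down preserves the order. This monotonicity is what prevents the main loop from
stopping early. -/
theorem descFactorial_div_mono {n m d w : ℕ} (hmn : m ≤ n) (hdw : d ≤ w) (hwm : w ≤ m) :
    n.descFactorial d / m.descFactorial d ≤ n.descFactorial w / m.descFactorial w := by
  induction w, hdw using Nat.le_induction with
  | base => exact le_rfl
  | succ w hdw ih =>
    refine (ih (by omega)).trans ?_
    rw [Nat.descFactorial_succ, Nat.descFactorial_succ]
    have hpos : 0 < m - w := by omega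
    calc n.descFactorial w / m.descFactorial w
        = ((m - w) * n.descFactorial w) / ((m - w) * m.descFactorial w) :=
          (Nat.mul_div_mul_left _ _ hpos).symm
      _ ≤ _ := Nat.div_le_div_right (Nat.mul_le_mul_right _ (by omega))

theorem numTrials_mono (q : ℕ) {n m d w : ℕ} (hmn : m ≤ n) (hdw : d ≤ w) (hwm : w ≤ m) :
    numTrials q n m d ≤ numTrials q n m w := by
  unfold numTrials
  exact Nat.mul_le_mul_left _ (Nat.add_le_add_right (descFactorial_div_mono hmn hdw hwm) 1)

/-- The factor `d !` cancels, so the quotient of falling factorials is that of the binomial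
coefficients; the summand `1` makes up for the integer division. -/
theorem choose_le_mul_descFactorial {n m d : ℕ} (hdm : d ≤ m) :
    (n.choose d : ℝ) ≤ m.choose d * (n.descFactorial d / m.descFactorial d + 1 : ℕ) := by
  have h1 : 0 < m.descFactorial d := Nat.descFactorial_pos.2 hdm
  have h2 : n.descFactorial d ≤ m.descFactorial d * (n.descFactorial d / m.descFactorial d + 1) :=
    (Nat.lt_mul_div_succ _ h1).le
  rw [Nat.descFactorial_eq_factorial_mul_choose n, Nat.descFactorial_eq_factorial_mul_choose m,
    mul_assoc] at h2
  have h3 := Nat.le_of_mul_le_mul_left h2 (Nat.factorial_pos d)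
  rw [← Nat.descFactorial_eq_factorial_mul_choose n,
    ← Nat.descFactorial_eq_factorial_mul_choose m] at h3
  exact_mod_cast h3

/-- Polynomially bounded functions. -/
def PolyBdd (f : ℕ → ℕ) : Prop := ∃ C D, ∀ n, f n ≤ C * (n + 1) ^ D

theorem PolyBdd.const (c : ℕ) : PolyBdd fun _ => c := ⟨c, 0, fun n => by simp⟩

theorem PolyBdd.id : PolyBdd fun n => n := ⟨1, 1, fun n => by simp⟩

theorem PolyBdd.add {f g : ℕ → ℕ} (hf : PolyBdd f) (hg : PolyBdd g) :
    PolyBdd fun n => f n + g n := by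
  obtain ⟨C, D, h⟩ := hf
  obtain ⟨C', D', h'⟩ := hg
  refine ⟨C + C', D + D', fun n => ?_⟩
  have h1 : (n + 1) ^ D ≤ (n + 1) ^ (D + D') := Nat.pow_le_pow_right (by omega) (by omega)
  have h2 : (n + 1) ^ D' ≤ (n + 1) ^ (D + D') := Nat.pow_le_pow_right (by omega) (by omega)
  calc f n + g n ≤ C * (n + 1) ^ D + C' * (n + 1) ^ D' := add_le_add (h n) (h' n)
    _ ≤ C * (n + 1) ^ (D + D') + C' * (n + 1) ^ (D + D') := by gcongr
    _ = _ := by ring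

theorem PolyBdd.mul {f g : ℕ → ℕ} (hf : PolyBdd f) (hg : PolyBdd g) :
    PolyBdd fun n => f n * g n := by
  obtain ⟨C, D, h⟩ := hf
  obtain ⟨C', D', h'⟩ := hg
  refine ⟨C * C', D + D', fun n => ?_⟩
  calc f n * g n ≤ C * (n + 1) ^ D * (C' * (n + 1) ^ D') := Nat.mul_le_mul (h n) (h' n)
    _ = _ := by ring

theorem PolyBdd.pow {f : ℕ → ℕ} (hf : PolyBdd f) (k : ℕ) : PolyBdd fun n => f n ^ k := by
  induction k with
  | zero => simpa using PolyBdd.const 1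
  | succ k ih => simpa only [pow_succ] using ih.mul hf

theorem PolyBdd.mono {f g : ℕ → ℕ} (hg : PolyBdd g) (h : ∀ n, f n ≤ g n) : PolyBdd f := by
  obtain ⟨C, D, h'⟩ := hg
  exact ⟨C, D, fun n => (h n).trans (h' n)⟩

theorem PolyBdd.cst (c : Cmd) {f : ℕ → ℕ} (hf : PolyBdd f) : PolyBdd fun n => c.cst (f n) := by
  obtain ⟨C, D, h⟩ := c.cst_poly
  exact ((PolyBdd.const C).mul ((hf.add (.const 1)).pow D)).mono fun n => h (f n)

/-- Bound for the addresses. -/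
def addrBound (q s n : ℕ) : ℕ := ((s + q + 1) * (n + 1)) ^ 2

/-- Bound for the bit lengths. -/
def sizeBound (q s L n : ℕ) : ℕ := 5 * addrBound q s n + L

theorem polyBdd_addrBound (q s : ℕ) : PolyBdd (addrBound q s) :=
  ((PolyBdd.const (s + q + 1)).mul (PolyBdd.id.add (.const 1))).pow 2

theorem polyBdd_sizeBound (q s L : ℕ) : PolyBdd (sizeBound q s L) :=
  ((PolyBdd.const 5).mul (polyBdd_addrBound q s)).add (.const L)

theorem exponent_lt_sizeBound {q s L n : ℕ} (hs : 0 < s) :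
    4 * n * (n + 1) * 2 ^ (4 * q * n) * (n ^ n + 1) < 2 ^ sizeBound q s L n := by
  have h1 : n ≤ 2 ^ n := Nat.lt_two_pow_self.le
  have h2 : n + 1 ≤ 2 ^ n := Nat.lt_two_pow_self
  have h3 : n ^ n + 1 ≤ 2 ^ (n * n + 1) := by
    calc n ^ n + 1 ≤ (2 ^ n) ^ n + 1 := by gcongr
      _ = 2 ^ (n * n) + 1 := by rw [pow_mul]
      _ ≤ 2 ^ (n * n) + 2 ^ (n * n) := by have := Nat.one_le_two_pow (n := n * n); omega
      _ = _ := by ring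
  calc _ ≤ 2 ^ 2 * 2 ^ n * 2 ^ n * 2 ^ (4 * q * n) * 2 ^ (n * n + 1) :=
        Nat.mul_le_mul (Nat.mul_le_mul_right _ (Nat.mul_le_mul (Nat.mul_le_mul_left 4 h1) h2)) h3
    _ = 2 ^ (2 + n + n + 4 * q * n + (n * n + 1)) := by simp only [← pow_add]
    _ < _ := by
      refine Nat.pow_lt_pow_right (by omega) ?_
      unfold sizeBound addrBound
      obtain ⟨s', rfl⟩ : ∃ s', s = s' + 1 := ⟨s - 1, by omega⟩
      have : ((q + 2) * (n + 1)) ^ 2 ≤ ((s' + 1 + q + 1) * (n + 1)) ^ 2 :=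
        Nat.pow_le_pow_left (Nat.mul_le_mul_right _ (by omega)) 2
      have h4 : ((q + 2) * (n + 1)) ^ 2 = q * q * (n + 1) ^ 2 + 4 * q * n * n + 8 * (q * n) + 4 * q +
        4 * (n * n) + 8 * n + 4 := by ring
      have h5 : 4 * q * n = 4 * (q * n) := by ring
      omega

theorem enough_bounds {K : Type} [Fintype K] {n r s mm : ℕ} (hs : 0 < s) (L : ℕ) (hr : r ≤ n * s) (hmm : mm ≤ n) :
    Enough K (sizeBound (Fintype.card K) s L n) (addrBound (Fintype.card K) s n) n r s mm ∧
      n * n + n * s * Fintype.card K ≤ addrBound (Fintype.card K) s n := by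
  set q := Fintype.card K
  set X := (s + q + 1) * (n + 1) with hX
  have hXX : X ≤ X ^ 2 := by nlinarith [Nat.zero_le X, Nat.mul_pos (show 0 < s + q + 1 by omega) (show 0 < n + 1 by omega)]
  have e : X = s * n + q * n + n + s + q + 1 := by rw [hX]; ring
  have hns : n * s ≤ X := by rw [e, mul_comm]; omega
  have hB : addrBound q s n = X ^ 2 := rfl
  have hS : sizeBound q s L n = 5 * X ^ 2 + L := rfl
  have hn : n < X := by rw [e]; have := Nat.zero_le (s * n); have := Nat.zero_le (q * n); omega
  have hq : q < X := by rw [e]; have := Nat.zero_le (s * n); have := Nat.zero_le (q * n); omega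
  have hs : s < X := by rw [e]; have := Nat.zero_le (s * n); have := Nat.zero_le (q * n); omega
  have hmul : n * s * (n * s) ≤ X ^ 2 := by rw [sq]; exact Nat.mul_le_mul hns hns
  refine ⟨⟨?_, ?_, ?_, ?_, ?_, ?_, ?_, ?_, ?_, ?_, ?_, ?_⟩, ?_⟩ <;> (try rw [hB]) <;> (try rw [hS])
  · exact lt_of_lt_of_le Nat.lt_two_pow_self (Nat.pow_le_pow_right (by omega) (by omega))
  · exact hmul
  · exact (Nat.mul_le_mul_right _ hr).trans hmul
  · omega
  · omega
  · omega
  · omega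
  · omega
  · omega
  · omega
  · omega
  · calc mm * 2 ^ n < 2 ^ X * 2 ^ n := by
          refine Nat.mul_lt_mul_of_pos_right ?_ (by positivity)
          exact lt_of_lt_of_le Nat.lt_two_pow_self (Nat.pow_le_pow_right (by omega) (by omega))
      _ = 2 ^ (X + n) := by rw [pow_add]
      _ ≤ _ := Nat.pow_le_pow_right (by omega) (by omega)
  · have : X ^ 2 = n * n + n * s * q + (X ^ 2 - (n * n + n * s * q)) := by
      have : n * n + n * s * q ≤ X ^ 2 := by
        rw [hX]
        have h : ((s + q + 1) * (n + 1)) ^ 2 =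
          n * n + n * s * q + (s ^ 2 * (n + 1) ^ 2 + q ^ 2 * (n + 1) ^ 2 + 2 * s * (n + 1) ^ 2 +
            2 * q * (n + 1) ^ 2 + 2 * s * q * n ^ 2 + 3 * s * q * n + 2 * s * q + 2 * n + 1) := by ring
        rw [h]
        exact Nat.le_add_right _ _
      omega
    omega

theorem le_passCost (K : Type) [Field K] [Fintype K] (B s : ℕ) : B ≤ passCost K B s := by
  have h : 1 ≤ coinCost (Fintype.card K) := by unfold coinCost; omega
  have h2 : B * 1 ≤ (B + 2) * coinCost (Fintype.card K) := Nat.mul_le_mul (by omega) h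
  unfold passCost
  omega

/-- If `P` is the probability of a hit, the number `T` of trials is such that `P * T ≥ n`, so all
trials miss with probability `(1 - P) ^ T ≤ exp (-P * T) ≤ exp (-n)`. The constants `C` and `D`
depend only on the field, the tables, `L` and `s`; they absorb the polynomial cost of the
initialization and of a single trial. -/
theorem successProb_mainProg {K : Type} [Field K] [Fintype K] (F₁ F₂ : ℕ → K) (L s : ℕ) (hs : 0 < s) :
    ∃ C D, ∀ (n r mm d t : ℕ) (m : Mem) (H G : ℕ → ℕ → K) (x : ℕ → K), 0 < n → 2 * n * n ≤ 2 ^ n →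
      r ≤ n * s → mm = r / s + 1 → mm ≤ n → m 0 0 = n → m 0 1 = r → (∀ i, m 1 i < L) →
      (∀ i, m 12 i = 0) → (∀ a i, m a i ≤ n + r + L) →
      (H = fun ρ t => F₁ (m 1 (ρ * n + t / s) * s + t % s)) →
      (G = kerFam n s r (fun ρ t => F₂ (m 1 (ρ * n + t / s) * s + t % s)) Set.univ) →
      1 ≤ d → d ≤ mm →
      (∀ x ∈ kerSpace n s r H Set.univ, (∃ i < n * s, dotFun (n * s) (G i) x ≠ 0) →
        d ≤ blockWeight n s x) →
      x ∈ kerSpace n s r H Set.univ → blockWeight n s x = d →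
      (∃ i < n * s, dotFun (n * s) (G i) x ≠ 0) →
      (∀ T ⊆ Finset.range n, T.card = mm →
        Module.finrank K (kerSpace n s r H (T : Set ℕ)) ≤ 4 * rootCount n) →
      C * (n + 1) ^ D * 2 ^ (4 * Fintype.card K * rootCount n) *
        (n.descFactorial d / mm.descFactorial d + 1) ≤ t →
      1 - Real.exp (-n) ≤ successProb (mainProg K F₁ F₂ L s) m d t := by
  set q := Fintype.card K with hq
  have hp : PolyBdd fun n => ((startC K F₁ F₂ L s).cst (addrBound q s n) + passCost K (addrBound q s n) s +
      setCost (.lit 0) (.var 29)) * (sizeBound q s L n + 1) ^ 2 * (8 * n * (n + 1)) := by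
    refine PolyBdd.mul (PolyBdd.mul (((PolyBdd.cst _ (polyBdd_addrBound q s)).add ?_).add (.const _))
      (((polyBdd_sizeBound q s L).add (.const 1)).pow 2))
      (((PolyBdd.const 8).mul .id).mul (PolyBdd.id.add (.const 1)))
    unfold passCost
    exact ((((PolyBdd.const _).add (.const _)).add (.const _)).add
      (((polyBdd_addrBound q s).add (.const 2)).mul (.const _))).add
        (.cst _ (polyBdd_addrBound q s))
  obtain ⟨C, D, hCD⟩ := hp
  refine ⟨C, D, ?_⟩
  intro n r mm d t m H G x hn0 hn2 hrn hmm hmn hmn0 hmr hL h12 hbd hH hG hd hdm hmin hx hw ht hker htt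
  obtain ⟨hE, hBC⟩ := enough_bounds (K := K) (r := r) hs L hrn hmn
  rw [← hq] at hE hBC
  have hS := exponent_lt_sizeBound (q := q) (L := L) (n := n) hs
  set T := numTrials q n mm d with hT
  have hTS : T < 2 ^ sizeBound q s L n := by
    refine lt_of_le_of_lt ?_ hS
    rw [hT, numTrials]
    have h1 : n.descFactorial d / mm.descFactorial d ≤ n ^ n := by
      refine (Nat.div_le_self _ _).trans ((Nat.descFactorial_le_pow _ _).trans ?_)
      exact Nat.pow_le_pow_right hn0 (hdm.trans hmn)
    have h2 := rootCount_le n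
    gcongr
    norm_num
  have hbdd : m.Bdd (sizeBound q s L n) := fun a i => by
    have h1 := hE.r_le
    refine lt_of_le_of_lt (hbd a i) (lt_of_lt_of_le Nat.lt_two_pow_self
      (Nat.pow_le_pow_right (by omega) ?_))
    have := hE.n_le
    unfold sizeBound
    omega
  have hpass := le_passCost K (addrBound q s n) s
  have hcost : totalCost K F₁ F₂ L s (addrBound q s n) T * (sizeBound q s L n + 1) ^ 2 ≤ t := by
    refine le_trans ?_ htt
    have h1 := hCD n
    calc _ ≤ (T + 1) * ((startC K F₁ F₂ L s).cst (addrBound q s n) + passCost K (addrBound q s n) s +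
          setCost (.lit 0) (.var 29)) * (sizeBound q s L n + 1) ^ 2 := by
          refine Nat.mul_le_mul_right _ ?_
          unfold totalCost
          generalize (startC K F₁ F₂ L s).cst (addrBound q s n) = u
          generalize setCost (.lit 0) (.var 29) = v
          generalize passCost K (addrBound q s n) s = w
          nlinarith [Nat.zero_le (T * u), Nat.zero_le (T * v)]
      _ ≤ (2 * T) * ((startC K F₁ F₂ L s).cst (addrBound q s n) + passCost K (addrBound q s n) s +
          setCost (.lit 0) (.var 29)) * (sizeBound q s L n + 1) ^ 2 := by
          have : 1 ≤ T := by
            rw [hT, numTrials]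
            exact Nat.mul_pos (by positivity) (Nat.succ_pos _)
          gcongr
          omega
      _ = (((startC K F₁ F₂ L s).cst (addrBound q s n) + passCost K (addrBound q s n) s +
          setCost (.lit 0) (.var 29)) * (sizeBound q s L n + 1) ^ 2 * (8 * n * (n + 1))) *
          2 ^ (4 * q * rootCount n) * (n.descFactorial d / mm.descFactorial d + 1) := by
          rw [hT, numTrials]; ring
      _ ≤ _ := by gcongr
  -- Success is measured on `t` coins, so the coins of all `T` trials have to fit into the cost
  -- bound.
  have hTC : T * (n * n + n * s * q) ≤
      totalCost K F₁ F₂ L s (addrBound q s n) T * (sizeBound q s L n + 1) ^ 2 := by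
    calc T * (n * n + n * s * q) ≤ (T + 1) * passCost K (addrBound q s n) s :=
          Nat.mul_le_mul (by omega) (hBC.trans hpass)
      _ ≤ totalCost K F₁ F₂ L s (addrBound q s n) T := by unfold totalCost; omega
      _ ≤ _ := Nat.le_mul_of_pos_right _ (by positivity)
  have hmain := successProb_ge (p := mainProg K F₁ F₂ L s) (m := m) (d := d) (hits n s r mm H G d)
    (cost := totalCost K F₁ F₂ L s (addrBound q s n) T * (sizeBound q s L n + 1) ^ 2) (T := T) (t := t)
    (fun Ls hLs hlen ⟨f, hf, hfL⟩ ω => exec_mainProg hE hBC hmm hmn hS F₁ F₂ hbdd hmn0 hmr hL h12 hH hG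
      hd hdm (fun w hw hw' => numTrials_mono _ hmn hw hw') hTS
      (fun ρ b hb => le_trialBest hmin ρ b hb) Ls hLs hlen
      ⟨_, hfL, by simpa [hits] using hf⟩ ω) hTC hcost
  refine le_trans ?_ hmain
  have hhits := card_hits_ge hmn hn2 hn0 hdm hx hw ht hker
  set P : ℝ := ((hits n s r mm H G d).card : ℝ) / 2 ^ (n * n + n * s * q) with hP
  have hP1 : P ≤ 1 := by
    rw [hP, div_le_one (by positivity)]
    have := (hits n s r mm H G d).card_le_univ
    rw [Fintype.card_fun, Fintype.card_bool, Fintype.card_fin] at this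
    exact_mod_cast this
  have hch := choose_le_mul_descFactorial (n := n) hdm
  have hmd : (0 : ℝ) < mm.choose d := by exact_mod_cast Nat.choose_pos hdm
  -- The factors of `numTrials` are those lost in `card_hits_ge`, times `n`; its leading constant
  -- `4` instead of `2` is slack.
  have hPT : (n : ℝ) ≤ P * T := by
    have hcd : (0 : ℝ) < n.choose d := by exact_mod_cast Nat.choose_pos (hdm.trans hmn)
    have h1 : (mm.choose d : ℝ) ≤ 2 * (n + 1) * 2 ^ (q * (4 * rootCount n)) * n.choose d * P := by
      rw [hP, mul_div_assoc', le_div_iff₀ (by positivity), mul_comm]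
      exact hhits
    have hP0 : 0 ≤ P := by positivity
    have h2 : (mm.choose d : ℝ) * n ≤ mm.choose d * (P * T) := by
      calc (mm.choose d : ℝ) * n
          ≤ (2 * (n + 1) * 2 ^ (q * (4 * rootCount n)) * n.choose d * P) * n := by gcongr
        _ ≤ (2 * (n + 1) * 2 ^ (q * (4 * rootCount n)) * (mm.choose d *
            (n.descFactorial d / mm.descFactorial d + 1 : ℕ)) * P) * n := by gcongr
        _ ≤ 2 * ((2 * (n + 1) * 2 ^ (q * (4 * rootCount n)) * (mm.choose d *
            (n.descFactorial d / mm.descFactorial d + 1 : ℕ)) * P) * n) := by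
            have : 0 ≤ (2 * ((n : ℝ) + 1) * 2 ^ (q * (4 * rootCount n)) * (mm.choose d *
              (n.descFactorial d / mm.descFactorial d + 1 : ℕ)) * P) * n := by positivity
            linarith
        _ = mm.choose d * (P * T) := by
            rw [hT, numTrials, show 4 * q * rootCount n = q * (4 * rootCount n) by ring]
            push_cast
            ring
    exact le_of_mul_le_mul_left h2 hmd
  have h3 : (1 - P) ^ T ≤ Real.exp (-n) := by
    calc (1 - P) ^ T ≤ (Real.exp (-P)) ^ T :=
          pow_le_pow_left₀ (by linarith) (Real.one_sub_le_exp_neg P) _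
      _ = Real.exp (-(P * T)) := by rw [← Real.exp_nat_mul]; ring_nf
      _ ≤ _ := Real.exp_le_exp.2 (by linarith)
  linarith

end RAM

/-! ## Words over a module as sequences of field elements -/

section Words

variable {K β : Type} [Field K] [AddCommGroup β] [Module K β] {s n r : ℕ}

/-- The words that vanish outside `J`. -/
def supportedOn (K : Type) {β : Type} [Field K] [AddCommGroup β] [Module K β] {n : ℕ}
    (J : Finset (Fin n)) : Submodule K (Fin n → β) where
  carrier := {x | ∀ j ∉ J, x j = 0}
  zero_mem' := fun _ _ => rfl
  add_mem' := fun hx hy j hj => by simp [hx j hj, hy j hj]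
  smul_mem' := fun c x hx j hj => by simp [hx j hj]

/-- The words that solve the equations with the coefficients `κ (M ρ j)`. -/
def solSpace (ψ : β ≃ₗ[K] (Fin s → K)) (κ : β → Fin s → K) (M : Fin r → Fin n → β) :
    Submodule K (Fin n → β) where
  carrier := {x | ∀ ρ, ∑ j, ∑ c, κ (M ρ j) c * ψ (x j) c = 0}
  zero_mem' := fun _ => by simp
  add_mem' := fun {x y} hx hy ρ => by
    have := congrArg₂ (· + ·) (hx ρ) (hy ρ)
    simpa [mul_add, Finset.sum_add_distrib] using this
  smul_mem' := fun a x hx ρ => by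
    have := congrArg (a * ·) (hx ρ)
    simpa [Finset.mul_sum, mul_left_comm] using this

theorem mem_solSpace {ψ : β ≃ₗ[K] (Fin s → K)} {κ : β → Fin s → K} {M : Fin r → Fin n → β}
    {x : Fin n → β} :
    x ∈ solSpace ψ κ M ↔ ∀ ρ, ∑ j, ∑ c, κ (M ρ j) c * ψ (x j) c = 0 := Iff.rfl

variable [NeZero s]

/-- The coordinates of a word, as one sequence. -/
def flatten (ψ : β ≃ₗ[K] (Fin s → K)) : (Fin n → β) →ₗ[K] (ℕ → K) where
  toFun x t := if h : t / s < n then ψ (x ⟨t / s, h⟩) ⟨t % s, Nat.mod_lt _ (NeZero.pos s)⟩ else 0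
  map_add' x y := by
    funext t
    by_cases h : t / s < n <;> simp [h]
  map_smul' a x := by
    funext t
    by_cases h : t / s < n <;> simp [h]

theorem block_div {j c : ℕ} (hc : c < s) : (j * s + c) / s = j := by
  rw [add_comm, Nat.add_mul_div_right _ _ (NeZero.pos s), Nat.div_eq_of_lt hc, zero_add]

theorem block_mod {s j c : ℕ} (hc : c < s) : (j * s + c) % s = c := by
  rw [add_comm, Nat.add_mul_mod_self_right, Nat.mod_eq_of_lt hc]

theorem flatten_apply (ψ : β ≃ₗ[K] (Fin s → K)) (x : Fin n → β) (j : Fin n) (c : Fin s) :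
    flatten ψ x (j * s + c) = ψ (x j) c := by
  have h1 := block_div (s := s) (j := j) c.2
  have h2 := block_mod (s := s) (j := j) c.2
  simp only [flatten, LinearMap.coe_mk, AddHom.coe_mk, h1, h2, j.2, dite_true]

theorem flatten_eq_zero (ψ : β ≃ₗ[K] (Fin s → K)) (x : Fin n → β) {t : ℕ} (h : n * s ≤ t) :
    flatten ψ x t = 0 := by
  have : ¬ t / s < n := by
    rw [not_lt, Nat.le_div_iff_mul_le (NeZero.pos s)]
    exact h
  simp [flatten, this]

theorem exists_flatten (ψ : β ≃ₗ[K] (Fin s → K)) {y : ℕ → K} (hy : ∀ t, y t ≠ 0 → t < n * s) :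
    ∃ x : Fin n → β, flatten ψ x = y ∧ ∀ j : Fin n, (∀ c < s, y (j * s + c) = 0) → x j = 0 := by
  refine ⟨fun j => ψ.symm fun c => y (j * s + c), ?_, ?_⟩
  · funext t
    by_cases h : t / s < n
    · simp [flatten, h, Nat.div_add_mod']
    · rw [flatten_eq_zero]
      · by_contra hne
        exact h ((Nat.div_lt_iff_lt_mul (NeZero.pos s)).2 (hy t (Ne.symm hne)))
      · rw [not_lt, Nat.le_div_iff_mul_le (NeZero.pos s)] at h
        exact h
  · intro j hj
    rw [LinearEquiv.map_eq_zero_iff]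
    funext c
    exact hj c c.2

theorem sum_range_mul_blocks {M : Type*} [AddCommMonoid M] (f : ℕ → M) (n s : ℕ) :
    ∑ t ∈ Finset.range (n * s), f t =
      ∑ j ∈ Finset.range n, ∑ c ∈ Finset.range s, f (j * s + c) := by
  induction n with
  | zero => simp
  | succ n ih => rw [Nat.succ_mul, Finset.sum_range_add, ih, Finset.sum_range_succ]

theorem dotFun_flatten (ψ : β ≃ₗ[K] (Fin s → K)) {h : ℕ → K} {a : Fin n → Fin s → K}
    (ha : ∀ (j : Fin n) (c : Fin s), h (j * s + c) = a j c) (x : Fin n → β) :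
    dotFun (n * s) h (flatten ψ x) = ∑ j, ∑ c, a j c * ψ (x j) c := by
  rw [dotFun_apply, sum_range_mul_blocks, Finset.sum_range]
  refine Finset.sum_congr rfl fun j _ => ?_
  rw [Finset.sum_range]
  refine Finset.sum_congr rfl fun c _ => ?_
  rw [ha, flatten_apply]

theorem blockWeight_flatten [DecidableEq β] (ψ : β ≃ₗ[K] (Fin s → K)) (x : Fin n → β) :
    RAM.blockWeight n s (flatten ψ x) = hammingNorm x := by
  classical
  have h : ∀ j : Fin n, (∃ c < s, flatten ψ x (j * s + c) ≠ 0) ↔ x j ≠ 0 := fun j => by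
    constructor
    · rintro ⟨c, hc, h⟩ h0
      exact h (by rw [flatten_apply ψ x j ⟨c, hc⟩, h0]; simp)
    · intro h
      by_contra hc
      push Not at hc
      refine h (ψ.map_eq_zero_iff.1 ?_)
      funext c
      rw [← flatten_apply]
      exact hc c c.2
  rw [RAM.blockWeight, hammingNorm]
  refine Finset.card_bij' (fun j hj => ⟨j, Finset.mem_range.1 (Finset.mem_filter.1 hj).1⟩)
    (fun j _ => j) ?_ ?_ ?_ ?_
  · intro j hj
    simp only [Finset.mem_filter, Finset.mem_univ, true_and]
    exact (h ⟨j, _⟩).1 (Finset.mem_filter.1 hj).2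
  · intro j hj
    simp only [Finset.mem_filter, Finset.mem_range]
    exact ⟨j.2, (h j).2 (Finset.mem_filter.1 hj).2⟩
  · intro j _; rfl
  · intro j _; rfl

end Words

/-! ### From input matrices to solution spaces -/

namespace RAM

section Input

variable {K β : Type} [Field K] {s n r : ℕ}

open Classical in
/-- The table of the coefficients `κ`. -/
noncomputable def coeffTable [NeZero s] (κ : β → Fin s → K) (label : β → ℕ) (u : ℕ) : K :=
  if h : ∃ b, label b = u / s then κ h.choose ⟨u % s, Nat.mod_lt _ (NeZero.pos s)⟩ else 0

theorem coeffTable_apply [NeZero s] (κ : β → Fin s → K) {label : β → ℕ} (hl : Function.Injective label) (b : β)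
    (c : Fin s) : coeffTable κ label (label b * s + c) = κ b c := by
  have h1 := block_div (s := s) (j := label b) c.2
  have h2 := block_mod (s := s) (j := label b) c.2
  have h : ∃ b', label b' = (label b * s + c) / s := ⟨b, h1.symm⟩
  have h3 : h.choose = b := hl (h.choose_spec.trans h1)
  rw [coeffTable, dif_pos h, h3]
  simp only [h2]

theorem input_entry (label : β → ℕ) (M : Fin r → Fin n → β) (ρ : Fin r) (j : Fin n) :
    input label M 1 (ρ * n + j) = label (M ρ j) := by
  have h1 : ((ρ : ℕ) * n + j) / n = ρ := by
    rw [add_comm, Nat.add_mul_div_right _ _ (by have := j.2; omega), Nat.div_eq_of_lt j.2, zero_add]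
  have h2 : ((ρ : ℕ) * n + j) % n = j := by
    rw [add_comm, Nat.add_mul_mod_self_right, Nat.mod_eq_of_lt j.2]
  simp only [input, h1, h2, ρ.2, true_and]
  rw [if_neg one_ne_zero, dif_pos (by have := j.2; omega)]

variable [NeZero s]

theorem coeffTable_input (κ : β → Fin s → K) {label : β → ℕ} (hl : Function.Injective label)
    (M : Fin r → Fin n → β) (ρ : Fin r) (j : Fin n) (c : Fin s) :
    coeffTable κ label (input label M 1 (ρ * n + (j * s + c) / s) * s + (j * s + c) % s) =
      κ (M ρ j) c := by
  rw [block_div c.2, block_mod c.2, input_entry, coeffTable_apply κ hl]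

variable [AddCommGroup β] [Module K β]

/-- One inclusion is enough, since only an upper bound for the dimension of the space on the left is
needed. -/
theorem map_flatten_solSpace (ψ : β ≃ₗ[K] (Fin s → K)) (κ : β → Fin s → K) {label : β → ℕ}
    (hl : Function.Injective label) (M : Fin r → Fin n → β) (T : Finset ℕ) :
    kerSpace n s r (fun ρ t => coeffTable κ label (input label M 1 (ρ * n + t / s) * s + t % s)) T ≤
      (solSpace ψ κ M ⊓ supportedOn K (Finset.univ.filter fun j : Fin n => (j : ℕ) ∈ T)).map
        (flatten ψ) := by
  intro y hy
  rw [mem_kerSpace] at hy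
  obtain ⟨x, rfl, hx⟩ := exists_flatten ψ fun t ht => (hy.1 t ht).1
  refine ⟨x, ⟨fun ρ => ?_, fun j hj => hx j fun c hc => ?_⟩, rfl⟩
  · rw [← dotFun_flatten ψ (h := fun t => coeffTable κ label
      (input label M 1 (ρ * n + t / s) * s + t % s)) (coeffTable_input κ hl M ρ) x]
    exact hy.2 ρ ρ.2
  · by_contra h
    have := (hy.1 _ h).2
    rw [block_div hc] at this
    exact hj (Finset.mem_filter.2 ⟨Finset.mem_univ _, this⟩)

theorem mem_kerSpace_univ (ψ : β ≃ₗ[K] (Fin s → K)) (κ : β → Fin s → K) {label : β → ℕ}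
    (hl : Function.Injective label) (M : Fin r → Fin n → β) {y : ℕ → K} :
    y ∈ kerSpace n s r (fun ρ t => coeffTable κ label (input label M 1 (ρ * n + t / s) * s + t % s))
      Set.univ ↔ ∃ x ∈ solSpace ψ κ M, flatten ψ x = y := by
  rw [mem_kerSpace]
  constructor
  · intro hy
    obtain ⟨x, rfl, hx⟩ := exists_flatten ψ fun t ht => (hy.1 t ht).1
    refine ⟨x, fun ρ => ?_, rfl⟩
    rw [← dotFun_flatten ψ (h := fun t => coeffTable κ label
      (input label M 1 (ρ * n + t / s) * s + t % s)) (coeffTable_input κ hl M ρ) x]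
    exact hy.2 ρ ρ.2
  · rintro ⟨x, hx, rfl⟩
    refine ⟨fun t ht => ⟨?_, Set.mem_univ _⟩, fun ρ hρ => ?_⟩
    · by_contra h
      exact ht (flatten_eq_zero ψ x (not_lt.1 h))
    · have := dotFun_flatten ψ (h := fun t => coeffTable κ label
        (input label M 1 (ρ * n + t / s) * s + t % s)) (coeffTable_input κ hl M ⟨ρ, hρ⟩) x
      exact this.trans (hx ⟨ρ, hρ⟩)

theorem dotFun_comm (N : ℕ) (x y : ℕ → K) : dotFun N x y = dotFun N y x := by
  simp only [dotFun_apply, mul_comm]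

/-- A functional vanishes on the generators computed by elimination if and only if it vanishes on
the space that they span, which is the solution space. The test by finitely many inner products is
therefore exact. -/
theorem kerFam_test_iff (ψ : β ≃ₗ[K] (Fin s → K)) (κ : β → Fin s → K) {label : β → ℕ}
    (hl : Function.Injective label) (M : Fin r → Fin n → β) (x : Fin n → β) :
    (∃ i < n * s, dotFun (n * s) (kerFam n s r (fun ρ t => coeffTable κ label
        (input label M 1 (ρ * n + t / s) * s + t % s)) Set.univ i) (flatten ψ x) ≠ 0) ↔
      ¬ ∀ y ∈ solSpace ψ κ M, ∑ j, ∑ c, ψ (x j) c * ψ (y j) c = 0 := by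
  have h := (isBasisFamily_kerFam (n := n) (s := s) (r := r) (fun ρ t => coeffTable κ label
    (input label M 1 (ρ * n + t / s) * s + t % s)) Set.univ).mem_iff
    (ψ := dotFun (n * s) (flatten ψ x))
  rw [show (∀ y ∈ solSpace ψ κ M, ∑ j, ∑ c, ψ (x j) c * ψ (y j) c = 0) ↔
    ∀ y ∈ kerSpace n s r (fun ρ t => coeffTable κ label
      (input label M 1 (ρ * n + t / s) * s + t % s)) Set.univ, dotFun (n * s) (flatten ψ x) y = 0 by
    constructor
    · intro h y hy
      obtain ⟨x', hx', rfl⟩ := (mem_kerSpace_univ ψ κ hl M).1 hy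
      rw [dotFun_flatten ψ (flatten_apply ψ x)]
      exact h x' hx'
    · intro h y hy
      rw [← dotFun_flatten ψ (flatten_apply ψ x)]
      exact h _ ((mem_kerSpace_univ ψ κ hl M).2 ⟨y, hy, rfl⟩), ← h]
  push Not
  simp only [dotFun_comm (n * s) (flatten ψ x)]

/-- The common form of both parts. Candidates solve the equations given by `κ₁`; the excluded set
`E` is recognized among them as the orthogonal complement, for the standard inner product of
coordinates, of the solutions for `κ₂`. The program is fixed before the length and the matrix. -/
theorem successProb_code [Fintype K] [Fintype β] [DecidableEq β] (ψ : β ≃ₗ[K] (Fin s → K))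
    (κ₁ κ₂ : β → Fin s → K) (label : β → ℕ) (hl : Function.Injective label) :
    ∃ (p : Prog) (C D : ℕ), ∀ (n r mm d t : ℕ) (M : Fin r → Fin n → β) (E : Set (Fin n → β))
      (x₀ : Fin n → β), 0 < n → 2 * n * n ≤ 2 ^ n → r ≤ n * s → mm = r / s + 1 → mm ≤ n → 1 ≤ d →
      d ≤ mm →
      (∀ x ∈ solSpace ψ κ₁ M,
        x ∈ E ↔ ∀ y ∈ solSpace ψ κ₂ M, ∑ j, ∑ c, ψ (x j) c * ψ (y j) c = 0) →
      (∀ x ∈ solSpace ψ κ₁ M, x ∉ E → d ≤ hammingNorm x) → x₀ ∈ solSpace ψ κ₁ M → x₀ ∉ E →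
      hammingNorm x₀ = d →
      (∀ J : Finset (Fin n), J.card = mm →
        Module.finrank K ↥(solSpace ψ κ₁ M ⊓ supportedOn K J) ≤ 4 * rootCount n) →
      C * (n + 1) ^ D * 2 ^ (4 * Fintype.card K * rootCount n) *
        (n.descFactorial d / mm.descFactorial d + 1) ≤ t →
      1 - Real.exp (-n) ≤ successProb p (input label M) d t := by
  obtain ⟨L, hL⟩ : ∃ L, ∀ b, label b < L :=
    ⟨Finset.univ.sup label + 1, fun b => Nat.lt_succ_of_le (Finset.le_sup (Finset.mem_univ b))⟩
  obtain ⟨C, D, h⟩ := successProb_mainProg (coeffTable κ₁ label) (coeffTable κ₂ label) L s (NeZero.pos s)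
  refine ⟨mainProg K (coeffTable κ₁ label) (coeffTable κ₂ label) L s, C, D, ?_⟩
  intro n r mm d t M E x₀ hn hn2 hr hmm hmn hd hdm hE hmin hx₀ hx₀E hw hker ht
  have hL1 : ∀ a i, a ≠ 0 → input label M a i < L := fun a i ha => by
    simp only [input, if_neg ha]
    split_ifs
    · exact hL _
    · exact (Nat.zero_le _).trans_lt (hL 0)
  refine h n r mm d t (input label M) _ _ (flatten ψ x₀) hn hn2 hr hmm hmn ?_ ?_
    (fun i => hL1 1 i one_ne_zero) (fun i => ?_) (fun a i => ?_) rfl rfl hd hdm ?_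
    ((mem_kerSpace_univ ψ κ₁ hl M).2 ⟨x₀, hx₀, rfl⟩) ?_ ?_ ?_ ht
  · simp [input]
  · simp [input]
  · simp [input]
  · by_cases ha : a = 0
    · subst ha
      simp only [input, if_true]
      split_ifs <;> omega
    · have := hL1 a i ha
      omega
  · intro y hy htest
    obtain ⟨x, hx, rfl⟩ := (mem_kerSpace_univ ψ κ₁ hl M).1 hy
    rw [kerFam_test_iff ψ κ₂ hl M, ← hE x hx] at htest
    rw [blockWeight_flatten]
    exact hmin x hx htest
  · rw [blockWeight_flatten, hw]
  · rw [kerFam_test_iff ψ κ₂ hl M, ← hE x₀ hx₀]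
    exact hx₀E
  · intro T hT hTc
    refine (Submodule.finrank_mono (map_flatten_solSpace ψ κ₁ hl M T)).trans
      ((Submodule.finrank_map_le _ _).trans (hker _ ?_))
    rw [← hTc]
    refine Finset.card_bij (fun j _ => (j : ℕ)) ?_ ?_ ?_
    · intro j hj; exact (Finset.mem_filter.1 hj).2
    · intro j _ j' _ h; exact Fin.ext h
    · intro j hj
      exact ⟨⟨j, Finset.mem_range.1 (hT hj)⟩, Finset.mem_filter.2 ⟨Finset.mem_univ _, hj⟩, rfl⟩

end Input

end RAM

/-! ## Counting linearly independent tuples and subspaces -/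

section Counting

variable {K V : Type} [Field K] [AddCommGroup V] [Module K V]

/-- The linear group acts transitively on independent tuples, so all of them lie in equally many
subspaces of a given dimension. -/
theorem LinearIndependent.exists_linearEquiv [Module.Finite K V] {t : ℕ} {v w : Fin t → V}
    (hv : LinearIndependent K v) (hw : LinearIndependent K w) :
    ∃ g : V ≃ₗ[K] V, ∀ i, g (v i) = w i := by
  let f := hv.linearCombinationEquiv.symm ≪≫ₗ hw.linearCombinationEquiv
  obtain ⟨g, hg⟩ := Submodule.exists_linearEquiv_restrict_eq f
  refine ⟨g, fun i => ?_⟩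
  have h1 : (hv.linearCombinationEquiv (Finsupp.single i 1) : V) = v i := by simp
  have h2 : (hw.linearCombinationEquiv (Finsupp.single i 1) : V) = w i := by simp
  rw [← h1, ← hg, ← h2]
  simp [f]

variable [Fintype V]

open Classical in
/-- The linearly independent tuples of elements of `U`. -/
noncomputable def liTuples (t : ℕ) (U : Submodule K V) : Finset (Fin t → V) :=
  Finset.univ.filter fun v => LinearIndependent K v ∧ ∀ i, v i ∈ U

theorem mem_liTuples {t : ℕ} {U : Submodule K V} {v : Fin t → V} :
    v ∈ liTuples t U ↔ LinearIndependent K v ∧ ∀ i, v i ∈ U := by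
  simp [liTuples]

theorem card_liTuples [Fintype K] (t : ℕ) (U : Submodule K V) :
    (liTuples t U).card =
      ∏ i ∈ Finset.range t, (Fintype.card K ^ Module.finrank K U - Fintype.card K ^ i) := by
  rcases le_or_gt t (Module.finrank K U) with h | h
  · classical
    rw [Finset.prod_range, ← card_linearIndependent h, Nat.card_eq_fintype_card, ← Finset.card_univ]
    symm
    refine Finset.card_bij (fun w _ i => (w.1 i : V)) ?_ ?_ ?_
    · intro w _
      exact mem_liTuples.2 ⟨w.2.map' U.subtype U.ker_subtype, fun i => (w.1 i).2⟩
    · intro w _ w' _ h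
      exact Subtype.ext (funext fun i => Subtype.ext (congrFun h i))
    · intro v hv
      obtain ⟨h1, h2⟩ := mem_liTuples.1 hv
      exact ⟨⟨fun i => ⟨v i, h2 i⟩, LinearIndependent.of_comp U.subtype h1⟩, Finset.mem_univ _, rfl⟩
  · have h0 : ∏ i ∈ Finset.range t,
        (Fintype.card K ^ Module.finrank K U - Fintype.card K ^ i) = 0 :=
      Finset.prod_eq_zero (Finset.mem_range.2 h) (Nat.sub_self _)
    rw [h0, Finset.card_eq_zero,
      Finset.eq_empty_iff_forall_notMem]
    intro v hv
    obtain ⟨h1, h2⟩ := mem_liTuples.1 hv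
    have h3 : LinearIndependent K fun i => (⟨v i, h2 i⟩ : U) :=
      LinearIndependent.of_comp U.subtype h1
    have := h3.fintype_card_le_finrank
    rw [Fintype.card_fin] at this
    omega

open Classical in
/-- The subspaces of dimension `k`. -/
noncomputable def subspaces (K V : Type) [Field K] [AddCommGroup V] [Module K V] [Fintype V] (k : ℕ) :
    Finset (Submodule K V) :=
  (Set.toFinite {C : Submodule K V | Module.finrank K C = k}).toFinset

theorem mem_subspaces {k : ℕ} {C : Submodule K V} :
    C ∈ subspaces K V k ↔ Module.finrank K C = k := by
  simp [subspaces]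

-- Double counting of the pairs of an independent tuple and a `k`-dimensional subspace containing
-- it: by transitivity the number of subspaces is the same for every tuple.
open Classical in
theorem card_subspaces_containing [Fintype K] (k : ℕ) {t : ℕ} {v : Fin t → V} (hv : LinearIndependent K v) :
    ((subspaces K V k).filter fun C => ∀ i, v i ∈ C).card *
        ∏ i ∈ Finset.range t, (Fintype.card K ^ Module.finrank K V - Fintype.card K ^ i) =
      (subspaces K V k).card *
        ∏ i ∈ Finset.range t, (Fintype.card K ^ k - Fintype.card K ^ i) := by
  have hconst : ∀ w ∈ liTuples t (⊤ : Submodule K V),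
      ((subspaces K V k).filter fun C => ∀ i, w i ∈ C).card =
        ((subspaces K V k).filter fun C => ∀ i, v i ∈ C).card := by
    intro w hw
    obtain ⟨g, hg⟩ := hv.exists_linearEquiv (mem_liTuples.1 hw).1
    symm
    refine Finset.card_bij (fun C _ => C.map g.toLinearMap) ?_ ?_ ?_
    · intro C hC
      obtain ⟨h1, h2⟩ := Finset.mem_filter.1 hC
      refine Finset.mem_filter.2 ⟨mem_subspaces.2 ?_, fun i => ?_⟩
      · rw [LinearEquiv.finrank_map_eq]
        exact mem_subspaces.1 h1
      · rw [← hg]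
        exact Submodule.mem_map_of_mem (h2 i)
    · intro C _ C' _ h
      exact Submodule.map_injective_of_injective g.injective h
    · intro C hC
      obtain ⟨h1, h2⟩ := Finset.mem_filter.1 hC
      refine ⟨C.map g.symm.toLinearMap, Finset.mem_filter.2 ⟨mem_subspaces.2 ?_, fun i => ?_⟩, ?_⟩
      · rw [LinearEquiv.finrank_map_eq]
        exact mem_subspaces.1 h1
      · refine ⟨w i, h2 i, ?_⟩
        rw [← hg]
        simp
      · rw [← Submodule.map_comp]
        simp
  have hdouble := Finset.sum_card_bipartiteAbove_eq_sum_card_bipartiteBelow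
    (s := liTuples t (⊤ : Submodule K V)) (t := subspaces K V k)
    (r := fun w C => ∀ i, w i ∈ C)
  have h1 : ∀ C ∈ subspaces K V k, ((liTuples t (⊤ : Submodule K V)).bipartiteBelow
      (fun w C => ∀ i, w i ∈ C) C).card =
        ∏ i ∈ Finset.range t, (Fintype.card K ^ k - Fintype.card K ^ i) := by
    intro C hC
    rw [← mem_subspaces.1 hC, ← card_liTuples]
    congr 1
    ext w
    simp [Finset.bipartiteBelow, mem_liTuples]
  unfold Finset.bipartiteAbove at hdouble
  rw [Finset.sum_congr rfl hconst, Finset.sum_congr rfl h1, Finset.sum_const, Finset.sum_const,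
    card_liTuples, finrank_top, smul_eq_mul, smul_eq_mul] at hdouble
  rw [mul_comm, hdouble]

/-- Factor by factor: multiplying `q ^ k - q ^ i` by `q ^ (n - k)` subtracts at least `q ^ i` from
`q ^ n`. Thus `t` independent vectors lie in a random subspace with probability at most `q ^ (-(n -
k) * t)`. -/
theorem prod_pow_sub_mul_le {q k n t : ℕ} (hq : 0 < q) (hkn : k ≤ n) :
    (∏ i ∈ Finset.range t, (q ^ k - q ^ i)) * q ^ ((n - k) * t) ≤
      ∏ i ∈ Finset.range t, (q ^ n - q ^ i) := by
  calc _ = ∏ i ∈ Finset.range t, (q ^ k - q ^ i) * q ^ (n - k) := by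
        rw [Finset.prod_mul_distrib, Finset.prod_const, Finset.card_range, pow_mul]
    _ ≤ _ := by
      refine Finset.prod_le_prod' fun i _ => ?_
      rw [Nat.sub_mul, ← pow_add, Nat.add_sub_cancel' hkn]
      exact Nat.sub_le_sub_left (Nat.le_mul_of_pos_right _ (by positivity)) _

open Classical in
theorem card_subspaces_containing_mul_le [Fintype K] {k : ℕ} (hk : k ≤ Module.finrank K V) {t : ℕ}
    {v : Fin t → V} (hv : LinearIndependent K v) :
    ((subspaces K V k).filter fun C => ∀ i, v i ∈ C).card *
        Fintype.card K ^ ((Module.finrank K V - k) * t) ≤ (subspaces K V k).card := by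
  have h1 := card_subspaces_containing k hv
  have h2 := prod_pow_sub_mul_le (t := t) (Fintype.card_pos (α := K)) hk
  have ht : t ≤ Module.finrank K V := by
    simpa using hv.fintype_card_le_finrank
  have hpos : 0 < ∏ i ∈ Finset.range t, (Fintype.card K ^ Module.finrank K V - Fintype.card K ^ i) :=
    Finset.prod_pos fun i hi => Nat.sub_pos_of_lt (Nat.pow_lt_pow_right Fintype.one_lt_card
      ((Finset.mem_range.1 hi).trans_le ht))
  refine Nat.le_of_mul_le_mul_right ?_ hpos
  calc _ = ((subspaces K V k).card * ∏ i ∈ Finset.range t, (Fintype.card K ^ k - Fintype.card K ^ i)) *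
        Fintype.card K ^ ((Module.finrank K V - k) * t) := by rw [← h1]; ring
    _ ≤ _ := by rw [mul_assoc]; exact Nat.mul_le_mul_left _ h2

-- Markov's inequality for the number of independent `t`-tuples in `D c ⊓ U`. In dimension f ≥ `B` ≥
-- `t` there are at least `q ^ ((B - 1) * t)` of them, because q^f - q^i ≥ q^(f-1) for i < f; in
-- total `U` has at most `q ^ (finrank U * t)`, each lying in at most `Y` of the spaces.
open Classical in
theorem card_filter_finrank_le [Fintype K] {ι : Type*} (X : Finset ι) (D : ι → Submodule K V)
    (U : Submodule K V) {t B Y : ℕ} (ht : t ≤ B)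
    (hf : ∀ v : Fin t → V, LinearIndependent K v → (X.filter fun c => ∀ i, v i ∈ D c).card ≤ Y) :
    (X.filter fun c => B ≤ Module.finrank K ↥(D c ⊓ U)).card * Fintype.card K ^ ((B - 1) * t) ≤
      Fintype.card K ^ (Module.finrank K U * t) * Y := by
  set q := Fintype.card K with hqK
  have hq : 2 ≤ q := Fintype.one_lt_card
  have hdouble := Finset.sum_card_bipartiteAbove_eq_sum_card_bipartiteBelow
    (s := liTuples t U) (t := X.filter fun c => B ≤ Module.finrank K ↥(D c ⊓ U))
    (r := fun w c => ∀ i, w i ∈ D c)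
  have h1 : ∀ c ∈ X.filter fun c => B ≤ Module.finrank K ↥(D c ⊓ U), q ^ ((B - 1) * t) ≤
      ((liTuples t U).bipartiteBelow (fun w c => ∀ i, w i ∈ D c) c).card := by
    intro c hc
    have hB := (Finset.mem_filter.1 hc).2
    have h2 : (liTuples t U).bipartiteBelow (fun w c => ∀ i, w i ∈ D c) c = liTuples t (D c ⊓ U) := by
      ext w
      simp only [Finset.bipartiteBelow, Finset.mem_filter, mem_liTuples, Submodule.mem_inf,
        forall_and]
      tauto
    rw [h2, card_liTuples, ← hqK, pow_mul]
    calc (q ^ (B - 1)) ^ t = ∏ _i ∈ Finset.range t, q ^ (B - 1) := by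
          rw [Finset.prod_const, Finset.card_range]
      _ ≤ _ := by
        refine Finset.prod_le_prod' fun i hi => ?_
        have hi' := Finset.mem_range.1 hi
        have h3 : q ^ i ≤ q ^ (Module.finrank K ↥(D c ⊓ U) - 1) :=
          Nat.pow_le_pow_right (by omega) (by omega)
        have h4 : q ^ (B - 1) ≤ q ^ (Module.finrank K ↥(D c ⊓ U) - 1) :=
          Nat.pow_le_pow_right (by omega) (by omega)
        have h5 : q ^ Module.finrank K ↥(D c ⊓ U) = q ^ (Module.finrank K ↥(D c ⊓ U) - 1) * q := by
          rw [← pow_succ]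
          congr 1
          omega
        have h6 := Nat.mul_le_mul_left (q ^ (Module.finrank K ↥(D c ⊓ U) - 1)) hq
        omega
  have h2 : ∀ w ∈ liTuples t U, ((X.filter fun c => B ≤ Module.finrank K ↥(D c ⊓ U)).bipartiteAbove
      (fun w c => ∀ i, w i ∈ D c) w).card ≤ Y := by
    intro w hw
    refine le_trans (Finset.card_le_card fun c hc => ?_) (hf w (mem_liTuples.1 hw).1)
    simp only [Finset.bipartiteAbove, Finset.mem_filter] at hc
    exact Finset.mem_filter.2 ⟨hc.1.1, hc.2⟩
  have h3 : (liTuples t U).card ≤ q ^ (Module.finrank K U * t) := by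
    rw [card_liTuples, pow_mul]
    calc _ ≤ ∏ _i ∈ Finset.range t, q ^ Module.finrank K U :=
          Finset.prod_le_prod' fun i _ => Nat.sub_le _ _
      _ = _ := by rw [Finset.prod_const, Finset.card_range]
  calc _ = ∑ _c ∈ X.filter fun c => B ≤ Module.finrank K ↥(D c ⊓ U), q ^ ((B - 1) * t) := by
        rw [Finset.sum_const, smul_eq_mul]
    _ ≤ _ := Finset.sum_le_sum h1
    _ = _ := hdouble.symm
    _ ≤ ∑ _w ∈ liTuples t U, Y := Finset.sum_le_sum h2
    _ = (liTuples t U).card * Y := by rw [Finset.sum_const, smul_eq_mul]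
    _ ≤ _ := Nat.mul_le_mul_right _ h3

end Counting

/-! ### Words supported on few coordinates form small subspaces of almost every code -/

section Supports

variable {K β : Type} [Field K] [AddCommGroup β] [Module K β] [Fintype β] {n : ℕ}

theorem finrank_supportedOn_le (J : Finset (Fin n)) :
    Module.finrank K (supportedOn K J : Submodule K (Fin n → β)) ≤ J.card * Module.finrank K β := by
  let f : (supportedOn K J : Submodule K (Fin n → β)) →ₗ[K] (J → β) :=
    (LinearMap.funLeft K β (Subtype.val : J → Fin n)).comp (Submodule.subtype _)
  have hf : Function.Injective f := by
    rw [injective_iff_map_eq_zero]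
    intro x hx
    ext j
    by_cases hj : j ∈ J
    · exact congrFun hx ⟨j, hj⟩
    · exact x.2 j hj
  have := LinearMap.finrank_le_finrank_of_injective hf
  rwa [Module.finrank_pi_fintype, Finset.sum_const, Finset.card_univ, Fintype.card_coe,
    smul_eq_mul] at this

-- The moment argument with tuples of length `t`, about the square root of `n`. For one set J,
-- dimension `4 * t + 1` gains `q ^ (4 * t * t)`, the hypothesis on tuples loses `q ^ (2 * (t * t) +
-- 2)`, and the dimension of the space of supported words, at most `r + 2`, loses a further `q ^ (2
-- * t)`. Of the remaining `q ^ (2 * (t * t))` the union over at most `2 ^ n ≤ q ^ (t * t)` sets J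
-- uses up half the exponent.
open Classical in
theorem card_bad_supports_le [Fintype K] {ι : Type*} (X : Finset ι) (D : ι → Submodule K (Fin n → β))
    {r mm t : ℕ} (hmm : mm * Module.finrank K β ≤ r + 2)
    (hn : n ≤ t * t)
    (hf : ∀ v : Fin t → Fin n → β, LinearIndependent K v →
      (X.filter fun c => ∀ i, v i ∈ D c).card * Fintype.card K ^ (r * t) ≤
        X.card * Fintype.card K ^ (2 * (t * t) + 2)) :
    (X.filter fun c => ∃ J : Finset (Fin n), J.card = mm ∧
        4 * t + 1 ≤ Module.finrank K ↥(D c ⊓ supportedOn K J)).card * Fintype.card K ^ (t * t) ≤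
      X.card * Fintype.card K ^ (2 * t + 2) := by
  set q := Fintype.card K
  have hq : 2 ≤ q := Fintype.one_lt_card
  have hJ : ∀ J : Finset (Fin n), J.card = mm →
      (X.filter fun c => 4 * t + 1 ≤ Module.finrank K ↥(D c ⊓ supportedOn K J)).card *
        q ^ (2 * (t * t)) ≤ X.card * q ^ (2 * t + 2) := by
    intro J hJ
    have h1 := card_filter_finrank_le X D (supportedOn K J) (t := t) (B := 4 * t + 1)
      (Y := X.card * q ^ (2 * (t * t) + 2) / q ^ (r * t)) (by omega) fun v hv => by
        rw [Nat.le_div_iff_mul_le (by positivity)]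
        convert hf v hv
    have h2 : Module.finrank K (supportedOn K J : Submodule K (Fin n → β)) ≤ r + 2 := by
      refine (finrank_supportedOn_le J).trans ?_
      rw [hJ]
      exact hmm
    set P := (X.filter fun c => 4 * t + 1 ≤ Module.finrank K ↥(D c ⊓ supportedOn K J)).card with hP
    have h3 : P * q ^ ((4 * t + 1 - 1) * t) * q ^ (r * t) ≤
        q ^ ((r + 2) * t) * (X.card * q ^ (2 * (t * t) + 2)) := by
      calc _ ≤ q ^ (Module.finrank K (supportedOn K J : Submodule K (Fin n → β)) * t) *
            (X.card * q ^ (2 * (t * t) + 2) / q ^ (r * t)) * q ^ (r * t) :=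
            Nat.mul_le_mul_right _ (by convert h1)
        _ ≤ q ^ ((r + 2) * t) * (X.card * q ^ (2 * (t * t) + 2)) := by
            rw [mul_assoc]
            refine Nat.mul_le_mul (Nat.pow_le_pow_right (by omega) (Nat.mul_le_mul_right _ h2)) ?_
            exact Nat.div_mul_le_self _ _
    refine Nat.le_of_mul_le_mul_right (c := q ^ (2 * (t * t)) * q ^ (r * t)) ?_ (by positivity)
    calc _ = P * q ^ ((4 * t + 1 - 1) * t) * q ^ (r * t) := by
          rw [Nat.add_sub_cancel]; ring
      _ ≤ _ := h3
      _ = _ := by ring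
  have hunion : (X.filter fun c => ∃ J : Finset (Fin n), J.card = mm ∧
        4 * t + 1 ≤ Module.finrank K ↥(D c ⊓ supportedOn K J)) ⊆
      (Finset.univ.filter fun J : Finset (Fin n) => J.card = mm).biUnion fun J =>
        X.filter fun c => 4 * t + 1 ≤ Module.finrank K ↥(D c ⊓ supportedOn K J) := by
    intro c hc
    obtain ⟨h1, J, h2, h3⟩ := Finset.mem_filter.1 hc
    exact Finset.mem_biUnion.2 ⟨J, by simpa using h2, Finset.mem_filter.2 ⟨h1, h3⟩⟩
  have hcard : (Finset.univ.filter fun J : Finset (Fin n) => J.card = mm).card ≤ q ^ (t * t) := by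
    refine (Finset.card_le_univ _).trans ?_
    rw [Fintype.card_finset, Fintype.card_fin]
    exact (Nat.pow_le_pow_left hq n).trans (Nat.pow_le_pow_right (by omega) hn)
  refine Nat.le_of_mul_le_mul_right (c := q ^ (t * t)) ?_ (by positivity)
  calc _ = (X.filter fun c => ∃ J : Finset (Fin n), J.card = mm ∧
        4 * t + 1 ≤ Module.finrank K ↥(D c ⊓ supportedOn K J)).card * q ^ (2 * (t * t)) := by ring
    _ ≤ (∑ J ∈ Finset.univ.filter fun J : Finset (Fin n) => J.card = mm,
        (X.filter fun c => 4 * t + 1 ≤ Module.finrank K ↥(D c ⊓ supportedOn K J)).card) *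
          q ^ (2 * (t * t)) :=
        Nat.mul_le_mul_right _ ((Finset.card_le_card hunion).trans Finset.card_biUnion_le)
    _ = ∑ J ∈ Finset.univ.filter fun J : Finset (Fin n) => J.card = mm,
        (X.filter fun c => 4 * t + 1 ≤ Module.finrank K ↥(D c ⊓ supportedOn K J)).card *
          q ^ (2 * (t * t)) := Finset.sum_mul _ _ _
    _ ≤ ∑ _J ∈ Finset.univ.filter fun J : Finset (Fin n) => J.card = mm, X.card * q ^ (2 * t + 2) :=
        Finset.sum_le_sum fun J hJ' => hJ J (by simpa using hJ')
    _ = (Finset.univ.filter fun J : Finset (Fin n) => J.card = mm).card * (X.card * q ^ (2 * t + 2)) := by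
        rw [Finset.sum_const, smul_eq_mul]
    _ ≤ q ^ (t * t) * (X.card * q ^ (2 * t + 2)) := Nat.mul_le_mul_right _ hcard
    _ = _ := by ring

end Supports

/-! ## Counting isotropic tuples -/

section Potential

/-- The weight of a partial tuple of `i` vectors whose span meets the given `t`-dimensional space in
dimension `a`. -/
def potential (n r t i a : ℕ) : ℕ := 2 ^ (a * (r - i)) * 2 ^ (2 * t * (t - a)) * (2 ^ (n + 1) - 2 ^ i)

/-- This explains the three factors of `potential`. The `c₀` extensions outside S + W leave `a`
unchanged. Their number may exceed `2 ^ (2 * n - i - t)` by the factor `2 ^ a`, and this is paid by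
the decrease of `2 ^ (a * (r - i))`. The `c₁` extensions inside S + W increase `a` by one; they are
few, and the drop of the second factor by `2 ^ (2 * t)` makes their contribution fit into the gap `2
^ i` between the last factors at `i` and `i + 1`. -/
theorem potential_step {n r t i a D c₀ c₁ : ℕ} (hir : i < r) (hrn : r ≤ n) (hD : D + a = i + t)
    (h₀ : (c₀ + c₁) * 2 ^ D ≤ 2 ^ (2 * n)) (h₁ : c₁ ≤ 2 ^ D) (ha : c₁ ≠ 0 → a < t) :
    (c₀ * potential n r t (i + 1) a + c₁ * potential n r t (i + 1) (a + 1)) * 2 ^ (i + t) ≤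
      2 ^ (2 * n) * potential n r t i a := by
  obtain ⟨e, rfl⟩ : ∃ e, r = i + 1 + e := ⟨r - (i + 1), by omega⟩
  obtain ⟨z, hz⟩ : ∃ z, 2 ^ (n + 1) = z + 2 ^ (i + 1) := ⟨2 ^ (n + 1) - 2 ^ (i + 1), by
    have : 2 ^ (i + 1) ≤ 2 ^ (n + 1) := Nat.pow_le_pow_right (by omega) (by omega)
    omega⟩
  have hz1 : 2 ^ (n + 1) - 2 ^ (i + 1) = z := by omega
  have hz2 : 2 ^ (n + 1) - 2 ^ i = z + 2 ^ i := by
    have h2 : 2 ^ (i + 1) = 2 * 2 ^ i := by ring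
    rw [h2] at hz
    rw [hz]
    omega
  have hzn : z ≤ 2 ^ (n + 1) := hz ▸ Nat.le_add_right _ _
  have e1 : i + 1 + e - (i + 1) = e := by omega
  have e2 : i + 1 + e - i = e + 1 := by omega
  simp only [potential, hz1, hz2, e1, e2]
  have hfirst : (c₀ * (2 ^ (a * e) * 2 ^ (2 * t * (t - a)) * z)) * 2 ^ (i + t) ≤
      2 ^ (2 * n) * (2 ^ (a * (e + 1)) * 2 ^ (2 * t * (t - a)) * z) := by
    have h2 : c₀ * 2 ^ D ≤ 2 ^ (2 * n) := (Nat.mul_le_mul_right _ (by omega)).trans h₀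
    calc _ = (c₀ * 2 ^ D) * (2 ^ (a * (e + 1)) * 2 ^ (2 * t * (t - a)) * z) := by
          rw [← hD, mul_add, mul_one, pow_add, pow_add]; ring
      _ ≤ _ := Nat.mul_le_mul_right _ h2
  have hsecond : (c₁ * (2 ^ ((a + 1) * e) * 2 ^ (2 * t * (t - (a + 1))) * z)) * 2 ^ (i + t) ≤
      2 ^ (2 * n) * (2 ^ (a * (e + 1)) * 2 ^ (2 * t * (t - a)) * 2 ^ i) := by
    by_cases hc : c₁ = 0
    · simp [hc]
    · obtain ⟨f, rfl⟩ : ∃ f, t = a + 1 + f := ⟨t - (a + 1), by have := ha hc; omega⟩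
      have e3 : a + 1 + f - (a + 1) = f := by omega
      have e4 : a + 1 + f - a = f + 1 := by omega
      rw [e3, e4]
      calc _ ≤ (2 ^ D * (2 ^ ((a + 1) * e) * 2 ^ (2 * (a + 1 + f) * f) * 2 ^ (n + 1))) *
            2 ^ (i + (a + 1 + f)) := by gcongr
        _ = 2 ^ (D + ((a + 1) * e + 2 * (a + 1 + f) * f + (n + 1)) + (i + (a + 1 + f))) := by
            simp only [pow_add]
        _ ≤ 2 ^ (2 * n + (a * (e + 1) + 2 * (a + 1 + f) * (f + 1) + i)) := by
            refine Nat.pow_le_pow_right (by omega) ?_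
            have e5 : (a + 1) * e = a * e + e := by ring
            have e6 : a * (e + 1) = a * e + a := by ring
            have e7 : 2 * (a + 1 + f) * (f + 1) = 2 * (a + 1 + f) * f + 2 * (a + 1 + f) := by ring
            omega
        _ = _ := by simp only [pow_add]
  calc _ = (c₀ * (2 ^ (a * e) * 2 ^ (2 * t * (t - a)) * z)) * 2 ^ (i + t) +
        (c₁ * (2 ^ ((a + 1) * e) * 2 ^ (2 * t * (t - (a + 1))) * z)) * 2 ^ (i + t) := by ring
    _ ≤ _ := add_le_add hfirst hsecond
    _ = _ := by ring

end Potential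

/-! ### Isotropic tuples and spaces of an alternating form over the field with two elements -/

section Isotropic

variable {V : Type} [AddCommGroup V] [Module (ZMod 2) V]

variable {B : LinearMap.BilinForm (ZMod 2) V} {W : Submodule (ZMod 2) V}

theorem span_range_cons {i : ℕ} (x : V) (g : Fin i → V) :
    Submodule.span (ZMod 2) (Set.range (Fin.cons x g : Fin (i + 1) → V)) =
      Submodule.span (ZMod 2) {x} ⊔ Submodule.span (ZMod 2) (Set.range g) := by
  rw [Fin.range_cons, Submodule.span_insert]

/-- Since the form is alternating, a new vector is orthogonal to itself and only has to be compared
with the old span and with `W`. -/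
theorem span_sup_le_orthogonal_iff (hB : B.IsAlt) {S : Submodule (ZMod 2) V} {x : V} :
    Submodule.span (ZMod 2) {x} ⊔ S ≤ B.orthogonal (Submodule.span (ZMod 2) {x} ⊔ S ⊔ W) ↔
      S ≤ B.orthogonal (S ⊔ W) ∧ x ∈ B.orthogonal (S ⊔ W) := by
  constructor
  · intro h
    have h1 : B.orthogonal (Submodule.span (ZMod 2) {x} ⊔ S ⊔ W) ≤ B.orthogonal (S ⊔ W) :=
      LinearMap.BilinForm.orthogonal_le (sup_le_sup_right le_sup_right _)
    exact ⟨le_sup_right.trans (h.trans h1),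
      h1 (h (le_sup_left (a := Submodule.span (ZMod 2) {x}) (Submodule.mem_span_singleton_self x)))⟩
  · rintro ⟨hS, hx⟩
    refine sup_le ?_ ?_
    · rw [Submodule.span_singleton_le_iff_mem, sup_assoc]
      intro w hw
      obtain ⟨u, hu, y, hy, rfl⟩ := Submodule.mem_sup.1 hw
      obtain ⟨α, rfl⟩ := Submodule.mem_span_singleton.1 hu
      have h1 : B y x = 0 := hx y hy
      have h2 : B x x = 0 := hB x
      change B (α • x + y) x = 0
      simp [h1, h2]
    · intro s hs
      rw [sup_assoc]
      intro w hw
      obtain ⟨u, hu, y, hy, rfl⟩ := Submodule.mem_sup.1 hw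
      obtain ⟨α, rfl⟩ := Submodule.mem_span_singleton.1 hu
      have h1 : B y s = 0 := hS hs y hy
      have h2 : B x s = 0 := hB.isRefl s x (hx s (le_sup_left (a := S) hs))
      change B (α • x + y) s = 0
      simp [h1, h2]

variable [Fintype V]

open Classical in
theorem card_filter_mem_submodule (U : Submodule (ZMod 2) V) :
    (Finset.univ.filter fun x => x ∈ U).card = 2 ^ Module.finrank (ZMod 2) U := by
  have h : Nat.card U = 2 ^ Module.finrank (ZMod 2) U := by
    rw [Module.natCard_eq_pow_finrank (K := ZMod 2), Nat.card_zmod]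
  rw [← h, Nat.card_eq_fintype_card, Fintype.card_subtype]

theorem finrank_span_singleton_sup {U : Submodule (ZMod 2) V} {x : V} (hx : x ∉ U) :
    Module.finrank (ZMod 2) ↥(Submodule.span (ZMod 2) {x} ⊔ U) = Module.finrank (ZMod 2) U + 1 := by
  have hx0 : x ≠ 0 := fun h => hx (h ▸ U.zero_mem)
  have h1 := Submodule.finrank_sup_add_finrank_inf_eq (Submodule.span (ZMod 2) {x}) U
  have h2 : Submodule.span (ZMod 2) {x} ⊓ U = ⊥ :=
    ((Submodule.disjoint_span_singleton' hx0).2 hx).symm.eq_bot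
  rw [h2, finrank_bot, finrank_span_singleton hx0] at h1
  omega

open Classical in
/-- The linearly independent tuples with isotropic span that are orthogonal to `W`. -/
noncomputable def isoTuples (B : LinearMap.BilinForm (ZMod 2) V) (W : Submodule (ZMod 2) V) (i : ℕ) :
    Finset (Fin i → V) :=
  Finset.univ.filter fun g => LinearIndependent (ZMod 2) g ∧
    Submodule.span (ZMod 2) (Set.range g) ≤ B.orthogonal (Submodule.span (ZMod 2) (Set.range g) ⊔ W)

theorem mem_isoTuples {i : ℕ} {g : Fin i → V} : g ∈ isoTuples B W i ↔
    LinearIndependent (ZMod 2) g ∧ Submodule.span (ZMod 2) (Set.range g) ≤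
      B.orthogonal (Submodule.span (ZMod 2) (Set.range g) ⊔ W) := by
  simp [isoTuples]

open Classical in
/-- The vectors that extend an isotropic tuple with span `S`. -/
noncomputable def extensions (B : LinearMap.BilinForm (ZMod 2) V) (W S : Submodule (ZMod 2) V) :
    Finset V :=
  Finset.univ.filter fun x => x ∈ B.orthogonal (S ⊔ W) ∧ x ∉ S

theorem mem_extensions {S : Submodule (ZMod 2) V} {x : V} :
    x ∈ extensions B W S ↔ x ∈ B.orthogonal (S ⊔ W) ∧ x ∉ S := by
  simp [extensions]

theorem sum_isoTuples_succ (hB : B.IsAlt) (i : ℕ) (F : Submodule (ZMod 2) V → ℕ) :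
    ∑ g ∈ isoTuples B W (i + 1), F (Submodule.span (ZMod 2) (Set.range g)) =
      ∑ g ∈ isoTuples B W i, ∑ x ∈ extensions B W (Submodule.span (ZMod 2) (Set.range g)),
        F (Submodule.span (ZMod 2) {x} ⊔ Submodule.span (ZMod 2) (Set.range g)) := by
  rw [Finset.sum_sigma']
  have key : ∀ (x : V) (g : Fin i → V), (Fin.cons x g : Fin (i + 1) → V) ∈ isoTuples B W (i + 1) ↔
      g ∈ isoTuples B W i ∧ x ∈ extensions B W (Submodule.span (ZMod 2) (Set.range g)) := by
    intro x g
    rw [mem_isoTuples, mem_isoTuples, mem_extensions, span_range_cons, span_sup_le_orthogonal_iff hB,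
      linearIndependent_finCons]
    tauto
  refine Finset.sum_bij' (fun g _ => ⟨Fin.tail g, g 0⟩) (fun p _ => Fin.cons p.2 p.1) ?_ ?_ ?_ ?_ ?_
  · intro g hg
    rw [← Fin.cons_self_tail g, key] at hg
    exact Finset.mem_sigma.2 hg
  · intro p hp
    exact (key _ _).2 (Finset.mem_sigma.1 hp)
  · intro g _
    exact Fin.cons_self_tail g
  · intro p _
    rfl
  · intro g _
    rw [← span_range_cons, Fin.cons_self_tail]

/-- By the dimension formula, adding `x` enlarges the intersection of the span with `W` exactly when
`x` already lies in `S ⊔ W`. So the extensions split into two classes with constant potential. All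
of them lie in the orthogonal space of `S ⊔ W`, which bounds their total number. -/
theorem sum_potential_extensions_le (hB' : B.Nondegenerate) {n r i : ℕ}
    (hV : Module.finrank (ZMod 2) V = 2 * n) (hir : i < r) (hrn : r ≤ n) {S : Submodule (ZMod 2) V}
    (hS : Module.finrank (ZMod 2) S = i) :
    (∑ x ∈ extensions B W S, potential n r (Module.finrank (ZMod 2) W) (i + 1)
        (Module.finrank (ZMod 2) ↥((Submodule.span (ZMod 2) {x} ⊔ S) ⊓ W))) *
        2 ^ (i + Module.finrank (ZMod 2) W) ≤
      2 ^ (2 * n) * potential n r (Module.finrank (ZMod 2) W) i (Module.finrank (ZMod 2) ↥(S ⊓ W)) := by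
  classical
  set t := Module.finrank (ZMod 2) W with ht
  set a := Module.finrank (ZMod 2) ↥(S ⊓ W) with ha
  set D := Module.finrank (ZMod 2) ↥(S ⊔ W) with hD
  have hDa : D + a = i + t := by
    rw [← hS]
    exact Submodule.finrank_sup_add_finrank_inf_eq S W
  have hdim : ∀ x ∈ extensions B W S, Module.finrank (ZMod 2) ↥((Submodule.span (ZMod 2) {x} ⊔ S) ⊓ W) =
      if x ∈ S ⊔ W then a + 1 else a := by
    intro x hx
    have h1 := Submodule.finrank_sup_add_finrank_inf_eq (Submodule.span (ZMod 2) {x} ⊔ S) W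
    rw [finrank_span_singleton_sup (mem_extensions.1 hx).2, hS, sup_assoc] at h1
    split_ifs with h
    · rw [sup_eq_right.2 ((Submodule.span_singleton_le_iff_mem _ _).2 h)] at h1
      omega
    · rw [finrank_span_singleton_sup h] at h1
      omega
  rw [Finset.sum_congr rfl fun x hx => by rw [hdim x hx]]
  rw [← Finset.sum_filter_add_sum_filter_not (extensions B W S) (fun x => x ∈ S ⊔ W)]
  rw [Finset.sum_congr rfl (g := fun _ => potential n r t (i + 1) (a + 1)) fun x hx => by
    rw [if_pos (Finset.mem_filter.1 hx).2]]
  rw [Finset.sum_congr (s₁ := (extensions B W S).filter fun x => ¬ x ∈ S ⊔ W) rfl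
    (g := fun _ => potential n r t (i + 1) a) fun x hx => by
    rw [if_neg (Finset.mem_filter.1 hx).2]]
  rw [Finset.sum_const, Finset.sum_const, smul_eq_mul, smul_eq_mul, add_comm]
  refine potential_step hir hrn hDa ?_ ?_ ?_
  · rw [add_comm, Finset.card_filter_add_card_filter_not]
    have h1 : (extensions B W S).card ≤ 2 ^ (2 * n - D) := by
      rw [← hV, hD, ← LinearMap.BilinForm.finrank_orthogonal hB', ← card_filter_mem_submodule]
      refine Finset.card_le_card fun x hx => ?_
      simpa using (mem_extensions.1 hx).1
    have hDn : D ≤ 2 * n := hV ▸ Submodule.finrank_le _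
    calc _ ≤ 2 ^ (2 * n - D) * 2 ^ D := Nat.mul_le_mul_right _ h1
      _ = _ := by rw [← pow_add, Nat.sub_add_cancel hDn]
  · rw [hD, ← card_filter_mem_submodule]
    refine Finset.card_le_card fun x hx => ?_
    simpa using (Finset.mem_filter.1 hx).2
  · intro hne
    obtain ⟨x, hx⟩ := Finset.card_pos.1 (Nat.pos_of_ne_zero hne)
    obtain ⟨h1, h2⟩ := Finset.mem_filter.1 hx
    have h3 := hdim x h1
    rw [if_pos h2] at h3
    have h4 : Module.finrank (ZMod 2) ↥((Submodule.span (ZMod 2) {x} ⊔ S) ⊓ W) ≤ t :=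
      Submodule.finrank_mono inf_le_right
    omega

theorem sum_potential_le (hB : B.IsAlt) (hB' : B.Nondegenerate) {n r : ℕ}
    (hV : Module.finrank (ZMod 2) V = 2 * n) (hrn : r ≤ n) {i : ℕ} (hir : i ≤ r) :
    (∑ g ∈ isoTuples B W i, potential n r (Module.finrank (ZMod 2) W) i
        (Module.finrank (ZMod 2) ↥(Submodule.span (ZMod 2) (Set.range g) ⊓ W))) *
        ∏ j ∈ Finset.range i, 2 ^ (j + Module.finrank (ZMod 2) W) ≤
      (2 ^ (2 * n)) ^ i * potential n r (Module.finrank (ZMod 2) W) 0 0 := by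
  set t := Module.finrank (ZMod 2) W with ht
  induction i with
  | zero =>
    have h : ∀ g ∈ isoTuples B W 0, potential n r t 0
        (Module.finrank (ZMod 2) ↥(Submodule.span (ZMod 2) (Set.range g) ⊓ W)) = potential n r t 0 0 := by
      intro g _
      rw [Set.range_eq_empty, Submodule.span_empty, bot_inf_eq, finrank_bot]
    rw [Finset.sum_congr rfl h, Finset.sum_const, smul_eq_mul]
    have hc : (isoTuples B W 0).card ≤ 1 := by
      refine (Finset.card_le_univ _).trans ?_
      simp
    simpa using Nat.mul_le_mul_right (potential n r t 0 0) hc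
  | succ i ih =>
    have hsum := sum_isoTuples_succ (W := W) hB i fun S => potential n r t (i + 1)
      (Module.finrank (ZMod 2) ↥(S ⊓ W))
    rw [hsum, Finset.prod_range_succ, mul_comm (∏ j ∈ Finset.range i, 2 ^ (j + t)), ← mul_assoc,
      Finset.sum_mul]
    calc _ ≤ (∑ g ∈ isoTuples B W i, 2 ^ (2 * n) * potential n r t i
          (Module.finrank (ZMod 2) ↥(Submodule.span (ZMod 2) (Set.range g) ⊓ W))) *
            ∏ j ∈ Finset.range i, 2 ^ (j + t) := by
          refine Nat.mul_le_mul_right _ (Finset.sum_le_sum fun g hg => ?_)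
          refine sum_potential_extensions_le hB' hV hir hrn ?_
          rw [finrank_span_eq_card (mem_isoTuples.1 hg).1, Fintype.card_fin]
      _ = 2 ^ (2 * n) * ((∑ g ∈ isoTuples B W i, potential n r t i
          (Module.finrank (ZMod 2) ↥(Submodule.span (ZMod 2) (Set.range g) ⊓ W))) *
            ∏ j ∈ Finset.range i, 2 ^ (j + t)) := by rw [← Finset.mul_sum]; ring
      _ ≤ 2 ^ (2 * n) * ((2 ^ (2 * n)) ^ i * potential n r t 0 0) :=
          Nat.mul_le_mul_left _ (ih (by omega))
      _ = _ := by ring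

/-- An isotropic span `S` of dimension `i` lies in its orthogonal space of dimension `2 * n - i`,
and the extensions are the vectors of the difference. -/
theorem card_isoTuples_succ (hB : B.IsAlt) (hB' : B.Nondegenerate) {n : ℕ}
    (hV : Module.finrank (ZMod 2) V = 2 * n) (i : ℕ) :
    (isoTuples B ⊥ (i + 1)).card = (isoTuples B ⊥ i).card * (2 ^ (2 * n - i) - 2 ^ i) := by
  classical
  have h := sum_isoTuples_succ (W := ⊥) hB i fun _ => 1
  rw [Finset.sum_const, smul_eq_mul, mul_one] at h
  rw [h, ← smul_eq_mul, ← Finset.sum_const]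
  refine Finset.sum_congr rfl fun g hg => ?_
  obtain ⟨h1, h2⟩ := mem_isoTuples.1 hg
  set S := Submodule.span (ZMod 2) (Set.range g) with hS
  have hSi : Module.finrank (ZMod 2) S = i := by
    rw [hS, finrank_span_eq_card h1, Fintype.card_fin]
  rw [Finset.sum_const, smul_eq_mul, mul_one]
  have h3 : extensions B ⊥ S = (Finset.univ.filter fun x => x ∈ B.orthogonal S) \
      (Finset.univ.filter fun x => x ∈ S) := by
    ext x
    simp [mem_extensions]
  rw [sup_bot_eq] at h2
  rw [h3, Finset.card_sdiff_of_subset, card_filter_mem_submodule, card_filter_mem_submodule,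
    LinearMap.BilinForm.finrank_orthogonal hB', hV, hSi]
  intro x hx
  simp only [Finset.mem_filter, Finset.mem_univ, true_and] at hx ⊢
  exact h2 hx

/-- Each step loses the fraction `2 ^ (2 * i - 2 * n)` of the vectors orthogonal to the span. The
accumulated loss is kept below `2 ^ i / 2 ^ (n + 1)`, hence below one half, by an induction
hypothesis that carries this explicit correction. -/
theorem card_isoTuples_ge (hB : B.IsAlt) (hB' : B.Nondegenerate) {n : ℕ}
    (hV : Module.finrank (ZMod 2) V = 2 * n) {i : ℕ} (hi : i ≤ n) :
    (2 ^ (2 * n)) ^ i * (2 ^ (n + 1) - 2 ^ i) ≤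
      (isoTuples B ⊥ i).card * (∏ j ∈ Finset.range i, 2 ^ j) * 2 ^ (n + 1) := by
  induction i with
  | zero =>
    have hc : (isoTuples B ⊥ 0).card = 1 := by
      refine le_antisymm ((Finset.card_le_univ _).trans (by simp)) (Finset.card_pos.2
        ⟨Fin.elim0, mem_isoTuples.2 ⟨linearIndependent_empty_type, ?_⟩⟩)
      rw [Set.range_eq_empty, Submodule.span_empty]
      exact bot_le
    simp [hc]
  | succ i ih =>
    have ih := ih (by omega)
    rw [card_isoTuples_succ hB hB' hV, Finset.prod_range_succ]
    obtain ⟨e, rfl⟩ : ∃ e, n = i + 1 + e := ⟨n - (i + 1), by omega⟩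
    have e1 : 2 * (i + 1 + e) - i = i + 2 + 2 * e := by omega
    rw [e1, pow_succ (2 ^ (2 * (i + 1 + e))) i]
    set P := 2 ^ i with hP
    set E := 2 ^ e with hE
    set Q := ∏ j ∈ Finset.range i, 2 ^ j
    set N := (isoTuples B ⊥ i).card
    set X := (2 ^ (2 * (i + 1 + e))) ^ i
    clear_value X
    have hP1 : 1 ≤ P := Nat.one_le_two_pow
    have hE1 : 1 ≤ E := Nat.one_le_two_pow
    have p1 : 2 ^ (i + 1 + e + 1) = 4 * P * E := by rw [hP, hE]; ring
    have p2 : 2 ^ (i + 2 + 2 * e) = 4 * P * (E * E) := by rw [hP, hE]; ring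
    have p3 : 2 ^ (2 * (i + 1 + e)) = 4 * P * P * (E * E) := by rw [hP, hE]; ring
    have p4 : 2 ^ (i + 1) = 2 * P := by rw [hP]; ring
    rw [p1] at ih ⊢
    rw [p2, p3, p4]
    have s1 : 4 * P * E - P = P * (4 * E - 1) := by
      rw [Nat.mul_sub]; congr 1 <;> ring
    have s2 : 4 * P * E - 2 * P = P * (4 * E - 2) := by
      rw [Nat.mul_sub]; congr 1 <;> ring
    have s3 : 4 * P * (E * E) - P = P * (4 * (E * E) - 1) := by
      rw [Nat.mul_sub]; congr 1 <;> ring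
    rw [s1] at ih
    rw [s2, s3]
    -- With E = 2^e, the right side exceeds the left side by (2E - 1)².
    have key : 4 * (E * E) * (4 * E - 2) ≤ (4 * E - 1) * (4 * (E * E) - 1) := by
      obtain ⟨f, hf⟩ : ∃ f, E = f + 1 := ⟨E - 1, by omega⟩
      have k1 : 4 * E - 2 = 4 * f + 2 := by omega
      have k2 : 4 * E - 1 = 4 * f + 3 := by omega
      have k3 : 4 * (E * E) - 1 = 4 * f * f + 8 * f + 3 := by rw [hf]; ring_nf; omega
      rw [k1, k2, k3, hf]
      nlinarith [Nat.zero_le (f * f), Nat.zero_le (f * f * f)]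
    calc X * (4 * P * P * (E * E)) * (P * (4 * E - 2))
        = X * (P * P * P) * (4 * (E * E) * (4 * E - 2)) := by ring
      _ ≤ X * (P * P * P) * ((4 * E - 1) * (4 * (E * E) - 1)) := Nat.mul_le_mul_left _ key
      _ = (X * (P * (4 * E - 1))) * (P * P * (4 * (E * E) - 1)) := by ring
      _ ≤ (N * Q * (4 * P * E)) * (P * P * (4 * (E * E) - 1)) := Nat.mul_le_mul_right _ ih
      _ = _ := by ring

/-- The isotropic tuples orthogonal to a space of dimension `t` are a small part of all of them. -/
theorem card_isoTuples_mul_le (hB : B.IsAlt) (hB' : B.Nondegenerate) {n r : ℕ}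
    (hV : Module.finrank (ZMod 2) V = 2 * n) (hrn : r ≤ n) :
    (isoTuples B W r).card * 2 ^ (r * Module.finrank (ZMod 2) W) ≤
      (isoTuples B ⊥ r).card *
        2 ^ (2 * (Module.finrank (ZMod 2) W * Module.finrank (ZMod 2) W) + 2) := by
  set t := Module.finrank (ZMod 2) W with ht
  have h1 := sum_potential_le (W := W) hB hB' hV hrn le_rfl
  have h2 := card_isoTuples_ge hB hB' hV hrn
  have hsub : 2 ^ n ≤ 2 ^ (n + 1) - 2 ^ r := by
    have := Nat.pow_le_pow_right (n := 2) (by omega) hrn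
    rw [pow_succ]
    omega
  -- At the end of the process the potential is at least its last factor, whatever the dimension of
  -- the intersection with `W` is.
  have h3 : (isoTuples B W r).card * 2 ^ n ≤ ∑ g ∈ isoTuples B W r, potential n r t r
      (Module.finrank (ZMod 2) ↥(Submodule.span (ZMod 2) (Set.range g) ⊓ W)) := by
    rw [← smul_eq_mul, ← Finset.sum_const]
    refine Finset.sum_le_sum fun g _ => ?_
    unfold potential
    exact hsub.trans (Nat.le_mul_of_pos_left _ (by positivity))
  have h4 : potential n r t 0 0 ≤ 2 ^ (2 * (t * t)) * 2 ^ (n + 1) := by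
    unfold potential
    rw [zero_mul, pow_zero, one_mul, Nat.sub_zero, mul_assoc 2 t t]
    exact Nat.mul_le_mul_left _ (Nat.sub_le _ _)
  rw [← ht] at h1
  have h5 : ∏ j ∈ Finset.range r, 2 ^ (j + t) = (∏ j ∈ Finset.range r, 2 ^ j) * 2 ^ (r * t) := by
    simp only [pow_add, Finset.prod_mul_distrib, Finset.prod_const, Finset.card_range]
    rw [mul_comm r t, pow_mul]
  set Q := ∏ j ∈ Finset.range r, 2 ^ j with hQ
  have hQ0 : 0 < Q := Finset.prod_pos fun j _ => by positivity
  set X := (2 ^ (2 * n)) ^ r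
  refine Nat.le_of_mul_le_mul_right (c := Q * 2 ^ n) ?_ (by positivity)
  calc _ = ((isoTuples B W r).card * 2 ^ n) * (Q * 2 ^ (r * t)) := by ring
    _ ≤ X * potential n r t 0 0 := by
        rw [← h5]
        exact (Nat.mul_le_mul_right _ h3).trans h1
    _ ≤ X * (2 ^ (2 * (t * t)) * (2 * (2 ^ (n + 1) - 2 ^ r))) := by
        refine Nat.mul_le_mul_left _ (h4.trans (Nat.mul_le_mul_left _ ?_))
        rw [pow_succ, mul_comm]
        rw [pow_succ] at hsub
        omega
    _ = 2 ^ (2 * (t * t)) * 2 * (X * (2 ^ (n + 1) - 2 ^ r)) := by ring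
    _ ≤ 2 ^ (2 * (t * t)) * 2 * ((isoTuples B ⊥ r).card * Q * 2 ^ (n + 1)) := Nat.mul_le_mul_left _ h2
    _ = _ := by ring

open Classical in
/-- The isotropic subspaces of dimension `r`. -/
noncomputable def isoSpaces (B : LinearMap.BilinForm (ZMod 2) V) (r : ℕ) :
    Finset (Submodule (ZMod 2) V) :=
  (subspaces (ZMod 2) V r).filter fun C => C ≤ B.orthogonal C

theorem mem_isoSpaces {r : ℕ} {C : Submodule (ZMod 2) V} :
    C ∈ isoSpaces B r ↔ Module.finrank (ZMod 2) C = r ∧ C ≤ B.orthogonal C := by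
  simp [isoSpaces, mem_subspaces]

-- Grouping tuples by their span: every isotropic space of dimension `r` that is orthogonal to `W`
-- is counted once for each of its ordered bases.
open Classical in
theorem card_isoTuples_eq (hB : B.IsAlt) (r : ℕ) :
    (isoTuples B W r).card = ((isoSpaces B r).filter fun C => W ≤ B.orthogonal C).card *
      ∏ i ∈ Finset.range r, (2 ^ r - 2 ^ i) := by
  have hle : ∀ C : Submodule (ZMod 2) V, C ≤ B.orthogonal (C ⊔ W) ↔
      C ≤ B.orthogonal C ∧ W ≤ B.orthogonal C := by
    intro C
    constructor
    · intro h
      refine ⟨h.trans (LinearMap.BilinForm.orthogonal_le le_sup_left), fun w hw c hc => ?_⟩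
      exact hB.isRefl w c (h hc w (le_sup_right (a := C) hw))
    · rintro ⟨h1, h2⟩ c hc u hu
      obtain ⟨c', hc', w, hw, rfl⟩ := Submodule.mem_sup.1 hu
      have h3 : B c' c = 0 := h1 hc c' hc'
      have h4 : B w c = 0 := hB.isRefl c w (h2 hw c hc)
      change B (c' + w) c = 0
      simp [h3, h4]
  rw [Finset.card_eq_sum_card_fiberwise (f := fun g => Submodule.span (ZMod 2) (Set.range g))
    (t := (isoSpaces B r).filter fun C => W ≤ B.orthogonal C)]
  · rw [← smul_eq_mul, ← Finset.sum_const]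
    refine Finset.sum_congr rfl fun C hC => ?_
    obtain ⟨h1, h2⟩ := Finset.mem_filter.1 hC
    obtain ⟨h3, h4⟩ := mem_isoSpaces.1 h1
    have h5 := card_liTuples r C
    rw [h3, ZMod.card] at h5
    rw [← h5]
    congr 1
    ext g
    rw [Finset.mem_filter, mem_isoTuples, mem_liTuples]
    constructor
    · rintro ⟨⟨h6, -⟩, rfl⟩
      exact ⟨h6, fun i => Submodule.subset_span (Set.mem_range_self i)⟩
    · rintro ⟨h6, h7⟩
      have h8 : Submodule.span (ZMod 2) (Set.range g) = C :=
        Submodule.eq_of_le_of_finrank_eq (Submodule.span_le.2 (by rintro _ ⟨i, rfl⟩; exact h7 i))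
          (by rw [finrank_span_eq_card h6, Fintype.card_fin, h3])
      refine ⟨⟨h6, ?_⟩, h8⟩
      rw [h8, hle]
      exact ⟨h4, h2⟩
  · intro g hg
    obtain ⟨h1, h2⟩ := mem_isoTuples.1 hg
    rw [hle] at h2
    refine Finset.mem_filter.2 ⟨mem_isoSpaces.2 ⟨?_, h2.1⟩, h2.2⟩
    rw [finrank_span_eq_card h1, Fintype.card_fin]

open Classical in
theorem card_isoSpaces_containing_mul_le (hB : B.IsAlt) (hB' : B.Nondegenerate) {n r t : ℕ}
    (hV : Module.finrank (ZMod 2) V = 2 * n) (hrn : r ≤ n) {v : Fin t → V}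
    (hv : LinearIndependent (ZMod 2) v) :
    ((isoSpaces B r).filter fun C => ∀ i, v i ∈ B.orthogonal C).card * 2 ^ (r * t) ≤
      (isoSpaces B r).card * 2 ^ (2 * (t * t) + 2) := by
  have h := card_isoTuples_mul_le (W := Submodule.span (ZMod 2) (Set.range v)) hB hB' hV hrn
  rw [card_isoTuples_eq hB, card_isoTuples_eq hB, finrank_span_eq_card hv, Fintype.card_fin] at h
  have h1 : ((isoSpaces B r).filter fun C => ∀ i, v i ∈ B.orthogonal C) =
      (isoSpaces B r).filter fun C => Submodule.span (ZMod 2) (Set.range v) ≤ B.orthogonal C := by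
    refine Finset.filter_congr fun C _ => ?_
    rw [Submodule.span_le, Set.range_subset_iff]
    rfl
  have h2 : ((isoSpaces B r).filter fun C => ⊥ ≤ B.orthogonal C) = isoSpaces B r := by simp
  rw [h2] at h
  rw [h1]
  refine Nat.le_of_mul_le_mul_right (c := ∏ i ∈ Finset.range r, (2 ^ r - 2 ^ i)) ?_
    (Finset.prod_pos fun i hi => Nat.sub_pos_of_lt (Nat.pow_lt_pow_right (by omega)
      (Finset.mem_range.1 hi)))
  calc _ = _ := by ring
    _ ≤ _ := h
    _ = _ := by ring

theorem isoSpaces_nonempty (hB : B.IsAlt) (hB' : B.Nondegenerate) {n r : ℕ}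
    (hV : Module.finrank (ZMod 2) V = 2 * n) (hrn : r ≤ n) : (isoSpaces B r).Nonempty := by
  classical
  have h1 := card_isoTuples_ge hB hB' hV hrn
  have h2 : 0 < 2 ^ (n + 1) - 2 ^ r := Nat.sub_pos_of_lt (Nat.pow_lt_pow_right (by omega) (by omega))
  have h3 : (isoTuples B ⊥ r).card ≠ 0 := by
    intro h
    rw [h, zero_mul, zero_mul] at h1
    have : 0 < (2 ^ (2 * n)) ^ r * (2 ^ (n + 1) - 2 ^ r) := by positivity
    omega
  rw [card_isoTuples_eq hB] at h3
  have h4 : ((isoSpaces B r).filter fun C => ⊥ ≤ B.orthogonal C).card ≠ 0 := fun h => h3 (by rw [h, zero_mul])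
  obtain ⟨C, hC⟩ := Finset.card_pos.1 (Nat.pos_of_ne_zero h4)
  exact ⟨C, (Finset.mem_filter.1 hC).1⟩

end Isotropic

/-! ## Singleton bounds -/

section Supports

variable {K β : Type} [Field K] [AddCommGroup β] [Module K β] {n : ℕ}

theorem finrank_supportedOn [Fintype β] (J : Finset (Fin n)) :
    Module.finrank K (supportedOn K J : Submodule K (Fin n → β)) = J.card * Module.finrank K β := by
  refine le_antisymm (finrank_supportedOn_le J) ?_
  let f : (J → β) →ₗ[K] (Fin n → β) :=
    { toFun := fun y j => if h : j ∈ J then y ⟨j, h⟩ else 0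
      map_add' := fun y z => by ext j; by_cases h : j ∈ J <;> simp [h]
      map_smul' := fun a y => by ext j; by_cases h : j ∈ J <;> simp [h] }
  have hf : Function.Injective f := by
    intro y z hyz
    ext ⟨j, hj⟩
    have := congrFun hyz j
    simpa [f, hj] using this
  have h1 := LinearMap.finrank_range_of_inj hf
  rw [Module.finrank_pi_fintype, Finset.sum_const, Finset.card_univ, Fintype.card_coe,
    smul_eq_mul] at h1
  rw [← h1]
  refine Submodule.finrank_mono ?_
  rintro _ ⟨y, rfl⟩ j hj
  simp [f, hj]

theorem hammingNorm_le_of_mem_supportedOn [DecidableEq β] {J : Finset (Fin n)} {x : Fin n → β}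
    (hx : x ∈ supportedOn K J) : hammingNorm x ≤ J.card := by
  refine Finset.card_le_card fun j hj => ?_
  by_contra h
  exact (Finset.mem_filter.1 hj).2 (hx j h)

end Supports

theorem exists_card_eq {n m : ℕ} (h : m ≤ n) : ∃ J : Finset (Fin n), J.card = m := by
  obtain ⟨J, -, hJ⟩ := Finset.exists_subset_card_eq
    (show m ≤ (Finset.univ : Finset (Fin n)).card by simpa using h)
  exact ⟨J, hJ⟩

/-- The Singleton bound. -/
theorem exists_mem_hammingNorm_le {K : Type} [Field K] [Fintype K] [DecidableEq K] {n k : ℕ}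
    (hk : 1 ≤ k) (hkn : k ≤ n) {C : Submodule K (Fin n → K)} (hC : Module.finrank K C = k) :
    ∃ c ∈ C, c ≠ 0 ∧ hammingNorm c ≤ n - k + 1 := by
  obtain ⟨J, hJ⟩ := exists_card_eq (show n - k + 1 ≤ n by omega)
  have h1 := Submodule.finrank_sup_add_finrank_inf_eq C (supportedOn K J)
  have h2 := Submodule.finrank_le (C ⊔ supportedOn K J)
  rw [finrank_supportedOn, hC, hJ, Module.finrank_self] at h1
  rw [Module.finrank_fin_fun] at h2
  have h3 : C ⊓ supportedOn K J ≠ ⊥ := by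
    intro h
    rw [h, finrank_bot] at h1
    omega
  obtain ⟨c, hc, hc0⟩ := Submodule.exists_mem_ne_zero_of_ne_bot h3
  exact ⟨c, hc.1, hc0, hJ ▸ hammingNorm_le_of_mem_supportedOn hc.2⟩

theorem codeDistance_spec {K : Type} [Field K] [Fintype K] [DecidableEq K] {n k : ℕ}
    (hk : 1 ≤ k) (hkn : k ≤ n) {C : Submodule K (Fin n → K)} (hC : Module.finrank K C = k) :
    1 ≤ codeDistance C ∧ codeDistance C ≤ n - k + 1 ∧
      (∀ c ∈ C, c ≠ 0 → codeDistance C ≤ hammingNorm c) ∧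
      ∃ c ∈ C, c ≠ 0 ∧ hammingNorm c = codeDistance C := by
  obtain ⟨c, hc, hc0, hcw⟩ := exists_mem_hammingNorm_le hk hkn hC
  have hmin : ∀ c ∈ C, c ≠ 0 → codeDistance C ≤ hammingNorm c := fun c h h' =>
    Nat.sInf_le ⟨c, h, h', rfl⟩
  have hne : {w | ∃ c ∈ C, c ≠ 0 ∧ hammingNorm c = w}.Nonempty := ⟨_, c, hc, hc0, rfl⟩
  obtain ⟨c', h1, h2, h3⟩ := Nat.sInf_mem hne
  refine ⟨?_, (hmin c hc hc0).trans hcw, hmin, c', h1, h2, h3⟩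
  change 1 ≤ sInf _
  rw [← h3]
  exact hammingNorm_pos_iff.2 h2

/-! ### The trace form, and the Singleton bound for stabilizer codes -/

section Pauli

variable {n : ℕ}

/-- The trace inner product as a bilinear form. -/
def pauliForm (n : ℕ) : LinearMap.BilinForm (ZMod 2) (PauliVec n) :=
  LinearMap.mk₂ (ZMod 2) tracePairing
    (fun e e' f => by
      simp only [tracePairing, Pi.add_apply, Prod.fst_add, Prod.snd_add, ← Finset.sum_add_distrib]
      exact Finset.sum_congr rfl fun i _ => by ring)
    (fun c e f => by
      simp only [tracePairing, Pi.smul_apply, Prod.smul_fst, Prod.smul_snd, smul_eq_mul,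
        Finset.mul_sum]
      exact Finset.sum_congr rfl fun i _ => by ring)
    (fun e f f' => by
      simp only [tracePairing, Pi.add_apply, Prod.fst_add, Prod.snd_add, ← Finset.sum_add_distrib]
      exact Finset.sum_congr rfl fun i _ => by ring)
    (fun c e f => by
      simp only [tracePairing, Pi.smul_apply, Prod.smul_fst, Prod.smul_snd, smul_eq_mul,
        Finset.mul_sum]
      exact Finset.sum_congr rfl fun i _ => by ring)

/-- The standard inner product of the coordinates. -/
def coordForm (n : ℕ) : LinearMap.BilinForm (ZMod 2) (PauliVec n) :=
  LinearMap.mk₂ (ZMod 2) (fun e f => ∑ i, ((e i).1 * (f i).1 + (e i).2 * (f i).2))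
    (fun e e' f => by
      simp only [Pi.add_apply, Prod.fst_add, Prod.snd_add, ← Finset.sum_add_distrib]
      exact Finset.sum_congr rfl fun i _ => by ring)
    (fun c e f => by
      simp only [Pi.smul_apply, Prod.smul_fst, Prod.smul_snd, smul_eq_mul, Finset.mul_sum]
      exact Finset.sum_congr rfl fun i _ => by ring)
    (fun e f f' => by
      simp only [Pi.add_apply, Prod.fst_add, Prod.snd_add, ← Finset.sum_add_distrib]
      exact Finset.sum_congr rfl fun i _ => by ring)
    (fun c e f => by
      simp only [Pi.smul_apply, Prod.smul_fst, Prod.smul_snd, smul_eq_mul, Finset.mul_sum]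
      exact Finset.sum_congr rfl fun i _ => by ring)

theorem pauliForm_apply (e f : PauliVec n) : pauliForm n e f = tracePairing e f := rfl

theorem coordForm_apply (e f : PauliVec n) :
    coordForm n e f = ∑ i, ((e i).1 * (f i).1 + (e i).2 * (f i).2) := rfl

theorem pauliForm_isAlt : (pauliForm n).IsAlt := by
  intro e
  rw [pauliForm_apply, tracePairing]
  refine Finset.sum_eq_zero fun i _ => ?_
  rw [mul_comm (e i).2]
  exact CharTwo.add_self_eq_zero _

theorem coordForm_isRefl : (coordForm n).IsRefl := by
  intro e f h
  rw [coordForm_apply] at h ⊢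
  rw [← h]
  exact Finset.sum_congr rfl fun i _ => by ring

theorem pauliForm_single_fst (e : PauliVec n) (i : Fin n) :
    pauliForm n (Pi.single i (1, 0)) e = (e i).2 := by
  rw [pauliForm_apply, tracePairing, Finset.sum_eq_single i]
  · simp
  · intro j _ hj
    simp [Pi.single_eq_of_ne hj]
  · simp

theorem pauliForm_single_snd (e : PauliVec n) (i : Fin n) :
    pauliForm n (Pi.single i (0, 1)) e = (e i).1 := by
  rw [pauliForm_apply, tracePairing, Finset.sum_eq_single i]
  · simp
  · intro j _ hj
    simp [Pi.single_eq_of_ne hj]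
  · simp

theorem coordForm_single_fst (e : PauliVec n) (i : Fin n) :
    coordForm n (Pi.single i (1, 0)) e = (e i).1 := by
  rw [coordForm_apply, Finset.sum_eq_single i]
  · simp
  · intro j _ hj
    simp [Pi.single_eq_of_ne hj]
  · simp

theorem coordForm_single_snd (e : PauliVec n) (i : Fin n) :
    coordForm n (Pi.single i (0, 1)) e = (e i).2 := by
  rw [coordForm_apply, Finset.sum_eq_single i]
  · simp
  · intro j _ hj
    simp [Pi.single_eq_of_ne hj]
  · simp

theorem pauliForm_nondegenerate : (pauliForm n).Nondegenerate := by
  rw [LinearMap.BilinForm.Nondegenerate, pauliForm_isAlt.isRefl.nondegenerate_iff_separatingRight]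
  intro e h
  ext i
  · rw [← pauliForm_single_snd]; exact h _
  · rw [← pauliForm_single_fst]; exact h _

theorem coordForm_nondegenerate : (coordForm n).Nondegenerate := by
  rw [LinearMap.BilinForm.Nondegenerate, coordForm_isRefl.nondegenerate_iff_separatingRight]
  intro e h
  ext i
  · rw [← coordForm_single_fst]; exact h _
  · rw [← coordForm_single_snd]; exact h _

theorem mem_traceDual {C : Submodule (ZMod 2) (PauliVec n)} {e : PauliVec n} :
    e ∈ traceDual C ↔ e ∈ (pauliForm n).orthogonal C := by
  rw [LinearMap.BilinForm.mem_orthogonal_iff]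
  constructor
  · intro h f hf
    exact pauliForm_isAlt.isRefl e f (h f hf)
  · intro h f hf
    exact pauliForm_isAlt.isRefl f e (h f hf)

theorem mem_stabilizerCodes {k : ℕ} {C : Submodule (ZMod 2) (PauliVec n)} :
    C ∈ stabilizerCodes n k ↔ C ∈ isoSpaces (pauliForm n) (n - k) := by
  rw [mem_isoSpaces]
  refine and_congr_right fun _ => ⟨fun h x hx => mem_traceDual.1 (h hx), fun h x hx =>
    mem_traceDual.2 (h hx)⟩

theorem finrank_pauli : Module.finrank (ZMod 2) (ZMod 2 × ZMod 2) = 2 := by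
  rw [Module.finrank_prod, Module.finrank_self]

theorem finrank_pauliVec : Module.finrank (ZMod 2) (PauliVec n) = 2 * n := by
  rw [Module.finrank_pi_fintype, Finset.sum_const, Finset.card_univ, Fintype.card_fin, finrank_pauli,
    smul_eq_mul, mul_comm]

/-- Orthogonality to the two single-qubit operators X and Z at a position forces the entry there to
vanish. The point is that the dimension of the left side follows from nondegeneracy. -/
theorem orthogonal_sup_supportedOn_le (C : Submodule (ZMod 2) (PauliVec n)) (J : Finset (Fin n)) :
    (pauliForm n).orthogonal (C ⊔ supportedOn (ZMod 2) Jᶜ) ≤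
      (pauliForm n).orthogonal C ⊓ supportedOn (ZMod 2) J := by
  intro e he
  refine ⟨LinearMap.BilinForm.orthogonal_le le_sup_left he, fun i hi => ?_⟩
  have h1 : ∀ a, (Pi.single i a : PauliVec n) ∈ C ⊔ supportedOn (ZMod 2) Jᶜ := fun a => by
    refine le_sup_right (a := C) (fun j hj => ?_)
    refine Pi.single_eq_of_ne (fun h => hj ?_) _
    rw [h, Finset.mem_compl]
    exact hi
  ext
  · rw [← pauliForm_single_snd]; exact he _ (h1 _)
  · rw [← pauliForm_single_fst]; exact he _ (h1 _)

/-- The Singleton bound for stabilizer codes. -/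
theorem exists_mem_orthogonal_hammingNorm_le {r : ℕ} (hr : r < n)
    {C : Submodule (ZMod 2) (PauliVec n)} (hC : Module.finrank (ZMod 2) C = r) :
    ∃ e ∈ (pauliForm n).orthogonal C, e ∉ C ∧ hammingNorm e ≤ r / 2 + 1 := by
  by_contra hcon
  push Not at hcon
  -- If all small words of the dual belonged to `C`, then the dual and `C` would have the same words
  -- supported on `J`. The first space has dimension at least 2|J| - r plus the dimension of the
  -- words of `C` that vanish on `J`, among which are those supported on `A`.
  have key : ∀ A J : Finset (Fin n), J.card ≤ r / 2 + 1 → Disjoint A J →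
      2 * J.card + Module.finrank (ZMod 2) ↥(C ⊓ supportedOn (ZMod 2) A) ≤
        r + Module.finrank (ZMod 2) ↥(C ⊓ supportedOn (ZMod 2) J) := by
    intro A J hJ hAJ
    have h1 := Submodule.finrank_mono (orthogonal_sup_supportedOn_le C J)
    have h2 : (pauliForm n).orthogonal C ⊓ supportedOn (ZMod 2) J ≤ C ⊓ supportedOn (ZMod 2) J := by
      rintro e ⟨he, heJ⟩
      refine ⟨?_, heJ⟩
      by_contra hne
      have h3 := hcon e he hne
      have h4 := hammingNorm_le_of_mem_supportedOn heJ
      omega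
    have h3 := h1.trans (Submodule.finrank_mono h2)
    rw [LinearMap.BilinForm.finrank_orthogonal pauliForm_nondegenerate, finrank_pauliVec] at h3
    have h4 := Submodule.finrank_sup_add_finrank_inf_eq C (supportedOn (ZMod 2) Jᶜ)
    rw [finrank_supportedOn, finrank_pauli, hC, Finset.card_compl, Fintype.card_fin] at h4
    have h5 : Module.finrank (ZMod 2) ↥(C ⊓ supportedOn (ZMod 2) A) ≤
        Module.finrank (ZMod 2) ↥(C ⊓ supportedOn (ZMod 2) Jᶜ) := by
      refine Submodule.finrank_mono (inf_le_inf_left _ fun e he j hj => he j fun hA => hj ?_)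
      rw [Finset.mem_compl]
      exact Finset.disjoint_left.1 hAJ hA
    have h6 : J.card ≤ n := by simpa using J.card_le_univ
    omega
  -- `J` is taken as large as allowed and disjoint from `A`, so that |A| + |J| > r. Applying `key`
  -- in both orders and adding cancels the dimensions and gives |A| + |J| ≤ r, a contradiction.
  obtain ⟨A, hA⟩ := exists_card_eq (show r / 2 + 1 ≤ n by omega)
  obtain ⟨J, hJA, hJ⟩ := Finset.exists_subset_card_eq
    (show min (r / 2 + 1) (n - (r / 2 + 1)) ≤ (Aᶜ).card by
      rw [Finset.card_compl, Fintype.card_fin, hA]; omega)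
  have hd : Disjoint A J := (Finset.disjoint_left.2 fun j hj hj' =>
    Finset.mem_compl.1 (hJA hj') hj)
  have h1 := key A J (by omega) hd
  have h2 := key J A (by omega) hd.symm
  omega

theorem stabilizerDistance_spec {r : ℕ} (hr : r < n)
    {C : Submodule (ZMod 2) (PauliVec n)} (hC : Module.finrank (ZMod 2) C = r) :
    1 ≤ stabilizerDistance C ∧ stabilizerDistance C ≤ r / 2 + 1 ∧
      (∀ e ∈ (pauliForm n).orthogonal C, e ∉ C → stabilizerDistance C ≤ hammingNorm e) ∧
      ∃ e ∈ (pauliForm n).orthogonal C, e ∉ C ∧ hammingNorm e = stabilizerDistance C := by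
  obtain ⟨c, hc, hc0, hcw⟩ := exists_mem_orthogonal_hammingNorm_le hr hC
  have hmin : ∀ e ∈ (pauliForm n).orthogonal C, e ∉ C → stabilizerDistance C ≤ hammingNorm e :=
    fun e h h' => Nat.sInf_le ⟨e, mem_traceDual.2 h, h', rfl⟩
  have hne : {w | ∃ e ∈ traceDual C, e ∉ C ∧ hammingNorm e = w}.Nonempty :=
    ⟨_, c, mem_traceDual.2 hc, hc0, rfl⟩
  obtain ⟨c', h1, h2, h3⟩ := Nat.sInf_mem hne
  refine ⟨?_, (hmin c hc hc0).trans hcw, hmin, c', mem_traceDual.1 h1, h2, h3⟩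
  change 1 ≤ sInf _
  rw [← h3]
  refine hammingNorm_pos_iff.2 fun h => h2 ?_
  rw [h]
  exact C.zero_mem

end Pauli

/-! ### The two programs, and the rarity of codes with large shortenings -/

namespace RAM

theorem le_rootCount_sq (n : ℕ) : n ≤ rootCount n * rootCount n := by
  by_contra h
  push Not at h
  have h1 : Finset.range (rootCount n + 1) ⊆ (Finset.range n).filter fun i => i * i < n := by
    intro i hi
    have h2 : i ≤ rootCount n := by simpa [Nat.lt_succ_iff] using hi
    have h3 : i * i < n := (Nat.mul_le_mul h2 h2).trans_lt h
    have h4 : i ≤ i * i := Nat.le_mul_self i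
    exact Finset.mem_filter.2 ⟨Finset.mem_range.2 (by omega), h3⟩
  have h2 := Finset.card_le_card h1
  rw [Finset.card_range] at h2
  unfold rootCount at h2
  omega

theorem rootCount_le_sqrt (n : ℕ) : rootCount n ≤ Nat.sqrt n + 1 := by
  unfold rootCount
  rw [← Finset.card_range (Nat.sqrt n + 1)]
  refine Finset.card_le_card fun i hi => ?_
  have h := (Finset.mem_filter.1 hi).2
  rw [Finset.mem_range, Nat.lt_succ_iff, Nat.le_sqrt]
  exact h.le

/-- Shortened codes of length `mm` have small dimension. -/
def SmallShortenings {K β : Type} [Field K] [AddCommGroup β] [Module K β] {n : ℕ} (mm : ℕ)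
    (D : Submodule K (Fin n → β)) : Prop :=
  ∀ J : Finset (Fin n), J.card = mm → Module.finrank K ↥(D ⊓ supportedOn K J) ≤ 4 * rootCount n

/-- With `κ₂ = 0` the second system is empty, all words solve it, and only the zero word is
orthogonal to all of them. The test thus rejects exactly the zero word. -/
theorem exists_prog_linear {K : Type} [Field K] [Fintype K] [DecidableEq K] (label : K → ℕ)
    (hl : Function.Injective label) : ∃ (p : Prog) (C₀ D₀ : ℕ), ∀ (n k t : ℕ)
      (C : Submodule K (Fin n → K)) (H : Matrix (Fin (n - k)) (Fin n) K), 0 < n → 2 * n * n ≤ 2 ^ n →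
      1 ≤ k → k ≤ n → Module.finrank K C = k → SmallShortenings (n - k + 1) C → IsParityCheck H C →
      C₀ * (n + 1) ^ D₀ * 2 ^ (4 * Fintype.card K * rootCount n) *
        (n.descFactorial (codeDistance C) / (n - k + 1).descFactorial (codeDistance C) + 1) ≤ t →
      1 - Real.exp (-n) ≤ successProb p (input label H) (codeDistance C) t := by
  let ψ : K ≃ₗ[K] (Fin 1 → K) := (LinearEquiv.funUnique (Fin 1) K K).symm
  have hψ : ∀ x c, ψ x c = x := fun x c => rfl
  obtain ⟨p, C₀, D₀, h⟩ := successProb_code ψ (fun a _ => a) (fun _ _ => 0) label hl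
  refine ⟨p, C₀, D₀, ?_⟩
  intro n k t C H hn hn2 hk hkn hC hgood hH ht
  obtain ⟨h1, h2, h3, c, hc, hc0, hcw⟩ := codeDistance_spec hk hkn hC
  have hsol : solSpace ψ (fun a _ => a) H = C := by
    ext x
    rw [hH x, funext_iff]
    refine forall_congr' fun ρ => ?_
    simp [hψ, Matrix.mulVec, dotProduct]
  refine h n (n - k) (n - k + 1) (codeDistance C) t H {0} c hn hn2 (by omega) (by simp) (by omega)
    h1 h2 ?_ ?_ (by rw [hsol]; exact hc) hc0 hcw (by rw [hsol]; exact hgood) ht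
  · intro x _
    simp only [Set.mem_singleton_iff]
    constructor
    · rintro rfl y -
      simp [hψ]
    · intro hx
      funext j
      have := hx (Pi.single j 1) (fun ρ => by simp)
      simpa [hψ, Pi.single_apply] using this
  · intro x hx hx0
    rw [hsol] at hx
    exact h3 x hx hx0

theorem pauliLabel_injective : Function.Injective pauliLabel := by decide

/-- Exchanging the two coordinates in `κ₁` turns the standard inner product into the trace product,
so the candidates are the vectors of the trace dual. Without the exchange, as in `κ₂`, the solutions
form the orthogonal space of `C` for `coordForm`, and the orthogonal space of that is `C` again; so
the test detects membership in `C`. -/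
theorem exists_prog_stabilizer : ∃ (p : Prog) (C₀ D₀ : ℕ), ∀ (n r t : ℕ)
      (C : Submodule (ZMod 2) (PauliVec n)) (g : Fin r → PauliVec n), 0 < n → 2 * n * n ≤ 2 ^ n →
      r < n → Module.finrank (ZMod 2) C = r →
      SmallShortenings (r / 2 + 1) ((pauliForm n).orthogonal C) →
      Submodule.span (ZMod 2) (Set.range g) = C →
      C₀ * (n + 1) ^ D₀ * 2 ^ (4 * 2 * rootCount n) *
        (n.descFactorial (stabilizerDistance C) / (r / 2 + 1).descFactorial (stabilizerDistance C) +
          1) ≤ t →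
      1 - Real.exp (-n) ≤ successProb p (input pauliLabel g) (stabilizerDistance C) t := by
  let ψ : (ZMod 2 × ZMod 2) ≃ₗ[ZMod 2] (Fin 2 → ZMod 2) := (LinearEquiv.finTwoArrow (ZMod 2) _).symm
  have hψ0 : ∀ x, ψ x 0 = x.1 := fun x => rfl
  have hψ1 : ∀ x, ψ x 1 = x.2 := fun x => rfl
  obtain ⟨p, C₀, D₀, h⟩ := successProb_code ψ (fun a => ![a.2, a.1]) (fun a => ![a.1, a.2]) pauliLabel
    pauliLabel_injective
  refine ⟨p, C₀, D₀, ?_⟩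
  intro n r t C g hn hn2 hr hC hgood hg ht
  obtain ⟨h1, h2, h3, c, hc, hc0, hcw⟩ := stabilizerDistance_spec hr hC
  have horth : ∀ (B : LinearMap.BilinForm (ZMod 2) (PauliVec n)) x,
      x ∈ B.orthogonal C ↔ ∀ ρ, B (g ρ) x = 0 := by
    intro B x
    rw [LinearMap.BilinForm.mem_orthogonal_iff, ← hg]
    constructor
    · intro hx ρ
      exact hx _ (Submodule.subset_span (Set.mem_range_self ρ))
    · intro hx y hy
      have : Submodule.span (ZMod 2) (Set.range g) ≤ LinearMap.ker (B.flip x) :=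
        Submodule.span_le.2 (by rintro _ ⟨ρ, rfl⟩; exact hx ρ)
      exact this hy
  have hsol : solSpace ψ (fun a => ![a.2, a.1]) g = (pauliForm n).orthogonal C := by
    ext x
    rw [horth, mem_solSpace]
    refine forall_congr' fun ρ => ?_
    rw [pauliForm_apply, tracePairing]
    simp only [Fin.sum_univ_two, hψ0, hψ1, Matrix.cons_val_zero, Matrix.cons_val_one]
    simp only [add_comm]
  have hsol2 : solSpace ψ (fun a => ![a.1, a.2]) g = (coordForm n).orthogonal C := by
    ext x
    rw [horth, mem_solSpace]
    refine forall_congr' fun ρ => ?_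
    rw [coordForm_apply]
    simp only [Fin.sum_univ_two, hψ0, hψ1, Matrix.cons_val_zero, Matrix.cons_val_one]
  have hq : Fintype.card (ZMod 2) = 2 := ZMod.card 2
  rw [hq] at h
  refine h n r (r / 2 + 1) (stabilizerDistance C) t g C c hn hn2 (by omega) rfl (by omega)
    h1 h2 ?_ ?_ (by rw [hsol]; exact hc) hc0 hcw (by rw [hsol]; exact hgood) ht
  · intro x _
    rw [hsol2]
    have h4 := LinearMap.BilinForm.orthogonal_orthogonal coordForm_nondegenerate coordForm_isRefl C
    rw [SetLike.mem_coe]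
    nth_rw 1 [← h4]
    rw [LinearMap.BilinForm.mem_orthogonal_iff]
    refine forall₂_congr fun y _ => ?_
    rw [coordForm_apply]
    simp only [Fin.sum_univ_two, hψ0, hψ1, mul_comm]
  · intro x hx hx0
    rw [hsol] at hx
    exact h3 x hx hx0

open Classical in
theorem card_not_smallShortenings_linear {K : Type} [Field K] [Fintype K] {n k : ℕ} (hkn : k ≤ n) :
    ((subspaces K (Fin n → K) k).filter fun C => ¬ SmallShortenings (n - k + 1) C).card *
        Fintype.card K ^ (rootCount n * rootCount n) ≤
      (subspaces K (Fin n → K) k).card * Fintype.card K ^ (2 * rootCount n + 2) := by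
  have h := card_bad_supports_le (subspaces K (Fin n → K) k) (fun C => C) (r := n - k)
    (mm := n - k + 1) (t := rootCount n) (by rw [Module.finrank_self]; omega) (le_rootCount_sq n)
    (fun v hv => by
      have h1 := card_subspaces_containing_mul_le (k := k)
        (by rw [Module.finrank_fin_fun]; exact hkn) hv
      rw [Module.finrank_fin_fun] at h1
      exact h1.trans (Nat.le_mul_of_pos_right _ (by have := Fintype.card_pos (α := K); positivity)))
  refine le_trans (Nat.mul_le_mul_right _ (Finset.card_le_card fun C hC => ?_)) h
  obtain ⟨h1, h2⟩ := Finset.mem_filter.1 hC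
  unfold SmallShortenings at h2
  push Not at h2
  exact Finset.mem_filter.2 ⟨h1, h2⟩

open Classical in
theorem card_not_smallShortenings_stabilizer {n r : ℕ} (hr : r ≤ n) :
    ((isoSpaces (pauliForm n) r).filter fun C =>
        ¬ SmallShortenings (r / 2 + 1) ((pauliForm n).orthogonal C)).card *
        2 ^ (rootCount n * rootCount n) ≤
      (isoSpaces (pauliForm n) r).card * 2 ^ (2 * rootCount n + 2) := by
  have h := card_bad_supports_le (isoSpaces (pauliForm n) r) (fun C => (pauliForm n).orthogonal C)
    (r := r) (mm := r / 2 + 1) (t := rootCount n) (by rw [finrank_pauli]; omega) (le_rootCount_sq n)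
    (fun v hv => by
      rw [ZMod.card]
      exact card_isoSpaces_containing_mul_le pauliForm_isAlt pauliForm_nondegenerate finrank_pauliVec
        hr hv)
  rw [ZMod.card] at h
  refine le_trans (Nat.mul_le_mul_right _ (Finset.card_le_card fun C hC => ?_)) h
  obtain ⟨h1, h2⟩ := Finset.mem_filter.1 hC
  unfold SmallShortenings at h2
  push Not at h2
  exact Finset.mem_filter.2 ⟨h1, h2⟩

end RAM

/-! ## Second moments -/

section SecondMoment

variable {K V : Type} [Field K] [AddCommGroup V] [Module K V] [Fintype K] [Fintype V]

open Classical in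
theorem card_subspaces_mem {k : ℕ} {v : V} (hv : v ≠ 0) :
    ((subspaces K V k).filter fun C => v ∈ C).card * (Fintype.card K ^ Module.finrank K V - 1) =
      (subspaces K V k).card * (Fintype.card K ^ k - 1) := by
  have h := card_subspaces_containing (K := K) k (v := ![v])
    (linearIndependent_unique_iff.2 hv)
  simpa [Finset.prod_range_one] using h

open Classical in
theorem card_subspaces_mem_mem {k : ℕ} {v w : V} (hvw : LinearIndependent K ![v, w]) :
    ((subspaces K V k).filter fun C => v ∈ C ∧ w ∈ C).card *
        ((Fintype.card K ^ Module.finrank K V - 1) *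
          (Fintype.card K ^ Module.finrank K V - Fintype.card K)) =
      (subspaces K V k).card * ((Fintype.card K ^ k - 1) * (Fintype.card K ^ k - Fintype.card K)) := by
  have h := card_subspaces_containing (K := K) k hvw
  simpa [Finset.prod_range_succ, Fin.forall_fin_two] using h

open Classical in
/-- Few subspaces avoid a large set of pairwise independent vectors. -/
theorem card_subspaces_avoiding_mul_le {k : ℕ} (hk : 1 ≤ k) (hkV : k ≤ Module.finrank K V)
    (T : Finset V) (hT0 : ∀ v ∈ T, v ≠ 0)
    (hT : ∀ v ∈ T, ∀ w ∈ T, v ≠ w → LinearIndependent K ![v, w])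
    {Z : Finset (Submodule K V)} (hZ : Z ⊆ subspaces K V k) (hZT : ∀ C ∈ Z, ∀ v ∈ T, v ∉ C) :
    (Z.card : ℝ) *
        (T.card * (((Fintype.card K : ℝ) ^ k - 1) / ((Fintype.card K : ℝ) ^ Module.finrank K V - 1))) ≤
      (subspaces K V k).card := by
  set X := subspaces K V k with hX
  set q : ℝ := ((Fintype.card K : ℕ) : ℝ) with hq
  set N := Module.finrank K V with hN
  set α : ℝ := (q ^ k - 1) / (q ^ N - 1) with hα
  have hqK : 1 < Fintype.card K := Fintype.one_lt_card
  have hq1 : 1 < q := by rw [hq]; exact_mod_cast hqK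
  have hqk : 1 < q ^ k := one_lt_pow₀ hq1 (by omega)
  have hqN : 1 < q ^ N := one_lt_pow₀ hq1 (by omega)
  have hkN : q ^ k ≤ q ^ N := pow_le_pow_right₀ hq1.le hkV
  have hα0 : 0 < α := div_pos (by linarith) (by linarith)
  have cast1 : ∀ j, ((Fintype.card K ^ j - 1 : ℕ) : ℝ) = q ^ j - 1 := fun j => by
    rw [Nat.cast_sub (Nat.one_le_pow _ _ (by omega))]
    push_cast
    rfl
  have cast2 : ∀ j, 1 ≤ j → ((Fintype.card K ^ j - Fintype.card K : ℕ) : ℝ) = q ^ j - q := fun j hj => by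
    rw [Nat.cast_sub (Nat.le_self_pow (by omega) _)]
    push_cast
    rfl
  have f1 : ∀ v ∈ T, ((X.filter fun C => v ∈ C).card : ℝ) = X.card * α := fun v hv => by
    have h := card_subspaces_mem (K := K) (k := k) (hT0 v hv)
    have h' : ((X.filter fun C => v ∈ C).card : ℝ) * (q ^ N - 1) = X.card * (q ^ k - 1) := by
      rw [← cast1, ← cast1]
      exact_mod_cast h
    rw [hα, mul_div_assoc', eq_div_iff (by linarith), h']
  have f2 : ∀ v ∈ T, ∀ w ∈ T, v ≠ w →
      ((X.filter fun C => v ∈ C ∧ w ∈ C).card : ℝ) ≤ X.card * α ^ 2 := fun v hv w hw hvw => by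
    have hLI := hT v hv w hw hvw
    have hN2 : 2 ≤ N := by simpa using hLI.fintype_card_le_finrank
    have h := card_subspaces_mem_mem (K := K) (k := k) hLI
    have h' : ((X.filter fun C => v ∈ C ∧ w ∈ C).card : ℝ) * ((q ^ N - 1) * (q ^ N - q)) =
        X.card * ((q ^ k - 1) * (q ^ k - q)) := by
      rw [← cast1, ← cast1, ← cast2 k hk, ← cast2 N (by omega)]
      exact_mod_cast h
    have hQq : q < q ^ N := by
      calc q = q ^ 1 := (pow_one q).symm
        _ < q ^ N := pow_lt_pow_right₀ hq1 (by omega)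
    -- Negative correlation: the conditional proportion (q^k - q) / (q^N - q) is at most (q^k - 1) /
    -- (q^N - 1).
    have hle : (q ^ k - q) * (q ^ N - 1) ≤ (q ^ k - 1) * (q ^ N - q) := by nlinarith
    have hpos : 0 < (q ^ N - 1) * (q ^ N - q) := mul_pos (by linarith) (by linarith)
    refine le_of_mul_le_mul_right ?_ hpos
    rw [h', hα, div_pow, mul_assoc]
    refine mul_le_mul_of_nonneg_left ?_ (Nat.cast_nonneg _)
    rw [div_mul_eq_mul_div, le_div_iff₀ (by nlinarith)]
    nlinarith [mul_le_mul_of_nonneg_left hle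
      (show 0 ≤ (q ^ k - 1) * (q ^ N - 1) from mul_nonneg (by linarith) (by linarith))]
  let Y : Submodule K V → ℝ := fun C => (T.filter fun v => v ∈ C).card
  have hY : ∀ C, Y C = ∑ v ∈ T, if v ∈ C then (1 : ℝ) else 0 := fun C => by
    simp [Y]
  have s1 : ∑ C ∈ X, Y C = T.card * (X.card * α) := by
    simp only [hY]
    rw [Finset.sum_comm, ← nsmul_eq_mul, ← Finset.sum_const]
    refine Finset.sum_congr rfl fun v hv => ?_
    rw [← f1 v hv]
    simp
  have s2 : ∑ C ∈ X, Y C ^ 2 ≤ T.card * (X.card * α) + T.card * T.card * (X.card * α ^ 2) := by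
    have e : ∀ C, Y C ^ 2 = ∑ v ∈ T, ∑ w ∈ T, if v ∈ C ∧ w ∈ C then (1 : ℝ) else 0 := fun C => by
      rw [sq, hY, Finset.sum_mul_sum]
      refine Finset.sum_congr rfl fun v _ => Finset.sum_congr rfl fun w _ => ?_
      by_cases h1 : v ∈ C <;> by_cases h2 : w ∈ C <;> simp [h1, h2]
    simp only [e]
    rw [Finset.sum_comm]
    have h3 : ∀ v ∈ T, ∑ C ∈ X, ∑ w ∈ T, (if v ∈ C ∧ w ∈ C then (1 : ℝ) else 0) ≤
        X.card * α + T.card * (X.card * α ^ 2) := fun v hv => by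
      rw [Finset.sum_comm, ← Finset.add_sum_erase T _ hv]
      refine add_le_add ?_ ?_
      · rw [← f1 v hv]
        simp
      · calc _ ≤ ∑ _w ∈ T.erase v, (X.card : ℝ) * α ^ 2 := by
              refine Finset.sum_le_sum fun w hw => ?_
              refine le_trans (le_of_eq ?_) (f2 v hv w (Finset.mem_of_mem_erase hw)
                (Finset.ne_of_mem_erase hw).symm)
              simp
          _ ≤ ∑ _w ∈ T, (X.card : ℝ) * α ^ 2 :=
              Finset.sum_le_sum_of_subset_of_nonneg (Finset.erase_subset _ _) fun _ _ _ => by positivity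
          _ = _ := by rw [Finset.sum_const, nsmul_eq_mul]
    calc _ ≤ ∑ _v ∈ T, ((X.card : ℝ) * α + T.card * (X.card * α ^ 2)) := Finset.sum_le_sum h3
      _ = _ := by rw [Finset.sum_const, nsmul_eq_mul]; ring
  set μ : ℝ := T.card * α with hμ
  -- The mean of `Y` is exactly `μ`, and negative correlation bounds the variance by the mean.
  have hvar : ∑ C ∈ X, (Y C - μ) ^ 2 ≤ X.card * μ := by
    have : ∑ C ∈ X, (Y C - μ) ^ 2 = ∑ C ∈ X, Y C ^ 2 - 2 * μ * ∑ C ∈ X, Y C + X.card * μ ^ 2 := by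
      rw [Finset.mul_sum, ← Finset.sum_sub_distrib, ← nsmul_eq_mul, ← Finset.sum_const,
        ← Finset.sum_add_distrib]
      exact Finset.sum_congr rfl fun C _ => by ring
    rw [this, s1]
    rw [hμ]
    nlinarith
  -- Each member of `Z` contains no vector of `T`, so there `Y` deviates from its mean by `μ`; this
  -- is Chebyshev's inequality.
  have hlow : (Z.card : ℝ) * μ ^ 2 ≤ ∑ C ∈ X, (Y C - μ) ^ 2 := by
    calc _ = ∑ C ∈ Z, (Y C - μ) ^ 2 := by
          rw [← nsmul_eq_mul, ← Finset.sum_const]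
          refine Finset.sum_congr rfl fun C hC => ?_
          have : Y C = 0 := by
            simp only [Y, Nat.cast_eq_zero, Finset.card_eq_zero, Finset.filter_eq_empty_iff]
            exact fun {v} hv => hZT C hC v hv
          rw [this]
          ring
      _ ≤ _ := Finset.sum_le_sum_of_subset_of_nonneg hZ
          fun _ _ _ => sq_nonneg _
  rcases T.eq_empty_or_nonempty with hTe | hTn
  · have : μ = 0 := by rw [hμ, hTe]; simp
    rw [this, mul_zero]
    positivity
  · have hμ0 : 0 < μ := mul_pos (by exact_mod_cast Finset.card_pos.2 hTn) hα0
    refine le_of_mul_le_mul_right ?_ hμ0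
    calc _ = (Z.card : ℝ) * μ ^ 2 := by ring
      _ ≤ _ := hlow.trans hvar

end SecondMoment

/-! ### Words of small weight in random binary codes -/

section Binary

variable {K : Type} [Field K] {n : ℕ}

/-- The words of weight `w` all of whose nonzero entries are `1`. -/
def zeroOneWords (K : Type) [Field K] [DecidableEq K] (n w : ℕ) : Finset (Fin n → K) :=
  (Finset.powersetCard w Finset.univ).image fun S j => if j ∈ S then 1 else 0

theorem card_zeroOneWords (K : Type) [Field K] [DecidableEq K] (n w : ℕ) :
    (zeroOneWords K n w).card = n.choose w := by
  rw [zeroOneWords, Finset.card_image_of_injective, Finset.card_powersetCard, Finset.card_univ,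
    Fintype.card_fin]
  intro S S' h
  ext j
  have := congrFun h j
  by_cases h1 : j ∈ S <;> by_cases h2 : j ∈ S' <;> simp_all

theorem hammingNorm_of_mem_zeroOneWords [DecidableEq K] {w : ℕ} {v : Fin n → K}
    (hv : v ∈ zeroOneWords K n w) : hammingNorm v = w := by
  rw [zeroOneWords, Finset.mem_image] at hv
  obtain ⟨S, hS, rfl⟩ := hv
  rw [← (Finset.mem_powersetCard.1 hS).2]
  simp [hammingNorm]

theorem ne_zero_of_mem_zeroOneWords [DecidableEq K] {w : ℕ} (hw : 1 ≤ w) {v : Fin n → K}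
    (hv : v ∈ zeroOneWords K n w) : v ≠ 0 := by
  rintro rfl
  have := hammingNorm_of_mem_zeroOneWords hv
  rw [hammingNorm_zero] at this
  omega

variable [Fintype K]

theorem eq_zero_or_one_of_card_eq_two (h2 : Fintype.card K = 2) (a : K) : a = 0 ∨ a = 1 := by
  classical
  have h : ({0, 1} : Finset K) = Finset.univ := by
    rw [← Finset.card_eq_iff_eq_univ, h2, Finset.card_pair zero_ne_one]
  have := Finset.mem_univ a
  rw [← h] at this
  simpa using this

theorem linearIndependent_pair_of_card_eq_two {V : Type} [AddCommGroup V] [Module K V]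
    (h2 : Fintype.card K = 2) {v w : V} (hv : v ≠ 0) (hw : w ≠ 0) (hvw : v ≠ w) :
    LinearIndependent K ![v, w] := by
  have hneg : (-1 : K) = 1 := by
    rcases eq_zero_or_one_of_card_eq_two h2 (-1 : K) with h | h
    · simp at h
    · exact h
  rw [LinearIndependent.pair_iff]
  intro a b hab
  rcases eq_zero_or_one_of_card_eq_two h2 a with rfl | rfl <;>
    rcases eq_zero_or_one_of_card_eq_two h2 b with rfl | rfl
  · simp
  · simp [hw] at hab
  · simp [hv] at hab
  · exfalso
    apply hvw
    rw [one_smul, one_smul] at hab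
    rw [eq_neg_of_add_eq_zero_left hab, ← one_smul K w, ← neg_smul, hneg]

theorem notMem_of_lt_codeDistance [DecidableEq K] {k w : ℕ} (hk : 1 ≤ k) (hkn : k ≤ n) (hw : 1 ≤ w)
    {C : Submodule K (Fin n → K)} (hC : Module.finrank K C = k) (hCw : w < codeDistance C)
    {v : Fin n → K} (hv : v ∈ zeroOneWords K n w) : v ∉ C := fun hvC => by
  have h := (codeDistance_spec hk hkn hC).2.2.1 v hvC (ne_zero_of_mem_zeroOneWords hw hv)
  rw [hammingNorm_of_mem_zeroOneWords hv] at h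
  exact absurd hCw (not_lt.2 h)

/-- Few binary codes have a distance above `w`. -/
theorem card_distance_gt_mul_le [DecidableEq K] (h2 : Fintype.card K = 2) {k w : ℕ} (hk : 1 ≤ k)
    (hkn : k ≤ n) (hw : 1 ≤ w) {Z : Finset (Submodule K (Fin n → K))}
    (hZ : Z ⊆ subspaces K (Fin n → K) k) (hZw : ∀ C ∈ Z, w < codeDistance C) :
    (Z.card : ℝ) *
        (n.choose w * (2 : ℝ) ^ k) ≤ 2 * 2 ^ n * (subspaces K (Fin n → K) k).card := by
  have hZk : ∀ C ∈ Z, Module.finrank K C = k := fun C hC => by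
    have h := hZ hC
    exact mem_subspaces.1 h
  have havoid : ∀ C ∈ Z, ∀ v ∈ zeroOneWords K n w, v ∉ C := fun C hC v hv =>
    notMem_of_lt_codeDistance hk hkn hw (hZk C hC) (hZw C hC) hv
  have h := card_subspaces_avoiding_mul_le (K := K) (V := Fin n → K) hk
    (by rw [Module.finrank_fin_fun]; exact hkn) (zeroOneWords K n w)
    (fun v hv => ne_zero_of_mem_zeroOneWords hw hv)
    (fun v hv w' hw' hne => linearIndependent_pair_of_card_eq_two h2
      (ne_zero_of_mem_zeroOneWords hw hv) (ne_zero_of_mem_zeroOneWords hw hw') hne)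
    hZ havoid
  rw [card_zeroOneWords, Module.finrank_fin_fun, h2] at h
  have hk2 : (2 : ℝ) ≤ 2 ^ k := by
    calc (2 : ℝ) = 2 ^ 1 := (pow_one _).symm
      _ ≤ 2 ^ k := pow_le_pow_right₀ (by norm_num) hk
  have hn2 : (2 : ℝ) ^ k ≤ 2 ^ n := pow_le_pow_right₀ (by norm_num) hkn
  -- The factor `2` covers the step from `2 ^ k - 1` to `2 ^ k`, which is where `k ≥ 1` enters.
  have hfrac : (2 : ℝ) ^ k ≤ 2 * 2 ^ n * (((2 : ℝ) ^ k - 1) / (2 ^ n - 1)) := by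
    rw [mul_div_assoc', le_div_iff₀ (by linarith)]
    nlinarith
  push_cast at h
  generalize Z.card = P at h ⊢
  calc (P : ℝ) * (n.choose w * (2 : ℝ) ^ k)
      ≤ P * (n.choose w * (2 * 2 ^ n * (((2 : ℝ) ^ k - 1) / (2 ^ n - 1)))) :=
        mul_le_mul_of_nonneg_left (mul_le_mul_of_nonneg_left hfrac (Nat.cast_nonneg _))
          (Nat.cast_nonneg _)
    _ = 2 * 2 ^ n * (P * (n.choose w * (((2 : ℝ) ^ k - 1) / (2 ^ n - 1)))) := by ring
    _ ≤ _ := mul_le_mul_of_nonneg_left h (by positivity)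

end Binary

/-! ## Asymptotics -/

/-- The product form remains valid for `a = 0`, where `0 ^ 0 = 1`; a quotient by powers of `a / n`
would need a case distinction in every application. -/
theorem exp_mul_log_mul_pow {n : ℕ} (hn : 0 < n) (a : ℕ) :
    Real.exp (a * Real.log ((a : ℝ) / n)⁻¹) * (a : ℝ) ^ a = (n : ℝ) ^ a := by
  rcases Nat.eq_zero_or_pos a with rfl | ha
  · simp
  · have hn' : (0 : ℝ) < n := by exact_mod_cast hn
    have ha' : (0 : ℝ) < a := by exact_mod_cast ha
    rw [inv_div, Real.exp_nat_mul, Real.exp_log (by positivity), ← mul_pow, div_mul_cancel₀ _ ha'.ne']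

/-- An exact identity that includes the boundary cases `m = 0` and `m = n`. Together with the two
bounds for the largest binomial term it determines `n.choose m` up to the factor `n + 1`, without
Stirling's formula. -/
theorem two_rpow_entropy {n m : ℕ} (hn : 0 < n) (hm : m ≤ n) :
    (2 : ℝ) ^ ((n : ℝ) * h₂ (m / n)) * ((m : ℝ) ^ m * ((n - m : ℕ) : ℝ) ^ (n - m)) = (n : ℝ) ^ n := by
  have hn' : (n : ℝ) ≠ 0 := by exact_mod_cast hn.ne'
  have hlog : Real.log 2 ≠ 0 := (Real.log_pos one_lt_two).ne'
  have h1 : 1 - (m : ℝ) / n = ((n - m : ℕ) : ℝ) / n := by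
    rw [Nat.cast_sub hm]
    field_simp
  have h2 : Real.log 2 * ((n : ℝ) * h₂ (m / n)) = m * Real.log ((m : ℝ) / n)⁻¹ +
      (n - m : ℕ) * Real.log (((n - m : ℕ) : ℝ) / n)⁻¹ := by
    rw [h₂, Real.binEntropy, h1]
    field_simp
  rw [Real.rpow_def_of_pos two_pos, h2, Real.exp_add]
  calc _ = (Real.exp (m * Real.log ((m : ℝ) / n)⁻¹) * (m : ℝ) ^ m) *
        (Real.exp ((n - m : ℕ) * Real.log (((n - m : ℕ) : ℝ) / n)⁻¹) *
          ((n - m : ℕ) : ℝ) ^ (n - m)) := by ring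
    _ = (n : ℝ) ^ m * (n : ℝ) ^ (n - m) := by rw [exp_mul_log_mul_pow hn, exp_mul_log_mul_pow hn]
    _ = _ := by rw [← pow_add, Nat.add_sub_cancel' hm]

theorem pow_self_mul_pos (n m : ℕ) : 0 < ((m : ℝ) ^ m * ((n - m : ℕ) : ℝ) ^ (n - m)) := by
  have h : ∀ a : ℕ, 0 < (a : ℝ) ^ a := fun a => by
    rcases Nat.eq_zero_or_pos a with rfl | ha
    · simp
    · positivity
  exact mul_pos (h m) (h (n - m))

theorem choose_le_two_rpow {n m : ℕ} (hn : 0 < n) (hm : m ≤ n) :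
    (n.choose m : ℝ) ≤ 2 ^ ((n : ℝ) * h₂ (m / n)) := by
  refine le_of_mul_le_mul_right ?_ (pow_self_mul_pos n m)
  rw [two_rpow_entropy hn hm, ← mul_assoc]
  exact_mod_cast choose_mul_pow_le_pow hm

theorem two_rpow_le_choose {n m : ℕ} (hn : 0 < n) (hm : m ≤ n) :
    (2 : ℝ) ^ ((n : ℝ) * h₂ (m / n)) ≤ (n + 1) * n.choose m := by
  refine le_of_mul_le_mul_right ?_ (pow_self_mul_pos n m)
  rw [two_rpow_entropy hn hm, mul_assoc, ← mul_assoc (n.choose m : ℝ)]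
  exact_mod_cast pow_le_choose_mul hm

theorem continuous_h₂ : Continuous h₂ := Real.binEntropy_continuous.div_const _

theorem h₂_nonneg {x : ℝ} (h0 : 0 ≤ x) (h1 : x ≤ 1) : 0 ≤ h₂ x :=
  div_nonneg (Real.binEntropy_nonneg h0 h1) (Real.log_pos one_lt_two).le

theorem h₂_le_one (x : ℝ) : h₂ x ≤ 1 := by
  rw [h₂, div_le_one (Real.log_pos one_lt_two)]
  exact Real.binEntropy_le_log_two

/-- The size of the coordinate set divided by `n` only tends to `ρ`, and the distance varies with
the code. The estimate therefore has to be uniform in `x`, the ratio of the distance to that size.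
-/
theorem eventually_entropy_le {ρ : ℝ} (hρ : 0 < ρ) {μ : ℕ → ℝ} (hμ : Tendsto μ atTop (𝓝 ρ)) {η : ℝ}
    (hη : 0 < η) :
    ∀ᶠ n in atTop, ∀ x ∈ Set.Icc (0 : ℝ) 1, ρ * h₂ (x * μ n / ρ) - μ n * h₂ x ≤ η := by
  -- The argument `x * μ n / ρ` may be slightly larger than one, so uniform continuity is taken on a
  -- longer interval.
  have huc : UniformContinuousOn h₂ (Set.Icc 0 2) :=
    isCompact_Icc.uniformContinuousOn_of_continuous continuous_h₂.continuousOn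
  obtain ⟨θ, hθ, huc⟩ := Metric.uniformContinuousOn_iff.1 huc (η / (2 * ρ)) (by positivity)
  have h1 : Tendsto (fun n => μ n / ρ) atTop (𝓝 1) := by
    simpa [hρ.ne'] using hμ.div_const ρ
  filter_upwards [Metric.tendsto_nhds.1 h1 (min θ 1) (by positivity),
    Metric.tendsto_nhds.1 hμ (η / 2) (by positivity)] with n h2 h3 x hx
  obtain ⟨hx0, hx1⟩ := hx
  rw [Real.dist_eq] at h2 h3
  have h4 := abs_lt.1 (h2.trans_le (min_le_right _ _))
  have h5 : |x * μ n / ρ - x| < θ := by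
    rw [show x * μ n / ρ - x = x * (μ n / ρ - 1) by ring, abs_mul, abs_of_nonneg hx0]
    calc x * |μ n / ρ - 1| ≤ 1 * |μ n / ρ - 1| := by gcongr
      _ < θ := by rw [one_mul]; exact h2.trans_le (min_le_left _ _)
  have h6 := huc (x * μ n / ρ) (by
    rw [mul_div_assoc]
    exact ⟨mul_nonneg hx0 (by linarith), by nlinarith⟩) x ⟨hx0, by linarith⟩
    (by rw [Real.dist_eq]; exact h5)
  rw [Real.dist_eq] at h6
  have h7 : ρ * (h₂ (x * μ n / ρ) - h₂ x) ≤ η / 2 := by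
    calc _ ≤ ρ * (η / (2 * ρ)) := by
          gcongr
          exact (le_abs_self _).trans h6.le
      _ = η / 2 := by field_simp
  have h8 : (ρ - μ n) * h₂ x ≤ η / 2 := by
    calc _ ≤ |ρ - μ n| * 1 := by
          have := le_abs_self (ρ - μ n)
          have := abs_nonneg (ρ - μ n)
          have := h₂_nonneg hx0 hx1
          have := h₂_le_one x
          nlinarith
      _ ≤ η / 2 := by rw [mul_one, abs_sub_comm]; exact h3.le
  nlinarith

theorem tendsto_rootCount_div : Tendsto (fun n : ℕ => (RAM.rootCount n : ℝ) / n) atTop (𝓝 0) := by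
  have h1 : Tendsto (fun n : ℕ => (Real.sqrt n)⁻¹ + (n : ℝ)⁻¹) atTop (𝓝 0) := by
    have h2 : Tendsto (fun n : ℕ => Real.sqrt (n : ℝ)) atTop atTop :=
      Real.tendsto_sqrt_atTop.comp tendsto_natCast_atTop_atTop
    simpa using (tendsto_inv_atTop_zero.comp h2).add
      (tendsto_inv_atTop_zero.comp (tendsto_natCast_atTop_atTop (R := ℝ)))
  refine squeeze_zero' (.of_forall fun n => by positivity) ?_ h1
  filter_upwards [eventually_gt_atTop 0] with n hn
  have hn' : (0 : ℝ) < n := by exact_mod_cast hn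
  have h2 : (RAM.rootCount n : ℝ) ≤ Real.sqrt n + 1 := by
    refine le_trans (by exact_mod_cast RAM.rootCount_le_sqrt n : (RAM.rootCount n : ℝ) ≤
      (Nat.sqrt n : ℝ) + 1) ?_
    gcongr
    exact Real.nat_sqrt_le_real_sqrt
  have h3 : 0 < Real.sqrt n := Real.sqrt_pos.2 hn'
  rw [div_le_iff₀ hn', add_mul, inv_mul_cancel₀ hn'.ne']
  have h4 : (Real.sqrt n)⁻¹ * n = Real.sqrt n := by
    nth_rw 2 [← Real.mul_self_sqrt hn'.le]
    rw [← mul_assoc, inv_mul_cancel₀ h3.ne', one_mul]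
  rw [h4]
  exact h2

theorem tendsto_rootCount : Tendsto RAM.rootCount atTop atTop := by
  refine tendsto_atTop.2 fun b => ?_
  filter_upwards [eventually_ge_atTop (b * b)] with n hn
  have h := RAM.le_rootCount_sq n
  by_contra hlt
  push Not at hlt
  have := Nat.mul_lt_mul'' hlt hlt
  omega

/-- Both factors are subexponential, since `rootCount n` is of the order of the square root of `n`;
each receives half of the exponent. -/
theorem eventually_poly_le (C D c : ℕ) {η : ℝ} (hη : 0 < η) :
    ∀ᶠ n : ℕ in atTop, (C : ℝ) * ((n : ℝ) + 1) ^ D * 2 ^ (c * RAM.rootCount n) ≤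
      (2 : ℝ) ^ ((n : ℝ) * η) := by
  have hr : 1 < (2 : ℝ) ^ (η / 2) := Real.one_lt_rpow one_lt_two (by positivity)
  have h1 := (tendsto_pow_const_div_const_pow_of_one_lt D hr).comp (tendsto_add_atTop_nat 1)
  have hc : (0 : ℝ) < (((C : ℝ) + 1) * 2 ^ (η / 2))⁻¹ := by positivity
  have h2 := (tendsto_rootCount_div.const_mul (c : ℝ))
  rw [mul_zero] at h2
  filter_upwards [h1.eventually_lt_const hc, h2.eventually_lt_const (half_pos hη),
    eventually_gt_atTop 0] with n h3 h4 hn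
  have hn' : (0 : ℝ) < n := by exact_mod_cast hn
  simp only [Function.comp] at h3
  rw [div_lt_iff₀ (by positivity)] at h3
  push_cast at h3
  have h5 : (C : ℝ) * ((n : ℝ) + 1) ^ D ≤ 2 ^ ((n : ℝ) * (η / 2)) := by
    calc (C : ℝ) * ((n : ℝ) + 1) ^ D ≤ (C + 1) * ((n : ℝ) + 1) ^ D := by
          gcongr
          linarith
      _ ≤ (C + 1) * ((((C : ℝ) + 1) * 2 ^ (η / 2))⁻¹ * ((2 : ℝ) ^ (η / 2)) ^ (n + 1)) := by gcongr
      _ = ((2 : ℝ) ^ (η / 2)) ^ n := by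
          rw [pow_succ]
          field_simp
      _ = _ := by rw [← Real.rpow_natCast, ← Real.rpow_mul (by norm_num), mul_comm]
  have h6 : (2 : ℝ) ^ (c * RAM.rootCount n) ≤ 2 ^ ((n : ℝ) * (η / 2)) := by
    rw [← Real.rpow_natCast]
    refine Real.rpow_le_rpow_of_exponent_le one_le_two ?_
    push_cast
    rw [mul_div_assoc', div_lt_iff₀ hn'] at h4
    linarith
  calc _ ≤ (2 : ℝ) ^ ((n : ℝ) * (η / 2)) * 2 ^ ((n : ℝ) * (η / 2)) := by gcongr
    _ = _ := by rw [← Real.rpow_add two_pos]; ring_nf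

theorem descFactorial_ratio_le {n m d : ℕ} (hn : 0 < n) (hmn : m ≤ n) (hm : 0 < m) (hdm : d ≤ m) :
    ((n.descFactorial d / m.descFactorial d + 1 : ℕ) : ℝ) ≤
      2 * (n + 1) * 2 ^ ((n : ℝ) * h₂ (d / n) - m * h₂ (d / m)) := by
  have hpos : 0 < m.choose d := Nat.choose_pos hdm
  have hle : m.choose d ≤ n.choose d := Nat.choose_le_choose d hmn
  -- The quotient is at least one, so the summand `1` at most doubles it.
  have h1 : n.descFactorial d / m.descFactorial d + 1 ≤ 2 * (n.choose d / m.choose d) := by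
    rw [Nat.descFactorial_eq_factorial_mul_choose, Nat.descFactorial_eq_factorial_mul_choose,
      Nat.mul_div_mul_left _ _ (Nat.factorial_pos d)]
    have := Nat.div_pos hle hpos
    omega
  have hpos' : (0 : ℝ) < m.choose d := by exact_mod_cast hpos
  have h2 := choose_le_two_rpow hn (hdm.trans hmn)
  have h3 := two_rpow_le_choose hm hdm
  have hm' : (m : ℝ) ≤ n := by exact_mod_cast hmn
  calc _ ≤ ((2 * (n.choose d / m.choose d) : ℕ) : ℝ) := by exact_mod_cast h1
    _ ≤ 2 * ((n.choose d : ℝ) / m.choose d) := by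
        rw [Nat.cast_mul]
        exact mul_le_mul_of_nonneg_left Nat.cast_div_le (by norm_num)
    _ ≤ 2 * ((n + 1) * 2 ^ ((n : ℝ) * h₂ (d / n) - m * h₂ (d / m))) := by
        refine mul_le_mul_of_nonneg_left ?_ (by norm_num)
        rw [div_le_iff₀ hpos', Real.rpow_sub two_pos, mul_div_assoc', div_mul_eq_mul_div,
          le_div_iff₀ (by positivity)]
        calc _ ≤ (2 : ℝ) ^ ((n : ℝ) * h₂ (d / n)) * ((m + 1) * m.choose d) := by gcongr
          _ ≤ (2 : ℝ) ^ ((n : ℝ) * h₂ (d / n)) * ((n + 1) * m.choose d) := by gcongr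
          _ = _ := by ring
    _ = _ := by ring

/-- One half of `ε` pays for the subexponential factors, the other for replacing `mm n / n` by its
limit `ρ`. All `d ≤ mm n` are treated at once, because the distance is not known beforehand. -/
theorem eventually_le_budget {ρ : ℝ} (hρ : 0 < ρ) {mm : ℕ → ℕ}
    (hmm : Tendsto (fun n : ℕ => (mm n : ℝ) / n) atTop (𝓝 ρ)) (hmn : ∀ᶠ n in atTop, mm n ≤ n)
    (C D c : ℕ) {ε : ℝ} (hε : 0 < ε) :
    ∀ᶠ n in atTop, ∀ d ≤ mm n, C * (n + 1) ^ D * 2 ^ (c * RAM.rootCount n) *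
      (n.descFactorial d / (mm n).descFactorial d + 1) ≤
        budget n (h₂ ((d : ℝ) / n) - ρ * h₂ ((d : ℝ) / n / ρ) + ε) := by
  filter_upwards [hmn, eventually_entropy_le hρ hmm (half_pos hε),
    eventually_poly_le (2 * C) (D + 1) c (half_pos hε), hmm.eventually_const_lt hρ,
    eventually_gt_atTop 0] with n hmn hent hpoly hpos hn d hd
  have hn' : (0 : ℝ) < n := by exact_mod_cast hn
  have hm : 0 < mm n := by
    by_contra h
    have h0 : mm n = 0 := by omega
    simp [h0] at hpos
  have hm' : (0 : ℝ) < mm n := by exact_mod_cast hm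
  have hd' : (d : ℝ) ≤ mm n := by exact_mod_cast hd
  have h1 := hent ((d : ℝ) / mm n) ⟨by positivity, (div_le_one hm').2 hd'⟩
  rw [div_mul_div_cancel₀ hm'.ne'] at h1
  have h2 := descFactorial_ratio_le hn hmn hm hd
  refine Nat.le_floor ?_
  rw [Nat.cast_mul]
  push_cast at h2 hpoly ⊢
  calc _ ≤ (C : ℝ) * (n + 1) ^ D * 2 ^ (c * RAM.rootCount n) *
        (2 * (n + 1) * 2 ^ ((n : ℝ) * h₂ (d / n) - mm n * h₂ (d / mm n))) := by gcongr
    _ = (2 * C : ℝ) * (n + 1) ^ (D + 1) * 2 ^ (c * RAM.rootCount n) *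
        2 ^ ((n : ℝ) * h₂ (d / n) - mm n * h₂ (d / mm n)) := by ring
    _ ≤ 2 ^ ((n : ℝ) * (ε / 2)) * 2 ^ ((n : ℝ) * h₂ (d / n) - mm n * h₂ (d / mm n)) := by gcongr
    _ = 2 ^ ((n : ℝ) * (ε / 2) + ((n : ℝ) * h₂ (d / n) - mm n * h₂ (d / mm n))) := by
        rw [Real.rpow_add two_pos]
    _ ≤ _ := by
        refine Real.rpow_le_rpow_of_exponent_le one_le_two ?_
        have h3 := mul_le_mul_of_nonneg_left h1 hn'.le
        have h4 : (n : ℝ) * ((mm n : ℝ) / n * h₂ (d / mm n)) = mm n * h₂ (d / mm n) := by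
          field_simp
        rw [mul_sub, h4] at h3
        linarith

theorem budget_mono {n : ℕ} {F F' : ℝ} (h : F ≤ F') : budget n F ≤ budget n F' :=
  Nat.floor_mono (Real.rpow_le_rpow_of_exponent_le one_le_two
    (mul_le_mul_of_nonneg_left h (Nat.cast_nonneg n)))

/-! ## Proportions -/

theorem tendsto_proportion {α : ℕ → Type} [∀ n, Finite (α n)] {S : ∀ n, Set (α n)}
    {P : ∀ n, α n → Prop} {b : ℕ → ℝ} (hb : Tendsto b atTop (𝓝 0))
    (hne : ∀ᶠ n in atTop, (S n).Nonempty)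
    (h : ∀ᶠ n in atTop, ({x | x ∈ S n ∧ ¬ P n x}.ncard : ℝ) ≤ b n * (S n).ncard) :
    Tendsto (fun n => proportion (S n) (P n)) atTop (𝓝 1) := by
  have h1 : Tendsto (fun n => 1 - b n) atTop (𝓝 1) := by simpa using hb.const_sub 1
  refine tendsto_of_tendsto_of_tendsto_of_le_of_le' h1 tendsto_const_nhds ?_ ?_
  · filter_upwards [hne, h] with n h2 h3
    have h4 : (0 : ℝ) < (S n).ncard := by
      exact_mod_cast (Set.ncard_pos (Set.toFinite _)).2 h2
    have h5 : {x | x ∈ S n ∧ P n x}.ncard + {x | x ∈ S n ∧ ¬ P n x}.ncard = (S n).ncard := by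
      rw [← Set.ncard_union_eq _ (Set.toFinite _) (Set.toFinite _)]
      · congr 1
        ext x
        simp only [Set.mem_union, Set.mem_ofPred_eq]
        tauto
      · rw [Set.disjoint_left]
        rintro x ⟨-, hx⟩ ⟨-, hx'⟩
        exact hx' hx
    have h6 : ({x | x ∈ S n ∧ P n x}.ncard : ℝ) + {x | x ∈ S n ∧ ¬ P n x}.ncard = (S n).ncard := by
      exact_mod_cast h5
    rw [proportion, le_div_iff₀ h4]
    linarith
  · refine .of_forall fun n => ?_
    refine div_le_one_of_le₀ ?_ (Nat.cast_nonneg _)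
    exact Nat.cast_le.2 (Set.ncard_le_ncard (fun x (hx : x ∈ S n ∧ P n x) => hx.1) (Set.toFinite _))

/-- For `t ≥ 4` one has t² - 2t - 2 ≥ t. -/
theorem pow_ratio_le {q t : ℕ} (hq : 2 ≤ q) (ht : 4 ≤ t) {A X : ℕ}
    (h : A * q ^ (t * t) ≤ X * q ^ (2 * t + 2)) : (A : ℝ) ≤ (1 / 2) ^ t * X := by
  have h1 : t * t = (2 * t + 2) + (t * t - (2 * t + 2)) := by
    have := Nat.mul_le_mul_right t ht
    omega
  rw [h1, pow_add, mul_comm (q ^ (2 * t + 2)), ← mul_assoc] at h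
  have h2 := Nat.le_of_mul_le_mul_right h (by positivity)
  have h3 : 2 ^ t ≤ q ^ (t * t - (2 * t + 2)) := by
    have := Nat.mul_le_mul_right t ht
    calc 2 ^ t ≤ q ^ t := Nat.pow_le_pow_left hq _
      _ ≤ _ := Nat.pow_le_pow_right (by omega) (by omega)
  have h4 : A * 2 ^ t ≤ X := (Nat.mul_le_mul_left _ h3).trans h2
  rw [one_div, inv_pow, inv_mul_eq_div, le_div_iff₀ (by positivity)]
  exact_mod_cast h4

theorem tendsto_half_pow_rootCount :
    Tendsto (fun n => (1 / 2 : ℝ) ^ RAM.rootCount n) atTop (𝓝 0) :=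
  (tendsto_pow_atTop_nhds_zero_of_lt_one (by norm_num) (by norm_num)).comp tendsto_rootCount

theorem eventually_exp_neg_le {ε : ℝ} (hε : 0 < ε) :
    ∀ᶠ n : ℕ in atTop, Real.exp (-(n : ℝ)) ≤ ε := by
  have h : Tendsto (fun n : ℕ => Real.exp (-(n : ℝ))) atTop (𝓝 0) :=
    Real.tendsto_exp_neg_atTop_nhds_zero.comp tendsto_natCast_atTop_atTop
  filter_upwards [h.eventually_lt_const hε] with n hn using hn.le

theorem eventually_two_mul_mul_le_pow : ∀ᶠ n : ℕ in atTop, 2 * n * n ≤ 2 ^ n := by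
  filter_upwards [eventually_ge_atTop 7] with n hn
  induction n, hn using Nat.le_induction with
  | base => norm_num
  | succ n hn ih => rw [pow_succ]; nlinarith

/-! ## Codes of given rate -/

section Rate

variable {k : ℕ → ℕ} {R : ℝ}

theorem HasRate.nonneg (h : HasRate k R) : 0 ≤ R :=
  ge_of_tendsto' h.2 fun n => by positivity

theorem HasRate.eventually_lt (h : HasRate k R) (hR : R < 1) : ∀ᶠ n in atTop, k n < n := by
  filter_upwards [h.2.eventually_lt_const hR, eventually_gt_atTop 0] with n h1 hn
  have hn' : (0 : ℝ) < n := by exact_mod_cast hn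
  rw [div_lt_one hn'] at h1
  exact_mod_cast h1

theorem HasRate.tendsto_sub_div (h : HasRate k R) (hR : R < 1) :
    Tendsto (fun n : ℕ => ((n - k n : ℕ) : ℝ) / n) atTop (𝓝 (1 - R)) := by
  refine (h.2.const_sub 1).congr' ?_
  filter_upwards [h.eventually_lt hR] with n hn
  have hn' : (n : ℝ) ≠ 0 := by
    have : 0 < n := by omega
    exact_mod_cast this.ne'
  rw [Nat.cast_sub hn.le]
  field_simp

theorem tendsto_const_div_nat (c : ℝ) : Tendsto (fun n : ℕ => c / n) atTop (𝓝 0) :=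
  tendsto_const_nhds.div_atTop tendsto_natCast_atTop_atTop

theorem HasRate.tendsto_linear (h : HasRate k R) (hR : R < 1) :
    Tendsto (fun n : ℕ => ((n - k n + 1 : ℕ) : ℝ) / n) atTop (𝓝 (1 - R)) := by
  have h1 := (h.tendsto_sub_div hR).add (tendsto_const_div_nat 1)
  rw [add_zero] at h1
  refine h1.congr fun n => ?_
  push_cast
  rw [add_div]

theorem HasRate.tendsto_stabilizer (h : HasRate k R) (hR : R < 1) :
    Tendsto (fun n : ℕ => (((n - k n) / 2 + 1 : ℕ) : ℝ) / n) atTop (𝓝 ((1 - R) / 2)) := by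
  have h0 := (h.tendsto_sub_div hR).div_const 2
  have h1 := h0.add (tendsto_const_div_nat 1)
  rw [add_zero] at h1
  refine tendsto_of_tendsto_of_tendsto_of_le_of_le h0 h1 (fun n => ?_) (fun n => ?_)
  · change ((n - k n : ℕ) : ℝ) / n / 2 ≤ _
    rw [div_right_comm]
    gcongr
    have : n - k n ≤ 2 * ((n - k n) / 2 + 1) := by omega
    have h2 : ((n - k n : ℕ) : ℝ) ≤ 2 * ((n - k n) / 2 + 1 : ℕ) := by exact_mod_cast this
    linarith
  · change _ ≤ ((n - k n : ℕ) : ℝ) / n / 2 + 1 / n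
    rw [div_right_comm, ← add_div]
    gcongr
    have : 2 * ((n - k n) / 2 + 1) ≤ n - k n + 2 := by omega
    have h2 : 2 * (((n - k n) / 2 + 1 : ℕ) : ℝ) ≤ ((n - k n : ℕ) : ℝ) + 2 := by exact_mod_cast this
    linarith

end Rate

/-! ### Properties of almost all codes, and the exponents -/

theorem linearCodes_eq (K : Type) [Field K] [Fintype K] (n k : ℕ) :
    linearCodes K n k = (subspaces K (Fin n → K) k : Set (Submodule K (Fin n → K))) := by
  ext C
  rw [Finset.mem_coe, mem_subspaces]
  rfl

theorem stabilizerCodes_eq (n k : ℕ) :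
    stabilizerCodes n k = (isoSpaces (pauliForm n) (n - k) : Set (Submodule (ZMod 2) (PauliVec n))) := by
  ext C
  rw [Finset.mem_coe, mem_stabilizerCodes]

theorem linearCodes_nonempty (K : Type) [Field K] [Fintype K] {n k : ℕ} (hk : k ≤ n) :
    (linearCodes K n k).Nonempty := by
  obtain ⟨J, hJ⟩ := exists_card_eq hk
  refine ⟨supportedOn K J, ?_⟩
  change Module.finrank K _ = k
  rw [finrank_supportedOn, hJ, Module.finrank_self, mul_one]

theorem ncard_filter_eq {α : Type} (X : Finset α) (P : α → Prop) [DecidablePred P] :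
    {x | x ∈ (X : Set α) ∧ P x}.ncard = (X.filter P).card := by
  rw [← Set.ncard_coe_finset]
  congr 1
  ext x
  simp

theorem ncard_not_smallShortenings_linear {K : Type} [Field K] [Fintype K] {n k : ℕ} (hkn : k ≤ n)
    (ht : 4 ≤ RAM.rootCount n) :
    ({C | C ∈ linearCodes K n k ∧ ¬ RAM.SmallShortenings (n - k + 1) C}.ncard : ℝ) ≤
      (1 / 2) ^ RAM.rootCount n * (linearCodes K n k).ncard := by
  classical
  rw [linearCodes_eq, ncard_filter_eq, Set.ncard_coe_finset]
  refine pow_ratio_le (Fintype.one_lt_card (α := K)) ht ?_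
  convert RAM.card_not_smallShortenings_linear hkn

theorem ncard_not_smallShortenings_stabilizer {n k : ℕ} (ht : 4 ≤ RAM.rootCount n) :
    ({C | C ∈ stabilizerCodes n k ∧
        ¬ RAM.SmallShortenings ((n - k) / 2 + 1) ((pauliForm n).orthogonal C)}.ncard : ℝ) ≤
      (1 / 2) ^ RAM.rootCount n * (stabilizerCodes n k).ncard := by
  classical
  rw [stabilizerCodes_eq, ncard_filter_eq, Set.ncard_coe_finset]
  refine pow_ratio_le le_rfl ht ?_
  convert RAM.card_not_smallShortenings_stabilizer (n := n) (r := n - k) (Nat.sub_le _ _)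

/-- For large `n` only codes that violate `SmallShortenings` can be exceptional; for all others the
guarantee holds for every choice of generators. -/
theorem exists_findsStabilizerDistance : ∃ p : RAM.Prog, ∀ (R : ℝ) (k : ℕ → ℕ), R < 1 → HasRate k R →
    FindsStabilizerDistance p k (expCS R) := by
  obtain ⟨p, C₀, D₀, hp⟩ := RAM.exists_prog_stabilizer
  refine ⟨p, fun R k hR hk ε hε => ?_⟩
  have hρ : 0 < (1 - R) / 2 := by linarith
  refine tendsto_proportion tendsto_half_pow_rootCount ?_ ?_
  · filter_upwards with n
    rw [stabilizerCodes_eq]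
    exact isoSpaces_nonempty pauliForm_isAlt pauliForm_nondegenerate finrank_pauliVec (Nat.sub_le _ _)
  · filter_upwards [hk.1, hk.eventually_lt hR, tendsto_rootCount.eventually_ge_atTop 4,
      eventually_two_mul_mul_le_pow, eventually_exp_neg_le hε,
      eventually_le_budget hρ (hk.tendsto_stabilizer hR) (by
        filter_upwards [hk.1, hk.eventually_lt hR] with n h1 h2
        omega) C₀ D₀ (4 * 2) hε] with n hk0 hkn ht h2n hexp hbud
    refine le_trans (Nat.cast_le.2 (Set.ncard_le_ncard ?_ (Set.toFinite _)))
      (ncard_not_smallShortenings_stabilizer ht)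
    rintro C ⟨hC, hbad⟩
    refine ⟨hC, fun hgood => hbad fun g hg => ?_⟩
    have hsub : 1 - ε ≤ 1 - Real.exp (-(n : ℝ)) := by linarith
    refine hsub.trans (hp n (n - k n) _ C g (by omega) h2n (by omega) hC.1 hgood hg ?_)
    have h1 := hbud (stabilizerDistance C) (stabilizerDistance_spec (by omega) hC.1).2.1
    refine h1.trans (budget_mono (le_of_eq ?_))
    rw [expCS]
    congr 4
    have : 1 - R ≠ 0 := by linarith
    field_simp

/-- Reduction to the codes whose distance is compatible with the exponent `F`. -/
theorem exists_findsLinearDistance {K : Type} [Field K] [Fintype K] [DecidableEq K] (label : K → ℕ)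
    (hl : Function.Injective label) : ∃ p : RAM.Prog, ∀ (R : ℝ) (k : ℕ → ℕ), R < 1 → HasRate k R →
    ∀ F : ℝ → ℝ, (∀ ε > 0, ∃ b : ℕ → ℝ, Tendsto b atTop (𝓝 0) ∧ ∀ᶠ n : ℕ in atTop,
      ({C | C ∈ linearCodes K n (k n) ∧ F ((codeDistance C : ℝ) / n) + ε <
        expLinear R ((codeDistance C : ℝ) / n)}.ncard : ℝ) ≤ b n * (linearCodes K n (k n)).ncard) →
    FindsLinearDistance label p k F := by
  obtain ⟨p, C₀, D₀, hp⟩ := RAM.exists_prog_linear label hl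
  refine ⟨p, fun R k hR hk F hF ε hε => ?_⟩
  have hρ : 0 < 1 - R := by linarith
  obtain ⟨b, hb, hbF⟩ := hF (ε / 2) (half_pos hε)
  have hlim : Tendsto (fun n => (1 / 2 : ℝ) ^ RAM.rootCount n + b n) atTop (𝓝 0) := by
    simpa using tendsto_half_pow_rootCount.add hb
  refine tendsto_proportion hlim ?_ ?_
  · filter_upwards [hk.eventually_lt hR] with n hn
    exact linearCodes_nonempty K hn.le
  · filter_upwards [hk.1, hk.eventually_lt hR, tendsto_rootCount.eventually_ge_atTop 4,
      eventually_two_mul_mul_le_pow, eventually_exp_neg_le hε, hbF,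
      eventually_le_budget hρ (hk.tendsto_linear hR) (by
        filter_upwards [hk.1, hk.eventually_lt hR] with n h1 h2
        omega) C₀ D₀ (4 * Fintype.card K) (half_pos hε)] with n hk0 hkn ht h2n hexp hbF hbud
    -- A code can be exceptional only because a shortening is large or because the covering set
    -- exponent exceeds `F` noticeably. The `ε` is divided between this excess and the running time.
    have hsub : {C | C ∈ linearCodes K n (k n) ∧ ¬ ∀ H : Matrix (Fin (n - k n)) (Fin n) K,
        IsParityCheck H C → 1 - ε ≤ RAM.successProb p (RAM.input label H) (codeDistance C)
          (budget n (F ((codeDistance C : ℝ) / n) + ε))} ⊆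
        {C | C ∈ linearCodes K n (k n) ∧ ¬ RAM.SmallShortenings (n - k n + 1) C} ∪
        {C | C ∈ linearCodes K n (k n) ∧ F ((codeDistance C : ℝ) / n) + ε / 2 <
          expLinear R ((codeDistance C : ℝ) / n)} := by
      rintro C ⟨hC, hbad⟩
      by_contra hnot
      simp only [Set.mem_union, Set.mem_ofPred_eq, not_or, not_and, not_not, not_lt] at hnot
      refine hbad fun H hH => ?_
      have hsub : 1 - ε ≤ 1 - Real.exp (-(n : ℝ)) := by linarith
      refine hsub.trans (hp n (k n) _ C H (by omega) h2n hk0 hkn.le hC (hnot.1 hC) hH ?_)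
      have h1 := hbud (codeDistance C) (codeDistance_spec hk0 hkn.le hC).2.1
      refine h1.trans (budget_mono ?_)
      have h2 := hnot.2 hC
      rw [expLinear] at h2
      linarith
    calc _ ≤ (({C | C ∈ linearCodes K n (k n) ∧ ¬ RAM.SmallShortenings (n - k n + 1) C}.ncard : ℕ) : ℝ) +
          {C | C ∈ linearCodes K n (k n) ∧ F ((codeDistance C : ℝ) / n) + ε / 2 <
            expLinear R ((codeDistance C : ℝ) / n)}.ncard := by
          rw [← Nat.cast_add]
          exact Nat.cast_le.2 ((Set.ncard_le_ncard hsub (Set.toFinite _)).trans (Set.ncard_union_le _ _))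
      _ ≤ (1 / 2) ^ RAM.rootCount n * (linearCodes K n (k n)).ncard +
          b n * (linearCodes K n (k n)).ncard :=
          add_le_add (ncard_not_smallShortenings_linear hkn.le ht) hbF
      _ = _ := by ring

theorem exists_h₂_eq {y : ℝ} (h0 : 0 < y) (h1 : y ≤ 1) : ∃ x : ℝ, 0 < x ∧ x ≤ 1 / 2 ∧ h₂ x = y := by
  have h2 : h₂ 0 = 0 := by simp [h₂]
  have h3 : h₂ (1 / 2) = 1 := by
    rw [h₂, one_div, Real.binEntropy_two_inv, div_self (Real.log_pos one_lt_two).ne']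
  obtain ⟨x, ⟨hx0, hx1⟩, hx⟩ := intermediate_value_Icc (show (0 : ℝ) ≤ 1 / 2 by norm_num)
    continuous_h₂.continuousOn (show y ∈ Set.Icc (h₂ 0) (h₂ (1 / 2)) by
      rw [h2, h3]; exact ⟨h0.le, h1⟩)
  refine ⟨x, lt_of_le_of_ne hx0 ?_, hx1, hx⟩
  rintro rfl
  rw [h2] at hx
  exact h0.ne hx

theorem h₂_mono {x y : ℝ} (h0 : 0 ≤ x) (hxy : x ≤ y) (hy : y ≤ 1 / 2) : h₂ x ≤ h₂ y := by
  refine div_le_div_of_nonneg_right ?_ (Real.log_pos one_lt_two).le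
  exact Real.binEntropy_strictMonoOn.monotoneOn ⟨h0, by linarith⟩ ⟨by linarith, by linarith⟩ hxy

/-- The distance of almost all binary codes obeys the Gilbert-Varshamov bound. -/
theorem ncard_entropy_gt_le {K : Type} [Field K] [Fintype K] [DecidableEq K]
    (h2 : Fintype.card K = 2) {R : ℝ} {k : ℕ → ℕ} (hR : R < 1) (hk : HasRate k R) {ε : ℝ}
    (hε : 0 < ε) : ∃ b : ℕ → ℝ, Tendsto b atTop (𝓝 0) ∧ ∀ᶠ n : ℕ in atTop,
      ({C | C ∈ linearCodes K n (k n) ∧ 1 - R + ε < h₂ ((codeDistance C : ℝ) / n)}.ncard : ℝ) ≤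
        b n * (linearCodes K n (k n)).ncard := by
  classical
  -- At rate zero the condition cannot hold, since the entropy is at most one.
  rcases hk.nonneg.eq_or_lt with hR0 | hR0
  · refine ⟨0, tendsto_const_nhds, .of_forall fun n => ?_⟩
    have : {C | C ∈ linearCodes K n (k n) ∧ 1 - R + ε < h₂ ((codeDistance C : ℝ) / n)} = ∅ := by
      ext C
      simp only [Set.mem_ofPred_eq, Set.mem_empty_iff_false, iff_false, not_and, not_lt]
      intro _
      have := h₂_le_one ((codeDistance C : ℝ) / n)
      linarith
    rw [this]
    simp
  -- The minimum with `R` keeps `1 - R + η` within the range of the entropy function, so that `x`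
  -- exists.
  set η := min ε R with hη
  have hη0 : 0 < η := lt_min hε hR0
  obtain ⟨x, hx0, hx1, hx⟩ := exists_h₂_eq (y := 1 - R + η) (by linarith)
    (by linarith [min_le_right ε R])
  let w : ℕ → ℕ := fun n => ⌊x * n⌋₊
  have hwlim : Tendsto (fun n : ℕ => (w n : ℝ) / n) atTop (𝓝 x) :=
    (tendsto_nat_floor_mul_div_atTop hx0.le).comp tendsto_natCast_atTop_atTop
  have hexp : Tendsto (fun n : ℕ => 1 - (k n : ℝ) / n - h₂ ((w n : ℝ) / n)) atTop (𝓝 (-η)) := by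
    have h := (hk.2.const_sub 1).sub ((continuous_h₂.tendsto x).comp hwlim)
    rw [hx, show 1 - R - (1 - R + η) = -η by ring] at h
    exact h
  refine ⟨fun n => ((2 : ℝ) ^ (-(η / 4))) ^ n, tendsto_pow_atTop_nhds_zero_of_lt_one (by positivity)
    (Real.rpow_lt_one_of_one_lt_of_neg one_lt_two (by linarith)), ?_⟩
  filter_upwards [hk.1, hk.eventually_lt hR, hexp.eventually_lt_const (show -η < -(η / 2) by linarith),
    hwlim.eventually_const_lt hx0, eventually_poly_le 2 1 0 (show 0 < η / 4 by linarith)]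
    with n hk0 hkn hlt hwpos hpoly
  have hn : 0 < n := by omega
  have hn' : (0 : ℝ) < n := by exact_mod_cast hn
  have hw1 : 1 ≤ w n := by
    by_contra h
    have h0 : w n = 0 := by omega
    simp [h0] at hwpos
  have hwx : (w n : ℝ) ≤ x * n := Nat.floor_le (by positivity)
  have hwn : w n ≤ n := by
    have : (w n : ℝ) ≤ n := by nlinarith
    exact_mod_cast this
  set Z := (subspaces K (Fin n → K) (k n)).filter fun C => w n < codeDistance C with hZ
  have hsub : {C | C ∈ linearCodes K n (k n) ∧ 1 - R + ε < h₂ ((codeDistance C : ℝ) / n)} ⊆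
      (Z : Set (Submodule K (Fin n → K))) := by
    rintro C ⟨hC, hCd⟩
    rw [linearCodes_eq] at hC
    rw [Finset.mem_coe, hZ, Finset.mem_filter]
    refine ⟨hC, ?_⟩
    by_contra hle
    push Not at hle
    have h3 : (codeDistance C : ℝ) / n ≤ x := by
      rw [div_le_iff₀ hn']
      exact le_trans (by exact_mod_cast hle) hwx
    have h4 := h₂_mono (by positivity) h3 hx1
    rw [hx] at h4
    have := min_le_left ε R
    linarith
  have hcount := card_distance_gt_mul_le h2 hk0 hkn.le hw1 (Finset.filter_subset _ _)
    (fun C (hC : C ∈ Z) => (Finset.mem_filter.1 hC).2)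
  have hncard : (linearCodes K n (k n)).ncard = (subspaces K (Fin n → K) (k n)).card := by
    rw [linearCodes_eq, Set.ncard_coe_finset]
  have h5 : {C | C ∈ linearCodes K n (k n) ∧ 1 - R + ε < h₂ ((codeDistance C : ℝ) / n)}.ncard ≤
      Z.card := by
    rw [← Set.ncard_coe_finset]
    exact Set.ncard_le_ncard hsub (Set.toFinite _)
  refine le_trans (Nat.cast_le.2 h5) ?_
  rw [hncard]
  have hch := two_rpow_le_choose hn hwn
  have hcpos : (0 : ℝ) < n.choose (w n) * (2 : ℝ) ^ k n :=
    mul_pos (by exact_mod_cast Nat.choose_pos hwn) (by positivity)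
  refine le_of_mul_le_mul_right (hcount.trans ?_) hcpos
  have hM : (0 : ℝ) ≤ (subspaces K (Fin n → K) (k n)).card := Nat.cast_nonneg _
  -- For the weight `w n` the exponent `n - k - n h₂(w/n)` is below `-n η / 2`. One half of this
  -- absorbs the factor `2 * (n + 1)`, the other remains as exponential decay.
  have key : 2 * (2 : ℝ) ^ n ≤ ((2 : ℝ) ^ (-(η / 4))) ^ n * (n.choose (w n) * (2 : ℝ) ^ k n) := by
    refine le_of_mul_le_mul_right ?_ (show (0 : ℝ) < n + 1 by positivity)
    simp only [Nat.cast_ofNat, pow_one, zero_mul, pow_zero, mul_one] at hpoly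
    have e1 : ((2 : ℝ) ^ (-(η / 4))) ^ n = 2 ^ (-((n : ℝ) * (η / 4))) := by
      rw [← Real.rpow_natCast, ← Real.rpow_mul (by norm_num)]
      ring_nf
    calc 2 * (2 : ℝ) ^ n * (n + 1) = (2 * (n + 1)) * 2 ^ (n : ℝ) := by
          rw [Real.rpow_natCast]; ring
      _ ≤ 2 ^ ((n : ℝ) * (η / 4)) * 2 ^ (n : ℝ) := by gcongr
      _ = 2 ^ ((n : ℝ) * (η / 4) + n) := by rw [Real.rpow_add two_pos]
      _ ≤ 2 ^ (-((n : ℝ) * (η / 4)) + ((n : ℝ) * h₂ (w n / n) + k n)) := by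
          refine Real.rpow_le_rpow_of_exponent_le one_le_two ?_
          have h6 := mul_le_mul_of_nonneg_left hlt.le hn'.le
          have h7 : (n : ℝ) * (1 - (k n : ℝ) / n - h₂ ((w n : ℝ) / n)) =
              n - k n - n * h₂ ((w n : ℝ) / n) := by field_simp
          rw [h7] at h6
          linarith
      _ = 2 ^ (-((n : ℝ) * (η / 4))) * (2 ^ ((n : ℝ) * h₂ (w n / n)) * 2 ^ k n) := by
          rw [Real.rpow_add two_pos, Real.rpow_add two_pos, Real.rpow_natCast]
      _ ≤ 2 ^ (-((n : ℝ) * (η / 4))) * (((n + 1) * n.choose (w n)) * 2 ^ k n) := by gcongr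
      _ = _ := by rw [e1]; ring
  calc _ ≤ (((2 : ℝ) ^ (-(η / 4))) ^ n * (n.choose (w n) * (2 : ℝ) ^ k n)) *
        (subspaces K (Fin n → K) (k n)).card := by gcongr
    _ = _ := by ring

theorem mainTheorem7 :
    (∃ p : RAM.Prog, ∀ (R : ℝ) (k : ℕ → ℕ), R < 1 → HasRate k R →
      FindsStabilizerDistance p k (expCS R)) ∧
    (∀ (K : Type) [Field K] [Fintype K] [DecidableEq K] (label : K → ℕ),
      Function.Injective label →
      ∃ p : RAM.Prog, ∀ (R : ℝ) (k : ℕ → ℕ), R < 1 → HasRate k R →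
        FindsLinearDistance label p k (expLinear R) ∧
        (Fintype.card K = 2 → FindsLinearDistance label p k (expBinary R))) := by
  refine ⟨exists_findsStabilizerDistance, fun K _ _ _ label hl => ?_⟩
  obtain ⟨p, hp⟩ := exists_findsLinearDistance label hl
  refine ⟨p, fun R k hR hk => ⟨hp R k hR hk _ fun ε hε => ⟨0, tendsto_const_nhds, ?_⟩, fun h2 =>
    hp R k hR hk _ fun ε hε => ?_⟩⟩
  -- For `F = expLinear R` the condition on the exponents excludes no code.
  · refine .of_forall fun n => ?_
    have : {C | C ∈ linearCodes K n (k n) ∧ expLinear R ((codeDistance C : ℝ) / n) + ε <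
        expLinear R ((codeDistance C : ℝ) / n)} = ∅ := by
      ext C
      simp only [Set.mem_ofPred_eq, Set.mem_empty_iff_false, iff_false, not_and, not_lt]
      intro _
      linarith
    rw [this]
    simp
  -- The two exponents differ by `h₂ δ - (1 - R)`, so a code on which they differ by more than `ε`
  -- has a distance beyond the Gilbert-Varshamov bound.
  · obtain ⟨b, hb, h⟩ := ncard_entropy_gt_le h2 hR hk hε
    refine ⟨b, hb, ?_⟩
    filter_upwards [h] with n hn
    refine le_trans (Nat.cast_le.2 (Set.ncard_le_ncard ?_ (Set.toFinite _))) hn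
    rintro C ⟨hC, hlt⟩
    refine ⟨hC, ?_⟩
    rw [expBinary, expLinear] at hlt
    linarith
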